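/- Let $\mathfrak g$ be a finite-dimensional real simple Lie algebra with Cartan involution $\theta$ and Cartan decomposition $\mathfrak g=\mathfrak k+\mathfrak p$. Suppose that $\mathfrak g$ is of Hermitian type, i.e. there is $z\in\mathfrak k$ with $\operatorname{ad}(z)=0$ on $\mathfrak k$ and $\operatorname{ad}(z)^2=-1$ on $\mathfrak p$, and that the real rank of $\mathfrak g$ (the maximal dimension of an abelian subspace of $\mathfrak p$) is greater than $1$. Put $z'=-\sqrt{-1}\,z$ and let $\mathfrak p_\pm\subset\mathfrak p_{\mathbb C}$ be the $\pm1$-eigenspaces of $\operatorname{ad}(z')$. Let $\mathfrak t$ be a Cartan subalgebra of $\mathfrak k$, fix a positive system $\Delta^+(\mathfrak k_{\mathbb C},\mathfrak t_{\mathbb C})$, let $\beta$ be the highest root in $\mathfrak p_+$, and let $\zeta\in\sqrt{-1}\,\mathfrak t^*$ satisfy $\zeta(z')>0$ and $\zeta([\mathfrak k,\mathfrak k]\cap\mathfrak t)=0$. Let $F^{\mathfrak k}(\mu)$ denote the irreducible $\mathfrak k$-module with highest weight $\mu$. For $x\in\mathbb R$ let $L^{\mathfrak g}(x\zeta)$ be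 the unique irreducible quotient of $U(\mathfrak g_{\mathbb C})\otimes_{U(\mathfrak k_{\mathbb C}+\mathfrak p_-)}F^{\mathfrak k}(x\zeta)$, where $\mathfrak p_-$ acts by zero on the one-dimensional module $F^{\mathfrak k}(x\zeta)$. Let $c$ be the smallest $x>0$ for which $L^{\mathfrak g}(x\zeta)$ is unitarizable (i.e. admits a positive definite Hermitian inner product for which $\mathfrak g$ acts by skew-Hermitian operators). The module $L^{\mathfrak g}(c\zeta)$ is the minimal holomorphic representation. Let $\sigma$ be an involutive automorphism of $\mathfrak g$ commuting with $\theta$ such that $\mathfrak g^\sigma$ is non-compact, i.e. $\mathfrak p^\sigma=\mathfrak g^\sigma\cap\mathfrak p\ne0$. Put $\mathfrak k^\sigma=\mathfrak g^\sigma\cap\mathfrak k$. Suppose that $L^{\mathfrak g}(c\zeta)|_{\mathfrak g^\sigma}$ is discretely decomposable, i.e. it is a sum of $\mathfrak g^\sigma$-submodules of finite length. If $F^{\mathfrak k}(c\zeta+k\beta)|_{\mathfrak k^\sigma}$ is irreducible for every integer $k\ge0$, and if the modules $F^{\mathfrak k}(c\zeta+k\beta)$, $k\ge0$, are pairwise non-isomorphic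 as $\mathfrak k^\sigma$-modules, then $L^{\mathfrak g}(c\zeta)|_{\mathfrak g^\sigma}$ is irreducible. -/

import Mathlib

open scoped TensorProduct

noncomputable section

namespace HermitianLie

/-! ### Modules presented as quotients of an enveloping algebra -/

section Env

variable {𝔞 : Type*} [LieRing 𝔞] [LieAlgebra ℂ 𝔞]

/-- The left `U(𝔞)`-module `U(𝔞) / M` for a left ideal `M`, viewed below as an `𝔞`-module. -/
def EnvQuot (M : Ideal (UniversalEnvelopingAlgebra ℂ 𝔞)) : Type _ :=
  UniversalEnvelopingAlgebra ℂ 𝔞 ⧸ M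

variable (M : Ideal (UniversalEnvelopingAlgebra ℂ 𝔞))

instance : AddCommGroup (EnvQuot M) :=
  inferInstanceAs (AddCommGroup (UniversalEnvelopingAlgebra ℂ 𝔞 ⧸ M))

instance : Module (UniversalEnvelopingAlgebra ℂ 𝔞) (EnvQuot M) :=
  inferInstanceAs (Module (UniversalEnvelopingAlgebra ℂ 𝔞) (UniversalEnvelopingAlgebra ℂ 𝔞 ⧸ M))

instance : Module ℂ (EnvQuot M) :=
  inferInstanceAs (Module ℂ (UniversalEnvelopingAlgebra ℂ 𝔞 ⧸ M))

instance : IsScalarTower ℂ (UniversalEnvelopingAlgebra ℂ 𝔞) (EnvQuot M) :=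
  inferInstanceAs (IsScalarTower ℂ (UniversalEnvelopingAlgebra ℂ 𝔞)
    (UniversalEnvelopingAlgebra ℂ 𝔞 ⧸ M))

instance : LieRingModule 𝔞 (EnvQuot M) where
  bracket X v := UniversalEnvelopingAlgebra.ι ℂ X • v
  add_lie X Y v := by
    rw [map_add, add_smul]
  lie_add X v w := smul_add _ v w
  leibniz_lie X Y v := by
    change _ • _ • v = UniversalEnvelopingAlgebra.ι ℂ ⁅X, Y⁆ • v + _ • _ • v
    let _ : LieRing (UniversalEnvelopingAlgebra ℂ 𝔞) := LieRing.ofAssociativeRing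
    have h : UniversalEnvelopingAlgebra.ι ℂ ⁅X, Y⁆ =
        UniversalEnvelopingAlgebra.ι ℂ X * UniversalEnvelopingAlgebra.ι ℂ Y -
          UniversalEnvelopingAlgebra.ι ℂ Y * UniversalEnvelopingAlgebra.ι ℂ X :=
      LieHom.map_lie _ X Y
    rw [h, sub_smul, mul_smul, mul_smul, sub_add_cancel]

theorem EnvQuot.lie_def (X : 𝔞) (v : EnvQuot M) :
    ⁅X, v⁆ = UniversalEnvelopingAlgebra.ι ℂ X • v := rfl

instance : LieModule ℂ 𝔞 (EnvQuot M) where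
  smul_lie a X v := by
    rw [EnvQuot.lie_def, EnvQuot.lie_def, map_smul, smul_assoc]
  lie_smul a X v := by
    rw [EnvQuot.lie_def, EnvQuot.lie_def, ← algebraMap_smul (UniversalEnvelopingAlgebra ℂ 𝔞) a v,
      ← algebraMap_smul (UniversalEnvelopingAlgebra ℂ 𝔞) a (_ • v), ← mul_smul, ← mul_smul,
      Algebra.commutes]

/-- `EnvQuot M` is an irreducible quotient of the cyclic `𝔞`-module `U(𝔞) / J`: the left ideal `M`
contains `J` and is a maximal (proper) left ideal. -/
def IsIrredQuotient (J M : Ideal (UniversalEnvelopingAlgebra ℂ 𝔞)) : Prop :=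
  J ≤ M ∧ M.IsMaximal

end Env

/-- A module over a complex Lie algebra has finite length: its lattice of submodules satisfies both
chain conditions. -/
def HasFiniteLength (𝔥 V : Type*) [LieRing 𝔥] [LieAlgebra ℂ 𝔥] [AddCommGroup V] [Module ℂ V]
    [LieRingModule 𝔥 V] [LieModule ℂ 𝔥 V] : Prop :=
  WellFoundedLT (LieSubmodule ℂ 𝔥 V) ∧ WellFoundedGT (LieSubmodule ℂ 𝔥 V)

/-- An `𝔥`-module is discretely decomposable: it is the sum of `𝔥`-submodules of finite length. -/
def IsDiscretelyDecomposable (𝔥 V : Type*) [LieRing 𝔥] [LieAlgebra ℂ 𝔥] [AddCommGroup V]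
    [Module ℂ V] [LieRingModule 𝔥 V] [LieModule ℂ 𝔥 V] : Prop :=
  sSup {W : LieSubmodule ℂ 𝔥 V | HasFiniteLength 𝔥 W} = ⊤

/-! ### Real Lie algebras with a Cartan involution -/

section Real

variable {𝔤 : Type*} [LieRing 𝔤] [LieAlgebra ℝ 𝔤]

/-- A module over `𝔤_ℂ` is unitarizable: it has a positive definite Hermitian form for which the
real Lie algebra `𝔤` acts by skew-Hermitian operators. -/
def IsUnitarizable (𝔤 V : Type*) [LieRing 𝔤] [LieAlgebra ℝ 𝔤] [AddCommGroup V] [Module ℂ V]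
    [LieRingModule (ℂ ⊗[ℝ] 𝔤) V] : Prop :=
  ∃ B : V →ₗ⋆[ℂ] V →ₗ[ℂ] ℂ,
    (∀ v w, B w v = starRingEnd ℂ (B v w)) ∧
    (∀ v, v ≠ 0 → 0 < (B v v).re) ∧
    (∀ (X : 𝔤) (v w : V), B ⁅(1 : ℂ) ⊗ₜ[ℝ] X, v⁆ w = -B v ⁅(1 : ℂ) ⊗ₜ[ℝ] X, w⁆)

/-- The subalgebra of fixed points `𝔤^φ`. -/
def fixedPoints (φ : 𝔤 ≃ₗ⁅ℝ⁆ 𝔤) : LieSubalgebra ℝ 𝔤 where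
  carrier := {X | φ X = X}
  add_mem' {X Y} hX hY := by simp_all
  zero_mem' := by simp
  smul_mem' a X hX := by simp_all
  lie_mem' {X Y} hX hY := by
    have h := φ.toLieHom.map_lie X Y
    exact h.trans (congrArg₂ _ hX hY)

/-- The complexification of `𝔤^φ`, a subalgebra of `𝔤_ℂ`. -/
def fixedPointsC (φ : 𝔤 ≃ₗ⁅ℝ⁆ 𝔤) : LieSubalgebra ℂ (ℂ ⊗[ℝ] 𝔤) :=
  { (fixedPoints φ).toSubmodule.baseChange ℂ with
    lie_mem' := by
      intro X Y hX hY
      change X ∈ (fixedPoints φ).toSubmodule.baseChange ℂ at hX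
      change Y ∈ (fixedPoints φ).toSubmodule.baseChange ℂ at hY
      change ⁅X, Y⁆ ∈ (fixedPoints φ).toSubmodule.baseChange ℂ
      rw [Submodule.baseChange_eq_span] at hX hY
      induction hX, hY using Submodule.span_induction₂ with
      | mem_mem X Y hX hY =>
        obtain ⟨X, hX, rfl⟩ := hX
        obtain ⟨Y, hY, rfl⟩ := hY
        change ⁅(1 : ℂ) ⊗ₜ[ℝ] X, (1 : ℂ) ⊗ₜ[ℝ] Y⁆ ∈ _
        rw [LieAlgebra.ExtendScalars.bracket_tmul]
        exact Submodule.tmul_mem_baseChange_of_mem _ ((fixedPoints φ).lie_mem hX hY)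
      | zero_left Y _ => rw [zero_lie]; exact zero_mem _
      | zero_right X _ => exact (congrArg (· ∈ _) (map_zero (LieAlgebra.ad ℂ _ X))).mpr (zero_mem _)
      | add_left X Y Z _ _ _ h₁ h₂ => rw [add_lie]; exact add_mem h₁ h₂
      | add_right X Y Z _ _ _ h₁ h₂ =>
        exact (congrArg (· ∈ _) (map_add (LieAlgebra.ad ℂ _ X) Y Z)).mpr (add_mem h₁ h₂)
      | smul_left a X Y _ _ h => rw [smul_lie]; exact Submodule.smul_mem _ a h
      | smul_right a X Y _ _ h =>
        exact (congrArg (· ∈ _) (map_smul (LieAlgebra.ad ℂ _ X) a Y)).mpr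
          (Submodule.smul_mem _ a h) }

/-- `θ` is a Cartan involution: `θ² = 1` and `-B(X, θ X) > 0` for `X ≠ 0`, with `B` the Killing
form. -/
def IsCartanInvolution (θ : 𝔤 ≃ₗ⁅ℝ⁆ 𝔤) : Prop :=
  (∀ X, θ (θ X) = X) ∧ ∀ X, X ≠ 0 → 0 < -killingForm ℝ 𝔤 X (θ X)

/-- The `-1`-eigenspace `𝔭` of `θ`; the `+1`-eigenspace `𝔨` is `fixedPoints θ`. -/
def noncompactPart (θ : 𝔤 ≃ₗ⁅ℝ⁆ 𝔤) : Submodule ℝ 𝔤 where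
  carrier := {X | θ X = -X}
  add_mem' {X Y} hX hY := by simp_all [add_comm]
  zero_mem' := by simp
  smul_mem' a X hX := by simp_all

/-- `z ∈ 𝔨` makes `𝔤` of Hermitian type: `ad z = 0` on `𝔨` and `(ad z)² = -1` on `𝔭`. -/
def IsHermitianElement (θ : 𝔤 ≃ₗ⁅ℝ⁆ 𝔤) (z : 𝔤) : Prop :=
  z ∈ fixedPoints θ ∧ (∀ X ∈ fixedPoints θ, ⁅z, X⁆ = 0) ∧
    ∀ X ∈ noncompactPart θ, ⁅z, ⁅z, X⁆⁆ = -X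

/-- The real rank: the largest dimension of an abelian subspace of `𝔭`. -/
def realRank (θ : 𝔤 ≃ₗ⁅ℝ⁆ 𝔤) : ℕ :=
  sSup {d | ∃ A : Submodule ℝ 𝔤, A ≤ noncompactPart θ ∧ (∀ X ∈ A, ∀ Y ∈ A, ⁅X, Y⁆ = 0) ∧
    Module.finrank ℝ A = d}

/-- The derived algebra `[𝔨, 𝔨]`, as a subspace of `𝔤`. -/
def derivedK (θ : 𝔤 ≃ₗ⁅ℝ⁆ 𝔤) : Submodule ℝ 𝔤 :=
  Submodule.span ℝ {W | ∃ X ∈ fixedPoints θ, ∃ Y ∈ fixedPoints θ, ⁅X, Y⁆ = W}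

/-- The eigenspace of `ad z'` on `𝔭_ℂ` for the eigenvalue `s`, where `z' = -√-1 z`. -/
def pEigen (θ : 𝔤 ≃ₗ⁅ℝ⁆ 𝔤) (z : 𝔤) (s : ℂ) : Submodule ℂ (ℂ ⊗[ℝ] 𝔤) :=
  (noncompactPart θ).baseChange ℂ ⊓
    Module.End.eigenspace (LieAlgebra.ad ℂ (ℂ ⊗[ℝ] 𝔤) ((-Complex.I) ⊗ₜ[ℝ] z)) s

/-- `𝔭₊`. -/
abbrev pPlus (θ : 𝔤 ≃ₗ⁅ℝ⁆ 𝔤) (z : 𝔤) : Submodule ℂ (ℂ ⊗[ℝ] 𝔤) := pEigen θ z 1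

/-- `𝔭₋`. -/
abbrev pMinus (θ : 𝔤 ≃ₗ⁅ℝ⁆ 𝔤) (z : 𝔤) : Submodule ℂ (ℂ ⊗[ℝ] 𝔤) := pEigen θ z (-1)

/-! ### Roots

Complex linear forms on `𝔱_ℂ` are identified with real linear maps `𝔱 → ℂ`. -/

/-- The weight space of `𝔤_ℂ` under `ad 𝔱` for the weight `α`. -/
def weightSpace (𝔱 : LieSubalgebra ℝ 𝔤) (α : 𝔱 →ₗ[ℝ] ℂ) : Submodule ℂ (ℂ ⊗[ℝ] 𝔤) :=
  ⨅ H : 𝔱, Module.End.eigenspace (LieAlgebra.ad ℂ (ℂ ⊗[ℝ] 𝔤) ((1 : ℂ) ⊗ₜ[ℝ] (H : 𝔤))) (α H)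

/-- `Δ(𝔨_ℂ, 𝔱_ℂ)`. -/
def compactRoots (θ : 𝔤 ≃ₗ⁅ℝ⁆ 𝔤) (𝔱 : LieSubalgebra ℝ 𝔤) : Set (𝔱 →ₗ[ℝ] ℂ) :=
  {α | α ≠ 0 ∧ ∃ X ∈ fixedPointsC θ, X ≠ 0 ∧ X ∈ weightSpace 𝔱 α}

/-- `Δ(𝔭₊, 𝔱_ℂ)`. -/
def pPlusRoots (θ : 𝔤 ≃ₗ⁅ℝ⁆ 𝔤) (z : 𝔤) (𝔱 : LieSubalgebra ℝ 𝔤) : Set (𝔱 →ₗ[ℝ] ℂ) :=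
  {α | ∃ X ∈ pPlus θ z, X ≠ 0 ∧ X ∈ weightSpace 𝔱 α}

/-- `P` is a positive system of `Δ(𝔨_ℂ, 𝔱_ℂ)`: the set of roots that are positive on some regular
element `-√-1 H₀` of `√-1 𝔱`. Roots take imaginary values on `𝔱`, so that
`α(-√-1 H₀) = Im α(H₀)`. -/
def IsPositiveSystem (θ : 𝔤 ≃ₗ⁅ℝ⁆ 𝔤) (𝔱 : LieSubalgebra ℝ 𝔤) (P : Set (𝔱 →ₗ[ℝ] ℂ)) : Prop :=
  ∃ H₀ : 𝔱, (∀ α ∈ compactRoots θ 𝔱, (α H₀).im ≠ 0) ∧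
    P = {α | α ∈ compactRoots θ 𝔱 ∧ 0 < (α H₀).im}

/-- `β` is the highest root in `𝔭₊`: for every root `γ` in `𝔭₊` the difference `β - γ` is a sum of
positive roots of `𝔨_ℂ`. -/
def IsHighestRoot (θ : 𝔤 ≃ₗ⁅ℝ⁆ 𝔤) (z : 𝔤) (𝔱 : LieSubalgebra ℝ 𝔤) (P : Set (𝔱 →ₗ[ℝ] ℂ))
    (β : 𝔱 →ₗ[ℝ] ℂ) : Prop :=
  β ∈ pPlusRoots θ z 𝔱 ∧ ∀ γ ∈ pPlusRoots θ z 𝔱, β - γ ∈ AddSubmonoid.closure P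

/-- `ζ ∈ √-1 𝔱*` with `ζ = 0` on `[𝔨, 𝔨] ∩ 𝔱` and `ζ(z') > 0`, where `ζ(z') = -√-1 ζ(z)`. (The
element `z` is central in `𝔨`, hence lies in every Cartan subalgebra `𝔱` of `𝔨`.) -/
def IsScalarWeight (θ : 𝔤 ≃ₗ⁅ℝ⁆ 𝔤) (z : 𝔤) (𝔱 : LieSubalgebra ℝ 𝔤) (ζ : 𝔱 →ₗ[ℝ] ℂ) : Prop :=
  (∀ H, (ζ H).re = 0) ∧ (∀ H : 𝔱, (H : 𝔤) ∈ derivedK θ → ζ H = 0) ∧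
    ∃ H : 𝔱, (H : 𝔤) = z ∧ 0 < (-Complex.I * ζ H).re

/-! ### The modules `N(λ)`, `L(λ)` and `F(μ)` -/

/-- The left ideal `J` of `U(𝔤_ℂ)` with `U(𝔤_ℂ) / J = N(λ) = U(𝔤_ℂ) ⊗_{U(𝔨_ℂ + 𝔭₋)} F(λ)`, for a
weight `λ` that vanishes on `[𝔨, 𝔨] ∩ 𝔱`. In this case `F(λ)` is one-dimensional: `[𝔨, 𝔨]` acts
on it by zero and `H ∈ 𝔱` by `λ(H)`, while `𝔭₋` is made to act by zero. -/
def scalarVermaIdeal (θ : 𝔤 ≃ₗ⁅ℝ⁆ 𝔤) (z : 𝔤) (𝔱 : LieSubalgebra ℝ 𝔤) (lam : 𝔱 →ₗ[ℝ] ℂ) :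
    Ideal (UniversalEnvelopingAlgebra ℂ (ℂ ⊗[ℝ] 𝔤)) :=
  Ideal.span
    ({u | ∃ Y ∈ pMinus θ z, u = UniversalEnvelopingAlgebra.ι ℂ Y} ∪
     {u | ∃ X ∈ derivedK θ, u = UniversalEnvelopingAlgebra.ι ℂ ((1 : ℂ) ⊗ₜ[ℝ] X)} ∪
     {u | ∃ H : 𝔱, u = UniversalEnvelopingAlgebra.ι ℂ ((1 : ℂ) ⊗ₜ[ℝ] (H : 𝔤)) -
        algebraMap ℂ _ (lam H)})

/-- `EnvQuot M` is the irreducible lowest weight module `L(λ)`, the (unique) irreducible quotient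
of `N(λ)`, for a weight `λ` that vanishes on `[𝔨, 𝔨] ∩ 𝔱`. -/
def IsL (θ : 𝔤 ≃ₗ⁅ℝ⁆ 𝔤) (z : 𝔤) (𝔱 : LieSubalgebra ℝ 𝔤) (lam : 𝔱 →ₗ[ℝ] ℂ)
    (M : Ideal (UniversalEnvelopingAlgebra ℂ (ℂ ⊗[ℝ] 𝔤))) : Prop :=
  IsIrredQuotient (scalarVermaIdeal θ z 𝔱 lam) M

/-- The left ideal of `U(𝔨_ℂ)` that presents the Verma module of highest weight `μ`: its generator
is annihilated by the positive root vectors and has weight `μ`. -/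
def compactVermaIdeal (θ : 𝔤 ≃ₗ⁅ℝ⁆ 𝔤) (𝔱 : LieSubalgebra ℝ 𝔤) (P : Set (𝔱 →ₗ[ℝ] ℂ))
    (mu : 𝔱 →ₗ[ℝ] ℂ) : Ideal (UniversalEnvelopingAlgebra ℂ (fixedPointsC θ)) :=
  Ideal.span
    ({u | ∃ α ∈ P, ∃ X : fixedPointsC θ, (X : ℂ ⊗[ℝ] 𝔤) ∈ weightSpace 𝔱 α ∧
        u = UniversalEnvelopingAlgebra.ι ℂ X} ∪
     {u | ∃ (H : 𝔱) (X : fixedPointsC θ), (X : ℂ ⊗[ℝ] 𝔤) = (1 : ℂ) ⊗ₜ[ℝ] (H : 𝔤) ∧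
        u = UniversalEnvelopingAlgebra.ι ℂ X - algebraMap ℂ _ (mu H)})

/-- `EnvQuot Q` is `F(μ)`, the irreducible `𝔨_ℂ`-module of highest weight `μ`. -/
def IsF (θ : 𝔤 ≃ₗ⁅ℝ⁆ 𝔤) (𝔱 : LieSubalgebra ℝ 𝔤) (P : Set (𝔱 →ₗ[ℝ] ℂ)) (mu : 𝔱 →ₗ[ℝ] ℂ)
    (Q : Ideal (UniversalEnvelopingAlgebra ℂ (fixedPointsC θ))) : Prop :=
  IsIrredQuotient (compactVermaIdeal θ 𝔱 P mu) Q

/-- The number `c`: the least `x > 0` for which `L(x ζ)` is unitarizable. -/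
def IsFirstWallachPoint (θ : 𝔤 ≃ₗ⁅ℝ⁆ 𝔤) (z : 𝔤) (𝔱 : LieSubalgebra ℝ 𝔤) (ζ : 𝔱 →ₗ[ℝ] ℂ)
    (c : ℝ) : Prop :=
  IsLeast {x : ℝ | 0 < x ∧ ∃ M, IsL θ z 𝔱 (x • ζ) M ∧ IsUnitarizable 𝔤 (EnvQuot M)} c

/-- `𝔨^σ_ℂ = 𝔨_ℂ ∩ 𝔤^σ_ℂ`, as a subalgebra of `𝔨_ℂ`. -/
abbrev compactFixedPointsC (θ σ : 𝔤 ≃ₗ⁅ℝ⁆ 𝔤) : LieSubalgebra ℂ (fixedPointsC θ) :=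
  (fixedPointsC σ).comap (fixedPointsC θ).incl

end Real

end HermitianLie

end

open HermitianLie

noncomputable section

/-! ### The three-step grading of the complexified Lie algebra by `ad z` -/

namespace HermitianLie

/-! The module L(cζ) is graded by the eigenvalue of z', its degree n piece is the 𝔨-module F(cζ+nβ),
and elements of 𝔭₊ and 𝔭₋ shift the degree by +1 and -1. Once these facts are known, the theorem is
short. By the hypotheses the degree pieces are irreducible and pairwise inequivalent under 𝔨^σ, so
an invariant subspace contains every piece to which it projects nontrivially
(`exists_of_multiplicityFree`). A nonzero element of 𝔭^σ has the form x + x̄ with x ∈ 𝔭₊; x maps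
each piece nontrivially to the next one and x̄ maps it nontrivially back. One piece therefore yields
all pieces (`isIrreducible_of_components`).

The main work is to prove that the degree n piece is F(cζ+nβ), without classification. Since 𝔭₊ is
abelian, the scalar generalized Verma module is a polynomial ring, on which 𝔤_ℂ acts by differential
operators of order at most two (`fock`). The weight enters through one real parameter r. The module
carries a contravariant Hermitian form (`form`), and L is the quotient by its radical
(`eq_annIdeal`).

The key operator is T = ∑ XᵢYᵢ for dual bases of 𝔭₊ and 𝔭₋ (`opT`). It commutes with 𝔨, satisfies
⟨p, Tp⟩ = -∑ ⟨Yᵢp, Yᵢp⟩, and in degree n differs from its value T₀ at r = 0 by the scalar -rn. In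
degree two, T₀ has the eigenvalue -s on the square of the highest root vector, and at most one other
eigenvalue t, which is positive (`eigenvalue_two`, `exists_eigenvalue_quad`). The reason is a
highest vector argument: either the lowering of a highest vector of degree two is a multiple of the
highest root vector, or it lies in the null space V₀ of ad h in 𝔭₊, which is irreducible under the
centralizer of h (`V0_le`), so that a Casimir-like operator is a negative scalar on it. If t did not
occur, the curvature tensor [[Y,X],X'] would be that of a complex hyperbolic space, and commuting
elements of 𝔭 would be proportional (`exists_real_of_scalar`), which contradicts real rank greater
than one.

Positivity on the t-eigenvectors forces r ≥ t/2. At r = t/2 these eigenvectors are annihilated by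
every Yᵢ, so they lie in the radical. Because T₀ is of second order, it is then a known scalar
modulo the radical in every degree (`IsEigenvalue.opT_sub_mem`), and T acts in degree n by a
negative number for n > 0. Induction on the degree gives semidefiniteness (`IsEigenvalue.isPos`), so
r = t/2 is the point c. The same scalars, compared in adjacent degrees, show that the power of the
highest root vector is the only highest vector modulo the radical (`IsEigenvalue.X_pow_mem`); hence
each degree is irreducible, of highest weight cζ+nβ.

The remaining parts construct the required basis from a Cartan subalgebra of 𝔨 and match the
modules, presented as quotients of enveloping algebras, with this model. The matching rests on the
uniqueness of maximal left ideals above a triangular one (`IsTriangular.eq_of_isMaximal`). -/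

/-- The complexified data attached to a simple Lie algebra of Hermitian type: conjugation `τ`, an
invariant form `B`, the grading element `z`, and an orthonormal basis `X` of the `1`-eigenspace of
`ad z` consisting of eigenvectors of `ad h`, where `h = [X o, τ (X o)]`. -/
structure HermitianDatum (G ι : Type*) [LieRing G] [LieAlgebra ℂ G] [Fintype ι]
    [DecidableEq ι] where
  τ : G →ₛₗ[starRingEnd ℂ] G
  τ_lie : ∀ x y : G, τ ⁅x, y⁆ = ⁅τ x, τ y⁆
  τ_τ : ∀ x, τ (τ x) = x
  B : G →ₗ[ℂ] G →ₗ[ℂ] ℂ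
  B_symm : ∀ x y, B x y = B y x
  B_inv : ∀ x y w : G, B ⁅x, y⁆ w = B x ⁅y, w⁆
  B_τ : ∀ x y, B (τ x) (τ y) = starRingEnd ℂ (B x y)
  z : G
  τ_z : τ z = -z
  X : ι → G
  z_X : ∀ i, ⁅z, X i⁆ = X i
  B_X : ∀ i j, B (X i) (τ (X j)) = if i = j then 1 else 0
  decomp : ∀ x : G, ∃ k p n : G, x = k + p + n ∧ ⁅z, k⁆ = 0 ∧
    p ∈ Submodule.span ℂ (Set.range X) ∧ n ∈ Submodule.span ℂ (Set.range (τ ∘ X))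
  neg : ∀ x : G, ⁅z, x⁆ = 0 → x ≠ 0 → (B x (τ x)).re < 0
  irred : ∀ U : Submodule ℂ G, U ≤ Submodule.span ℂ (Set.range X) →
    (∀ w x : G, ⁅z, w⁆ = 0 → x ∈ U → ⁅w, x⁆ ∈ U) → U ≠ ⊥ → ∀ i, X i ∈ U
  o : ι
  a : ι → ℝ
  lie_h : ∀ i, ⁅⁅X o, τ (X o)⁆, X i⁆ = (a i : ℂ) • X i
  a_inj : ∀ i, a i = a o → i = o

namespace HermitianDatum

variable {G ι : Type*} [LieRing G] [LieAlgebra ℂ G] [Fintype ι] [DecidableEq ι]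
  (D : HermitianDatum G ι)

/-- The basis of the `-1`-eigenspace conjugate to `X`. -/
def Y (i : ι) : G := D.τ (D.X i)

theorem tau_X (i : ι) : D.τ (D.X i) = D.Y i := rfl

theorem tau_Y (i : ι) : D.τ (D.Y i) = D.X i := D.τ_τ _

theorem B_X_Y (i j : ι) : D.B (D.X i) (D.Y j) = if i = j then 1 else 0 := D.B_X i j

theorem z_Y (i : ι) : ⁅D.z, D.Y i⁆ = -D.Y i := by
  have := congrArg D.τ (D.z_X i)
  rw [D.τ_lie, D.τ_z, neg_lie] at this
  rw [← tau_X, ← neg_inj, neg_neg, this]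

theorem B_inv' (x y w : G) : D.B x ⁅y, w⁆ = -D.B ⁅y, x⁆ w := by
  rw [← D.B_inv, ← lie_skew, map_neg, LinearMap.neg_apply]

theorem exists_coeff (x : G) : ∃ (k : G) (b c : ι → ℂ), ⁅D.z, k⁆ = 0 ∧
    x = k + ∑ i, b i • D.X i + ∑ i, c i • D.Y i := by
  obtain ⟨k, p, n, rfl, hk, hp, hn⟩ := D.decomp x
  rw [Submodule.mem_span_range_iff_exists_fun] at hp hn
  obtain ⟨b, rfl⟩ := hp
  obtain ⟨c, rfl⟩ := hn
  exact ⟨k, b, c, hk, rfl⟩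

theorem z_sum (k : G) (hk : ⁅D.z, k⁆ = 0) (b c : ι → ℂ) :
    ⁅D.z, k + ∑ i, b i • D.X i + ∑ i, c i • D.Y i⁆ =
      ∑ i, b i • D.X i - ∑ i, c i • D.Y i := by
  simp only [lie_add, hk, lie_sum, lie_smul, D.z_X, D.z_Y, smul_neg, Finset.sum_neg_distrib]
  abel

/-- The decomposition leaves only the eigenvalues 0, 1 and -1, so T = `ad z` satisfies T³ = T. This
makes 𝔭₊ and 𝔭₋ abelian, since their brackets would have eigenvalue 2 or -2. -/
theorem eq_zero_of_eigen {x : G} {m : ℂ} (h0 : m ≠ 0) (h1 : m ≠ 1) (h2 : m ≠ -1)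
    (hx : ⁅D.z, x⁆ = m • x) : x = 0 := by
  obtain ⟨k, b, c, hk, hx'⟩ := D.exists_coeff x
  set p := ∑ i, b i • D.X i with hp
  set n := ∑ i, c i • D.Y i with hn
  have z1 : ⁅D.z, x⁆ = p - n := by rw [hx']; exact D.z_sum k hk b c
  have zp : ⁅D.z, p⁆ = p := by simp only [hp, lie_sum, lie_smul, D.z_X]
  have zn : ⁅D.z, n⁆ = -n := by
    simp only [hn, lie_sum, lie_smul, D.z_Y, smul_neg, Finset.sum_neg_distrib]
  have e1 : p - n = m • x := z1.symm.trans hx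
  have e2 : p + n = m • m • x := by
    rw [← hx, ← lie_smul, ← e1, lie_sub, zp, zn, sub_neg_eq_add]
  have e3 : p - n = m • m • m • x := by
    have := congrArg (fun y => ⁅D.z, y⁆) e2
    simp only [lie_add, zp, zn, lie_smul, hx] at this
    rw [sub_eq_add_neg, this]
  have : (m * (m ^ 2 - 1)) • x = 0 := by
    have h := e3.symm.trans e1
    rw [← sub_eq_zero] at h
    rw [← h]; module
  rcases smul_eq_zero.1 this with h | h
  · exfalso
    rcases mul_eq_zero.1 h with h | h
    · exact h0 h
    · have : (m - 1) * (m + 1) = 0 := by linear_combination h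
      rcases mul_eq_zero.1 this with h | h
      · exact h1 (by linear_combination h)
      · exact h2 (by linear_combination h)
  · exact h

theorem lie_PP {x y : G} (hx : ⁅D.z, x⁆ = x) (hy : ⁅D.z, y⁆ = y) : ⁅x, y⁆ = 0 := by
  refine D.eq_zero_of_eigen (m := 2) (by norm_num) (by norm_num) (by norm_num) ?_
  rw [leibniz_lie, hx, hy, two_smul]

theorem lie_NN {x y : G} (hx : ⁅D.z, x⁆ = -x) (hy : ⁅D.z, y⁆ = -y) : ⁅x, y⁆ = 0 := by
  refine D.eq_zero_of_eigen (m := -2) (by norm_num) (by norm_num) (by norm_num) ?_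
  rw [leibniz_lie, hx, hy, neg_lie, lie_neg]; module

theorem z_KP {w x : G} (hw : ⁅D.z, w⁆ = 0) (hx : ⁅D.z, x⁆ = x) : ⁅D.z, ⁅w, x⁆⁆ = ⁅w, x⁆ := by
  rw [leibniz_lie, hw, hx, zero_lie, zero_add]

theorem z_KN {w x : G} (hw : ⁅D.z, w⁆ = 0) (hx : ⁅D.z, x⁆ = -x) :
    ⁅D.z, ⁅w, x⁆⁆ = -⁅w, x⁆ := by
  rw [leibniz_lie, hw, hx, zero_lie, zero_add, lie_neg]

theorem z_KK {w x : G} (hw : ⁅D.z, w⁆ = 0) (hx : ⁅D.z, x⁆ = 0) : ⁅D.z, ⁅w, x⁆⁆ = 0 := by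
  rw [leibniz_lie, hw, hx, zero_lie, zero_add, lie_zero]

theorem z_PN {w x : G} (hw : ⁅D.z, w⁆ = w) (hx : ⁅D.z, x⁆ = -x) : ⁅D.z, ⁅w, x⁆⁆ = 0 := by
  rw [leibniz_lie, hw, hx, lie_neg, add_neg_cancel]

theorem z_NP {w x : G} (hw : ⁅D.z, w⁆ = -w) (hx : ⁅D.z, x⁆ = x) : ⁅D.z, ⁅w, x⁆⁆ = 0 := by
  rw [leibniz_lie, hw, hx, neg_lie, neg_add_cancel]

theorem z_τ {x : G} {m : ℝ} (hx : ⁅D.z, x⁆ = (m : ℂ) • x) :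
    ⁅D.z, D.τ x⁆ = -((m : ℂ) • D.τ x) := by
  have := congrArg D.τ hx
  rw [D.τ_lie, D.τ_z, neg_lie, map_smulₛₗ, Complex.conj_ofReal] at this
  rw [← this, neg_neg]

theorem z_τ_K {x : G} (hx : ⁅D.z, x⁆ = 0) : ⁅D.z, D.τ x⁆ = 0 := by
  simpa using D.z_τ (m := 0) (by simpa using hx)

theorem z_τ_P {x : G} (hx : ⁅D.z, x⁆ = x) : ⁅D.z, D.τ x⁆ = -D.τ x := by
  simpa using D.z_τ (m := 1) (by simpa using hx)

theorem z_τ_N {x : G} (hx : ⁅D.z, x⁆ = -x) : ⁅D.z, D.τ x⁆ = D.τ x := by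
  simpa using D.z_τ (m := -1) (by simpa using hx)

/-- By invariance, `ad z` is skew for `B`. -/
theorem B_eq_zero {x y : G} {m n : ℂ} (hx : ⁅D.z, x⁆ = m • x) (hy : ⁅D.z, y⁆ = n • y)
    (h : m + n ≠ 0) : D.B x y = 0 := by
  have h1 : D.B x ⁅D.z, y⁆ = -D.B ⁅D.z, x⁆ y := D.B_inv' _ _ _
  rw [hx, hy, map_smul, map_smul, LinearMap.smul_apply, smul_eq_mul, smul_eq_mul] at h1
  have : (m + n) * D.B x y = 0 := by linear_combination h1
  exact (mul_eq_zero.1 this).resolve_left h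

theorem B_KP {x y : G} (hx : ⁅D.z, x⁆ = 0) (hy : ⁅D.z, y⁆ = y) : D.B x y = 0 :=
  D.B_eq_zero (m := 0) (n := 1) (by simpa using hx) (by simpa using hy) (by norm_num)

theorem B_KN {x y : G} (hx : ⁅D.z, x⁆ = 0) (hy : ⁅D.z, y⁆ = -y) : D.B x y = 0 :=
  D.B_eq_zero (m := 0) (n := -1) (by simpa using hx) (by simpa using hy) (by norm_num)

theorem B_NN {x y : G} (hx : ⁅D.z, x⁆ = -x) (hy : ⁅D.z, y⁆ = -y) : D.B x y = 0 :=
  D.B_eq_zero (m := -1) (n := -1) (by simpa using hx) (by simpa using hy) (by norm_num)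

theorem z_z : ⁅D.z, D.z⁆ = 0 := lie_self _

/-- An element of the `1`-eigenspace in terms of the basis `X`. -/
theorem eq_sum_X {x : G} (hx : ⁅D.z, x⁆ = x) : x = ∑ i, D.B x (D.Y i) • D.X i := by
  obtain ⟨k, b, c, hk, hx'⟩ := D.exists_coeff x
  have h1 : k + ∑ i, b i • D.X i + ∑ i, c i • D.Y i = ∑ i, b i • D.X i - ∑ i, c i • D.Y i := by
    rw [← hx', ← D.z_sum k hk b c, ← hx', hx]
  have h2 : k + (2 : ℂ) • ∑ i, c i • D.Y i = 0 := by
    rw [two_smul]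
    have := sub_eq_zero.2 h1
    rw [← this]; abel
  have zn : ⁅D.z, ∑ i, c i • D.Y i⁆ = -∑ i, c i • D.Y i := by
    simp only [lie_sum, lie_smul, D.z_Y, smul_neg, Finset.sum_neg_distrib]
  have h3 : ∑ i, c i • D.Y i = 0 := by
    have := congrArg (fun y => ⁅D.z, y⁆) h2
    simp only [lie_add, hk, lie_smul, zn, lie_zero, zero_add, smul_neg, neg_eq_zero] at this
    exact (smul_eq_zero.1 this).resolve_left two_ne_zero
  rw [h3, smul_zero, add_zero] at h2
  rw [h3, h2, zero_add, add_zero] at hx'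
  conv_lhs => rw [hx']
  refine Finset.sum_congr rfl fun j _ => ?_
  congr 1
  rw [hx', map_sum, LinearMap.sum_apply]
  simp [D.B_X_Y]

theorem eq_sum_Y {x : G} (hx : ⁅D.z, x⁆ = -x) : x = ∑ i, D.B x (D.X i) • D.Y i := by
  have h := D.eq_sum_X (D.z_τ_N hx)
  have h2 := congrArg D.τ h
  rw [D.τ_τ, map_sum] at h2
  conv_lhs => rw [h2]
  refine Finset.sum_congr rfl fun i _ => ?_
  rw [map_smulₛₗ, tau_X, Y, D.B_τ, Complex.conj_conj]

/-! ### The Fock model: the scalar generalized Verma module on polynomials -/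

/-- The linear form on the dual of the `1`-eigenspace defined by the component of `x`. -/
def ell : G →ₗ[ℂ] MvPolynomial ι ℂ :=
  ∑ i, LinearMap.smulRight (D.B.flip (D.Y i)) (MvPolynomial.X i)

theorem ell_apply (x : G) : D.ell x = ∑ i, D.B x (D.Y i) • MvPolynomial.X i := by
  simp [ell]

theorem ell_X (k : ι) : D.ell (D.X k) = MvPolynomial.X k := by
  rw [ell_apply]
  simp [D.B_X_Y]

theorem ell_K {x : G} (hx : ⁅D.z, x⁆ = 0) : D.ell x = 0 := by
  rw [ell_apply]
  exact Finset.sum_eq_zero fun i _ => by rw [D.B_KN hx (D.z_Y i), zero_smul]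

theorem ell_N {x : G} (hx : ⁅D.z, x⁆ = -x) : D.ell x = 0 := by
  rw [ell_apply]
  exact Finset.sum_eq_zero fun i _ => by rw [D.B_NN hx (D.z_Y i), zero_smul]

/-- The action on the scalar generalized Verma module, realized on polynomials; `r` is the
parameter of the scalar weight. -/
def fock (r : ℝ) (x : G) : MvPolynomial ι ℂ →ₗ[ℂ] MvPolynomial ι ℂ :=
  -- Moving x through a monomial in the Xᵢ to the generator produces terms with zero, one or two
  -- commutators, each of which removes a variable; the factor 1/2 compensates for ordered pairs. An
  -- element y of degree zero or ±1 acts on the generator by `ell y + r B(z, y)`. Double commutators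
  -- lie in 𝔭₊, so the second order part has no scalar term, and triple commutators vanish.
  LinearMap.mulLeft ℂ (D.ell x) + ((r : ℂ) * D.B D.z x) • LinearMap.id +
    ∑ i, (LinearMap.mulLeft ℂ (D.ell ⁅x, D.X i⁆) + ((r : ℂ) * D.B D.z ⁅x, D.X i⁆) •
      LinearMap.id) ∘ₗ (MvPolynomial.pderiv i).toLinearMap +
    (1 / 2 : ℂ) • ∑ i, ∑ j, LinearMap.mulLeft ℂ (D.ell ⁅⁅x, D.X i⁆, D.X j⁆) ∘ₗ
      (MvPolynomial.pderiv i).toLinearMap ∘ₗ (MvPolynomial.pderiv j).toLinearMap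

variable (r : ℝ)

theorem fock_apply (x : G) (p : MvPolynomial ι ℂ) :
    D.fock r x p = D.ell x * p + ((r : ℂ) * D.B D.z x) • p +
      ∑ i, (D.ell ⁅x, D.X i⁆ * MvPolynomial.pderiv i p +
        ((r : ℂ) * D.B D.z ⁅x, D.X i⁆) • MvPolynomial.pderiv i p) +
      (1 / 2 : ℂ) • ∑ i, ∑ j, D.ell ⁅⁅x, D.X i⁆, D.X j⁆ *
        MvPolynomial.pderiv i (MvPolynomial.pderiv j p) := by
  simp [fock]

theorem fock_add (x y : G) : D.fock r (x + y) = D.fock r x + D.fock r y := by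
  refine LinearMap.ext fun p => ?_
  simp only [fock_apply, LinearMap.add_apply, add_lie, map_add, mul_add, add_mul, add_smul,
    Finset.sum_add_distrib, smul_add]
  abel

theorem fock_smul (a : ℂ) (x : G) : D.fock r (a • x) = a • D.fock r x := by
  refine LinearMap.ext fun p => ?_
  simp only [fock_apply, LinearMap.smul_apply, smul_lie, map_smul, smul_eq_mul, smul_add,
    Finset.smul_sum, smul_mul_assoc, smul_smul, mul_left_comm, mul_comm (1 / 2 : ℂ)]

/-- Moving both brackets to w gives `⁅X i, ⁅X j, w⁆⁆`, which is zero because 𝔭₊ is abelian. -/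
theorem B_lie_lie_lie (x : G) (i j : ι) {w : G} (hw : ⁅D.z, w⁆ = 0) :
    D.B ⁅⁅x, D.X i⁆, D.X j⁆ w = 0 := by
  have h : ⁅D.z, ⁅D.X j, w⁆⁆ = ⁅D.X j, w⁆ := by
    rw [← lie_skew (D.X j) w, lie_neg, D.z_KP hw (D.z_X j)]
  rw [D.B_inv, D.B_inv, D.lie_PP (D.z_X i) h, map_zero]

theorem ell_lie_lie_lie (x : G) (i j k : ι) : D.ell ⁅⁅⁅x, D.X i⁆, D.X j⁆, D.X k⁆ = 0 := by
  rw [ell_apply]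
  refine Finset.sum_eq_zero fun l _ => ?_
  rw [D.B_inv ⁅⁅x, D.X i⁆, D.X j⁆, D.B_lie_lie_lie x i j (D.z_PN (D.z_X k) (D.z_Y l)), zero_smul]

theorem lie_X_comm (x : G) (i j : ι) : ⁅⁅x, D.X i⁆, D.X j⁆ = ⁅⁅x, D.X j⁆, D.X i⁆ := by
  have := leibniz_lie x (D.X i) (D.X j)
  rw [D.lie_PP (D.z_X i) (D.z_X j), lie_zero, ← lie_skew (D.X i), ← sub_eq_add_neg] at this
  exact sub_eq_zero.1 this.symm

theorem pderiv_X_mul (i k : ι) (p : MvPolynomial ι ℂ) :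
    MvPolynomial.pderiv i (MvPolynomial.X k * p) =
      (if k = i then p else 0) + MvPolynomial.X k * MvPolynomial.pderiv i p := by
  rw [MvPolynomial.pderiv_mul, MvPolynomial.pderiv_X, Pi.single_apply]
  split_ifs <;> simp

/-- The commutation relation of the action with multiplication by a generator. -/
theorem fock_X_mul (x : G) (k : ι) (p : MvPolynomial ι ℂ) :
    D.fock r x (MvPolynomial.X k * p) =
      MvPolynomial.X k * D.fock r x p + D.fock r ⁅x, D.X k⁆ p := by
  have e1 : ∀ i, D.B D.z ⁅⁅x, D.X k⁆, D.X i⁆ = 0 := fun i => by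
    rw [D.B_symm, D.B_lie_lie_lie x k i D.z_z]
  simp only [fock_apply, pderiv_X_mul, map_add, e1, D.ell_lie_lie_lie, mul_zero, zero_smul,
    zero_mul, Finset.sum_const_zero, smul_zero, add_zero, mul_add, smul_add,
    Finset.sum_add_distrib, apply_ite (MvPolynomial.pderiv _), map_zero, mul_ite, smul_ite,
    Finset.sum_ite_eq, Finset.sum_ite_eq', Finset.mem_univ, if_true, Finset.mul_sum, mul_smul_comm]
  have e2 : ∑ i, ∑ j, (if k = i then D.ell ⁅⁅x, D.X i⁆, D.X j⁆ * MvPolynomial.pderiv j p else 0) =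
      ∑ j, D.ell ⁅⁅x, D.X k⁆, D.X j⁆ * MvPolynomial.pderiv j p := by
    rw [Finset.sum_comm]
    simp
  have e3 : ∑ i, D.ell ⁅⁅x, D.X i⁆, D.X k⁆ * MvPolynomial.pderiv i p =
      ∑ i, D.ell ⁅⁅x, D.X k⁆, D.X i⁆ * MvPolynomial.pderiv i p :=
    Finset.sum_congr rfl fun i _ => by rw [D.lie_X_comm]
  simp only [e2, e3, mul_left_comm (MvPolynomial.X k)]
  module

/-- An operator commuting with the generators and annihilating `1` vanishes. -/
theorem linearMap_eq_zero {A : MvPolynomial ι ℂ →ₗ[ℂ] MvPolynomial ι ℂ}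
    (h : ∀ k p, A (MvPolynomial.X k * p) = MvPolynomial.X k * A p) (h1 : A 1 = 0) : A = 0 := by
  refine LinearMap.ext fun p => ?_
  induction p using MvPolynomial.induction_on with
  | C a => rw [← mul_one (MvPolynomial.C a), ← MvPolynomial.smul_eq_C_mul, map_smul, h1, smul_zero,
      LinearMap.zero_apply]
  | add p q hp hq => rw [map_add, hp, hq]; simp
  | mul_X p i hp => rw [mul_comm, h, hp]; simp

theorem fock_one (x : G) : D.fock r x 1 = D.ell x + ((r : ℂ) * D.B D.z x) • 1 := by
  rw [fock_apply]; simp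

theorem fock_X (k : ι) (p : MvPolynomial ι ℂ) :
    D.fock r (D.X k) p = MvPolynomial.X k * p := by
  have h1 : ∀ i, ⁅D.X k, D.X i⁆ = 0 := fun i => D.lie_PP (D.z_X k) (D.z_X i)
  rw [fock_apply, D.ell_X, D.B_KP D.z_z (D.z_X k)]
  simp [h1]

/-- The action as a linear map. -/
def fockLin : G →ₗ[ℂ] Module.End ℂ (MvPolynomial ι ℂ) where
  toFun := D.fock r
  map_add' := D.fock_add r
  map_smul' := D.fock_smul r

theorem fock_zero : D.fock r 0 = 0 := (D.fockLin r).map_zero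

theorem fock_neg (x : G) : D.fock r (-x) = -D.fock r x := (D.fockLin r).map_neg x

theorem fock_sum {κ : Type*} (s : Finset κ) (f : κ → G) :
    D.fock r (∑ i ∈ s, f i) = ∑ i ∈ s, D.fock r (f i) := map_sum (D.fockLin r) f s

theorem fock_lie_X (x : G) (k : ι) : D.fock r ⁅x, D.X k⁆ =
    D.fock r x * D.fock r (D.X k) - D.fock r (D.X k) * D.fock r x := by
  refine LinearMap.ext fun p => ?_
  rw [LinearMap.sub_apply, Module.End.mul_apply, Module.End.mul_apply, fock_X, fock_X,
    fock_X_mul, add_sub_cancel_left]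

/-- The defect of `fock` from being a homomorphism of Lie algebras. -/
def fockDefect : G →ₗ[ℂ] G →ₗ[ℂ] Module.End ℂ (MvPolynomial ι ℂ) :=
  LinearMap.mk₂ ℂ (fun x y => D.fock r ⁅x, y⁆ -
      (D.fock r x * D.fock r y - D.fock r y * D.fock r x))
    (fun x x' y => by simp only [add_lie, fock_add, add_mul, mul_add]; abel)
    (fun a x y => by
      simp only [smul_lie, fock_smul, smul_mul_assoc, mul_smul_comm, smul_sub])
    (fun x y y' => by simp only [lie_add, fock_add, add_mul, mul_add]; abel)
    (fun a x y => by
      simp only [lie_smul, fock_smul, smul_mul_assoc, mul_smul_comm, smul_sub])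

theorem fockDefect_apply (x y : G) : D.fockDefect r x y = D.fock r ⁅x, y⁆ -
    (D.fock r x * D.fock r y - D.fock r y * D.fock r x) := rfl

theorem fockDefect_X (x : G) (k : ι) : D.fockDefect r x (D.X k) = 0 := by
  rw [fockDefect_apply, fock_lie_X, sub_self]

theorem fockDefect_symm (x y : G) : D.fockDefect r x y = -D.fockDefect r y x := by
  rw [fockDefect_apply, fockDefect_apply, ← lie_skew, fock_neg]
  abel

theorem fockDefect_P (x : G) {y : G} (hy : ⁅D.z, y⁆ = y) : D.fockDefect r x y = 0 := by
  rw [D.eq_sum_X hy, map_sum]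
  exact Finset.sum_eq_zero fun i _ => by rw [map_smul, fockDefect_X, smul_zero]

theorem fockDefect_P' {x : G} (y : G) (hx : ⁅D.z, x⁆ = x) : D.fockDefect r x y = 0 := by
  rw [fockDefect_symm, D.fockDefect_P r y hx, neg_zero]

/-- The commutator of the defect of (x, y) with multiplication by `X k` is the sum of the defects of
(⁅x, X k⁆, y) and (x, ⁅y, X k⁆). If these vanish, the defect is determined by its value at 1. This
gives an induction on the grading: bracketing with `X k` raises the degree, and defects with an
argument in 𝔭₊ are zero. -/
theorem fockDefect_step {x y : G} (h1 : ∀ k, D.fockDefect r ⁅x, D.X k⁆ y = 0)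
    (h2 : ∀ k, D.fockDefect r x ⁅y, D.X k⁆ = 0) (hx : D.ell x = 0) (hy : D.ell y = 0)
    (hxy : D.ell ⁅x, y⁆ = 0) (hz : D.B D.z ⁅x, y⁆ = 0) : D.fockDefect r x y = 0 := by
  refine linearMap_eq_zero (fun k p => ?_) ?_
  · have e1 := fun q => LinearMap.congr_fun (h1 k) q
    have e2 := fun q => LinearMap.congr_fun (h2 k) q
    have e3 : D.fock r ⁅⁅x, y⁆, D.X k⁆ = D.fock r ⁅x, ⁅y, D.X k⁆⁆ + D.fock r ⁅⁅x, D.X k⁆, y⁆ := by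
      rw [← fock_add, lie_lie x y, ← lie_skew y ⁅x, D.X k⁆, sub_neg_eq_add]
    simp only [fockDefect_apply, LinearMap.sub_apply, Module.End.mul_apply, LinearMap.zero_apply,
      sub_eq_zero] at e1 e2
    simp only [fockDefect_apply, LinearMap.sub_apply, Module.End.mul_apply, fock_X_mul, map_add,
      e3, LinearMap.add_apply, e1, e2]
    ring
  · simp only [fockDefect_apply, LinearMap.sub_apply, Module.End.mul_apply, fock_one, hx, hy, hxy,
      hz, zero_add, mul_zero, zero_smul, map_smul, smul_smul]
    rw [mul_comm, sub_self, sub_zero]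

theorem fockDefect_KK {x y : G} (hx : ⁅D.z, x⁆ = 0) (hy : ⁅D.z, y⁆ = 0) :
    D.fockDefect r x y = 0 :=
  D.fockDefect_step r (fun k => D.fockDefect_P' r _ (D.z_KP hx (D.z_X k)))
    (fun k => D.fockDefect_P r _ (D.z_KP hy (D.z_X k))) (D.ell_K hx) (D.ell_K hy)
    (D.ell_K (D.z_KK hx hy)) (by rw [← D.B_inv, hx, map_zero, LinearMap.zero_apply])

theorem fockDefect_KN {x y : G} (hx : ⁅D.z, x⁆ = 0) (hy : ⁅D.z, y⁆ = -y) :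
    D.fockDefect r x y = 0 :=
  D.fockDefect_step r (fun k => D.fockDefect_P' r _ (D.z_KP hx (D.z_X k)))
    (fun k => D.fockDefect_KK r hx (D.z_NP hy (D.z_X k))) (D.ell_K hx) (D.ell_N hy)
    (D.ell_N (D.z_KN hx hy)) (by rw [← D.B_inv, hx, map_zero, LinearMap.zero_apply])

theorem fockDefect_NN {x y : G} (hx : ⁅D.z, x⁆ = -x) (hy : ⁅D.z, y⁆ = -y) :
    D.fockDefect r x y = 0 := by
  refine D.fockDefect_step r (fun k => D.fockDefect_KN r (D.z_NP hx (D.z_X k)) hy)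
    (fun k => ?_) (D.ell_N hx) (D.ell_N hy) ?_ ?_
  · rw [fockDefect_symm, D.fockDefect_KN r (D.z_NP hy (D.z_X k)) hx, neg_zero]
  · rw [D.lie_NN hx hy, map_zero]
  · rw [D.lie_NN hx hy, map_zero]

theorem exists_graded (x : G) : ∃ k p n : G, x = k + p + n ∧ ⁅D.z, k⁆ = 0 ∧ ⁅D.z, p⁆ = p ∧
    ⁅D.z, n⁆ = -n := by
  obtain ⟨k, b, c, hk, hx⟩ := D.exists_coeff x
  refine ⟨k, _, _, hx, hk, ?_, ?_⟩
  · simp only [lie_sum, lie_smul, D.z_X]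
  · simp only [lie_sum, lie_smul, D.z_Y, smul_neg, Finset.sum_neg_distrib]

theorem fock_lie (x y : G) : D.fock r ⁅x, y⁆ =
    D.fock r x * D.fock r y - D.fock r y * D.fock r x := by
  rw [← sub_eq_zero, ← fockDefect_apply]
  obtain ⟨k, p, n, rfl, hk, hp, hn⟩ := D.exists_graded x
  obtain ⟨k', p', n', rfl, hk', hp', hn'⟩ := D.exists_graded y
  simp only [map_add, LinearMap.add_apply, D.fockDefect_P r _ hp', D.fockDefect_P' r _ hp,
    D.fockDefect_KK r hk hk', D.fockDefect_KN r hk hn', D.fockDefect_NN r hn hn',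
    D.fockDefect_symm r n k', D.fockDefect_KN r hk' hn, neg_zero, add_zero]

theorem fock_fock (x y : G) (p : MvPolynomial ι ℂ) : D.fock r x (D.fock r y p) =
    D.fock r y (D.fock r x p) + D.fock r ⁅x, y⁆ p := by
  rw [fock_lie, LinearMap.sub_apply, Module.End.mul_apply, Module.End.mul_apply]
  abel

theorem fock_Y_comm (i j : ι) (p : MvPolynomial ι ℂ) : D.fock r (D.Y i) (D.fock r (D.Y j) p) =
    D.fock r (D.Y j) (D.fock r (D.Y i) p) := by
  rw [fock_fock, D.lie_NN (D.z_Y i) (D.z_Y j), fock_zero, LinearMap.zero_apply, add_zero]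

theorem fock_P {x : G} (hx : ⁅D.z, x⁆ = x) (p : MvPolynomial ι ℂ) :
    D.fock r x p = D.ell x * p := by
  conv_lhs => rw [D.eq_sum_X hx]
  simp only [fock_sum, fock_smul, LinearMap.sum_apply, LinearMap.smul_apply, fock_X, ell_apply,
    Finset.sum_mul, smul_mul_assoc]

theorem fock_Y_one (i : ι) : D.fock r (D.Y i) 1 = 0 := by
  rw [fock_one, D.ell_N (D.z_Y i), D.B_KN D.z_z (D.z_Y i)]
  simp

end HermitianDatum
end HermitianLie

/-! ### The contravariant Hermitian form and its radical -/

namespace HermitianLie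
namespace HermitianDatum

variable {G ι : Type*} [LieRing G] [LieAlgebra ℂ G] [Fintype ι] [DecidableEq ι]
  (D : HermitianDatum G ι) (r : ℝ)

-- As 𝔭₋ is abelian, polynomials can be evaluated at the operators -Yᵢ. The sign is the one for
-- which these operators are adjoint to multiplication by the variables.
open scoped IsMulCommutative in
theorem exists_loweringHom : ∃ Ψ : MvPolynomial ι ℂ →ₐ[ℂ] Module.End ℂ (MvPolynomial ι ℂ),
    ∀ i, Ψ (MvPolynomial.X i) = -D.fock r (D.Y i) := by
  let s : Set (Module.End ℂ (MvPolynomial ι ℂ)) := Set.range fun i => -D.fock r (D.Y i)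
  have hs : ∀ a ∈ s, ∀ b ∈ s, a * b = b * a := by
    rintro _ ⟨i, rfl⟩ _ ⟨j, rfl⟩
    refine LinearMap.ext fun p => ?_
    simp only [Module.End.mul_apply, LinearMap.neg_apply, map_neg, neg_neg]
    exact D.fock_Y_comm r i j p
  haveI := Algebra.isMulCommutative_adjoin ℂ hs
  refine ⟨(Algebra.adjoin ℂ s).val.comp (MvPolynomial.aeval fun i =>
    (⟨-D.fock r (D.Y i), Algebra.subset_adjoin ⟨i, rfl⟩⟩ : Algebra.adjoin ℂ s)), fun i => ?_⟩
  rw [AlgHom.comp_apply, MvPolynomial.aeval_X]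
  rfl

/-- Polynomials in the lowering operators `-Y i`. -/
def lowering : MvPolynomial ι ℂ →ₐ[ℂ] Module.End ℂ (MvPolynomial ι ℂ) :=
  (D.exists_loweringHom r).choose

theorem lowering_X (i : ι) : D.lowering r (MvPolynomial.X i) = -D.fock r (D.Y i) :=
  (D.exists_loweringHom r).choose_spec i

/-- The contravariant Hermitian form on the Fock model. -/
def form : MvPolynomial ι ℂ →ₗ⋆[ℂ] MvPolynomial ι ℂ →ₗ[ℂ] ℂ :=
  LinearMap.mk₂'ₛₗ (starRingEnd ℂ) (RingHom.id ℂ)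
    -- The value at (p, q) is the constant term of p̄(-Y)q. Adjointness of Xᵢ and -Yᵢ thus holds by
    -- construction in one direction, and `form_K` and `form_Y` supply the rest.
    (fun p q => MvPolynomial.constantCoeff
      (D.lowering r (MvPolynomial.map (starRingEnd ℂ) p) q))
    (fun p p' q => by simp)
    (fun a p q => by
      rw [MvPolynomial.smul_eq_C_mul, map_mul, MvPolynomial.map_C, ← MvPolynomial.smul_eq_C_mul,
        map_smul, LinearMap.smul_apply, MvPolynomial.constantCoeff_smul])
    (fun p q q' => by simp)
    (fun a p q => by rw [map_smul, MvPolynomial.constantCoeff_smul, RingHom.id_apply])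

theorem form_apply (p q : MvPolynomial ι ℂ) : D.form r p q = MvPolynomial.constantCoeff
    (D.lowering r (MvPolynomial.map (starRingEnd ℂ) p) q) := rfl

theorem form_one_left (q : MvPolynomial ι ℂ) :
    D.form r 1 q = MvPolynomial.constantCoeff q := by
  simp [form_apply]

theorem form_X_mul (i : ι) (p q : MvPolynomial ι ℂ) :
    D.form r (MvPolynomial.X i * p) q = -D.form r p (D.fock r (D.Y i) q) := by
  rw [form_apply, form_apply, map_mul, MvPolynomial.map_X, mul_comm, map_mul, lowering_X,
    Module.End.mul_apply, LinearMap.neg_apply, map_neg, map_neg]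

theorem form_C_left (a : ℂ) (q : MvPolynomial ι ℂ) :
    D.form r (MvPolynomial.C a) q = starRingEnd ℂ a * MvPolynomial.constantCoeff q := by
  rw [← mul_one (MvPolynomial.C a), ← MvPolynomial.smul_eq_C_mul, map_smulₛₗ,
    LinearMap.smul_apply, form_one_left, smul_eq_mul]

theorem constantCoeff_ell_mul (x : G) (p : MvPolynomial ι ℂ) :
    MvPolynomial.constantCoeff (D.ell x * p) = 0 := by
  simp [ell_apply, MvPolynomial.smul_eq_C_mul]

theorem constantCoeff_fock_K {x : G} (hx : ⁅D.z, x⁆ = 0) (p : MvPolynomial ι ℂ) :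
    MvPolynomial.constantCoeff (D.fock r x p) =
      (r : ℂ) * D.B D.z x * MvPolynomial.constantCoeff p := by
  have h1 : ∀ i, D.B D.z ⁅x, D.X i⁆ = 0 := fun i => D.B_KP D.z_z (D.z_KP hx (D.z_X i))
  rw [fock_apply]
  simp only [map_add, map_sum, MvPolynomial.constantCoeff_smul, constantCoeff_ell_mul, h1,
    mul_zero, zero_smul, Finset.sum_const_zero, smul_zero, add_zero, zero_add, smul_eq_mul, map_zero]

theorem B_z_τ (x : G) : D.B D.z (D.τ x) = -starRingEnd ℂ (D.B D.z x) := by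
  rw [← D.B_τ, D.τ_z, map_neg, LinearMap.neg_apply, neg_neg]

/-- Contravariance for the degree zero part. -/
theorem form_K {w : G} (hw : ⁅D.z, w⁆ = 0) (p q : MvPolynomial ι ℂ) :
    D.form r (D.fock r w p) q = -D.form r p (D.fock r (D.τ w) q) := by
  induction p using MvPolynomial.induction_on generalizing q with
  | C a =>
    have : D.fock r w (MvPolynomial.C a) = MvPolynomial.C (((r : ℂ) * D.B D.z w) * a) := by
      rw [← mul_one (MvPolynomial.C a), ← MvPolynomial.smul_eq_C_mul, map_smul, fock_one,
        D.ell_K hw, zero_add, smul_smul, MvPolynomial.smul_eq_C_mul, mul_one, mul_comm]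
    rw [this, form_C_left, form_C_left, D.constantCoeff_fock_K r (D.z_τ_K hw), B_z_τ]
    simp only [map_mul, Complex.conj_ofReal]
    ring
  | add p p' hp hp' => simp only [map_add, LinearMap.add_apply, hp, hp', neg_add]
  | mul_X p i hp =>
    rw [mul_comm, fock_X_mul, map_add, LinearMap.add_apply, form_X_mul, form_X_mul, hp,
      D.fock_P r (D.z_KP hw (D.z_X i)), ell_apply, Finset.sum_mul, map_sum, LinearMap.sum_apply]
    simp only [smul_mul_assoc, map_smulₛₗ, LinearMap.smul_apply, form_X_mul, smul_eq_mul,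
      mul_neg]
    -- Conjugation carries the expansion of ⁅w, Xᵢ⁆ in the basis `X` to that of ⁅τw, Yᵢ⁆ in the
    -- basis `Y`, with conjugate coefficients; these are the ones the antilinear slot produces.
    have e1 : D.fock r ⁅D.τ w, D.Y i⁆ q =
        ∑ j, starRingEnd ℂ (D.B ⁅w, D.X i⁆ (D.Y j)) • D.fock r (D.Y j) q := by
      have h := D.eq_sum_Y (D.z_KN (D.z_τ_K hw) (D.z_Y i))
      rw [h, fock_sum, LinearMap.sum_apply]
      refine Finset.sum_congr rfl fun j _ => ?_
      rw [fock_smul, LinearMap.smul_apply, ← D.B_τ, D.τ_lie, tau_X, tau_Y]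
    rw [D.fock_fock r (D.τ w), e1, map_add, map_sum]
    simp only [map_smul, smul_eq_mul, Finset.sum_neg_distrib]
    ring

/-- Moving Yᵢ past a variable leaves a bracket of degree zero, to which `form_K` applies. -/
theorem form_Y (i : ι) (p q : MvPolynomial ι ℂ) :
    D.form r (D.fock r (D.Y i) p) q = -D.form r p (MvPolynomial.X i * q) := by
  induction p using MvPolynomial.induction_on generalizing q with
  | C a =>
    rw [← mul_one (MvPolynomial.C a), ← MvPolynomial.smul_eq_C_mul, map_smul, fock_Y_one,
      smul_zero, map_zero, map_smulₛₗ, LinearMap.smul_apply, form_one_left]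
    simp
  | add p p' hp hp' => simp only [map_add, LinearMap.add_apply, hp, hp', neg_add]
  | mul_X p j hp =>
    rw [mul_comm, fock_X_mul, map_add, LinearMap.add_apply, form_X_mul, hp, form_X_mul,
      D.form_K r (D.z_NP (D.z_Y i) (D.z_X j)), D.τ_lie, tau_Y, tau_X, ← D.fock_X r i,
      ← D.fock_X r i, D.fock_fock r (D.X i), map_add]
    ring

/-- Contravariance of the form. -/
theorem form_fock (x : G) (p q : MvPolynomial ι ℂ) :
    D.form r (D.fock r x p) q = -D.form r p (D.fock r (D.τ x) q) := by
  obtain ⟨k, b, c, hk, rfl⟩ := D.exists_coeff x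
  simp only [fock_add, fock_sum, fock_smul, LinearMap.add_apply, LinearMap.sum_apply,
    LinearMap.smul_apply, map_add, map_sum, map_smulₛₗ, D.form_K r hk, form_Y, fock_X,
    form_X_mul, tau_X, tau_Y, smul_eq_mul, RingHom.id_apply, mul_neg, Finset.sum_neg_distrib,
    neg_add]

theorem form_symm (p q : MvPolynomial ι ℂ) :
    D.form r q p = starRingEnd ℂ (D.form r p q) := by
  induction p using MvPolynomial.induction_on generalizing q with
  | C a =>
    rw [form_C_left]
    induction q using MvPolynomial.induction_on with
    | C b => rw [form_C_left]; simp [mul_comm]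
    | add q q' hq hq' => simp only [map_add, LinearMap.add_apply, hq, hq', mul_add]
    | mul_X q j hq =>
      rw [mul_comm, form_X_mul, ← mul_one (MvPolynomial.C a), ← MvPolynomial.smul_eq_C_mul,
        map_smul, fock_Y_one]
      simp
  | add p p' hp hp' => simp only [map_add, LinearMap.add_apply, hp, hp']
  | mul_X p i hp => rw [mul_comm, form_X_mul, map_neg, ← hp, form_Y, neg_neg]

theorem form_self_im (p : MvPolynomial ι ℂ) : ((D.form r p p).re : ℂ) = D.form r p p :=
  Complex.conj_eq_iff_re.1 (D.form_symm r p p).symm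

/-- The radical of the contravariant form. -/
def radical : Submodule ℂ (MvPolynomial ι ℂ) where
  carrier := {p | ∀ q, D.form r q p = 0}
  add_mem' := fun hp hp' q => by rw [map_add, hp q, hp' q, add_zero]
  zero_mem' := fun q => map_zero _
  smul_mem' := fun a p hp q => by rw [map_smul, hp q, smul_zero]

theorem form_radical_left {p : MvPolynomial ι ℂ} (hp : p ∈ D.radical r) (q : MvPolynomial ι ℂ) :
    D.form r p q = 0 := by
  rw [form_symm, hp q, map_zero]

theorem fock_mem_radical (x : G) {p : MvPolynomial ι ℂ} (hp : p ∈ D.radical r) :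
    D.fock r x p ∈ D.radical r := fun q => by
  have := D.form_fock r (D.τ x) q p
  rw [hp, D.τ_τ] at this
  exact neg_eq_zero.1 this.symm

theorem one_notMem_radical : (1 : MvPolynomial ι ℂ) ∉ D.radical r := fun h => by
  have := h 1
  rw [form_one_left] at this
  simp at this

/-- The radical contains every subspace without constant terms that is stable under lowering. -/
theorem mem_radical_of_stable (U : Submodule ℂ (MvPolynomial ι ℂ))
    (hU : ∀ i, ∀ p ∈ U, D.fock r (D.Y i) p ∈ U)
    (hc : ∀ p ∈ U, MvPolynomial.constantCoeff p = 0) : U ≤ D.radical r := by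
  intro p hp q
  revert p
  induction q using MvPolynomial.induction_on with
  | C a => intro p hp; rw [form_C_left, hc p hp, mul_zero]
  | add q q' hq hq' => intro p hp; rw [map_add, LinearMap.add_apply, hq hp, hq' hp, add_zero]
  | mul_X q i hq => intro p hp; rw [mul_comm, form_X_mul, hq (hU i p hp), neg_zero]

/-- Pairing with a multiple of Xᵢ reduces to the image under Yᵢ, so only the pairing with constants
needs a separate assumption. -/
theorem mem_radical_of_Y {p : MvPolynomial ι ℂ} (h0 : MvPolynomial.constantCoeff p = 0)
    (h : ∀ i, D.fock r (D.Y i) p ∈ D.radical r) : p ∈ D.radical r := by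
  intro q
  induction q using MvPolynomial.induction_on with
  | C a => rw [form_C_left, h0, mul_zero]
  | add q q' hq hq' => rw [map_add, LinearMap.add_apply, hq, hq', add_zero]
  | mul_X q i _ => rw [mul_comm, form_X_mul, h i q, neg_zero]

end HermitianDatum
end HermitianLie

/-! ### The 𝔰𝔩₂-triple of the highest root vector and the eigenvalues of `ad h` -/

namespace HermitianLie
namespace HermitianDatum

variable {G ι : Type*} [LieRing G] [LieAlgebra ℂ G] [Fintype ι] [DecidableEq ι]
  (D : HermitianDatum G ι)

/-- The semisimple element of the `𝔰𝔩₂`-triple through `X o`. -/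
def h : G := ⁅D.X D.o, D.Y D.o⁆

/-- The largest eigenvalue of `ad h`. -/
def s : ℝ := D.a D.o

theorem z_h : ⁅D.z, D.h⁆ = 0 := D.z_PN (D.z_X _) (D.z_Y _)

theorem tau_h : D.τ D.h = -D.h := by
  rw [h, D.τ_lie, tau_X, tau_Y, lie_skew]

theorem h_X (i : ι) : ⁅D.h, D.X i⁆ = (D.a i : ℂ) • D.X i := D.lie_h i

theorem h_X_o : ⁅D.h, D.X D.o⁆ = (D.s : ℂ) • D.X D.o := D.lie_h _

theorem h_τ {x : G} {m : ℝ} (hx : ⁅D.h, x⁆ = (m : ℂ) • x) :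
    ⁅D.h, D.τ x⁆ = -((m : ℂ) • D.τ x) := by
  have := congrArg D.τ hx
  rw [D.τ_lie, D.tau_h, neg_lie, map_smulₛₗ, Complex.conj_ofReal] at this
  rw [← this, neg_neg]

theorem h_Y (i : ι) : ⁅D.h, D.Y i⁆ = -((D.a i : ℂ) • D.Y i) := D.h_τ (D.h_X i)

theorem h_Y_o : ⁅D.h, D.Y D.o⁆ = -((D.s : ℂ) • D.Y D.o) := D.h_τ (D.h_X_o)

theorem X_ne_zero (i : ι) : D.X i ≠ 0 := fun h0 => by
  have := D.B_X_Y i i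
  rw [h0] at this
  simp at this

theorem h_ne_zero : D.h ≠ 0 := fun h0 => by
  have : D.B D.z D.h = 1 := by
    rw [h, ← D.B_inv, D.z_X, D.B_X_Y, if_pos rfl]
  rw [h0, map_zero] at this
  exact zero_ne_one this

theorem B_z_h : D.B D.z D.h = 1 := by
  rw [h, ← D.B_inv, D.z_X, D.B_X_Y, if_pos rfl]

/-- Invariance gives B(h, h) = s. As τh = -h, this is the negative of B(h, τh), and the latter is
negative on the degree zero part. -/
theorem s_pos : 0 < D.s := by
  have h1 : D.B D.h D.h = D.s := by
    conv_lhs => rw [← neg_neg (D.B D.h D.h)]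
    have : D.B D.h ⁅D.X D.o, D.Y D.o⁆ = -D.B ⁅D.X D.o, D.h⁆ (D.Y D.o) := D.B_inv' _ _ _
    rw [← h, ← lie_skew, D.h_X_o, map_neg, LinearMap.neg_apply, map_smul, LinearMap.smul_apply,
      D.B_X_Y, if_pos rfl] at this
    rw [this]; simp
  have h2 := D.neg D.h D.z_h D.h_ne_zero
  rw [D.tau_h, map_neg, h1] at h2
  simpa using h2

theorem s_ne_zero : (D.s : ℂ) ≠ 0 := by exact_mod_cast D.s_pos.ne'

/-- Only the term ⁅h, Xᵢ⁆ of the Jacobi identity survives, because `X o` commutes with `X i`. -/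
theorem X_o_lie_lie (i : ι) : ⁅D.X D.o, ⁅D.Y D.o, D.X i⁆⁆ = (D.a i : ℂ) • D.X i := by
  rw [leibniz_lie, D.lie_PP (D.z_X _) (D.z_X _), lie_zero, add_zero]
  exact D.h_X i

/-- For k = ⁅Y o, X i⁆ one finds B(k, τk) = -aᵢ, and this form is definite on the degree zero part.
-/
theorem eq_zero_of_a {i : ι} (hi : D.a i = 0) : ⁅D.Y D.o, D.X i⁆ = 0 := by
  by_contra hne
  have h1 := D.neg _ (D.z_NP (D.z_Y _) (D.z_X _)) hne
  rw [D.τ_lie, tau_X, tau_Y, D.B_inv', D.X_o_lie_lie, hi] at h1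
  simp at h1

theorem eq_zero_of_a' {i : ι} (hi : D.a i = 0) : ⁅D.X D.o, D.Y i⁆ = 0 := by
  have := congrArg D.τ (D.eq_zero_of_a hi)
  rwa [D.τ_lie, map_zero, tau_X, tau_Y] at this

theorem h_lie {x y : G} {m n : ℂ} (hx : ⁅D.h, x⁆ = m • x) (hy : ⁅D.h, y⁆ = n • y) :
    ⁅D.h, ⁅x, y⁆⁆ = (m + n) • ⁅x, y⁆ := by
  rw [leibniz_lie, hx, hy, smul_lie, lie_smul, add_smul]

/-- Apply `Y o` to `X i` repeatedly. A third application gives zero, since 𝔭₋ is abelian; applying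
`X o` to this zero gives 3(aᵢ - s)n = 0 for the second image n. If n = 0, then (2aᵢ - s)k = 0 for
the first image k, and if k = 0, then aᵢ = 0. These are the three possible lengths of an 𝔰𝔩₂-string.
-/
theorem a_cases (i : ι) : D.a i = 0 ∨ 2 * D.a i = D.s ∨ i = D.o := by
  set k := ⁅D.Y D.o, D.X i⁆ with hk
  set n := ⁅D.Y D.o, k⁆ with hn
  have hY : ⁅D.h, D.Y D.o⁆ = (-(D.s : ℂ)) • D.Y D.o := by rw [D.h_Y_o, neg_smul]
  have zk : ⁅D.z, k⁆ = 0 := D.z_NP (D.z_Y _) (D.z_X _)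
  have zn : ⁅D.z, n⁆ = -n := by rw [hn, leibniz_lie, zk, D.z_Y, lie_zero, add_zero, neg_lie]
  have hk' : ⁅D.h, k⁆ = (-(D.s : ℂ) + D.a i) • k := D.h_lie hY (D.h_X i)
  have hn' : ⁅D.h, n⁆ = (-(D.s : ℂ) + (-(D.s : ℂ) + D.a i)) • n := D.h_lie hY hk'
  have e1 : ⁅D.X D.o, n⁆ = (2 * D.a i - D.s : ℂ) • k := by
    rw [hn, leibniz_lie, ← h, hk', D.X_o_lie_lie, lie_smul, ← hk]; module
  have e2 : ((3 * (D.a i - D.s) : ℝ) : ℂ) • n = 0 := by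
    have : ⁅D.X D.o, ⁅D.Y D.o, n⁆⁆ = 0 := by rw [D.lie_NN (D.z_Y _) zn, lie_zero]
    rw [leibniz_lie, ← h, hn', e1, lie_smul, ← hn] at this
    rw [← this]; push_cast; module
  rcases smul_eq_zero.1 e2 with h1 | h1
  · right; right
    apply D.a_inj
    have : 3 * (D.a i - D.s) = 0 := by exact_mod_cast h1
    rw [s] at this; linarith
  · rw [h1, lie_zero] at e1
    rcases smul_eq_zero.1 e1.symm with h2 | h2
    · right; left
      have : 2 * D.a i - D.s = 0 := by exact_mod_cast h2
      linarith
    · left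
      have h3 := D.X_o_lie_lie i
      rw [← hk, h2, lie_zero] at h3
      exact_mod_cast (smul_eq_zero.1 h3.symm).resolve_right (D.X_ne_zero i)

theorem a_o : D.a D.o = D.s := rfl

theorem a_nonneg (i : ι) : 0 ≤ D.a i := by
  have := D.s_pos
  rcases D.a_cases i with h | h | h
  · rw [h]
  · linarith
  · rw [h, a_o]; linarith

theorem a_le (i : ι) : D.a i ≤ D.s := by
  have := D.s_pos
  rcases D.a_cases i with h | h | h
  · rw [h]; linarith
  · linarith
  · rw [h, a_o]

/-- Coefficients of an eigenvector of `ad h`. -/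
theorem coeff_eq_zero {x : G} {m : ℂ} (hx : ⁅D.h, x⁆ = m • x) {j : ι} (hj : (D.a j : ℂ) ≠ m) :
    D.B x (D.Y j) = 0 := by
  have h1 : D.B x ⁅D.h, D.Y j⁆ = -D.B ⁅D.h, x⁆ (D.Y j) := D.B_inv' _ _ _
  rw [hx, D.h_Y, map_neg, map_smul, map_smul, LinearMap.smul_apply, neg_inj] at h1
  have : ((D.a j : ℂ) - m) * D.B x (D.Y j) = 0 := by
    rw [sub_mul]; exact sub_eq_zero.2 h1
  exact (mul_eq_zero.1 this).resolve_left (sub_ne_zero.2 hj)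

theorem eq_zero_of_h_eigen {x : G} {m : ℝ} (hP : ⁅D.z, x⁆ = x) (hx : ⁅D.h, x⁆ = (m : ℂ) • x)
    (hm : ∀ j, D.a j ≠ m) : x = 0 := by
  rw [D.eq_sum_X hP]
  exact Finset.sum_eq_zero fun j _ => by
    rw [D.coeff_eq_zero hx (by exact_mod_cast hm j), zero_smul]

theorem eq_zero_of_h_gt {x : G} {m : ℝ} (hP : ⁅D.z, x⁆ = x) (hx : ⁅D.h, x⁆ = (m : ℂ) • x)
    (hm : D.s < m) : x = 0 :=
  D.eq_zero_of_h_eigen hP hx fun j => by have := D.a_le j; linarith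

theorem eq_zero_of_h_neg {x : G} {m : ℝ} (hP : ⁅D.z, x⁆ = x) (hx : ⁅D.h, x⁆ = (m : ℂ) • x)
    (hm : m < 0) : x = 0 :=
  D.eq_zero_of_h_eigen hP hx fun j => by have := D.a_nonneg j; linarith

/-- Raising operators. -/
def Wp (i : ι) : G := (2 / D.s : ℂ) • ⁅D.X D.o, D.Y i⁆

/-- Lowering operators. -/
def Wm (i : ι) : G := ⁅D.Y D.o, D.X i⁆

theorem z_Wp (i : ι) : ⁅D.z, D.Wp i⁆ = 0 := by
  rw [Wp, lie_smul, D.z_PN (D.z_X _) (D.z_Y _), smul_zero]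

theorem z_Wm (i : ι) : ⁅D.z, D.Wm i⁆ = 0 := D.z_NP (D.z_Y _) (D.z_X _)

theorem tau_Wm (i : ι) : D.τ (D.Wm i) = (D.s / 2 : ℂ) • D.Wp i := by
  rw [Wm, D.τ_lie, tau_X, tau_Y, Wp, smul_smul, div_mul_div_cancel₀ two_ne_zero,
    div_self D.s_ne_zero, one_smul]

theorem tau_Wp (i : ι) : D.τ (D.Wp i) = (2 / D.s : ℂ) • D.Wm i := by
  rw [Wp, map_smulₛₗ, D.τ_lie, tau_X, tau_Y, Wm, map_div₀, Complex.conj_ofReal, map_ofNat]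

theorem h_Wp {i : ι} (hi : 2 * D.a i = D.s) : ⁅D.h, D.Wp i⁆ = ((D.s / 2 : ℝ) : ℂ) • D.Wp i := by
  have := D.h_lie D.h_X_o (y := D.Y i) (n := -(D.a i : ℂ)) (by rw [D.h_Y, neg_smul])
  rw [Wp, lie_smul, this, smul_comm]
  congr 2
  rw [← hi]; push_cast; ring

theorem h_Wm {i : ι} (hi : 2 * D.a i = D.s) :
    ⁅D.h, D.Wm i⁆ = ((-(D.s / 2) : ℝ) : ℂ) • D.Wm i := by
  have := D.h_lie (x := D.Y D.o) (m := -(D.s : ℂ)) (by rw [D.h_Y_o, neg_smul]) (D.h_X i)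
  rw [Wm, this]
  congr 1
  rw [← hi]; push_cast; ring

/-- The factor 2/s in `Wp` is chosen to make this normalization hold: it lets every Yᵢ of the middle
eigenvalue be written as a commutator of `Y o` with a raising operator. -/
theorem Y_o_Wp {i : ι} (hi : 2 * D.a i = D.s) : ⁅D.Y D.o, D.Wp i⁆ = D.Y i := by
  rw [Wp, lie_smul, leibniz_lie, D.lie_NN (D.z_Y _) (D.z_Y _), lie_zero, add_zero,
    ← lie_skew (D.Y D.o), ← h, neg_lie, D.h_Y, neg_neg, smul_smul]
  have : (2 / D.s * D.a i : ℂ) = 1 := by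
    have := D.s_ne_zero
    field_simp
    exact_mod_cast hi
  rw [this, one_smul]

/-- The result would have eigenvalue 3s/2, above the largest one. -/
theorem Wp_X_o {i : ι} (hi : 2 * D.a i = D.s) : ⁅D.Wp i, D.X D.o⁆ = 0 := by
  refine D.eq_zero_of_h_gt (m := D.s / 2 + D.s) (D.z_KP (D.z_Wp i) (D.z_X _)) ?_
    (by linarith [D.s_pos])
  rw [D.h_lie (D.h_Wp hi) D.h_X_o]
  push_cast; rfl

theorem Wm_Y_o {i : ι} (hi : 2 * D.a i = D.s) : ⁅D.Wm i, D.Y D.o⁆ = 0 := by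
  have := congrArg D.τ (D.Wp_X_o hi)
  rw [D.τ_lie, tau_Wp, tau_X, smul_lie, map_zero] at this
  exact (smul_eq_zero.1 this).resolve_left (div_ne_zero two_ne_zero D.s_ne_zero)

theorem Wm_X_o (i : ι) : ⁅D.Wm i, D.X D.o⁆ = -((D.a i : ℂ) • D.X i) := by
  rw [← D.X_o_lie_lie, ← Wm, lie_skew]

theorem Wp_Y_o {i : ι} (hi : 2 * D.a i = D.s) : ⁅D.Wp i, D.Y D.o⁆ = -D.Y i := by
  rw [← lie_skew, D.Y_o_Wp hi]

/-- The indices of the eigenvalue `s / 2`. -/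
def half : Finset ι := by classical exact Finset.univ.filter fun i => 2 * D.a i = D.s

theorem mem_half {i : ι} : i ∈ D.half ↔ 2 * D.a i = D.s := by simp [half]

theorem o_notMem_half : D.o ∉ D.half := fun h => by
  have := D.mem_half.1 h
  rw [a_o] at this
  linarith [D.s_pos]

theorem lie_X_o_coeff {w : G} {i : ι} (hi : D.a i = 0) : D.B ⁅w, D.X D.o⁆ (D.Y i) = 0 := by
  rw [D.B_inv, D.eq_zero_of_a' hi, map_zero]

/-- Sum over the basis when the coefficients of eigenvalue zero vanish. -/
theorem sum_eq_half {M : Type*} [AddCommMonoid M] (f : ι → M) (hf : ∀ i, D.a i = 0 → f i = 0) :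
    ∑ i, f i = f D.o + ∑ i ∈ D.half, f i := by
  rw [← Finset.sum_insert D.o_notMem_half]
  refine (Finset.sum_subset (Finset.subset_univ _) fun i _ hi => hf i ?_).symm
  rw [Finset.mem_insert, D.mem_half, not_or] at hi
  rcases D.a_cases i with h | h | h
  · exact h
  · exact absurd h hi.2
  · exact absurd h hi.1

theorem lie_X_o {w : G} (hw : ⁅D.z, w⁆ = 0) : ⁅w, D.X D.o⁆ =
    D.B ⁅w, D.X D.o⁆ (D.Y D.o) • D.X D.o +
      ∑ i ∈ D.half, D.B ⁅w, D.X D.o⁆ (D.Y i) • D.X i := by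
  conv_lhs => rw [D.eq_sum_X (D.z_KP hw (D.z_X D.o))]
  exact D.sum_eq_half _ fun i hi => by rw [D.lie_X_o_coeff hi, zero_smul]

theorem lie_Y_o {w : G} (hw : ⁅D.z, w⁆ = 0) : ⁅w, D.Y D.o⁆ =
    -(D.B ⁅w, D.X D.o⁆ (D.Y D.o)) • D.Y D.o +
      ∑ i ∈ D.half, D.B ⁅w, D.Y D.o⁆ (D.X i) • D.Y i := by
  conv_lhs => rw [D.eq_sum_Y (D.z_KN hw (D.z_Y D.o))]
  rw [D.sum_eq_half]
  · congr 2
    rw [D.B_symm, D.B_inv']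
  · intro i hi
    rw [D.B_inv, D.eq_zero_of_a hi, map_zero, zero_smul]

/-- An element of the degree zero part is the sum of one that commutes with `h` and of raising
and lowering operators. -/
theorem exists_K_decomp {w : G} (hw : ⁅D.z, w⁆ = 0) : ∃ (A : G) (b c : ι → ℂ),
    ⁅D.z, A⁆ = 0 ∧ ⁅D.h, A⁆ = 0 ∧
    w = A + ∑ i ∈ D.half, b i • D.Wm i + ∑ i ∈ D.half, c i • D.Wp i := by
  set β := D.B ⁅w, D.X D.o⁆ (D.Y D.o) with hβ
  -- The coefficients make V reproduce the parts of ⁅w, X o⁆ and ⁅w, Y o⁆ in the middle eigenspace.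
  -- The difference w - V then multiplies `X o` and `Y o` by opposite scalars, so it commutes with h
  -- = ⁅X o, Y o⁆.
  let b : ι → ℂ := fun i => -(2 / D.s) * D.B ⁅w, D.X D.o⁆ (D.Y i)
  let c : ι → ℂ := fun i => -D.B ⁅w, D.Y D.o⁆ (D.X i)
  set V := ∑ i ∈ D.half, b i • D.Wm i + ∑ i ∈ D.half, c i • D.Wp i with hV
  have zV : ⁅D.z, V⁆ = 0 := by
    simp only [hV, lie_add, lie_sum, lie_smul, D.z_Wm, D.z_Wp, smul_zero, Finset.sum_const_zero,
      add_zero]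
  have e1 : ⁅w - V, D.X D.o⁆ = β • D.X D.o := by
    have : ⁅V, D.X D.o⁆ = ∑ i ∈ D.half, D.B ⁅w, D.X D.o⁆ (D.Y i) • D.X i := by
      simp only [hV, add_lie, sum_lie, smul_lie]
      rw [Finset.sum_eq_zero (s := D.half) (f := fun i => c i • ⁅D.Wp i, D.X D.o⁆), add_zero]
      · refine Finset.sum_congr rfl fun i hi => ?_
        have h2 : (D.s : ℂ) = 2 * D.a i := by exact_mod_cast (D.mem_half.1 hi).symm
        have h3 : (D.a i : ℂ) ≠ 0 := fun h0 => D.s_ne_zero (by rw [h2, h0, mul_zero])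
        rw [D.Wm_X_o, smul_neg, smul_smul, ← neg_smul]
        congr 1
        simp only [b, h2]
        field_simp
      · intro i hi
        rw [D.Wp_X_o (D.mem_half.1 hi), smul_zero]
    rw [sub_lie, this, sub_eq_iff_eq_add]
    exact D.lie_X_o hw
  have e2 : ⁅w - V, D.Y D.o⁆ = -β • D.Y D.o := by
    have : ⁅V, D.Y D.o⁆ = ∑ i ∈ D.half, D.B ⁅w, D.Y D.o⁆ (D.X i) • D.Y i := by
      simp only [hV, add_lie, sum_lie, smul_lie]
      rw [Finset.sum_eq_zero (s := D.half) (f := fun i => b i • ⁅D.Wm i, D.Y D.o⁆), zero_add]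
      · refine Finset.sum_congr rfl fun i hi => ?_
        rw [D.Wp_Y_o (D.mem_half.1 hi)]
        simp [c]
      · intro i hi
        rw [D.Wm_Y_o (D.mem_half.1 hi), smul_zero]
    rw [sub_lie, this, sub_eq_iff_eq_add]
    exact D.lie_Y_o hw
  refine ⟨w - V, b, c, by rw [lie_sub, hw, zV, sub_zero], ?_, ?_⟩
  · rw [← lie_skew, h, leibniz_lie, e1, e2, smul_lie, lie_smul, neg_smul, add_neg_cancel, neg_zero]
  · rw [add_assoc, ← hV, sub_add_cancel]

/-- Raising elements are combinations of the `Wp i`. -/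
theorem raising_eq_sum {w : G} (hw : ⁅D.z, w⁆ = 0) (hh : ⁅D.h, w⁆ = ((D.s / 2 : ℝ) : ℂ) • w) :
    w = ∑ i ∈ D.half, -D.B ⁅w, D.Y D.o⁆ (D.X i) • D.Wp i := by
  -- A raising element annihilates `X o`. Hence ⁅X o, ⁅Y o, w⁆⁆ = (s/2)w, and w is recovered from ⁅Y
  -- o, w⁆, a combination of the `Y i` with i in `half`.
  have e0 : ⁅D.X D.o, w⁆ = 0 := by
    have hP : ⁅D.z, ⁅D.X D.o, w⁆⁆ = ⁅D.X D.o, w⁆ := by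
      rw [leibniz_lie, D.z_X, hw, lie_zero, add_zero]
    refine D.eq_zero_of_h_gt (m := D.s + D.s / 2) hP ?_ (by linarith [D.s_pos])
    rw [D.h_lie D.h_X_o hh]; push_cast; rfl
  have e1 : ⁅D.X D.o, ⁅D.Y D.o, w⁆⁆ = ((D.s / 2 : ℝ) : ℂ) • w := by
    rw [leibniz_lie, ← h, hh, e0, lie_zero, add_zero]
  have e2 : D.B ⁅w, D.X D.o⁆ (D.Y D.o) = 0 := by
    rw [← lie_skew, e0, neg_zero, map_zero, LinearMap.zero_apply]
  have e3 := D.lie_Y_o hw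
  rw [e2, neg_zero, zero_smul, zero_add] at e3
  have e4 : w = (2 / D.s : ℂ) • ⁅D.X D.o, ⁅D.Y D.o, w⁆⁆ := by
    rw [e1, smul_smul]
    have := D.s_ne_zero
    push_cast
    field_simp
    rw [one_smul]
  conv_lhs => rw [e4, ← lie_skew (D.Y D.o), e3, lie_neg, lie_sum]
  rw [smul_neg, Finset.smul_sum, ← Finset.sum_neg_distrib]
  refine Finset.sum_congr rfl fun i _ => ?_
  rw [lie_smul, smul_comm, ← Wp, neg_smul]

/-- The eigenspace of `ad h` on the `1`-eigenspace of `ad z` for the eigenvalue zero. -/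
def V0 : Submodule ℂ G where
  carrier := {x | ⁅D.z, x⁆ = x ∧ ⁅D.h, x⁆ = 0}
  add_mem' := fun hx hy => ⟨by rw [lie_add, hx.1, hy.1], by rw [lie_add, hx.2, hy.2, add_zero]⟩
  zero_mem' := ⟨lie_zero _, lie_zero _⟩
  smul_mem' := fun a x hx => ⟨by rw [lie_smul, hx.1], by rw [lie_smul, hx.2, smul_zero]⟩

theorem le_span_X {U : Submodule ℂ G} (hU : ∀ x ∈ U, ⁅D.z, x⁆ = x) :
    U ≤ Submodule.span ℂ (Set.range D.X) := fun x hx => by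
  rw [D.eq_sum_X (hU x hx)]
  exact Submodule.sum_mem _ fun i _ => Submodule.smul_mem _ _ (Submodule.subset_span ⟨i, rfl⟩)

theorem mem_of_irred {U : Submodule ℂ G} (hU : ∀ x ∈ U, ⁅D.z, x⁆ = x)
    (hK : ∀ w x : G, ⁅D.z, w⁆ = 0 → x ∈ U → ⁅w, x⁆ ∈ U) (hne : U ≠ ⊥) {x : G} (hx : ⁅D.z, x⁆ = x) :
    x ∈ U := by
  rw [D.eq_sum_X hx]
  exact Submodule.sum_mem _ fun i _ => Submodule.smul_mem _ _
    (D.irred U (D.le_span_X hU) hK hne i)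

/-- Raising elements of the degree zero part. -/
def IsRaising (w : G) : Prop := ⁅D.z, w⁆ = 0 ∧ ⁅D.h, w⁆ = ((D.s / 2 : ℝ) : ℂ) • w

theorem isRaising_Wp {i : ι} (hi : i ∈ D.half) : D.IsRaising (D.Wp i) :=
  ⟨D.z_Wp i, D.h_Wp (D.mem_half.1 hi)⟩

theorem IsRaising.lie {A w : G} (hw : D.IsRaising w) (hA : ⁅D.z, A⁆ = 0) (hA' : ⁅D.h, A⁆ = 0) :
    D.IsRaising ⁅A, w⁆ :=
  ⟨D.z_KK hA hw.1, by rw [leibniz_lie, hA', zero_lie, zero_add, hw.2, lie_smul]⟩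

theorem lie_Wm_raising {w : G} (hw : D.IsRaising w) {i : ι} (hi : i ∈ D.half) :
    ⁅D.z, ⁅D.Wm i, w⁆⁆ = 0 ∧ ⁅D.h, ⁅D.Wm i, w⁆⁆ = 0 := by
  refine ⟨D.z_KK (D.z_Wm i) hw.1, ?_⟩
  rw [D.h_lie (D.h_Wm (D.mem_half.1 hi)) hw.2, ← Complex.ofReal_add, neg_add_cancel,
    Complex.ofReal_zero, zero_smul]

/-! ### Irreducibility of the null space of `ad h` in 𝔭₊ -/

section V0irred

variable (U : Submodule ℂ G)

/-- The space generated by `U` under raising operators. -/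
def raisingSpan : Submodule ℂ G :=
  Submodule.span ℂ ((U : Set G) ∪ {y | ∃ w, D.IsRaising w ∧ ∃ x ∈ U, y = ⁅w, x⁆} ∪
    {y | ∃ w w', D.IsRaising w ∧ D.IsRaising w' ∧ ∃ x ∈ U, y = ⁅w, ⁅w', x⁆⁆})

variable {U}

theorem mem_raisingSpan0 {x : G} (hx : x ∈ U) : x ∈ D.raisingSpan U :=
  Submodule.subset_span (Or.inl (Or.inl hx))

theorem mem_raisingSpan1 {w x : G} (hw : D.IsRaising w) (hx : x ∈ U) : ⁅w, x⁆ ∈ D.raisingSpan U :=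
  Submodule.subset_span (Or.inl (Or.inr ⟨w, hw, x, hx, rfl⟩))

theorem mem_raisingSpan2 {w w' x : G} (hw : D.IsRaising w) (hw' : D.IsRaising w') (hx : x ∈ U) :
    ⁅w, ⁅w', x⁆⁆ ∈ D.raisingSpan U :=
  Submodule.subset_span (Or.inr ⟨w, w', hw, hw', x, hx, rfl⟩)

theorem Wm_U (hU : U ≤ D.V0) {x : G} (hx : x ∈ U) {i : ι} (hi : i ∈ D.half) : ⁅D.Wm i, x⁆ = 0 := by
  refine D.eq_zero_of_h_neg (m := -(D.s / 2)) (D.z_KP (D.z_Wm i) (hU hx).1) ?_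
    (by linarith [D.s_pos])
  rw [D.h_lie (D.h_Wm (D.mem_half.1 hi)) (n := 0) (by rw [(hU hx).2, zero_smul]), add_zero]

/-- Split w into a part commuting with h, lowering operators and raising operators. Lowering
operators annihilate `U` and, commuted past a raising operator, leave an element commuting with h,
which preserves `U`. Three raising operators applied to `U` give zero, so two suffice in
`raisingSpan`. -/
theorem lie_mem_raisingSpan (hU : U ≤ D.V0)
    (hk : ∀ A x : G, ⁅D.z, A⁆ = 0 → ⁅D.h, A⁆ = 0 → x ∈ U → ⁅A, x⁆ ∈ U)
    {w y : G} (hw : ⁅D.z, w⁆ = 0) (hy : y ∈ D.raisingSpan U) :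
    ⁅w, y⁆ ∈ D.raisingSpan U := by
  obtain ⟨A, b, c, hA, hA', rfl⟩ := D.exists_K_decomp hw
  simp only [add_lie, sum_lie, smul_lie]
  refine Submodule.add_mem _ (Submodule.add_mem _ ?_
    (Submodule.sum_mem _ fun i hi => Submodule.smul_mem _ _ ?_))
    (Submodule.sum_mem _ fun i hi => Submodule.smul_mem _ _ ?_) <;>
  induction hy using Submodule.span_induction with
  | mem y hy => ?_
  | zero => rw [lie_zero]; exact Submodule.zero_mem _
  | add y y' _ _ h1 h2 => rw [lie_add]; exact Submodule.add_mem _ h1 h2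
  | smul a y _ h1 => rw [lie_smul]; exact Submodule.smul_mem _ _ h1
  · rcases hy with (hy | ⟨w, hw, x, hx, rfl⟩) | ⟨w, w', hw, hw', x, hx, rfl⟩
    · exact D.mem_raisingSpan0 (hk _ _ hA hA' hy)
    · rw [leibniz_lie]
      exact Submodule.add_mem _ (D.mem_raisingSpan1 (hw.lie D hA hA') hx)
        (D.mem_raisingSpan1 hw (hk _ _ hA hA' hx))
    · rw [leibniz_lie, leibniz_lie A w', lie_add]
      exact Submodule.add_mem _ (D.mem_raisingSpan2 (hw.lie D hA hA') hw' hx)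
        (Submodule.add_mem _ (D.mem_raisingSpan2 hw (hw'.lie D hA hA') hx)
          (D.mem_raisingSpan2 hw hw' (hk _ _ hA hA' hx)))
  · rcases hy with (hy | ⟨w, hw, x, hx, rfl⟩) | ⟨w, w', hw, hw', x, hx, rfl⟩
    · rw [D.Wm_U hU hy hi]; exact Submodule.zero_mem _
    · have h1 := D.lie_Wm_raising hw hi
      rw [leibniz_lie, D.Wm_U hU hx hi, lie_zero, add_zero]
      exact D.mem_raisingSpan0 (hk _ _ h1.1 h1.2 hx)
    · have h1 := D.lie_Wm_raising hw hi
      have h2 := D.lie_Wm_raising hw' hi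
      rw [leibniz_lie, leibniz_lie (D.Wm i) w', D.Wm_U hU hx hi, lie_zero, add_zero,
        leibniz_lie _ w']
      exact Submodule.add_mem _ (Submodule.add_mem _ (D.mem_raisingSpan1 (hw'.lie D h1.1 h1.2) hx)
        (D.mem_raisingSpan1 hw' (hk _ _ h1.1 h1.2 hx)))
        (D.mem_raisingSpan1 hw (hk _ _ h2.1 h2.2 hx))
  · have hi' := D.isRaising_Wp hi
    rcases hy with (hy | ⟨w, hw, x, hx, rfl⟩) | ⟨w, w', hw, hw', x, hx, rfl⟩
    · exact D.mem_raisingSpan1 hi' hy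
    · exact D.mem_raisingSpan2 hi' hw hx
    · have : ⁅D.Wp i, ⁅w, ⁅w', x⁆⁆⁆ = 0 := by
        refine D.eq_zero_of_h_gt (m := D.s / 2 + (D.s / 2 + (D.s / 2 + 0)))
          (D.z_KP hi'.1 (D.z_KP hw.1 (D.z_KP hw'.1 (hU hx).1))) ?_ (by linarith [D.s_pos])
        rw [D.h_lie hi'.2 (D.h_lie hw.2 (D.h_lie hw'.2 (n := 0) (by rw [(hU hx).2, zero_smul])))]
        push_cast; rfl
      rw [this]; exact Submodule.zero_mem _

/-- Raising operators add s/2, so the generators have eigenvalues 0, s/2 and s, and those of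
eigenvalue 0 lie in `U`. -/
theorem raisingSpan_le (hU : U ≤ D.V0) {y : G} (hy : y ∈ D.raisingSpan U) : ⁅D.z, y⁆ = y ∧
    ∃ u ∈ U, ∃ y1 y2 : G, y = u + y1 + y2 ∧ ⁅D.h, y1⁆ = ((D.s / 2 : ℝ) : ℂ) • y1 ∧
      ⁅D.h, y2⁆ = (D.s : ℂ) • y2 := by
  induction hy using Submodule.span_induction with
  | mem y hy =>
    rcases hy with (hy | ⟨w, hw, x, hx, rfl⟩) | ⟨w, w', hw, hw', x, hx, rfl⟩
    · exact ⟨(hU hy).1, y, hy, 0, 0, by simp, by simp, by simp⟩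
    · refine ⟨D.z_KP hw.1 (hU hx).1, 0, Submodule.zero_mem _, ⁅w, x⁆, 0, by simp, ?_, by simp⟩
      rw [D.h_lie hw.2 (n := 0) (by rw [(hU hx).2, zero_smul]), add_zero]
    · refine ⟨D.z_KP hw.1 (D.z_KP hw'.1 (hU hx).1), 0, Submodule.zero_mem _, 0, _,
        by rw [zero_add, zero_add], by simp, ?_⟩
      rw [D.h_lie hw.2 (D.h_lie hw'.2 (n := 0) (by rw [(hU hx).2, zero_smul])), add_zero]
      congr 1
      push_cast; ring
  | zero => exact ⟨lie_zero _, 0, Submodule.zero_mem _, 0, 0, by simp, by simp, by simp⟩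
  | add y y' _ _ h1 h2 =>
    obtain ⟨hz, u, hu, y1, y2, rfl, g1, g2⟩ := h1
    obtain ⟨hz', u', hu', y1', y2', rfl, g1', g2'⟩ := h2
    refine ⟨by rw [lie_add, hz, hz'], u + u', Submodule.add_mem _ hu hu', y1 + y1', y2 + y2',
      by abel, by rw [lie_add, g1, g1', smul_add], by rw [lie_add, g2, g2', smul_add]⟩
  | smul a y _ h1 =>
    obtain ⟨hz, u, hu, y1, y2, rfl, g1, g2⟩ := h1
    exact ⟨by rw [lie_smul, hz], a • u, Submodule.smul_mem _ _ hu, a • y1, a • y2,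
      by rw [smul_add, smul_add], by rw [lie_smul, g1, smul_comm], by rw [lie_smul, g2, smul_comm]⟩

/-- The zero eigenspace is irreducible under the centralizer of `h`. -/
theorem V0_le (hU : U ≤ D.V0)
    (hk : ∀ A x : G, ⁅D.z, A⁆ = 0 → ⁅D.h, A⁆ = 0 → x ∈ U → ⁅A, x⁆ ∈ U)
    (hne : U ≠ ⊥) : D.V0 ≤ U := by
  intro y hy
  -- The span is stable under the degree zero part, so irreducibility of 𝔭₊ makes it everything.
  have hM : y ∈ D.raisingSpan U := by
    refine D.mem_of_irred (fun x hx => (D.raisingSpan_le hU hx).1)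
      (fun w x hw hx => D.lie_mem_raisingSpan hU hk hw hx) ?_ hy.1
    obtain ⟨x, hx, hx0⟩ := Submodule.exists_mem_ne_zero_of_ne_bot hne
    exact fun h0 => hx0 ((Submodule.mem_bot ℂ).1 (h0 ▸ D.mem_raisingSpan0 hx))
  obtain ⟨-, u, hu, y1, y2, rfl, g1, g2⟩ := D.raisingSpan_le hU hM
  have hs := D.s_ne_zero
  -- Since `ad h` annihilates y, applying it once and twice gives two independent relations between
  -- y1 and y2, which force both to vanish.
  have e1 : ((D.s / 2 : ℝ) : ℂ) • y1 + (D.s : ℂ) • y2 = 0 := by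
    have := hy.2
    rwa [lie_add, lie_add, (hU hu).2, g1, g2, zero_add] at this
  have e2 : ((D.s / 2 : ℝ) : ℂ) • ((D.s / 2 : ℝ) : ℂ) • y1 + (D.s : ℂ) • (D.s : ℂ) • y2 = 0 := by
    have := congrArg (fun v => ⁅D.h, v⁆) e1
    simpa only [lie_add, lie_smul, g1, g2, lie_zero] using this
  have e3 : ((D.s / 2 : ℂ) * D.s) • y2 = 0 := by
    have := congrArg₂ (· - ·) e2 (congrArg (fun v => ((D.s / 2 : ℝ) : ℂ) • v) e1)
    simp only [smul_add, smul_zero, sub_zero] at this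
    rw [← this]; push_cast; module
  have y20 : y2 = 0 := (smul_eq_zero.1 e3).resolve_left
    (mul_ne_zero (div_ne_zero hs two_ne_zero) hs)
  rw [y20, smul_zero, add_zero] at e1
  have y10 : y1 = 0 := (smul_eq_zero.1 e1).resolve_left
    (by push_cast; exact div_ne_zero hs two_ne_zero)
  rw [y10, y20, add_zero, add_zero]
  exact hu

end V0irred

end HermitianDatum
end HermitianLie

/-! ### Degrees, weights and the invariant operator `opT` -/

namespace HermitianLie

/-- The components of an element of an invariant subspace along eigenvectors for distinct
eigenvalues belong to the subspace. -/
theorem mem_of_sum_eigenvector_mem {V κ : Type*} [AddCommGroup V] [Module ℂ V]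
    {T : V →ₗ[ℂ] V} {q : Submodule ℂ V} (hq : ∀ x ∈ q, T x ∈ q) {F : Finset κ} {c : κ → ℂ}
    (hc : ∀ i ∈ F, ∀ j ∈ F, c i = c j → i = j) {x : κ → V} (hx : ∀ i ∈ F, T (x i) = c i • x i)
    (hs : ∑ i ∈ F, x i ∈ q) : ∀ i ∈ F, x i ∈ q := by
  classical
  induction F using Finset.induction_on generalizing x with
  | empty => simp
  | insert a F ha ih =>
    rw [Finset.sum_insert ha] at hs
    have h1 : ∀ i ∈ F, (c i - c a) • x i ∈ q := by
      refine ih (fun i hi j hj => hc i (Finset.mem_insert_of_mem hi) j (Finset.mem_insert_of_mem hj))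
        (fun i hi => ?_) ?_
      · rw [map_smul, hx i (Finset.mem_insert_of_mem hi), smul_comm]
      · have := q.sub_mem (hq _ hs) (q.smul_mem (c a) hs)
        rw [map_add, hx a (Finset.mem_insert_self _ _), map_sum, smul_add,
          add_sub_add_left_eq_sub, Finset.smul_sum, ← Finset.sum_sub_distrib] at this
        convert this using 2 with i hi
        rw [hx i (Finset.mem_insert_of_mem hi), sub_smul]
    have h2 : ∀ i ∈ F, x i ∈ q := fun i hi => by
      have hne : c i - c a ≠ 0 := fun h0 => by
        have := hc i (Finset.mem_insert_of_mem hi) a (Finset.mem_insert_self _ _)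
          (sub_eq_zero.1 h0)
        exact ha (this ▸ hi)
      have := q.smul_mem (c i - c a)⁻¹ (h1 i hi)
      rwa [smul_smul, inv_mul_cancel₀ hne, one_smul] at this
    intro i hi
    rcases Finset.mem_insert.1 hi with rfl | hi
    · have := q.sub_mem hs (q.sum_mem h2)
      rwa [add_sub_cancel_right] at this
    · exact h2 i hi

theorem coeff_X_mul_pderiv {ι : Type*} [DecidableEq ι] (i : ι) (p : MvPolynomial ι ℂ) (m : ι →₀ ℕ) :
    MvPolynomial.coeff m (MvPolynomial.X i * MvPolynomial.pderiv i p) =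
      (m i : ℂ) * MvPolynomial.coeff m p := by
  induction p using MvPolynomial.induction_on' with
  | monomial u a =>
    rw [MvPolynomial.X_mul_pderiv_monomial, MvPolynomial.coeff_smul, MvPolynomial.coeff_monomial]
    split_ifs with h
    · rw [h, nsmul_eq_mul]
    · simp
  | add p q hp hq => simp only [map_add, mul_add, MvPolynomial.coeff_add, hp, hq]

namespace HermitianDatum

variable {G ι : Type*} [LieRing G] [LieAlgebra ℂ G] [Fintype ι] [DecidableEq ι]
  (D : HermitianDatum G ι) (r : ℝ)

theorem fock_K_apply {w : G} (hw : ⁅D.z, w⁆ = 0) (p : MvPolynomial ι ℂ) :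
    D.fock r w p = ((r : ℂ) * D.B D.z w) • p +
      ∑ i, D.ell ⁅w, D.X i⁆ * MvPolynomial.pderiv i p := by
  have h1 : ∀ i, D.B D.z ⁅w, D.X i⁆ = 0 := fun i => D.B_KP D.z_z (D.z_KP hw (D.z_X i))
  have h2 : ∀ i j, ⁅⁅w, D.X i⁆, D.X j⁆ = 0 := fun i j => D.lie_PP (D.z_KP hw (D.z_X i)) (D.z_X j)
  rw [fock_apply, D.ell_K hw]
  simp [h1, h2]

theorem coeff_fock_z (p : MvPolynomial ι ℂ) (m : ι →₀ ℕ) : MvPolynomial.coeff m (D.fock r D.z p) =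
    ((r : ℂ) * D.B D.z D.z + m.degree) * MvPolynomial.coeff m p := by
  rw [D.fock_K_apply r D.z_z, MvPolynomial.coeff_add, MvPolynomial.coeff_smul,
    MvPolynomial.coeff_sum]
  simp only [D.z_X, ell_X, coeff_X_mul_pderiv, smul_eq_mul]
  rw [← Finset.sum_mul, ← add_mul, Finsupp.degree_eq_sum]
  push_cast
  rfl

theorem coeff_fock_h (p : MvPolynomial ι ℂ) (m : ι →₀ ℕ) : MvPolynomial.coeff m (D.fock r D.h p) =
    ((r + ∑ i, D.a i * m i : ℝ) : ℂ) * MvPolynomial.coeff m p := by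
  rw [D.fock_K_apply r D.z_h, MvPolynomial.coeff_add, MvPolynomial.coeff_smul,
    MvPolynomial.coeff_sum]
  simp only [D.h_X, map_smul, ell_X, smul_mul_assoc, MvPolynomial.coeff_smul,
    coeff_X_mul_pderiv, smul_eq_mul, B_z_h]
  push_cast
  rw [add_mul, mul_one, Finset.sum_mul]
  congr 1
  exact Finset.sum_congr rfl fun i _ => by ring

/-- Up to a constant, z acts as the Euler operator. Degree shifts of the action can therefore be
read from commutators with z. -/
theorem isHomogeneous_iff {p : MvPolynomial ι ℂ} {n : ℕ} : p.IsHomogeneous n ↔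
    D.fock r D.z p = ((r : ℂ) * D.B D.z D.z + n) • p := by
  constructor
  · intro h
    ext m
    rw [coeff_fock_z, MvPolynomial.coeff_smul, smul_eq_mul]
    by_cases hm : m.degree = n
    · rw [hm]
    · rw [h.coeff_eq_zero hm, mul_zero, mul_zero]
  · intro h
    rw [← MvPolynomial.mem_homogeneousSubmodule,
      MvPolynomial.homogeneousSubmodule_eq_finsupp_supported]
    intro m hm
    have h1 := congrArg (MvPolynomial.coeff m) h
    rw [coeff_fock_z, MvPolynomial.coeff_smul, smul_eq_mul] at h1
    have h2 := mul_right_cancel₀ (MvPolynomial.mem_support_iff.1 hm) h1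
    exact_mod_cast add_left_cancel h2

theorem isHomogeneous_fock_K {w : G} (hw : ⁅D.z, w⁆ = 0) {p : MvPolynomial ι ℂ} {n : ℕ}
    (hp : p.IsHomogeneous n) : (D.fock r w p).IsHomogeneous n := by
  rw [D.isHomogeneous_iff r] at hp ⊢
  rw [fock_fock, hw, fock_zero, LinearMap.zero_apply, add_zero, hp, map_smul]

theorem isHomogeneous_fock_N {w : G} (hw : ⁅D.z, w⁆ = -w) {p : MvPolynomial ι ℂ} {n : ℕ}
    (hp : p.IsHomogeneous (n + 1)) : (D.fock r w p).IsHomogeneous n := by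
  rw [D.isHomogeneous_iff r] at hp ⊢
  rw [fock_fock, hw, fock_neg, LinearMap.neg_apply, hp, map_smul]
  push_cast
  module

theorem isHomogeneous_fock_P {w : G} (hw : ⁅D.z, w⁆ = w) {p : MvPolynomial ι ℂ} {n : ℕ}
    (hp : p.IsHomogeneous n) : (D.fock r w p).IsHomogeneous (n + 1) := by
  rw [D.isHomogeneous_iff r] at hp ⊢
  rw [fock_fock, hw, hp, map_smul]
  push_cast
  module

theorem fock_N_zero {w : G} (hw : ⁅D.z, w⁆ = -w) {p : MvPolynomial ι ℂ}
    (hp : p.IsHomogeneous 0) : D.fock r w p = 0 := by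
  rw [← MvPolynomial.mem_homogeneousSubmodule, MvPolynomial.homogeneousSubmodule_zero] at hp
  obtain ⟨a, rfl⟩ := Submodule.mem_one.1 hp
  rw [Algebra.algebraMap_eq_smul_one, map_smul, fock_one, D.ell_N hw, D.B_KN D.z_z hw]
  simp

/-- The parameter enters only through B(z, ⁅Yᵢ, Xⱼ⁆) = -δᵢⱼ. -/
theorem fock_Y (i : ι) (p : MvPolynomial ι ℂ) :
    D.fock r (D.Y i) p = D.fock 0 (D.Y i) p - (r : ℂ) • MvPolynomial.pderiv i p := by
  have h1 : ∀ j, D.B D.z ⁅D.Y i, D.X j⁆ = if j = i then -1 else 0 := fun j => by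
    rw [← D.B_inv, D.z_Y, map_neg, LinearMap.neg_apply, D.B_symm, D.B_X_Y]
    split_ifs <;> simp
  simp only [fock_apply, h1, Finset.sum_add_distrib]
  simp [D.ell_N (D.z_Y i), D.B_KN D.z_z (D.z_Y i)]
  abel

theorem fock_K_r {w : G} (hw : ⁅D.z, w⁆ = 0) (p : MvPolynomial ι ℂ) :
    D.fock r w p = D.fock 0 w p + ((r : ℂ) * D.B D.z w) • p := by
  rw [D.fock_K_apply r hw, D.fock_K_apply 0 hw]
  simp [add_comm]

/-- The operator `∑ X i * Y i`. -/
def opT : MvPolynomial ι ℂ →ₗ[ℂ] MvPolynomial ι ℂ :=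
  ∑ i, LinearMap.mulLeft ℂ (MvPolynomial.X i) ∘ₗ D.fock r (D.Y i)

theorem opT_apply (p : MvPolynomial ι ℂ) :
    D.opT r p = ∑ i, MvPolynomial.X i * D.fock r (D.Y i) p := by simp [opT]

/-- The first order part of `fock_Y` contributes -r times the Euler operator. -/
theorem opT_eq {p : MvPolynomial ι ℂ} {n : ℕ} (hp : p.IsHomogeneous n) :
    D.opT r p = D.opT 0 p - ((r : ℂ) * n) • p := by
  simp only [opT_apply, D.fock_Y r, mul_sub, Finset.sum_sub_distrib, mul_smul_comm,
    ← Finset.smul_sum, hp.sum_X_mul_pderiv]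
  rw [mul_smul, ← Nat.cast_smul_eq_nsmul ℂ n p]

theorem isHomogeneous_opT {p : MvPolynomial ι ℂ} {n : ℕ} (hp : p.IsHomogeneous n) :
    (D.opT r p).IsHomogeneous n := by
  rw [opT_apply]
  refine MvPolynomial.IsHomogeneous.sum _ _ _ fun i _ => ?_
  cases n with
  | zero => rw [D.fock_N_zero r (D.z_Y i) hp, mul_zero]; exact MvPolynomial.isHomogeneous_zero _ _ _
  | succ n =>
    rw [add_comm]
    exact (MvPolynomial.isHomogeneous_X _ _).mul (D.isHomogeneous_fock_N r (D.z_Y i) hp)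

/-- The families `X` and `Y` are dual bases for the invariant form, so the two sums of commutators
cancel. -/
theorem opT_comm {w : G} (hw : ⁅D.z, w⁆ = 0) (p : MvPolynomial ι ℂ) :
    D.opT r (D.fock r w p) = D.fock r w (D.opT r p) := by
  simp only [opT_apply, map_sum, fock_X_mul, Finset.sum_add_distrib]
  simp only [D.fock_fock r w (D.Y _), mul_add, Finset.sum_add_distrib]
  rw [add_assoc, left_eq_add]
  have e1 : ∀ i, D.fock r ⁅w, D.X i⁆ (D.fock r (D.Y i) p) =
      ∑ j, D.B ⁅w, D.X i⁆ (D.Y j) • (MvPolynomial.X j * D.fock r (D.Y i) p) := fun i => by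
    rw [D.fock_P r (D.z_KP hw (D.z_X i)), ell_apply, Finset.sum_mul]
    simp only [smul_mul_assoc]
  have e2 : ∀ i, MvPolynomial.X i * D.fock r ⁅w, D.Y i⁆ p =
      ∑ j, -D.B ⁅w, D.X j⁆ (D.Y i) • (MvPolynomial.X i * D.fock r (D.Y j) p) := fun i => by
    conv_lhs => rw [D.eq_sum_Y (D.z_KN hw (D.z_Y i))]
    simp only [fock_sum, fock_smul, LinearMap.sum_apply, LinearMap.smul_apply, Finset.mul_sum,
      mul_smul_comm]
    refine Finset.sum_congr rfl fun j _ => ?_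
    rw [D.B_symm ⁅w, D.Y i⁆, D.B_inv']
  simp only [e1, e2, neg_smul, Finset.sum_neg_distrib]
  rw [Finset.sum_comm, neg_add_cancel]

theorem fock_K_ell {w x : G} (hw : ⁅D.z, w⁆ = 0) (hx : ⁅D.z, x⁆ = x) :
    D.fock r w (D.ell x) = D.ell ⁅w, x⁆ + ((r : ℂ) * D.B D.z w) • D.ell x := by
  have := D.fock_fock r w x 1
  have h1 : ∀ y : G, ⁅D.z, y⁆ = y → D.fock r y 1 = D.ell y := fun y hy => by
    rw [D.fock_P r hy, mul_one]
  rw [h1 x hx, h1 _ (D.z_KP hw hx), fock_one, D.ell_K hw, zero_add, map_smul, h1 x hx] at this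
  rw [this, add_comm]

theorem fock_Y_ell (i : ι) {x : G} (hx : ⁅D.z, x⁆ = x) :
    D.fock r (D.Y i) (D.ell x) = MvPolynomial.C (-(r : ℂ) * D.B x (D.Y i)) := by
  have h1 : D.ell x = D.fock r x 1 := by rw [D.fock_P r hx, mul_one]
  rw [h1, fock_fock, fock_Y_one, map_zero, zero_add, fock_one,
    D.ell_K (D.z_NP (D.z_Y i) hx), zero_add, ← D.B_inv, D.z_Y, map_neg, LinearMap.neg_apply,
    D.B_symm, MvPolynomial.smul_eq_C_mul, mul_one, mul_neg, neg_mul]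

/-- At r = 1, applying Yᵢ to `ell x` returns the i-th coefficient of x up to sign. -/
theorem ell_injective {x : G} (hx : ⁅D.z, x⁆ = x) (h : D.ell x = 0) : x = 0 := by
  rw [D.eq_sum_X hx]
  refine Finset.sum_eq_zero fun i _ => ?_
  have h1 := D.fock_Y_ell 1 i hx
  rw [h, map_zero] at h1
  have h2 : -((1 : ℝ) : ℂ) * D.B x (D.Y i) = 0 := MvPolynomial.C_eq_zero.1 h1.symm
  simp only [Complex.ofReal_one, neg_mul, one_mul, neg_eq_zero] at h2
  rw [h2, zero_smul]

theorem exists_ell {p : MvPolynomial ι ℂ} (hp : p.IsHomogeneous 1) :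
    ∃ x, ⁅D.z, x⁆ = x ∧ p = D.ell x := by
  refine ⟨∑ i, MvPolynomial.coeff (Finsupp.single i 1) p • D.X i, ?_, ?_⟩
  · simp only [lie_sum, lie_smul, D.z_X]
  · have h := hp.sum_X_mul_pderiv
    rw [one_smul] at h
    rw [← h, map_sum]
    refine Finset.sum_congr rfl fun i _ => ?_
    have h2 : (MvPolynomial.pderiv i p).IsHomogeneous 0 := hp.pderiv
    rw [← MvPolynomial.mem_homogeneousSubmodule, MvPolynomial.homogeneousSubmodule_zero] at h2
    obtain ⟨a, ha⟩ := Submodule.mem_one.1 h2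
    rw [map_smul, ell_X, h]
    have h3 := coeff_X_mul_pderiv i p (Finsupp.single i 1)
    rw [← ha, MvPolynomial.algebraMap_eq, mul_comm, MvPolynomial.coeff_C_mul] at h3
    simp at h3
    rw [← ha, ← h3, MvPolynomial.algebraMap_eq, mul_comm, MvPolynomial.smul_eq_C_mul]

theorem opT_zero_ell {x : G} (hx : ⁅D.z, x⁆ = x) : D.opT 0 (D.ell x) = 0 := by
  rw [opT_apply]
  refine Finset.sum_eq_zero fun i _ => ?_
  rw [D.fock_Y_ell 0 i hx]; simp

/-- The fundamental identity for vectors annihilated by raising operators. -/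
theorem fock_Y_opT (w : MvPolynomial ι ℂ) : D.fock r (D.Y D.o) (D.opT r w) =
    D.opT r (D.fock r (D.Y D.o) w) - D.fock r D.h (D.fock r (D.Y D.o) w) -
      ∑ i ∈ D.half, D.fock r (D.Wm i) (D.fock r (D.Wp i) (D.fock r (D.Y D.o) w)) +
      ∑ i ∈ D.half, D.fock r (D.Wm i) (D.fock r (D.Y D.o) (D.fock r (D.Wp i) w)) := by
  -- Moving `Y o` through ∑ XᵢYᵢ leaves ∑ ⁅Y o, Xᵢ⁆Yᵢ. The index o gives -h `Y o`, the middle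
  -- indices are rewritten by Yᵢ = ⁅Y o, Wp i⁆, and the indices of eigenvalue zero contribute
  -- nothing.
  have e1 : D.fock r (D.Y D.o) (D.opT r w) = D.opT r (D.fock r (D.Y D.o) w) +
      ∑ i, D.fock r (D.Wm i) (D.fock r (D.Y i) w) := by
    simp only [opT_apply, map_sum, fock_X_mul, Finset.sum_add_distrib, Wm,
      D.fock_Y_comm r D.o]
  have e2 : D.Wm D.o = -D.h := by rw [Wm, h, lie_skew]
  rw [e1, D.sum_eq_half, e2, fock_neg, LinearMap.neg_apply]
  · have e3 : ∀ i ∈ D.half, D.fock r (D.Wm i) (D.fock r (D.Y i) w) =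
        D.fock r (D.Wm i) (D.fock r (D.Y D.o) (D.fock r (D.Wp i) w)) -
        D.fock r (D.Wm i) (D.fock r (D.Wp i) (D.fock r (D.Y D.o) w)) := fun i hi => by
      rw [D.fock_fock r (D.Y D.o) (D.Wp i), D.Y_o_Wp (D.mem_half.1 hi), map_add]
      abel
    rw [Finset.sum_congr rfl e3, Finset.sum_sub_distrib]
    abel
  · intro i hi
    rw [Wm, D.eq_zero_of_a hi, fock_zero, LinearMap.zero_apply]

end HermitianDatum
end HermitianLie

namespace HermitianLie

/-- An operator that commutes with `T`, is symmetric for a definite form, and annihilates the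
eigenvectors of `T` vanishes. -/
theorem eq_zero_of_symmetric {V : Type*} [AddCommGroup V] [Module ℂ V] {T P : V →ₗ[ℂ] V}
    {F : Submodule ℂ V} [FiniteDimensional ℂ F] (hT : ∀ x ∈ F, T x ∈ F) (hP : ∀ x ∈ F, P x ∈ F)
    (hTP : ∀ x ∈ F, T (P x) = P (T x)) (g : V → V → ℂ)
    (hg : ∀ x ∈ F, ∀ y ∈ F, g (P x) y = g x (P y)) (hg0 : ∀ x, g x 0 = 0)
    (hdef : ∀ x ∈ F, g x x = 0 → x = 0)
    (hev : ∀ x ∈ F, x ≠ 0 → ∀ t : ℂ, T x = t • x → P x = 0) : ∀ x ∈ F, P x = 0 := by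
  by_contra! hne
  obtain ⟨x0, hx0, hx0'⟩ := hne
  -- The image of P is stable under T. If it is nonzero, it contains an eigenvector y = Px of T;
  -- then Py = 0 and g(y, y) = g(x, Py) = 0, which contradicts definiteness.
  let q : Submodule ℂ V := F.map P
  have hqF : q ≤ F := Submodule.map_le_iff_le_comap.2 hP
  haveI : FiniteDimensional ℂ q := inferInstanceAs (FiniteDimensional ℂ (F.map P))
  have hTq : ∀ y ∈ q, T y ∈ q := by
    rintro _ ⟨x, hx, rfl⟩
    exact ⟨T x, hT x hx, (hTP x hx).symm⟩
  haveI : Nontrivial q := ⟨⟨⟨P x0, x0, hx0, rfl⟩, 0, fun h => hx0' (congrArg Subtype.val h)⟩⟩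
  obtain ⟨t, ht⟩ := Module.End.exists_eigenvalue (T.restrict hTq)
  obtain ⟨⟨y, hy⟩, hy1⟩ := ht.exists_hasEigenvector
  have hy2 : T y = t • y := congrArg Subtype.val hy1.apply_eq_smul
  have hy3 : y ≠ 0 := fun h => hy1.2 (Subtype.ext h)
  obtain ⟨x, hx, rfl⟩ := hy
  have h1 := hev _ (hP x hx) hy3 t hy2
  exact hy3 (hdef _ (hP x hx) (by rw [hg x hx _ (hP x hx), h1, hg0]))

/-! ### The scalar on the null space of `ad h`, and generation of 𝔭₊ by lowering -/

namespace HermitianDatum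

variable {G ι : Type*} [LieRing G] [LieAlgebra ℂ G] [Fintype ι] [DecidableEq ι]
  (D : HermitianDatum G ι) (r : ℝ)

/-- The squared norm on the `1`-eigenspace. -/
def normSq (x : G) : ℝ := ∑ i, Complex.normSq (D.B x (D.Y i))

theorem normSq_nonneg (x : G) : 0 ≤ D.normSq x :=
  Finset.sum_nonneg fun _ _ => Complex.normSq_nonneg _

theorem normSq_eq_zero {x : G} (hx : ⁅D.z, x⁆ = x) (h : D.normSq x = 0) : x = 0 := by
  rw [D.eq_sum_X hx]
  refine Finset.sum_eq_zero fun i hi => ?_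
  have := (Finset.sum_eq_zero_iff_of_nonneg fun _ _ => Complex.normSq_nonneg _).1 h i hi
  rw [Complex.normSq_eq_zero.1 this, zero_smul]

theorem normSq_pos {x : G} (hx : ⁅D.z, x⁆ = x) (h : x ≠ 0) : 0 < D.normSq x :=
  lt_of_le_of_ne (D.normSq_nonneg x) fun h0 => h (D.normSq_eq_zero hx h0.symm)

theorem B_self_τ {x : G} (hx : ⁅D.z, x⁆ = x) : D.B x (D.τ x) = D.normSq x := by
  conv_lhs => rw [D.eq_sum_X hx]
  rw [normSq, map_sum, LinearMap.sum_apply, Complex.ofReal_sum]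
  refine Finset.sum_congr rfl fun i _ => ?_
  rw [map_smul, LinearMap.smul_apply, map_sum, map_sum]
  simp [map_smulₛₗ, tau_X, D.B_X_Y, Complex.mul_conj]

/-- The operator `∑ [Wm i, [Wp i, x]]`. -/
def Zop : G →ₗ[ℂ] G := ∑ i, LieAlgebra.ad ℂ G (D.Wm i) ∘ₗ LieAlgebra.ad ℂ G (D.Wp i)

theorem Zop_apply (x : G) : D.Zop x = ∑ i, ⁅D.Wm i, ⁅D.Wp i, x⁆⁆ := by
  simp [Zop, LieAlgebra.ad_apply]

/-- The image is again an eigenvector for the largest eigenvalue, whose eigenspace is the line of `X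
o`. -/
theorem lie_X_o_of_h {A : G} (hA : ⁅D.z, A⁆ = 0) (hA' : ⁅D.h, A⁆ = 0) :
    ⁅A, D.X D.o⁆ = D.B ⁅A, D.X D.o⁆ (D.Y D.o) • D.X D.o := by
  have h1 : ⁅D.h, ⁅A, D.X D.o⁆⁆ = (D.s : ℂ) • ⁅A, D.X D.o⁆ := by
    rw [leibniz_lie, hA', zero_lie, zero_add, D.h_X_o, lie_smul]
  conv_lhs => rw [D.eq_sum_X (D.z_KP hA (D.z_X D.o))]
  refine Finset.sum_eq_single D.o (fun i _ hi => ?_) (by simp)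
  rw [D.coeff_eq_zero h1 (fun h => hi (D.a_inj i (by exact_mod_cast h))), zero_smul]

theorem lie_Y_o_of_h {A : G} (hA : ⁅D.z, A⁆ = 0) (hA' : ⁅D.h, A⁆ = 0) :
    ⁅A, D.Y D.o⁆ = -(D.B ⁅A, D.X D.o⁆ (D.Y D.o)) • D.Y D.o := by
  rw [D.lie_Y_o hA, Finset.sum_eq_zero, add_zero]
  intro i hi
  have h1 : ⁅D.h, D.τ A⁆ = 0 := by
    simpa using D.h_τ (x := A) (m := 0) (by simpa using hA')
  have h2 : ⁅D.h, ⁅D.τ A, D.X D.o⁆⁆ = (D.s : ℂ) • ⁅D.τ A, D.X D.o⁆ := by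
    rw [leibniz_lie, h1, zero_lie, zero_add, D.h_X_o, lie_smul]
  have h3 := D.coeff_eq_zero h2 (j := i) (fun h => D.o_notMem_half (by
    have := D.a_inj i (by exact_mod_cast h)
    exact this ▸ hi))
  have h4 : D.B ⁅A, D.Y D.o⁆ (D.X i) = 0 := by
    have := D.B_τ ⁅D.τ A, D.X D.o⁆ (D.Y i)
    rwa [h3, D.τ_lie, D.τ_τ, tau_X, tau_Y, map_zero] at this
  rw [h4, zero_smul]

theorem lie_Wp {A : G} (hA : ⁅D.z, A⁆ = 0) (hA' : ⁅D.h, A⁆ = 0) (i : ι) : ⁅A, D.Wp i⁆ =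
    D.B ⁅A, D.X D.o⁆ (D.Y D.o) • D.Wp i - ∑ j, D.B ⁅A, D.X j⁆ (D.Y i) • D.Wp j := by
  rw [Wp, lie_smul, leibniz_lie A, D.lie_X_o_of_h hA hA', smul_lie]
  conv_lhs => rw [D.eq_sum_Y (D.z_KN hA (D.z_Y i))]
  rw [lie_sum, smul_add, Finset.smul_sum, sub_eq_add_neg, ← Finset.sum_neg_distrib]
  congr 1
  · rw [smul_comm]
    conv_rhs => rw [← D.lie_X_o_of_h hA hA']
  · refine Finset.sum_congr rfl fun j _ => ?_
    rw [D.B_symm ⁅A, D.Y i⁆, D.B_inv', lie_smul, Wp]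
    module

theorem lie_Wm {A : G} (hA : ⁅D.z, A⁆ = 0) (hA' : ⁅D.h, A⁆ = 0) (i : ι) : ⁅A, D.Wm i⁆ =
    -(D.B ⁅A, D.X D.o⁆ (D.Y D.o)) • D.Wm i + ∑ j, D.B ⁅A, D.X i⁆ (D.Y j) • D.Wm j := by
  rw [Wm, leibniz_lie A, D.lie_Y_o_of_h hA hA', smul_lie]
  conv_lhs => rw [D.eq_sum_X (D.z_KP hA (D.z_X i))]
  rw [lie_sum]
  simp only [lie_smul, Wm]

/-- The families `Wm` and `Wp` transform under A by mutually transposed matrices, and the scalars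
coming from `Y o` and `X o` are opposite, so all correction terms cancel. The sum defining `Zop`
runs over all indices to make this cancellation exact. -/
theorem lie_Zop {A : G} (hA : ⁅D.z, A⁆ = 0) (hA' : ⁅D.h, A⁆ = 0) (x : G) :
    ⁅A, D.Zop x⁆ = D.Zop ⁅A, x⁆ := by
  have e1 : ∀ i, ⁅A, ⁅D.Wm i, ⁅D.Wp i, x⁆⁆⁆ = ⁅D.Wm i, ⁅D.Wp i, ⁅A, x⁆⁆⁆ +
      (∑ j, D.B ⁅A, D.X i⁆ (D.Y j) • ⁅D.Wm j, ⁅D.Wp i, x⁆⁆ -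
        ∑ j, D.B ⁅A, D.X j⁆ (D.Y i) • ⁅D.Wm i, ⁅D.Wp j, x⁆⁆) := fun i => by
    rw [leibniz_lie A (D.Wm i), leibniz_lie A (D.Wp i), D.lie_Wm hA hA', D.lie_Wp hA hA']
    simp only [add_lie, sub_lie, smul_lie, sum_lie, lie_add, lie_sub, lie_smul, lie_sum]
    module
  simp only [Zop_apply, lie_sum, e1, Finset.sum_add_distrib, Finset.sum_sub_distrib]
  rw [Finset.sum_comm, sub_self, add_zero]

/-- The index o contributes a multiple of ⁅h, x⁆ inside, which is zero, and `Wm i` vanishes for the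
eigenvalue zero. -/
theorem Zop_eq_half {x : G} (hx : ⁅D.h, x⁆ = 0) :
    D.Zop x = ∑ i ∈ D.half, ⁅D.Wm i, ⁅D.Wp i, x⁆⁆ := by
  rw [Zop_apply, D.sum_eq_half]
  · have : D.Wp D.o = (2 / D.s : ℂ) • D.h := rfl
    rw [this, smul_lie, hx, smul_zero, lie_zero, zero_add]
  · intro i hi
    rw [Wm, D.eq_zero_of_a hi, zero_lie]

theorem Zop_mem_V0 {x : G} (hx : x ∈ D.V0) : D.Zop x ∈ D.V0 := by
  refine ⟨?_, ?_⟩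
  · simp only [Zop_apply, lie_sum]
    exact Finset.sum_congr rfl fun i _ => D.z_KP (D.z_Wm i) (D.z_KP (D.z_Wp i) hx.1)
  · rw [D.Zop_eq_half hx.2, lie_sum]
    refine Finset.sum_eq_zero fun i hi => ?_
    have hi' := D.mem_half.1 hi
    rw [D.h_lie (D.h_Wm hi') (D.h_lie (D.h_Wp hi') (n := 0) (by rw [hx.2, zero_smul]))]
    push_cast
    rw [add_zero, neg_add_cancel, zero_smul]

instance finiteDimensional_V0 : FiniteDimensional ℂ D.V0 :=
  haveI : FiniteDimensional ℂ (Submodule.span ℂ (Set.range D.X)) :=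
    FiniteDimensional.span_of_finite ℂ (Set.finite_range _)
  Submodule.finiteDimensional_of_le (D.le_span_X fun _ hx => hx.1)

/-- `Zop` acts by a scalar on `V0`. -/
theorem exists_Zop_scalar : ∃ μ : ℂ, ∀ x ∈ D.V0, D.Zop x = μ • x := by
  by_cases hV : D.V0 = ⊥
  · refine ⟨0, fun x hx => ?_⟩
    rw [hV, Submodule.mem_bot] at hx
    rw [hx, map_zero, smul_zero]
  haveI := Submodule.nontrivial_iff_ne_bot.2 hV
  obtain ⟨μ, hμ⟩ := Module.End.exists_eigenvalue (D.Zop.restrict fun x hx => D.Zop_mem_V0 hx)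
  obtain ⟨⟨y, hy⟩, hy1⟩ := hμ.exists_hasEigenvector
  have hy2 : D.Zop y = μ • y := congrArg Subtype.val hy1.apply_eq_smul
  have hy3 : y ≠ 0 := fun h => hy1.2 (Subtype.ext h)
  -- Schur's lemma: an eigenspace of `Zop` in `V0` is stable under the centralizer of h, hence is
  -- all of `V0`.
  let U : Submodule ℂ G := D.V0 ⊓ LinearMap.ker (D.Zop - μ • LinearMap.id)
  have hU : ∀ x, x ∈ U ↔ x ∈ D.V0 ∧ D.Zop x = μ • x := fun x => by
    simp [U, sub_eq_zero]
  refine ⟨μ, fun x hx => ((hU x).1 (D.V0_le (U := U) inf_le_left ?_ ?_ hx)).2⟩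
  · intro A x hA hA' hx
    obtain ⟨h1, h2⟩ := (hU x).1 hx
    refine (hU _).2 ⟨⟨D.z_KP hA h1.1, ?_⟩, ?_⟩
    · rw [leibniz_lie, hA', h1.2, zero_lie, lie_zero, add_zero]
    · rw [← D.lie_Zop hA hA', h2, lie_smul]
  · exact fun h0 => hy3 ((Submodule.mem_bot ℂ).1 (h0 ▸ (hU y).2 ⟨hy, hy2⟩))

/-- The vectors of `V0` that all raising operators annihilate form a subspace stable under the
degree zero part. If it were nonzero, irreducibility would put `X o` into it, but h does not
annihilate `X o`. -/
theorem eq_zero_of_Wp {x : G} (hx : x ∈ D.V0) (h : ∀ i ∈ D.half, ⁅D.Wp i, x⁆ = 0) : x = 0 := by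
  by_contra hne
  let U : Submodule ℂ G := D.V0 ⊓ ⨅ i : D.half, LinearMap.ker (LieAlgebra.ad ℂ G (D.Wp i))
  have hU : ∀ x, x ∈ U ↔ x ∈ D.V0 ∧ ∀ i ∈ D.half, ⁅D.Wp i, x⁆ = 0 := fun x => by
    simp [U, LieAlgebra.ad_apply]
  have h1 : D.X D.o ∈ U := by
    refine D.mem_of_irred (fun x hx => ((hU x).1 hx).1.1) (fun w x hw hx => ?_)
      (fun h0 => hne ((Submodule.mem_bot ℂ).1 (h0 ▸ (hU x).2 ⟨hx, h⟩))) (D.z_X _)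
    obtain ⟨A, b, c, hA, hA', rfl⟩ := D.exists_K_decomp hw
    obtain ⟨hx1, hx2⟩ := (hU x).1 hx
    have e1 : ⁅A + ∑ i ∈ D.half, b i • D.Wm i + ∑ i ∈ D.half, c i • D.Wp i, x⁆ = ⁅A, x⁆ := by
      simp only [add_lie, sum_lie, smul_lie]
      rw [Finset.sum_eq_zero, Finset.sum_eq_zero, add_zero, add_zero]
      · intro i hi; rw [hx2 i hi, smul_zero]
      · intro i hi; rw [D.Wm_U le_rfl hx1 hi, smul_zero]
    rw [e1]
    refine (hU _).2 ⟨⟨D.z_KP hA hx1.1, ?_⟩, fun i hi => ?_⟩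
    · rw [leibniz_lie, hA', hx1.2, zero_lie, lie_zero, add_zero]
    · rw [leibniz_lie, hx2 i hi, lie_zero, add_zero]
      have h2 := (D.isRaising_Wp hi).lie D hA hA'
      rw [← lie_skew (D.Wp i) A, D.raising_eq_sum h2.1 h2.2, neg_lie, sum_lie, Finset.sum_eq_zero, neg_zero]
      intro j hj
      rw [smul_lie, hx2 j hj, smul_zero]
  have h2 := ((hU _).1 h1).1.2
  rw [D.h_X_o] at h2
  exact (smul_ne_zero D.s_ne_zero (D.X_ne_zero _)) h2

/-- The scalar by which `Zop` acts is negative. -/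
theorem Zop_scalar_neg {x : G} (hx : x ∈ D.V0) (hne : x ≠ 0) {μ : ℂ} (h : D.Zop x = μ • x) :
    ∃ t : ℝ, 0 < t ∧ μ = -(t : ℂ) := by
  have hz : ∀ i, ⁅D.z, ⁅D.Wp i, x⁆⁆ = ⁅D.Wp i, x⁆ := fun i => D.z_KP (D.z_Wp i) hx.1
  -- As `Wm i` is s/2 times the conjugate of `Wp i`, pairing `Zop x` with τx gives minus a sum of
  -- squared norms. The sum is positive by `eq_zero_of_Wp`.
  have e1 : D.B (D.Zop x) (D.τ x) = -(D.s / 2 * ∑ i ∈ D.half, D.normSq ⁅D.Wp i, x⁆ : ℝ) := by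
    rw [D.Zop_eq_half hx.2, map_sum, LinearMap.sum_apply, Finset.mul_sum]
    push_cast
    rw [← Finset.sum_neg_distrib]
    refine Finset.sum_congr rfl fun i _ => ?_
    have h1 := D.B_self_τ (hz i)
    rw [D.τ_lie, tau_Wp, smul_lie, map_smul, D.B_inv', smul_eq_mul] at h1
    rw [← h1]
    have := D.s_ne_zero
    field_simp
  have e2 : μ * D.normSq x = -(D.s / 2 * ∑ i ∈ D.half, D.normSq ⁅D.Wp i, x⁆ : ℝ) := by
    rw [← e1, h, map_smul, LinearMap.smul_apply, smul_eq_mul, D.B_self_τ hx.1]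
  have hN := D.normSq_pos hx.1 hne
  have hS : 0 < ∑ i ∈ D.half, D.normSq ⁅D.Wp i, x⁆ := by
    refine lt_of_le_of_ne (Finset.sum_nonneg fun i _ => D.normSq_nonneg _) fun h0 => hne ?_
    refine D.eq_zero_of_Wp hx fun i hi => D.normSq_eq_zero (hz i) ?_
    exact (Finset.sum_eq_zero_iff_of_nonneg fun i _ => D.normSq_nonneg _).1 h0.symm i hi
  refine ⟨D.s / 2 * (∑ i ∈ D.half, D.normSq ⁅D.Wp i, x⁆) / D.normSq x,
    div_pos (mul_pos (half_pos D.s_pos) hS) hN, ?_⟩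
  have : (D.normSq x : ℂ) ≠ 0 := by exact_mod_cast hN.ne'
  rw [Complex.ofReal_div, ← neg_div, eq_div_iff this]
  exact e2

/-- The space generated from `X o` by lowering twice. -/
def loweringSpan : Submodule ℂ G := Submodule.span ℂ (({D.X D.o} : Set G) ∪
    {x : G | ⁅D.z, x⁆ = x ∧ ⁅D.h, x⁆ = ((D.s / 2 : ℝ) : ℂ) • x} ∪
    {y : G | ∃ w x : G, ⁅D.z, w⁆ = 0 ∧ ⁅D.h, w⁆ = ((-(D.s / 2) : ℝ) : ℂ) • w ∧ ⁅D.z, x⁆ = x ∧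
      ⁅D.h, x⁆ = ((D.s / 2 : ℝ) : ℂ) • x ∧ y = ⁅w, x⁆})

/-- The `1`-eigenspace is generated from `X o` by lowering twice. -/
theorem X_mem_loweringSpan (j : ι) : D.X j ∈ D.loweringSpan := by
  set L := D.loweringSpan with hL
  have m0 : D.X D.o ∈ L := Submodule.subset_span (Or.inl (Or.inl rfl))
  have m1 : ∀ {x : G}, ⁅D.z, x⁆ = x → ⁅D.h, x⁆ = ((D.s / 2 : ℝ) : ℂ) • x → x ∈ L :=
    fun h1 h2 => Submodule.subset_span (Or.inl (Or.inr ⟨h1, h2⟩))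
  have m2 : ∀ {w x : G}, ⁅D.z, w⁆ = 0 → ⁅D.h, w⁆ = ((-(D.s / 2) : ℝ) : ℂ) • w → ⁅D.z, x⁆ = x →
      ⁅D.h, x⁆ = ((D.s / 2 : ℝ) : ℂ) • x → ⁅w, x⁆ ∈ L :=
    fun h1 h2 h3 h4 => Submodule.subset_span (Or.inr ⟨_, _, h1, h2, h3, h4, rfl⟩)
  have k0 : ∀ {A x : G} {m : ℂ}, ⁅D.h, A⁆ = 0 → ⁅D.h, x⁆ = m • x → ⁅D.h, ⁅A, x⁆⁆ = m • ⁅A, x⁆ :=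
    fun hA hx => by rw [leibniz_lie, hA, hx, zero_lie, zero_add, lie_smul]
  have kX : ∀ {x : G}, ⁅D.z, x⁆ = x → ⁅D.h, x⁆ = (D.s : ℂ) • x → x ∈ L := fun {x} h1 h2 => by
    rw [D.eq_sum_X h1]
    refine Submodule.sum_mem _ fun i _ => ?_
    by_cases hi : i = D.o
    · exact Submodule.smul_mem _ _ (hi ▸ m0)
    · rw [D.coeff_eq_zero h2 (fun h => hi (D.a_inj i (by exact_mod_cast h))), zero_smul]
      exact Submodule.zero_mem _
  have hz : ∀ x ∈ L, ⁅D.z, x⁆ = x := fun x hx => by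
    induction hx using Submodule.span_induction with
    | mem y hy =>
      rcases hy with (rfl | hy) | ⟨w, x, hw, -, hx, -, rfl⟩
      · exact D.z_X _
      · exact hy.1
      · exact D.z_KP hw hx
    | zero => exact lie_zero _
    | add y y' _ _ h1 h2 => rw [lie_add, h1, h2]
    | smul a y _ h1 => rw [lie_smul, h1]
  refine D.mem_of_irred hz (fun w y hw hy => ?_)
    (fun h0 => D.X_ne_zero D.o ((Submodule.mem_bot ℂ).1 (h0 ▸ m0))) (D.z_X j)
  obtain ⟨A, b, c, hA, hA', rfl⟩ := D.exists_K_decomp hw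
  simp only [add_lie, sum_lie, smul_lie]
  refine Submodule.add_mem _ (Submodule.add_mem _ ?_
    (Submodule.sum_mem _ fun i hi => Submodule.smul_mem _ _ ?_))
    (Submodule.sum_mem _ fun i hi => Submodule.smul_mem _ _ ?_) <;>
  induction hy using Submodule.span_induction with
  | mem y hy => ?_
  | zero => rw [lie_zero]; exact Submodule.zero_mem _
  | add y y' _ _ h1 h2 => rw [lie_add]; exact Submodule.add_mem _ h1 h2
  | smul a y _ h1 => rw [lie_smul]; exact Submodule.smul_mem _ _ h1
  · rcases hy with (rfl | hy) | ⟨w, x, hw, hw', hx, hx', rfl⟩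
    · exact kX (D.z_KP hA (D.z_X _)) (k0 hA' D.h_X_o)
    · exact m1 (D.z_KP hA hy.1) (k0 hA' hy.2)
    · rw [leibniz_lie]
      exact Submodule.add_mem _ (m2 (D.z_KK hA hw) (k0 hA' hw') hx hx')
        (m2 hw hw' (D.z_KP hA hx) (k0 hA' hx'))
  · have hi' := D.mem_half.1 hi
    rcases hy with (rfl | hy) | ⟨w, x, hw, hw', hx, hx', rfl⟩
    · refine m1 (D.z_KP (D.z_Wm i) (D.z_X _)) ?_
      rw [D.h_lie (D.h_Wm hi') D.h_X_o]
      congr 1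
      push_cast; ring
    · exact m2 (D.z_Wm i) (D.h_Wm hi') hy.1 hy.2
    -- A third lowering would reach the eigenvalue -s/2, which does not occur in 𝔭₊. This is why two
    -- lowerings generate everything.
    · rw [D.eq_zero_of_h_neg (m := -(D.s / 2) + (-(D.s / 2) + D.s / 2))
        (D.z_KP (D.z_Wm i) (D.z_KP hw hx)) _ (by linarith [D.s_pos])]
      · exact Submodule.zero_mem _
      · rw [D.h_lie (D.h_Wm hi') (D.h_lie hw' hx')]
        push_cast; rfl
  · have hi' := D.mem_half.1 hi
    rcases hy with (rfl | hy) | ⟨w, x, hw, hw', hx, hx', rfl⟩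
    · rw [D.Wp_X_o hi']; exact Submodule.zero_mem _
    · refine kX (D.z_KP (D.z_Wp i) hy.1) ?_
      rw [D.h_lie (D.h_Wp hi') hy.2]
      congr 1
      push_cast; ring
    · rw [leibniz_lie]
      refine Submodule.add_mem _ (m1 (D.z_KP (D.z_KK (D.z_Wp i) hw) hx) (k0 ?_ hx')) (m1 ?_ ?_)
      · rw [D.h_lie (D.h_Wp hi') hw', ← Complex.ofReal_add, add_neg_cancel, Complex.ofReal_zero,
          zero_smul]
      · exact D.z_KP hw (D.z_KP (D.z_Wp i) hx)
      · rw [D.h_lie hw' (D.h_lie (D.h_Wp hi') hx')]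
        congr 1
        push_cast; ring

/-- A vector that is annihilated by `Y o` and by the raising operators, modulo an invariant
subspace, is annihilated by all `Y j`. -/
theorem fock_Y_mem {R : Submodule ℂ (MvPolynomial ι ℂ)} (hR : ∀ x, ∀ p ∈ R, D.fock r x p ∈ R)
    {w : MvPolynomial ι ℂ} (h1 : D.fock r (D.Y D.o) w ∈ R)
    (h2 : ∀ i ∈ D.half, D.fock r (D.Wp i) w ∈ R) (j : ι) : D.fock r (D.Y j) w ∈ R := by
  -- Conjugation turns the generation of 𝔭₊ from `X o` by lowering into the generation of 𝔭₋ from `Y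
  -- o` by raising. Each element of 𝔭₋ then acts through commutators of operators that map w into R.
  have key : ∀ x ∈ D.loweringSpan, D.fock r (D.τ x) w ∈ R := by
    have m1 : ∀ x : G, ⁅D.z, x⁆ = x → ⁅D.h, x⁆ = ((D.s / 2 : ℝ) : ℂ) • x →
        D.fock r (D.τ x) w ∈ R := fun x hx hx' => by
      rw [D.eq_sum_X hx, map_sum, fock_sum, LinearMap.sum_apply]
      refine Submodule.sum_mem _ fun i _ => ?_
      rw [map_smulₛₗ, fock_smul, LinearMap.smul_apply, tau_X]
      by_cases hi : i ∈ D.half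
      · refine Submodule.smul_mem _ _ ?_
        rw [← D.Y_o_Wp (D.mem_half.1 hi), fock_lie, LinearMap.sub_apply, Module.End.mul_apply,
          Module.End.mul_apply]
        exact Submodule.sub_mem _ (hR _ _ (h2 i hi)) (hR _ _ h1)
      · rw [D.coeff_eq_zero hx', map_zero, zero_smul]
        · exact Submodule.zero_mem _
        · intro h
          have h3 : D.a i = D.s / 2 := by exact_mod_cast h
          exact hi (D.mem_half.2 (by linarith))
    intro x hx
    induction hx using Submodule.span_induction with
    | mem y hy =>
      rcases hy with (rfl | hy) | ⟨v, x, hv, hv', hx, hx', rfl⟩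
      · exact h1
      · exact m1 y hy.1 hy.2
      · have h4 : ⁅D.h, D.τ v⁆ = ((D.s / 2 : ℝ) : ℂ) • D.τ v := by
          rw [D.h_τ hv']; push_cast; module
        have h5 : D.fock r (D.τ v) w ∈ R := by
          rw [D.raising_eq_sum (D.z_τ_K hv) h4, fock_sum, LinearMap.sum_apply]
          refine Submodule.sum_mem _ fun i hi => ?_
          rw [fock_smul, LinearMap.smul_apply]
          exact Submodule.smul_mem _ _ (h2 i hi)
        rw [D.τ_lie, fock_lie, LinearMap.sub_apply, Module.End.mul_apply,
          Module.End.mul_apply]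
        exact Submodule.sub_mem _ (hR _ _ (m1 x hx hx')) (hR _ _ h5)
    | zero => rw [map_zero, fock_zero]; exact Submodule.zero_mem _
    | add y y' _ _ h3 h4 => rw [map_add, fock_add]; exact Submodule.add_mem _ h3 h4
    | smul a y _ h3 => rw [map_smulₛₗ, fock_smul]; exact Submodule.smul_mem _ _ h3
  exact key _ (D.X_mem_loweringSpan j)

end HermitianDatum
end HermitianLie

/-! ### Weights of `h` on polynomials and the existence of highest vectors -/

namespace HermitianLie
namespace HermitianDatum

variable {G ι : Type*} [LieRing G] [LieAlgebra ℂ G] [Fintype ι] [DecidableEq ι]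
  (D : HermitianDatum G ι) (r : ℝ)

/-- The eigenvalues of `ad h` in units of `s / 2`. -/
def lv (i : ι) : ℕ := by classical exact if D.a i = 0 then 0 else if i = D.o then 2 else 1

theorem degree_eq_of_coeff_ne_zero {p : MvPolynomial ι ℂ} {n : ℕ}
    (hn : p.IsHomogeneous n) {m : ι →₀ ℕ} (hm : MvPolynomial.coeff m p ≠ 0) : m.degree = n := by
  by_contra h
  exact hm (hn.coeff_eq_zero h)

theorem a_eq_lv (i : ι) : D.a i = D.s / 2 * D.lv i := by
  have := D.s_pos
  rw [lv]
  split_ifs with h1 h2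
  · simp [h1]
  · rw [h2, a_o]; push_cast; ring
  · rcases D.a_cases i with h | h | h
    · exact absurd h h1
    · push_cast; linarith
    · exact absurd h h2

theorem lv_le (i : ι) : D.lv i ≤ 2 := by
  rw [lv]; split_ifs <;> norm_num

theorem lv_eq_two {i : ι} (hi : D.lv i = 2) : i = D.o := by
  rw [lv] at hi
  by_contra h2
  rw [if_neg h2] at hi
  split_ifs at hi
  omega

/-- Eigenvectors of `h`, labelled by the eigenvalue in units of `s / 2`. -/
def IsLevel (d : ℤ) (p : MvPolynomial ι ℂ) : Prop :=
  D.fock 0 D.h p = ((D.s / 2 * d : ℝ) : ℂ) • p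

variable {D}

theorem IsLevel.fock_h {d : ℤ} {p : MvPolynomial ι ℂ} (hp : D.IsLevel d p) :
    D.fock r D.h p = ((r + D.s / 2 * d : ℝ) : ℂ) • p := by
  rw [D.fock_K_r r D.z_h, hp, D.B_z_h]
  push_cast
  module

theorem isLevel_of_fock_h {d : ℤ} {p : MvPolynomial ι ℂ}
    (hp : D.fock r D.h p = ((r + D.s / 2 * d : ℝ) : ℂ) • p) : D.IsLevel d p := by
  rw [D.fock_K_r r D.z_h, D.B_z_h, mul_one] at hp
  rw [IsLevel, eq_sub_of_add_eq hp]
  push_cast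
  module

/-- Levels are defined at r = 0 but work for every r: the action of h at r differs from that at 0 by
the scalar r, because B(z, h) = 1. -/
theorem IsLevel.fock {d e : ℤ} {p : MvPolynomial ι ℂ} (hp : D.IsLevel d p) {w : G}
    (hw : ⁅D.h, w⁆ = ((D.s / 2 * e : ℝ) : ℂ) • w) : D.IsLevel (d + e) (D.fock r w p) := by
  refine isLevel_of_fock_h r ?_
  rw [D.fock_fock, hw, hp.fock_h r, map_smul, fock_smul, LinearMap.smul_apply]
  push_cast
  module

theorem IsLevel.Wp {d : ℤ} {p : MvPolynomial ι ℂ} (hp : D.IsLevel d p) {i : ι}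
    (hi : i ∈ D.half) : D.IsLevel (d + 1) (D.fock r (D.Wp i) p) :=
  hp.fock r (by rw [D.h_Wp (D.mem_half.1 hi)]; push_cast; rw [mul_one])

theorem IsLevel.Y_o {d : ℤ} {p : MvPolynomial ι ℂ} (hp : D.IsLevel d p) :
    D.IsLevel (d + -2) (D.fock r (D.Y D.o) p) :=
  hp.fock r (by rw [D.h_Y_o, ← neg_smul]; congr 1; push_cast; ring)

theorem IsLevel.sum_eq {d : ℤ} {p : MvPolynomial ι ℂ} (hp : D.IsLevel d p) {m : ι →₀ ℕ}
    (hm : MvPolynomial.coeff m p ≠ 0) : ∑ i, D.lv i * m i = d := by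
  have h1 := congrArg (MvPolynomial.coeff m) hp
  rw [coeff_fock_h, MvPolynomial.coeff_smul, smul_eq_mul] at h1
  have h2 := mul_right_cancel₀ hm h1
  simp only [a_eq_lv, zero_add, mul_assoc, ← Finset.mul_sum] at h2
  have h3 := mul_left_cancel₀ (half_pos D.s_pos).ne' (Complex.ofReal_injective h2)
  exact_mod_cast h3

theorem IsLevel.le {d : ℤ} {p : MvPolynomial ι ℂ} (hp : D.IsLevel d p) {n : ℕ}
    (hn : p.IsHomogeneous n) (h0 : p ≠ 0) : d ≤ 2 * n := by
  obtain ⟨m, hm⟩ := MvPolynomial.ne_zero_iff.1 h0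
  rw [← hp.sum_eq hm, ← degree_eq_of_coeff_ne_zero hn hm, Finsupp.degree_eq_sum]
  have : ∑ i, D.lv i * m i ≤ ∑ i, 2 * m i :=
    Finset.sum_le_sum fun i _ => Nat.mul_le_mul_right _ (D.lv_le i)
  rw [← Finset.mul_sum] at this
  exact_mod_cast this

/-- Each variable has level at most 2, and only `X o` attains 2, so the maximal level 2n in degree n
leaves a single monomial. -/
theorem IsLevel.eq_of_top {n : ℕ} {p : MvPolynomial ι ℂ} (hp : D.IsLevel (2 * n) p)
    (hn : p.IsHomogeneous n) : ∃ a : ℂ, p = a • MvPolynomial.X D.o ^ n := by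
  refine ⟨MvPolynomial.coeff (Finsupp.single D.o n) p, ?_⟩
  ext m
  rw [MvPolynomial.coeff_smul, MvPolynomial.coeff_X_pow, smul_eq_mul, mul_ite, mul_one, mul_zero]
  split_ifs with h
  · rw [h]
  · by_contra hm
    have h1 := hp.sum_eq hm
    have h2 := degree_eq_of_coeff_ne_zero hn hm
    rw [Finsupp.degree_eq_sum] at h2
    have h3 : ∑ i, (D.lv i * m i) = ∑ i, 2 * m i := by
      rw [← Finset.mul_sum, h2]; exact_mod_cast h1
    have h4 := (Finset.sum_eq_sum_iff_of_le fun i _ => Nat.mul_le_mul_right (m i) (D.lv_le i)).1 h3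
    have h5 : ∀ i, i ≠ D.o → m i = 0 := fun i hi => by
      by_contra h0
      exact hi (D.lv_eq_two (Nat.eq_of_mul_eq_mul_right (Nat.pos_of_ne_zero h0)
        (h4 i (Finset.mem_univ i))))
    apply h
    ext i
    by_cases hi : i = D.o
    · rw [← h2, Finset.sum_eq_single D.o (fun i _ hi => h5 i hi) (by simp), hi]
      simp
    · rw [h5 i hi, Finsupp.single_eq_of_ne hi]

variable (D)

theorem sum_weightedHomogeneousComponent {n : ℕ} {p : MvPolynomial ι ℂ}
    (hn : p.IsHomogeneous n) :
    ∑ d ∈ Finset.range (2 * n + 1), MvPolynomial.weightedHomogeneousComponent D.lv d p = p := by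
  ext m
  rw [MvPolynomial.coeff_sum]
  simp only [MvPolynomial.coeff_weightedHomogeneousComponent]
  rw [Finset.sum_ite_eq]
  split_ifs with h
  · rfl
  · by_contra hm
    have hm' : MvPolynomial.coeff m p ≠ 0 := fun h0 => hm h0.symm
    apply h
    rw [Finset.mem_range, Nat.lt_succ_iff, ← degree_eq_of_coeff_ne_zero hn hm',
      Finsupp.degree_eq_sum, Finset.mul_sum, Finsupp.weight_apply, Finsupp.sum_fintype _ _ (by simp)]
    exact Finset.sum_le_sum fun i _ => by
      rw [smul_eq_mul, mul_comm]; exact Nat.mul_le_mul_right _ (D.lv_le i)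

theorem isLevel_weightedHomogeneousComponent (d : ℕ) (p : MvPolynomial ι ℂ) :
    D.IsLevel d (MvPolynomial.weightedHomogeneousComponent D.lv d p) := by
  rw [IsLevel]
  ext m
  rw [coeff_fock_h, MvPolynomial.coeff_smul, MvPolynomial.coeff_weightedHomogeneousComponent]
  split_ifs with h
  · rw [Finsupp.weight_apply, Finsupp.sum_fintype _ _ (by simp)] at h
    simp only [a_eq_lv, ← h, smul_eq_mul]
    push_cast
    rw [zero_add, Finset.mul_sum]
    congr 1
    exact Finset.sum_congr rfl fun i _ => by ring
  · simp

/-- A stable subspace contains highest vectors for the raising operators. -/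
theorem exists_top {n : ℕ} {W R : Submodule ℂ (MvPolynomial ι ℂ)}
    (hWn : ∀ p ∈ W, p.IsHomogeneous n) (hW : ∀ w, ⁅D.z, w⁆ = 0 → ∀ p ∈ W, D.fock r w p ∈ W)
    (hR : ¬ W ≤ R) : ∃ d : ℤ, d ≤ 2 * n ∧ ∃ w ∈ W, w ∉ R ∧ D.IsLevel d w ∧
      ∀ i ∈ D.half, D.fock r (D.Wp i) w ∈ R := by
  -- The index e = 2n - d measures the distance from the maximal level, so the least e gives the
  -- highest level d. Raising such a w would give a still higher level, so the result must lie in R.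
  let A : Set ℕ := {e | ∃ w ∈ W, w ∉ R ∧ D.IsLevel (2 * n - e) w}
  have hA : A.Nonempty := by
    obtain ⟨p, hp, hpR⟩ := SetLike.not_le_iff_exists.1 hR
    have h1 : ∀ d ∈ Finset.range (2 * n + 1),
        MvPolynomial.weightedHomogeneousComponent D.lv d p ∈ W := by
      refine mem_of_sum_eigenvector_mem (T := D.fock 0 D.h)
        (c := fun d : ℕ => ((D.s / 2 * (d : ℤ) : ℝ) : ℂ)) (fun x hx => ?_) (fun i _ j _ hij => ?_)
        (fun i _ => D.isLevel_weightedHomogeneousComponent i p) ?_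
      -- Stability is assumed at the parameter r; it passes to r = 0 because the two actions of h
      -- differ by a scalar.
      · have h2 := W.sub_mem (hW D.h D.z_h x hx) (W.smul_mem ((r : ℂ) * D.B D.z D.h) hx)
        rwa [D.fock_K_r r D.z_h, add_sub_cancel_right] at h2
      · have h2 := mul_left_cancel₀ (half_pos D.s_pos).ne' (Complex.ofReal_injective hij)
        exact_mod_cast h2
      · rwa [D.sum_weightedHomogeneousComponent (hWn p hp)]
    have h2 : ∃ d ∈ Finset.range (2 * n + 1),
        MvPolynomial.weightedHomogeneousComponent D.lv d p ∉ R := by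
      by_contra! h3
      apply hpR
      rw [← D.sum_weightedHomogeneousComponent (hWn p hp)]
      exact R.sum_mem h3
    obtain ⟨d, hd, hd'⟩ := h2
    refine ⟨2 * n - d, _, h1 d hd, hd', ?_⟩
    have h3 := D.isLevel_weightedHomogeneousComponent d p
    rw [Finset.mem_range] at hd
    rwa [show (2 * n - ((2 * n - d : ℕ) : ℤ)) = (d : ℤ) by omega]
  classical
  obtain ⟨w, hwW, hwR, hw⟩ := Nat.find_spec hA
  refine ⟨2 * n - (Nat.find hA : ℕ), by omega, w, hwW, hwR, hw, fun i hi => ?_⟩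
  by_contra hiR
  have h1 := hw.Wp r hi
  have h2 := hW _ (D.z_Wp i) w hwW
  have h3 := h1.le (hWn _ h2) (fun h0 => hiR (h0 ▸ R.zero_mem))
  refine Nat.find_min hA (m := Nat.find hA - 1) (by omega) ⟨_, h2, hiR, ?_⟩
  rwa [show (2 * n - ((Nat.find hA - 1 : ℕ) : ℤ)) = 2 * n - (Nat.find hA : ℤ) + 1 by omega]

end HermitianDatum
end HermitianLie

/-! ### The spectrum of `opT` in degree two -/

namespace HermitianLie
namespace HermitianDatum

variable {G ι : Type*} [LieRing G] [LieAlgebra ℂ G] [Fintype ι] [DecidableEq ι]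
  (D : HermitianDatum G ι) (r : ℝ)

theorem fock_K_ell' {w x : G} (hw : ⁅D.z, w⁆ = 0) (hw' : D.B D.z w = 0) (hx : ⁅D.z, x⁆ = x) :
    D.fock r w (D.ell x) = D.ell ⁅w, x⁆ := by
  rw [D.fock_K_ell r hw hx, hw', mul_zero, zero_smul, add_zero]

theorem B_z_Wp {i : ι} (hi : i ∈ D.half) : D.B D.z (D.Wp i) = 0 := by
  have : D.o ≠ i := fun h => D.o_notMem_half (h ▸ hi)
  rw [Wp, map_smul, ← D.B_inv, D.z_X, D.B_X_Y, if_neg this, smul_zero]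

theorem B_z_Wm {i : ι} (hi : i ∈ D.half) : D.B D.z (D.Wm i) = 0 := by
  have : i ≠ D.o := fun h => D.o_notMem_half (h ▸ hi)
  rw [Wm, ← D.B_inv, D.z_Y, map_neg, LinearMap.neg_apply, D.B_symm, D.B_X_Y, if_neg this, neg_zero]

theorem constantCoeff_eq_zero {p : MvPolynomial ι ℂ} {n : ℕ} (hp : p.IsHomogeneous (n + 1)) :
    MvPolynomial.constantCoeff p = 0 := by
  rw [MvPolynomial.constantCoeff_eq]
  exact hp.coeff_eq_zero (by simp)

/-- If every Yᵢ annihilates w, then so does ∑ XᵢYᵢ, which excludes a nonzero eigenvalue. -/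
theorem eq_zero_of_fock_Y {n : ℕ} {w : MvPolynomial ι ℂ} (hw : w.IsHomogeneous n) {t : ℂ}
    (ht : t ≠ 0) (hT : D.opT r w = t • w) (h : ∀ i, D.fock r (D.Y i) w = 0) : w = 0 := by
  rw [opT_apply, Finset.sum_eq_zero fun i _ => by rw [h i, mul_zero]] at hT
  exact (smul_eq_zero.1 hT.symm).resolve_left ht

/-- The eigenvalues of `opT 0` in degree two. -/
theorem eigenvalue_two {e : MvPolynomial ι ℂ} (he : e.IsHomogeneous 2) (hne : e ≠ 0) {t : ℂ}
    (hT : D.opT 0 e = t • e) : t = -(D.s : ℂ) ∨ ∃ x ∈ D.V0, x ≠ 0 ∧ D.Zop x = -t • x := by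
  -- An auxiliary parameter: t - 2r, the eigenvalue of `opT r`, must be nonzero so that an
  -- eigenvector is not annihilated by all Yᵢ, and r itself must be nonzero to exclude the middle
  -- level below.
  obtain ⟨r, hr, hrt⟩ : ∃ r : ℝ, 0 < r ∧ t - 2 * r ≠ 0 := by
    by_cases h : t = 2
    · exact ⟨2, by norm_num, by rw [h]; norm_num⟩
    · exact ⟨1, by norm_num, by rw [sub_ne_zero]; simpa using h⟩
  have hr0 : (r : ℂ) ≠ 0 := by exact_mod_cast hr.ne'
  let W : Submodule ℂ (MvPolynomial ι ℂ) := MvPolynomial.homogeneousSubmodule ι ℂ 2 ⊓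
    LinearMap.ker (D.opT r - (t - 2 * r) • LinearMap.id)
  have hW : ∀ p, p ∈ W ↔ p.IsHomogeneous 2 ∧ D.opT r p = (t - 2 * r) • p := fun p => by
    simp [W, sub_eq_zero]
  have heW : e ∈ W := (hW e).2 ⟨he, by rw [D.opT_eq r he, hT]; push_cast; module⟩
  obtain ⟨d, hd, w, hwW, hw0, hwd, hwp⟩ := D.exists_top r (R := ⊥) (fun p hp => ((hW p).1 hp).1)
    (fun v hv p hp => (hW _).2 ⟨D.isHomogeneous_fock_K r hv ((hW p).1 hp).1, by
      rw [D.opT_comm r hv, ((hW p).1 hp).2, map_smul]⟩)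
    (fun h => hne ((Submodule.mem_bot ℂ).1 (h heW)))
  obtain ⟨hw2, hwT⟩ := (hW w).1 hwW
  simp only [Submodule.mem_bot] at hw0 hwp
  -- Lowering the highest vector w by `Y o` gives a linear form `ell x`, with x nonzero because
  -- otherwise all Yᵢ would annihilate w. The rest of the proof locates x among the three
  -- eigenspaces of `ad h`.
  obtain ⟨x, hx, hux⟩ := D.exists_ell (D.isHomogeneous_fock_N r (D.z_Y D.o) hw2)
  have hx0 : x ≠ 0 := fun h0 => hw0 <| D.eq_zero_of_fock_Y r hw2 hrt hwT fun j => by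
    rw [h0, map_zero] at hux
    exact (Submodule.mem_bot ℂ).1 (D.fock_Y_mem r (R := ⊥)
      (fun y p hp => by rw [(Submodule.mem_bot ℂ).1 hp, map_zero]; exact Submodule.zero_mem _)
      ((Submodule.mem_bot ℂ).2 hux) (fun i hi => (Submodule.mem_bot ℂ).2 (hwp i hi)) j)
  have hlv := hwd.Y_o r
  rw [hux] at hlv
  have hhx : ⁅D.h, x⁆ = ((D.s / 2 * (d + -2 : ℤ) : ℝ) : ℂ) • x := by
    have h1 : D.fock 0 D.h (D.ell x) = _ := hlv
    rw [D.fock_K_ell 0 D.z_h hx, Complex.ofReal_zero, zero_mul, zero_smul, add_zero,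
      ← map_smul] at h1
    rw [← sub_eq_zero]
    refine D.ell_injective ?_ (by rw [map_sub, h1, sub_self])
    rw [lie_sub, lie_smul, hx, D.z_KP D.z_h hx]
  have hop : D.opT r (D.ell x) = (-(r : ℂ)) • D.ell x := by
    have h1 : (D.ell x).IsHomogeneous 1 := hux ▸ D.isHomogeneous_fock_N r (D.z_Y D.o) hw2
    rw [D.opT_eq r h1, D.opT_zero_ell hx]; push_cast; module
  -- The identity `fock_Y_opT`, with the raising terms on w removed, becomes an eigenvalue equation
  -- for x.
  have hZ : ∑ i ∈ D.half, ⁅D.Wm i, ⁅D.Wp i, x⁆⁆ = -(D.s / 2 * (d - 2) + t) • x := by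
    have h1 := D.fock_Y_opT r w
    rw [hwT, map_smul, hux, hop, hlv.fock_h r, Finset.sum_eq_zero (s := D.half)
      (f := fun i => D.fock r (D.Wm i) (D.fock r (D.Y D.o) (D.fock r (D.Wp i) w)))
      (fun i hi => by rw [hwp i hi, map_zero, map_zero]), add_zero,
      Finset.sum_congr rfl (fun i hi => by
        rw [D.fock_K_ell' r (D.z_Wp i) (D.B_z_Wp hi) hx,
          D.fock_K_ell' r (D.z_Wm i) (D.B_z_Wm hi) (D.z_KP (D.z_Wp i) hx)]), ← map_sum,
      ← map_smul, ← map_smul, ← map_smul, ← map_sub, ← map_sub] at h1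
    have h2 := D.ell_injective (x := (t - 2 * r) • x - ((-(r : ℂ)) • x -
      ((r + D.s / 2 * (d + -2 : ℤ) : ℝ) : ℂ) • x - ∑ i ∈ D.half, ⁅D.Wm i, ⁅D.Wp i, x⁆⁆)) ?_
      (by rw [map_sub, h1, sub_self])
    · push_cast at h2
      rw [← sub_eq_zero, ← h2]; module
    · simp only [lie_sub, lie_smul, lie_sum, hx]
      congr 2
      exact Finset.sum_congr rfl fun i _ => D.z_KP (D.z_Wm i) (D.z_KP (D.z_Wp i) hx)
  have hs := D.s_pos
  -- The eigenvalue of `ad h` on x is (s/2)(d - 2), and only 0, s/2 and s occur in 𝔭₊.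
  have hd' : d = 2 ∨ d = 3 ∨ d = 4 := by
    by_contra hc
    refine hx0 (D.eq_zero_of_h_eigen hx hhx fun j hj => hc ?_)
    rw [a_eq_lv] at hj
    have h3 := mul_left_cancel₀ (half_pos hs).ne' hj
    have h4 : ((D.lv j : ℤ)) = d + -2 := by exact_mod_cast h3
    have h5 := D.lv_le j
    omega
  rcases hd' with rfl | rfl | rfl
  · right
    have hV : x ∈ D.V0 := ⟨hx, by rw [hhx]; norm_num⟩
    refine ⟨x, hV, hx0, ?_⟩
    rw [D.Zop_eq_half hV.2, hZ]
    congr 1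
    push_cast; ring
  -- The middle level d = 3: commuting `Wp i` with `Y o` on w gives Yᵢw = -B(x, Yᵢ)X_o. Evaluating
  -- `Y o` and Yᵢ on w in both orders then gives 2r B(x, Yᵢ) = 0.
  · exfalso
    apply hx0
    have hc : ∀ i ∈ D.half, D.B x (D.Y i) = 0 := fun i hi => by
      have hXo : ⁅D.Wp i, x⁆ = D.B x (D.Y i) • D.X D.o := by
        have hP := D.z_KP (D.z_Wp i) hx
        have h1 := D.h_lie (D.h_Wp (D.mem_half.1 hi)) hhx
        conv_lhs => rw [D.eq_sum_X hP]
        rw [Finset.sum_eq_single D.o]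
        · rw [← neg_neg (D.B ⁅D.Wp i, x⁆ (D.Y D.o)), ← D.B_inv', D.Wp_Y_o (D.mem_half.1 hi),
            map_neg, neg_neg]
        · intro j _ hj
          rw [D.coeff_eq_zero h1, zero_smul]
          intro h2
          rw [← Complex.ofReal_add] at h2
          have h3 := Complex.ofReal_injective h2
          refine hj (D.a_inj j ?_)
          rw [h3, a_o]; push_cast; ring
        · simp
      have h1 := D.fock_fock r (D.Wp i) (D.Y D.o) w
      rw [hwp i hi, map_zero, zero_add, D.Wp_Y_o (D.mem_half.1 hi), hux,
        D.fock_K_ell' r (D.z_Wp i) (D.B_z_Wp hi) hx, hXo, fock_neg, LinearMap.neg_apply] at h1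
      have h2 := congrArg (D.fock r (D.Y D.o)) h1
      rw [map_neg, D.fock_Y_comm r D.o i, hux, map_smul, map_smul, D.fock_Y_ell r D.o (D.z_X D.o),
        D.fock_Y_ell r i hx, D.B_X_Y, if_pos rfl, MvPolynomial.smul_eq_C_mul, ← map_mul,
        ← map_neg] at h2
      have h3 := MvPolynomial.C_injective _ _ h2
      have h4 : (2 * r) * D.B x (D.Y i) = 0 := by linear_combination -h3
      exact (mul_eq_zero.1 h4).resolve_left (mul_ne_zero two_ne_zero hr0)
    rw [D.eq_sum_X hx]
    refine Finset.sum_eq_zero fun i _ => ?_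
    by_cases hi : i ∈ D.half
    · rw [hc i hi, zero_smul]
    · rw [D.coeff_eq_zero hhx, zero_smul]
      intro h1
      have h2 := Complex.ofReal_injective h1
      push_cast at h2
      exact hi (D.mem_half.2 (by linarith))
  -- At the top level d = 4, x is a multiple of `X o`, raising operators annihilate it, and the
  -- equation reduces to t = -s.
  · left
    have hxo : x = D.B x (D.Y D.o) • D.X D.o := by
      conv_lhs => rw [D.eq_sum_X hx]
      refine Finset.sum_eq_single D.o (fun j _ hj => ?_) (by simp)
      rw [D.coeff_eq_zero hhx, zero_smul]
      intro h1
      have h2 := Complex.ofReal_injective h1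
      refine hj (D.a_inj j ?_)
      rw [h2, a_o]; push_cast; ring
    rw [Finset.sum_eq_zero, eq_comm] at hZ
    · have h1 := (smul_eq_zero.1 hZ).resolve_right hx0
      push_cast at h1
      linear_combination -h1
    · intro i hi
      rw [hxo, lie_smul, D.Wp_X_o (D.mem_half.1 hi), smul_zero, lie_zero]

end HermitianDatum
end HermitianLie

/-! ### The second eigenvalue, and its existence -/

namespace HermitianLie
namespace HermitianDatum

variable {G ι : Type*} [LieRing G] [LieAlgebra ℂ G] [Fintype ι] [DecidableEq ι]
  (D : HermitianDatum G ι) (r : ℝ)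

theorem form_opT (p q : MvPolynomial ι ℂ) : D.form r p (D.opT r q) =
    -∑ i, D.form r (D.fock r (D.Y i) p) (D.fock r (D.Y i) q) := by
  simp only [opT_apply, map_sum, form_Y, Finset.sum_neg_distrib, neg_neg]

theorem form_opT_left (p q : MvPolynomial ι ℂ) : D.form r (D.opT r p) q =
    -∑ i, D.form r (D.fock r (D.Y i) p) (D.fock r (D.Y i) q) := by
  simp only [opT_apply, map_sum, LinearMap.sum_apply, form_X_mul, Finset.sum_neg_distrib]

theorem form_opT_symm (p q : MvPolynomial ι ℂ) :
    D.form r (D.opT r p) q = D.form r p (D.opT r q) := by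
  rw [form_opT, form_opT_left]

theorem form_ell {x : G} (hx : ⁅D.z, x⁆ = x) :
    D.form r (D.ell x) (D.ell x) = (r * D.normSq x : ℝ) := by
  have h1 : ∀ i, D.form r (MvPolynomial.X i) (D.ell x) = r * D.B x (D.Y i) := fun i => by
    rw [← mul_one (MvPolynomial.X i), form_X_mul, form_one_left, D.fock_Y_ell r i hx]
    simp
  nth_rw 1 [D.ell_apply x]
  rw [map_sum, LinearMap.sum_apply]
  simp only [map_smulₛₗ, LinearMap.smul_apply, h1, normSq, smul_eq_mul]
  push_cast
  rw [Finset.mul_sum]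
  refine Finset.sum_congr rfl fun i _ => ?_
  rw [← Complex.mul_conj]; ring

theorem form_self_one {p : MvPolynomial ι ℂ} (hr : 0 < r) (hp : p.IsHomogeneous 1) :
    0 ≤ (D.form r p p).re ∧ ((D.form r p p).re = 0 → p = 0) := by
  obtain ⟨x, hx, rfl⟩ := D.exists_ell hp
  rw [D.form_ell r hx, Complex.ofReal_re]
  refine ⟨mul_nonneg hr.le (D.normSq_nonneg x), fun h => ?_⟩
  rw [D.normSq_eq_zero hx ((mul_eq_zero.1 h).resolve_left hr.ne'), map_zero]

/-- The pairing of q with `opT q` is minus the sum of the norms of the Yᵢq. These have degree one,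
where the form is definite for r > 0. -/
theorem fock_Y_eq_zero_of_form {q : MvPolynomial ι ℂ} (hr : 0 < r) (hq : q.IsHomogeneous 2)
    (h : (D.form r q (D.opT r q)).re = 0) (i : ι) : D.fock r (D.Y i) q = 0 := by
  have h1 := fun i => D.form_self_one r hr (D.isHomogeneous_fock_N r (D.z_Y i) hq)
  rw [form_opT, Complex.neg_re, Complex.re_sum, neg_eq_zero] at h
  exact (h1 i).2 ((Finset.sum_eq_zero_iff_of_nonneg fun i _ => (h1 i).1).1 h i (Finset.mem_univ i))

/-- The operator `opT 0` in degree two has the eigenvalue `t > 0` and no other eigenvalue except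
possibly `-s`. -/
structure IsEigenvalue (t : ℝ) : Prop where
  pos : 0 < t
  quad : ∀ q : MvPolynomial ι ℂ, q.IsHomogeneous 2 →
    D.opT 0 (D.opT 0 q + (D.s : ℂ) • q) = (t : ℂ) • (D.opT 0 q + (D.s : ℂ) • q)
  exists_eigenvector : ∃ e : MvPolynomial ι ℂ, e.IsHomogeneous 2 ∧ e ≠ 0 ∧
    D.opT 0 e = (t : ℂ) • e

/-- Every eigenvalue is -s or the negative t of the scalar of `Zop` on `V0`. The quadratic relation
also needs diagonalizability, which follows from symmetry for a definite form. -/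
theorem exists_eigenvalue_quad : ∃ t : ℝ, 0 < t ∧ ∀ q : MvPolynomial ι ℂ, q.IsHomogeneous 2 →
    D.opT 0 (D.opT 0 q + (D.s : ℂ) • q) = (t : ℂ) • (D.opT 0 q + (D.s : ℂ) • q) := by
  obtain ⟨t, ht, hV⟩ : ∃ t : ℝ, 0 < t ∧ ∀ x ∈ D.V0, D.Zop x = -(t : ℂ) • x := by
    obtain ⟨μ, hμ⟩ := D.exists_Zop_scalar
    by_cases h : ∃ x ∈ D.V0, x ≠ 0
    · obtain ⟨x, hx, hx0⟩ := h
      obtain ⟨t, ht, rfl⟩ := D.Zop_scalar_neg hx hx0 (hμ x hx)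
      exact ⟨t, ht, hμ⟩
    · push Not at h
      -- If `V0` is zero, -s is the only possible eigenvalue and t may be any positive number.
      exact ⟨1, one_pos, fun x hx => by rw [h x hx, map_zero, smul_zero]⟩
  have hev : ∀ e : MvPolynomial ι ℂ, e.IsHomogeneous 2 → e ≠ 0 → ∀ c : ℂ, D.opT 0 e = c • e →
      c = -(D.s : ℂ) ∨ c = t := fun e he he0 c hc => by
    refine (D.eigenvalue_two he he0 hc).imp_right fun ⟨x, hx, hx0, hZ⟩ => ?_
    rw [hV x hx, neg_smul, neg_smul, neg_inj] at hZ
    exact (smul_left_injective ℂ hx0 hZ).symm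
  -- With r > 0 and 2r ≠ t, neither -s - 2r nor t - 2r is zero, so `opT r` is injective in degree
  -- two.
  obtain ⟨r, hr, hrt⟩ : ∃ r : ℝ, 0 < r ∧ 2 * r ≠ t := by
    by_cases h : t = 2
    · exact ⟨2, by norm_num, by rw [h]; norm_num⟩
    · exact ⟨1, by norm_num, by rw [mul_one]; exact fun h' => h h'.symm⟩
  refine ⟨t, ht, ?_⟩
  have hT : ∀ q : MvPolynomial ι ℂ, q.IsHomogeneous 2 →
      D.opT 0 q = D.opT r q + ((2 * r : ℝ) : ℂ) • q :=
    fun q hq => by rw [D.opT_eq r hq]; push_cast; module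
  let P : MvPolynomial ι ℂ →ₗ[ℂ] MvPolynomial ι ℂ :=
    (D.opT r + ((2 * r - t : ℝ) : ℂ) • LinearMap.id) ∘ₗ
      (D.opT r + ((2 * r + D.s : ℝ) : ℂ) • LinearMap.id)
  have hPa : ∀ q, P q = D.opT r (D.opT r q) + ((2 * r - t + (2 * r + D.s) : ℝ) : ℂ) • D.opT r q +
      (((2 * r - t) * (2 * r + D.s) : ℝ) : ℂ) • q := fun q => by
    simp only [P, LinearMap.comp_apply, LinearMap.add_apply, LinearMap.smul_apply,
      LinearMap.id_apply, map_add, map_smul]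
    push_cast
    module
  have hPq : ∀ q : MvPolynomial ι ℂ, q.IsHomogeneous 2 →
      D.opT 0 (D.opT 0 q + (D.s : ℂ) • q) - (t : ℂ) • (D.opT 0 q + (D.s : ℂ) • q) = P q :=
    fun q hq => by
      rw [map_add, map_smul, hT _ (D.isHomogeneous_opT 0 hq), hT q hq, hPa]
      simp only [map_add, map_smul]
      push_cast
      module
  have hPz : ∀ q ∈ MvPolynomial.homogeneousSubmodule ι ℂ 2, P q = 0 := by
    haveI : FiniteDimensional ℂ (MvPolynomial.homogeneousSubmodule ι ℂ 2) :=
      Module.Finite.iff_fg.2 (MvPolynomial.homogeneousSubmodule_fg ι ℂ 2)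
    have hTm : ∀ q ∈ MvPolynomial.homogeneousSubmodule ι ℂ 2,
        D.opT r q ∈ MvPolynomial.homogeneousSubmodule ι ℂ 2 :=
      fun q hq => D.isHomogeneous_opT r hq
    -- The form is ⟨opT p, q⟩ rather than ⟨p, q⟩, as the latter need not be definite in degree two.
    -- The former is minus a sum of degree one pairings, and a null vector is annihilated by all Yᵢ,
    -- so `opT r` kills it.
    refine eq_zero_of_symmetric (T := D.opT r) hTm (fun q hq => ?_) (fun q _ => ?_)
      (fun p q => D.form r (D.opT r p) q) (fun p _ q _ => ?_) (fun p => map_zero _)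
      (fun q hq h => ?_) (fun q hq hq0 c hc => ?_)
    · rw [hPa]
      exact Submodule.add_mem _ (Submodule.add_mem _ (hTm _ (hTm _ hq))
        (Submodule.smul_mem _ _ (hTm _ hq))) (Submodule.smul_mem _ _ hq)
    · simp only [hPa, map_add, map_smul]
    · simp only [hPa, map_add, map_smul, map_smulₛₗ, LinearMap.add_apply, LinearMap.smul_apply,
        form_opT_symm, Complex.conj_ofReal, RingHom.id_apply]
    · have hY := D.fock_Y_eq_zero_of_form r hr hq (by
        rw [← form_opT_symm, h, Complex.zero_re])
      by_contra hq0
      have h1 : D.opT 0 q = ((2 * r : ℝ) : ℂ) • q := by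
        rw [hT q hq, opT_apply, Finset.sum_eq_zero fun i _ => by rw [hY i, mul_zero], zero_add]
      rcases hev q hq hq0 _ h1 with h2 | h2
      · rw [← Complex.ofReal_neg] at h2
        have := Complex.ofReal_injective h2
        linarith [D.s_pos]
      · exact hrt (Complex.ofReal_injective h2)
    · have h1 : D.opT 0 q = (c + (2 * r : ℝ)) • q := by rw [hT q hq, hc]; module
      rw [← hPq q hq, h1]
      simp only [map_add, map_smul, h1]
      rcases hev q hq hq0 _ h1 with h2 | h2 <;> rw [h2] <;> module
  intro q hq
  rw [← sub_eq_zero, hPq q hq, hPz q hq]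

/-- By the quadratic relation, `opT 0 q + s q` satisfies the eigenvalue equation for t. If t is not
an eigenvalue, this element is always zero. -/
theorem exists_isEigenvalue : (∃ t, D.IsEigenvalue t) ∨
    ∀ q : MvPolynomial ι ℂ, q.IsHomogeneous 2 → D.opT 0 q = -(D.s : ℂ) • q := by
  obtain ⟨t, ht, hq⟩ := D.exists_eigenvalue_quad
  by_cases h : ∃ e : MvPolynomial ι ℂ, e.IsHomogeneous 2 ∧ e ≠ 0 ∧ D.opT 0 e = (t : ℂ) • e
  · exact Or.inl ⟨t, ht, hq, h⟩
  · right
    intro q hq2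
    push Not at h
    by_contra hne
    refine h _ ?_ (fun h0 => hne ?_) (hq q hq2)
    · exact (D.isHomogeneous_opT 0 hq2).add
        ((MvPolynomial.homogeneousSubmodule ι ℂ 2).smul_mem _ hq2)
    · rw [neg_smul]; exact eq_neg_of_add_eq_zero_left h0

/-! ### The curvature tensor and the rank one case -/

theorem fock_zero_Y (i : ι) (p : MvPolynomial ι ℂ) : D.fock 0 (D.Y i) p =
    (1 / 2 : ℂ) • ∑ j, ∑ k, D.ell ⁅⁅D.Y i, D.X j⁆, D.X k⁆ *
      MvPolynomial.pderiv j (MvPolynomial.pderiv k p) := by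
  rw [fock_apply]
  simp [D.ell_N (D.z_Y i), D.ell_K (D.z_NP (D.z_Y i) (D.z_X _))]

theorem fock_zero_Y_X_mul_X (i j k : ι) :
    D.fock 0 (D.Y i) (MvPolynomial.X j * MvPolynomial.X k) = D.ell ⁅⁅D.Y i, D.X j⁆, D.X k⁆ := by
  rw [fock_X_mul, ← D.ell_X k, D.fock_Y_ell 0 i (D.z_X k),
    D.fock_K_ell 0 (D.z_NP (D.z_Y i) (D.z_X j)) (D.z_X k)]
  simp

/-- Coefficients of the curvature tensor. -/
def curv (i l j k : ι) : ℂ := D.B ⁅⁅D.Y i, D.X j⁆, D.X k⁆ (D.Y l)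

theorem curv_symm (i l j k : ι) : D.curv i l j k = D.curv l i j k := by
  rw [curv, curv, D.lie_X_comm (D.Y l), D.B_inv, D.B_symm, D.B_inv ⁅D.Y l, D.X k⁆,
    ← lie_skew (D.X k), ← lie_skew (D.X j), map_neg, map_neg, LinearMap.neg_apply]

/-- Euler's identity applied twice, once to p and once to its first derivatives. -/
theorem sum_X_mul_X_pderiv {p : MvPolynomial ι ℂ} {n : ℕ} (hp : p.IsHomogeneous n) :
    ∑ j, ∑ k, MvPolynomial.X j * MvPolynomial.X k *
      MvPolynomial.pderiv j (MvPolynomial.pderiv k p) = ((n : ℂ) * (n - 1)) • p := by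
  rw [Finset.sum_comm]
  have h1 : ∀ k, ∑ j, MvPolynomial.X j * MvPolynomial.X k *
      MvPolynomial.pderiv j (MvPolynomial.pderiv k p) =
      ((n : ℂ) - 1) • (MvPolynomial.X k * MvPolynomial.pderiv k p) := fun k => by
    have h2 := (hp.pderiv (i := k)).sum_X_mul_pderiv
    cases n with
    | zero =>
      rw [← MvPolynomial.mem_homogeneousSubmodule, MvPolynomial.homogeneousSubmodule_zero] at hp
      obtain ⟨a, rfl⟩ := Submodule.mem_one.1 hp
      simp [MvPolynomial.algebraMap_eq]
    | succ n =>
      rw [Nat.add_sub_cancel, ← Nat.cast_smul_eq_nsmul ℂ] at h2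
      push_cast
      rw [add_sub_cancel_right, ← mul_smul_comm, ← h2, Finset.mul_sum]
      exact Finset.sum_congr rfl fun j _ => by ring
  rw [Finset.sum_congr rfl fun k _ => h1 k, ← Finset.smul_sum, hp.sum_X_mul_pderiv,
    ← Nat.cast_smul_eq_nsmul ℂ n p, smul_smul, mul_comm]

/-- At r = 0 the operator is of pure second order, so its coefficients are its values on quadratic
monomials. Information in degree two thereby propagates to all degrees. -/
theorem opT_zero_apply (p : MvPolynomial ι ℂ) : D.opT 0 p =
    (1 / 2 : ℂ) • ∑ j, ∑ k, D.opT 0 (MvPolynomial.X j * MvPolynomial.X k) *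
      MvPolynomial.pderiv j (MvPolynomial.pderiv k p) := by
  have e1 : ∀ j k, D.opT 0 (MvPolynomial.X j * MvPolynomial.X k) =
      ∑ i, MvPolynomial.X i * D.ell ⁅⁅D.Y i, D.X j⁆, D.X k⁆ := fun j k => by
    simp only [opT_apply, fock_zero_Y_X_mul_X]
  rw [opT_apply]
  simp only [e1, D.fock_zero_Y _ p, mul_smul_comm, ← Finset.smul_sum, Finset.mul_sum,
    Finset.sum_mul, mul_assoc]
  refine congrArg ((1 / 2 : ℂ) • ·) ?_
  rw [Finset.sum_comm]
  refine Finset.sum_congr rfl fun j _ => ?_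
  rw [Finset.sum_comm]

theorem pderiv_opT_X_mul_X (m j k : ι) :
    MvPolynomial.pderiv m (D.opT 0 (MvPolynomial.X j * MvPolynomial.X k)) =
      (2 : ℂ) • D.fock 0 (D.Y m) (MvPolynomial.X j * MvPolynomial.X k) := by
  simp only [opT_apply, fock_zero_Y_X_mul_X, map_sum, pderiv_X_mul, Finset.sum_add_distrib,
    Finset.sum_ite_eq', Finset.mem_univ, if_true]
  rw [two_smul]
  congr 1
  have h1 : ∀ i, MvPolynomial.pderiv m (D.ell ⁅⁅D.Y i, D.X j⁆, D.X k⁆) =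
      MvPolynomial.C (D.curv m i j k) := fun i => by
    rw [ell_apply, map_sum, curv_symm]
    simp [MvPolynomial.pderiv_X, Pi.single_apply, MvPolynomial.smul_eq_C_mul, curv]
  simp only [h1]
  rw [ell_apply]
  exact Finset.sum_congr rfl fun i _ => by rw [mul_comm, ← MvPolynomial.smul_eq_C_mul]; rfl

theorem eq_sum_X_mul_X {q : MvPolynomial ι ℂ} (hq : q.IsHomogeneous 2) : ∃ c : ι → ι → ℂ,
    q = ∑ j, ∑ k, c j k • (MvPolynomial.X j * MvPolynomial.X k) := by
  have h1 : ∀ j k, ∃ a : ℂ, MvPolynomial.pderiv j (MvPolynomial.pderiv k q) =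
      MvPolynomial.C a := fun j k => by
    have h2 : (MvPolynomial.pderiv j (MvPolynomial.pderiv k q)).IsHomogeneous 0 :=
      (hq.pderiv (i := k)).pderiv (i := j)
    rw [← MvPolynomial.mem_homogeneousSubmodule, MvPolynomial.homogeneousSubmodule_zero] at h2
    obtain ⟨a, ha⟩ := Submodule.mem_one.1 h2
    exact ⟨a, ha.symm⟩
  choose c hc using h1
  refine ⟨fun j k => 1 / 2 * c j k, ?_⟩
  have h2 := sum_X_mul_X_pderiv hq
  simp only [hc] at h2
  have h3 : q = (1 / 2 : ℂ) • (((2 : ℕ) : ℂ) * ((2 : ℕ) - 1)) • q := by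
    push_cast; module
  rw [h3, ← h2]
  simp only [Finset.smul_sum, mul_smul]
  refine Finset.sum_congr rfl fun j _ => Finset.sum_congr rfl fun k _ => ?_
  rw [mul_comm (_ * _), ← MvPolynomial.smul_eq_C_mul]

/-- The curvature coefficients are symmetric in the two indices from 𝔭₋, so both factors of ∑ XᵢYᵢq
contribute equally to the derivative. This recovers the action of 𝔭₋ in degree two from `opT 0`. -/
theorem pderiv_opT {q : MvPolynomial ι ℂ} (hq : q.IsHomogeneous 2) (m : ι) :
    MvPolynomial.pderiv m (D.opT 0 q) = (2 : ℂ) • D.fock 0 (D.Y m) q := by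
  obtain ⟨c, rfl⟩ := eq_sum_X_mul_X hq
  simp only [map_sum, map_smul, Derivation.map_smul, pderiv_opT_X_mul_X, Finset.smul_sum]
  exact Finset.sum_congr rfl fun j _ => Finset.sum_congr rfl fun k _ => smul_comm _ _ _

/-- If `opT 0` is scalar in degree two, the curvature is that of rank one. -/
theorem lie_lie_of_scalar
    (h : ∀ q : MvPolynomial ι ℂ, q.IsHomogeneous 2 → D.opT 0 q = -(D.s : ℂ) • q) (i j k : ι) :
    ⁅⁅D.Y i, D.X j⁆, D.X k⁆ = -(D.s / 2 : ℂ) • ((if j = i then 1 else 0 : ℂ) • D.X k +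
      (if k = i then 1 else 0 : ℂ) • D.X j) := by
  have hq : (MvPolynomial.X j * MvPolynomial.X k : MvPolynomial ι ℂ).IsHomogeneous 2 :=
    (MvPolynomial.isHomogeneous_X ℂ j).mul (MvPolynomial.isHomogeneous_X ℂ k)
  have h1 := D.pderiv_opT hq i
  rw [h _ hq, Derivation.map_smul, fock_zero_Y_X_mul_X, pderiv_X_mul, MvPolynomial.pderiv_X,
    Pi.single_apply] at h1
  rw [← sub_eq_zero]
  refine D.ell_injective ?_ ?_
  · rw [lie_sub, lie_smul, lie_add, lie_smul, lie_smul, D.z_X, D.z_X,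
      D.z_KP (D.z_NP (D.z_Y i) (D.z_X j)) (D.z_X k)]
  · have h2 : D.ell ⁅⁅D.Y i, D.X j⁆, D.X k⁆ = (1 / 2 : ℂ) • (2 : ℂ) •
        D.ell ⁅⁅D.Y i, D.X j⁆, D.X k⁆ := by module
    rw [map_sub, h2, ← h1, map_smul, map_add, map_smul, map_smul, ell_X, ell_X]
    split_ifs <;> simp <;> module

theorem lie_lie_of_scalar'
    (h : ∀ q : MvPolynomial ι ℂ, q.IsHomogeneous 2 → D.opT 0 q = -(D.s : ℂ) • q) {y x x' : G}
    (hy : ⁅D.z, y⁆ = -y) (hx : ⁅D.z, x⁆ = x) (hx' : ⁅D.z, x'⁆ = x') :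
    ⁅⁅y, x⁆, x'⁆ = -(D.s / 2 : ℂ) • (D.B y x • x' + D.B y x' • x) := by
  obtain ⟨c, rfl⟩ : ∃ c : ι → ℂ, x' = ∑ i, c i • D.X i := ⟨_, D.eq_sum_X hx'⟩
  obtain ⟨b, rfl⟩ : ∃ b : ι → ℂ, x = ∑ i, b i • D.X i := ⟨_, D.eq_sum_X hx⟩
  obtain ⟨a, rfl⟩ : ∃ a : ι → ℂ, y = ∑ i, a i • D.Y i := ⟨_, D.eq_sum_Y hy⟩
  have step1 : ∀ i j, ⁅⁅D.Y i, D.X j⁆, ∑ l, c l • D.X l⁆ = -(D.s / 2 : ℂ) •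
      (D.B (D.Y i) (D.X j) • (∑ l, c l • D.X l) +
        D.B (D.Y i) (∑ l, c l • D.X l) • D.X j) := fun i j => by
    simp only [lie_sum, lie_smul, D.lie_lie_of_scalar h, map_sum, map_smul]
    simp only [D.B_symm (D.Y i), D.B_X_Y, Finset.smul_sum, Finset.sum_smul, smul_eq_mul]
    rw [← Finset.sum_add_distrib, Finset.smul_sum]
    exact Finset.sum_congr rfl fun l _ => by module
  have step2 : ∀ i, ⁅⁅D.Y i, ∑ j, b j • D.X j⁆, ∑ l, c l • D.X l⁆ = -(D.s / 2 : ℂ) •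
      (D.B (D.Y i) (∑ j, b j • D.X j) • (∑ l, c l • D.X l) +
        D.B (D.Y i) (∑ l, c l • D.X l) • (∑ j, b j • D.X j)) := fun i => by
    generalize ∑ l, c l • D.X l = x' at step1 ⊢
    simp only [lie_sum, lie_smul, sum_lie, smul_lie, step1, map_sum, map_smul]
    simp only [Finset.sum_smul, smul_eq_mul]
    rw [Finset.smul_sum (s := Finset.univ) (r := D.B (D.Y i) x'), ← Finset.sum_add_distrib,
      Finset.smul_sum]
    exact Finset.sum_congr rfl fun l _ => by module
  generalize ∑ l, c l • D.X l = x' at step2 ⊢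
  generalize ∑ j, b j • D.X j = x at step2 ⊢
  simp only [sum_lie, smul_lie, step2, map_sum, map_smul, LinearMap.sum_apply,
    LinearMap.smul_apply, Finset.sum_smul, smul_eq_mul]
  rw [← Finset.sum_add_distrib, Finset.smul_sum]
  exact Finset.sum_congr rfl fun l _ => by module

/-- Commuting elements are proportional if `opT 0` is scalar in degree two. -/
theorem exists_real_of_scalar
    (h : ∀ q : MvPolynomial ι ℂ, q.IsHomogeneous 2 → D.opT 0 q = -(D.s : ℂ) • q) {x y : G}
    (hx : ⁅D.z, x⁆ = x) (hy : ⁅D.z, y⁆ = y) (hx0 : x ≠ 0)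
    (hxy : ⁅x, D.τ y⁆ + ⁅D.τ x, y⁆ = 0) : ∃ ρ : ℝ, y = (ρ : ℂ) • x := by
  have hN := D.normSq_pos hx hx0
  have hN' : (D.normSq x : ℂ) ≠ 0 := by exact_mod_cast hN.ne'
  have hs := D.s_ne_zero
  -- Applying the vanishing bracket to x and inserting the explicit curvature gives |x|²y as a
  -- multiple of x. Pairing the same bracket with z afterwards shows that the factor is real.
  have h1 : ⁅⁅x, D.τ y⁆ + ⁅D.τ x, y⁆, x⁆ = 0 := by rw [hxy, zero_lie]
  rw [add_lie, ← lie_skew x, neg_lie, D.lie_lie_of_scalar' h (D.z_τ_P hy) hx hx,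
    D.lie_lie_of_scalar' h (D.z_τ_P hx) hy hx, D.B_symm (D.τ x) x, D.B_self_τ hx] at h1
  obtain ⟨ρ, hρ⟩ : ∃ ρ : ℂ, y = ρ • x := by
    refine ⟨(2 * D.B (D.τ y) x - D.B (D.τ x) y) / D.normSq x, ?_⟩
    have h2 : (D.s / 2 : ℂ) • ((D.normSq x : ℂ) • y - (2 * D.B (D.τ y) x - D.B (D.τ x) y) • x) =
        0 := by
      rw [← neg_eq_zero, ← h1]; module
    have h3 := sub_eq_zero.1 ((smul_eq_zero.1 h2).resolve_left (div_ne_zero hs two_ne_zero))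
    rw [div_eq_inv_mul, mul_smul, ← h3, smul_smul, inv_mul_cancel₀ hN', one_smul]
  have h2 : D.B D.z (⁅x, D.τ y⁆ + ⁅D.τ x, y⁆) = 0 := by rw [hxy, map_zero]
  rw [map_add, ← D.B_inv, ← D.B_inv, hx, D.z_τ_P hx, hρ, map_smulₛₗ, map_smul, map_neg,
    LinearMap.neg_apply, map_smul, D.B_symm (D.τ x), D.B_self_τ hx, smul_eq_mul, smul_eq_mul] at h2
  have h3 : (starRingEnd ℂ ρ - ρ) * D.normSq x = 0 := by linear_combination h2
  have h4 := sub_eq_zero.1 ((mul_eq_zero.1 h3).resolve_right hN')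
  exact ⟨ρ.re, by rw [Complex.conj_eq_iff_re.1 h4]; exact hρ⟩

end HermitianDatum
end HermitianLie

/-! ### Semidefiniteness at the parameter t/2 -/

namespace HermitianLie
namespace HermitianDatum

variable {G ι : Type*} [LieRing G] [LieAlgebra ℂ G] [Fintype ι] [DecidableEq ι]
  (D : HermitianDatum G ι) (r : ℝ)

/-- The radical is invariant under the action, and the Xᵢ act by multiplication. -/
theorem mul_mem_radical {p : MvPolynomial ι ℂ} (hp : p ∈ D.radical r) (q : MvPolynomial ι ℂ) :
    p * q ∈ D.radical r := by
  induction q using MvPolynomial.induction_on with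
  | C a => rw [mul_comm, ← MvPolynomial.smul_eq_C_mul]; exact Submodule.smul_mem _ _ hp
  | add q q' hq hq' => rw [mul_add]; exact Submodule.add_mem _ hq hq'
  | mul_X q i hq =>
    rw [← mul_assoc, mul_comm, ← D.fock_X r]
    exact D.fock_mem_radical r _ hq

/-- Since τz = -z, the operator z is symmetric for the form, and its eigenvalues separate the
degrees. -/
theorem form_pairing {p : MvPolynomial ι ℂ} {m n : ℕ} {q : MvPolynomial ι ℂ}
    (hp : p.IsHomogeneous m) (hq : q.IsHomogeneous n) (hmn : m ≠ n) : D.form r p q = 0 := by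
  have h1 := D.form_fock r D.z p q
  have hb : starRingEnd ℂ (D.B D.z D.z) = D.B D.z D.z := by
    rw [← D.B_τ, D.τ_z, map_neg, map_neg, LinearMap.neg_apply, neg_neg]
  rw [(D.isHomogeneous_iff r).1 hp, D.τ_z, fock_neg, LinearMap.neg_apply,
    (D.isHomogeneous_iff r).1 hq, map_neg, neg_neg, LinearMap.map_smul, LinearMap.map_smulₛₗ,
    LinearMap.smul_apply, map_add, map_mul, Complex.conj_ofReal, hb, map_natCast, smul_eq_mul,
    smul_eq_mul] at h1
  have h2 : ((m : ℂ) - n) * D.form r p q = 0 := by linear_combination h1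
  exact (mul_eq_zero.1 h2).resolve_left (sub_ne_zero.2 (by exact_mod_cast hmn))

theorem form_self_sum (p : MvPolynomial ι ℂ) : D.form r p p =
    ∑ n ∈ Finset.range (p.totalDegree + 1), D.form r (MvPolynomial.homogeneousComponent n p)
      (MvPolynomial.homogeneousComponent n p) := by
  conv_lhs => rw [← MvPolynomial.sum_homogeneousComponent p]
  rw [map_sum]
  refine Finset.sum_congr rfl fun n hn => ?_
  rw [map_sum, LinearMap.sum_apply]
  exact Finset.sum_eq_single n (fun m _ hm => D.form_pairing r
    (MvPolynomial.homogeneousComponent_isHomogeneous _ _)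
    (MvPolynomial.homogeneousComponent_isHomogeneous _ _) hm) (fun h => absurd hn h)

/-- The contravariant form is positive semidefinite. -/
def IsPos : Prop := ∀ p, 0 ≤ (D.form r p p).re

theorem isPos_of_homogeneous
    (h : ∀ n, ∀ p : MvPolynomial ι ℂ, p.IsHomogeneous n → 0 ≤ (D.form r p p).re) : D.IsPos r :=
  fun p => by
    rw [form_self_sum, Complex.re_sum]
    exact Finset.sum_nonneg fun n _ => h n _ (MvPolynomial.homogeneousComponent_isHomogeneous _ _)

variable {D r}

/-- Vectors of length zero belong to the radical of a semidefinite form. -/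
theorem IsPos.mem_radical (hD : D.IsPos r) {p : MvPolynomial ι ℂ}
    (hp : (D.form r p p).re = 0) : p ∈ D.radical r := by
  have hp' : D.form r p p = 0 := by rw [← form_self_im, hp, Complex.ofReal_zero]
  intro q
  by_contra hne
  set a := D.form r q p with ha
  have ha' : 0 < Complex.normSq a := Complex.normSq_pos.2 hne
  set N := (D.form r q q).re with hN
  have h1 : ∀ x : ℝ, 0 ≤ N + 2 * x * Complex.normSq a := fun x => by
    have h2 := hD (q + ((x : ℂ) * starRingEnd ℂ a) • p)
    have h3 : D.form r p q = starRingEnd ℂ a := by rw [D.form_symm r q p]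
    have h4 : D.form r (q + ((x : ℂ) * starRingEnd ℂ a) • p) (q + ((x : ℂ) * starRingEnd ℂ a) • p)
        = D.form r q q + 2 * x * (a * starRingEnd ℂ a) := by
      simp only [map_add, map_smul, map_smulₛₗ, LinearMap.add_apply, LinearMap.smul_apply, hp', h3,
        ← ha, smul_eq_mul, map_mul, Complex.conj_ofReal, Complex.conj_conj]
      ring
    rw [h4, Complex.mul_conj] at h2
    have h5 : (D.form r q q + 2 * x * (Complex.normSq a : ℂ)).re = N + 2 * x * Complex.normSq a := by
      rw [Complex.add_re]
      congr 1
      rw [← Complex.ofReal_ofNat, ← Complex.ofReal_mul, ← Complex.ofReal_mul, Complex.ofReal_re]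
    rwa [h5] at h2
  -- Since p is null, the norm of q + x ā p is affine in x. This value of x makes it -1.
  have h6 := h1 (-(N + 1) / (2 * Complex.normSq a))
  have h7 : 2 * (-(N + 1) / (2 * Complex.normSq a)) * Complex.normSq a = -(N + 1) := by
    field_simp
  rw [h7] at h6
  linarith

theorem IsPos.mem_radical_of_nonpos (hD : D.IsPos r) {p : MvPolynomial ι ℂ}
    (hp : (D.form r p p).re ≤ 0) : p ∈ D.radical r :=
  hD.mem_radical (le_antisymm hp (hD p))

/-- Orthogonal projection to a finitely generated subspace for a semidefinite form. -/
theorem IsPos.exists_orthogonal (hD : D.IsPos r) {W : Submodule ℂ (MvPolynomial ι ℂ)}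
    (hW : W.FG) (p : MvPolynomial ι ℂ) : ∃ w ∈ W, ∀ v ∈ W, D.form r v (p - w) = 0 := by
  classical
  obtain ⟨F, rfl⟩ := hW
  induction F using Finset.induction_on generalizing p with
  | empty => exact ⟨0, Submodule.zero_mem _, fun v hv => by
      rw [Finset.coe_empty, Submodule.span_empty, Submodule.mem_bot] at hv
      rw [hv, map_zero, LinearMap.zero_apply]⟩
  | insert a F _ ih =>
    obtain ⟨w, hw, hwo⟩ := ih p
    obtain ⟨b, hb, hbo⟩ := ih a
    have hle : Submodule.span ℂ (F : Set (MvPolynomial ι ℂ)) ≤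
        Submodule.span ℂ ((insert a F : Finset (MvPolynomial ι ℂ)) : Set (MvPolynomial ι ℂ)) :=
      Submodule.span_mono (by simp)
    have haF : a ∈ Submodule.span ℂ
        ((insert a F : Finset (MvPolynomial ι ℂ)) : Set (MvPolynomial ι ℂ)) :=
      Submodule.subset_span (by simp)
    set c := a - b with hc
    -- A Gram–Schmidt step: if the new direction c is null, it lies in the radical and needs no
    -- correction; otherwise one divides by its norm.
    obtain ⟨k, hk⟩ : ∃ k : ℂ, D.form r c (p - w - k • c) = 0 := by
      by_cases h0 : D.form r c c = 0
      · refine ⟨0, ?_⟩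
        rw [zero_smul, sub_zero]
        exact D.form_radical_left r (hD.mem_radical (by rw [h0, Complex.zero_re])) _
      · exact ⟨D.form r c (p - w) / D.form r c c, by
          rw [map_sub, map_smul, smul_eq_mul, div_mul_cancel₀ _ h0, sub_self]⟩
    refine ⟨w + k • c, Submodule.add_mem _ (hle hw) (Submodule.smul_mem _ _
      (Submodule.sub_mem _ haF (hle hb))), fun v hv => ?_⟩
    rw [← sub_sub]
    rw [Finset.coe_insert, Submodule.mem_span_insert] at hv
    obtain ⟨x, f, hf, rfl⟩ := hv
    have h1 : x • a + f = x • c + (x • b + f) := by rw [hc]; module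
    have h2 : x • b + f ∈ Submodule.span ℂ (F : Set (MvPolynomial ι ℂ)) :=
      Submodule.add_mem _ (Submodule.smul_mem _ _ hb) hf
    rw [h1, map_add, LinearMap.add_apply, map_smulₛₗ, LinearMap.smul_apply, hk, smul_zero, zero_add,
      map_sub, hwo _ h2, map_smul, hbo _ h2, smul_zero, sub_zero]

/-- The parameter is bounded below if the form is semidefinite. -/
theorem IsEigenvalue.le_of_isPos {t : ℝ} (ht : D.IsEigenvalue t) (hr : 0 < r) (hD : D.IsPos r) :
    t / 2 ≤ r := by
  by_contra! hlt
  obtain ⟨e, he, he0, hT⟩ := ht.exists_eigenvector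
  -- For r < t/2 the eigenvalue t - 2r is positive, while ⟨e, opT e⟩ is minus a sum of nonnegative
  -- norms. Hence all Yᵢe are null in degree one, so zero, and e = 0.
  have h1 : D.opT r e = ((t - 2 * r : ℝ) : ℂ) • e := by
    rw [D.opT_eq r he, hT]; push_cast; module
  have h2 : (D.form r e (D.opT r e)).re = 0 := by
    refine le_antisymm ?_ ?_
    · rw [form_opT, Complex.neg_re, Complex.re_sum]
      exact neg_nonpos.2 (Finset.sum_nonneg fun i _ => hD _)
    · rw [h1, map_smul, smul_eq_mul, Complex.re_ofReal_mul]
      exact mul_nonneg (by linarith) (hD e)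
  refine he0 (D.eq_zero_of_fock_Y r he ?_ h1 (D.fock_Y_eq_zero_of_form r hr he h2))
  exact Complex.ofReal_ne_zero.2 (by linarith : 0 < t - 2 * r).ne'

/-- The eigenvalue of `opT` modulo the radical. -/
def eig (D : HermitianDatum G ι) (r : ℝ) (n : ℕ) : ℝ := -(n * r + D.s * n * (n - 1) / 2)

/-- In degree two the image of `opT 0 + s` consists of vectors g with `opT 0 g = t g`. By
`pderiv_opT` the action of Yᵢ on g at r = 0 is (t/2)∂ᵢg, and at r = t/2 the first order term of
`fock_Y` cancels it, so g lies in the radical. The radical being an ideal, the second order operator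
`opT 0` acts modulo it as -s/2 times ∑ XⱼXₖ∂ⱼ∂ₖ, which is a scalar in each degree. -/
theorem IsEigenvalue.opT_sub_mem {t : ℝ} (ht : D.IsEigenvalue t) {n : ℕ} {p : MvPolynomial ι ℂ}
    (hp : p.IsHomogeneous n) :
    D.opT (t / 2) p - ((D.eig (t / 2) n : ℝ) : ℂ) • p ∈ D.radical (t / 2) := by
  have hg : ∀ j k, D.opT 0 (MvPolynomial.X j * MvPolynomial.X k) +
      (D.s : ℂ) • (MvPolynomial.X j * MvPolynomial.X k) ∈ D.radical (t / 2) := fun j k => by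
    have hq : (MvPolynomial.X j * MvPolynomial.X k : MvPolynomial ι ℂ).IsHomogeneous 2 :=
      (MvPolynomial.isHomogeneous_X ℂ j).mul (MvPolynomial.isHomogeneous_X ℂ k)
    have h1 : (D.opT 0 (MvPolynomial.X j * MvPolynomial.X k) +
        (D.s : ℂ) • (MvPolynomial.X j * MvPolynomial.X k)).IsHomogeneous 2 :=
      (D.isHomogeneous_opT 0 hq).add ((MvPolynomial.homogeneousSubmodule ι ℂ 2).smul_mem _ hq)
    refine D.mem_radical_of_Y _ (constantCoeff_eq_zero h1) fun i => ?_
    have h2 := D.pderiv_opT h1 i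
    rw [ht.quad _ hq, Derivation.map_smul] at h2
    have h3 : D.fock 0 (D.Y i) (D.opT 0 (MvPolynomial.X j * MvPolynomial.X k) +
        (D.s : ℂ) • (MvPolynomial.X j * MvPolynomial.X k)) = (1 / 2 : ℂ) • (2 : ℂ) •
        D.fock 0 (D.Y i) (D.opT 0 (MvPolynomial.X j * MvPolynomial.X k) +
        (D.s : ℂ) • (MvPolynomial.X j * MvPolynomial.X k)) := by module
    rw [fock_Y, h3, ← h2]
    convert Submodule.zero_mem (D.radical (t / 2)) using 1
    push_cast
    module
  have h1 : D.opT (t / 2) p - ((D.eig (t / 2) n : ℝ) : ℂ) • p = (1 / 2 : ℂ) • ∑ j, ∑ k,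
      (D.opT 0 (MvPolynomial.X j * MvPolynomial.X k) +
        (D.s : ℂ) • (MvPolynomial.X j * MvPolynomial.X k)) *
          MvPolynomial.pderiv j (MvPolynomial.pderiv k p) := by
    simp only [add_mul, Finset.sum_add_distrib, smul_add, smul_mul_assoc, ← Finset.smul_sum]
    rw [← opT_zero_apply, sum_X_mul_X_pderiv hp, D.opT_eq _ hp, eig]
    push_cast
    module
  rw [h1]
  exact Submodule.smul_mem _ _ (Submodule.sum_mem _ fun j _ => Submodule.sum_mem _ fun k _ =>
    D.mul_mem_radical _ (hg j k) _)

theorem eig_neg (hr : 0 < r) {n : ℕ} (hn : n ≠ 0) : D.eig r n < 0 := by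
  have h1 : (1 : ℝ) ≤ n := by exact_mod_cast Nat.one_le_iff_ne_zero.2 hn
  have := D.s_pos
  rw [eig, neg_lt_zero]
  have h2 : 0 ≤ D.s * n * (n - 1) / 2 := by
    have : 0 ≤ (n : ℝ) - 1 := by linarith
    positivity
  have h3 : 0 < n * r := by positivity
  linarith

/-- By induction on the degree: `eig n` times ⟨p, p⟩ equals minus the sum of the norms of the Yᵢp,
and `eig n` is negative for n > 0. -/
theorem IsEigenvalue.isPos {t : ℝ} (ht : D.IsEigenvalue t) : D.IsPos (t / 2) := by
  refine D.isPos_of_homogeneous _ fun n => ?_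
  induction n with
  | zero =>
    intro p hp
    rw [← MvPolynomial.mem_homogeneousSubmodule, MvPolynomial.homogeneousSubmodule_zero] at hp
    obtain ⟨a, rfl⟩ := Submodule.mem_one.1 hp
    rw [MvPolynomial.algebraMap_eq, form_C_left, MvPolynomial.constantCoeff_C, mul_comm,
      Complex.mul_conj, Complex.ofReal_re]
    exact Complex.normSq_nonneg a
  | succ n ih =>
    intro p hp
    have h1 := ht.opT_sub_mem hp p
    rw [map_sub, map_smul, sub_eq_zero, form_opT] at h1
    have h2 := congrArg Complex.re h1
    rw [smul_eq_mul, Complex.re_ofReal_mul, Complex.neg_re, Complex.re_sum] at h2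
    have h3 := Finset.sum_nonneg (s := Finset.univ) fun i _ =>
      ih _ (D.isHomogeneous_fock_N (t / 2) (D.z_Y i) hp)
    have h4 := D.eig_neg (half_pos ht.pos) n.succ_ne_zero
    by_contra! h5
    have := mul_pos_of_neg_of_neg h4 h5
    linarith

end HermitianDatum
end HermitianLie

/-! ### Irreducibility of the homogeneous components modulo the radical -/

namespace HermitianLie
namespace HermitianDatum

variable {G ι : Type*} [LieRing G] [LieAlgebra ℂ G] [Fintype ι] [DecidableEq ι]
  {D : HermitianDatum G ι} {r : ℝ}

/-- An 𝔰𝔩₂ computation: each further factor contributes minus the eigenvalue of h on the lower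
power, and these sum to `eig`. -/
theorem fock_Y_X_pow (n : ℕ) : D.fock r (D.Y D.o) (MvPolynomial.X D.o ^ (n + 1)) =
    ((D.eig r (n + 1) : ℝ) : ℂ) • MvPolynomial.X D.o ^ n := by
  have hh : ∀ n : ℕ, D.fock r D.h (MvPolynomial.X D.o ^ n) =
      ((r + D.s * n : ℝ) : ℂ) • MvPolynomial.X D.o ^ n := fun n => by
    ext m
    rw [coeff_fock_h, MvPolynomial.coeff_smul, MvPolynomial.coeff_X_pow, smul_eq_mul]
    split_ifs with h
    · rw [← h, Finset.sum_eq_single D.o (fun i _ hi => by rw [Finsupp.single_eq_of_ne hi]; simp)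
        (by simp), Finsupp.single_eq_same, a_o]
    · simp
  have hY : ⁅D.Y D.o, D.X D.o⁆ = -D.h := by rw [h, lie_skew]
  induction n with
  | zero =>
    have h1 : D.eig r (0 + 1) = -(r + D.s * (0 : ℕ)) := by rw [eig]; push_cast; ring
    rw [pow_succ', fock_X_mul, hY, fock_neg, LinearMap.neg_apply, hh, pow_zero, fock_Y_one, h1,
      mul_zero, zero_add, Complex.ofReal_neg, neg_smul]
  | succ n ih =>
    rw [pow_succ', fock_X_mul, ih, hY, fock_neg, LinearMap.neg_apply, hh, eig, eig,
      mul_smul_comm, ← pow_succ']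
    push_cast
    module

/-- Lowering by `Y o` has nonzero coefficients, so a power in the radical would bring 1 into the
radical. -/
theorem X_pow_notMem (hr : 0 < r) (n : ℕ) : (MvPolynomial.X D.o ^ n : MvPolynomial ι ℂ) ∉
    D.radical r := by
  induction n with
  | zero => rw [pow_zero]; exact D.one_notMem_radical r
  | succ n ih =>
    intro h
    have h1 := D.fock_mem_radical r (D.Y D.o) h
    rw [fock_Y_X_pow] at h1
    exact ih ((Submodule.smul_mem_iff _
      (Complex.ofReal_ne_zero.2 (D.eig_neg hr n.succ_ne_zero).ne)).1 h1)

theorem isHomogeneous_X_pow (n : ℕ) :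
    (MvPolynomial.X D.o ^ n : MvPolynomial ι ℂ).IsHomogeneous n :=
  MvPolynomial.isHomogeneous_X_pow D.o n

/-- A stable subspace not contained in the radical contains the highest vector. -/
theorem IsEigenvalue.X_pow_mem {t : ℝ} (ht : D.IsEigenvalue t) {n : ℕ}
    {W : Submodule ℂ (MvPolynomial ι ℂ)} (hWn : ∀ p ∈ W, p.IsHomogeneous n)
    (hW : ∀ w, ⁅D.z, w⁆ = 0 → ∀ p ∈ W, D.fock (t / 2) w p ∈ W)
    (hR : ¬ W ≤ D.radical (t / 2)) : MvPolynomial.X D.o ^ n ∈ W := by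
  set r := t / 2 with hr
  obtain ⟨d, hd, w, hwW, hwR, hwd, hwp⟩ := D.exists_top r hWn hW hR
  have hwn := hWn w hwW
  -- At the maximal level w is a multiple of the highest power. Below it, w is shown to lie in the
  -- radical, contrary to its choice.
  by_cases hdn : d = 2 * n
  · obtain ⟨a, rfl⟩ := IsLevel.eq_of_top (hdn ▸ hwd) hwn
    have ha : a ≠ 0 := fun h0 => hwR (by rw [h0, zero_smul]; exact Submodule.zero_mem _)
    exact (Submodule.smul_mem_iff _ ha).1 hwW
  exfalso
  apply hwR
  obtain ⟨n, rfl⟩ : ∃ m, n = m + 1 := by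
    refine Nat.exists_eq_succ_of_ne_zero fun h0 => hwR ?_
    subst h0
    have h1 : d ≤ -1 := by push_cast at hd hdn; omega
    have h2 : w = 0 := by
      by_contra hw0
      obtain ⟨m, hm⟩ := MvPolynomial.ne_zero_iff.1 hw0
      have h3 := hwd.sum_eq hm
      have h4 : (0 : ℤ) ≤ ∑ i, (D.lv i : ℤ) * (m i : ℤ) :=
        Finset.sum_nonneg fun i _ => by positivity
      omega
    rw [h2]; exact Submodule.zero_mem _
  have hopT : ∀ {n : ℕ} {p : MvPolynomial ι ℂ}, p.IsHomogeneous n →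
      D.opT r p - ((D.eig r n : ℝ) : ℂ) • p ∈ D.radical r := fun hp => ht.opT_sub_mem hp
  have hR' : ∀ x, ∀ p ∈ D.radical r, D.fock r x p ∈ D.radical r :=
    fun x p hp => D.fock_mem_radical r x hp
  set u := D.fock r (D.Y D.o) w with hu
  have hun : u.IsHomogeneous n := D.isHomogeneous_fock_N r (D.z_Y _) hwn
  have hud : D.IsLevel (d + -2) u := hwd.Y_o r
  -- Below the maximal level the lowered vector u has norm at most zero. Compare `fock_Y_opT` with
  -- the scalars of `opT` in the degrees of w and u: (s/2)(2(n+1) - d) times the norm of u equals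
  -- -(s/2) times the sum of the norms of the `Wp i` u. Here n + 1 is the degree of w.
  have huR : u ∈ D.radical r := by
    refine (ht.isPos).mem_radical_of_nonpos ?_
    have h1 := D.fock_Y_opT r w
    have h2 := D.fock_mem_radical r (D.Y D.o) (hopT hwn)
    rw [map_sub, map_smul, h1, ← hu, hud.fock_h r] at h2
    have h3 : ∑ i ∈ D.half, D.fock r (D.Wm i) (D.fock r (D.Y D.o) (D.fock r (D.Wp i) w)) ∈
        D.radical r := Submodule.sum_mem _ fun i hi => hR' _ _ (hR' _ _ (hwp i hi))
    have h4 := hopT hun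
    have h5 := (D.radical r).sub_mem ((D.radical r).sub_mem h2 h3) h4
    have h6 := h5 u
    have h7 : ∀ i, D.form r u (D.fock r (D.Wm i) (D.fock r (D.Wp i) u)) =
        -((D.s / 2 : ℝ) : ℂ) * D.form r (D.fock r (D.Wp i) u) (D.fock r (D.Wp i) u) := fun i => by
      have h8 := D.form_fock r (D.τ (D.Wm i)) u (D.fock r (D.Wp i) u)
      rw [D.τ_τ, tau_Wm, fock_smul, LinearMap.smul_apply, LinearMap.map_smulₛₗ,
        LinearMap.smul_apply, smul_eq_mul, map_div₀, Complex.conj_ofReal, Complex.conj_ofNat] at h8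
      rw [← neg_inj, ← h8]
      push_cast
      ring
    have h9 : ((D.s / 2 * (2 * (n + 1) - d) : ℝ) : ℂ) * D.form r u u =
        -((D.s / 2 : ℝ) : ℂ) * ∑ i ∈ D.half, D.form r (D.fock r (D.Wp i) u)
          (D.fock r (D.Wp i) u) := by
      rw [Finset.mul_sum, ← Finset.sum_congr rfl fun i _ => h7 i, ← map_sum]
      simp only [map_sub, map_add, map_smul, smul_eq_mul] at h6
      rw [← sub_eq_zero, ← h6, eig, eig]
      push_cast
      ring
    have h10 := congrArg Complex.re h9
    rw [Complex.re_ofReal_mul, ← Complex.ofReal_neg, Complex.re_ofReal_mul, Complex.re_sum] at h10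
    have h11 : 0 ≤ ∑ i ∈ D.half, (D.form r (D.fock r (D.Wp i) u) (D.fock r (D.Wp i) u)).re :=
      Finset.sum_nonneg fun i _ => ht.isPos _
    have hs := D.s_pos
    have h12 : (0 : ℝ) < 2 * (n + 1) - d := by
      have : (0 : ℤ) < 2 * (n + 1) - d := by push_cast at hd hdn; omega
      exact_mod_cast this
    by_contra! h13
    have h14 := mul_pos (mul_pos (half_pos hs) h12) h13
    have h15 := mul_nonneg (half_pos hs).le h11
    linarith
  exact D.mem_radical_of_Y r (constantCoeff_eq_zero hwn) (D.fock_Y_mem r hR' huR hwp)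

/-- The highest vector generates the homogeneous component modulo the radical. -/
theorem IsEigenvalue.exists_sub_mem {t : ℝ} (ht : D.IsEigenvalue t) {n : ℕ}
    {W : Submodule ℂ (MvPolynomial ι ℂ)} (hWn : ∀ p ∈ W, p.IsHomogeneous n)
    (hW : ∀ w, ⁅D.z, w⁆ = 0 → ∀ p ∈ W, D.fock (t / 2) w p ∈ W)
    (hX : MvPolynomial.X D.o ^ n ∈ W) {p : MvPolynomial ι ℂ} (hp : p.IsHomogeneous n) :
    ∃ w ∈ W, p - w ∈ D.radical (t / 2) := by
  haveI : FiniteDimensional ℂ (MvPolynomial.homogeneousSubmodule ι ℂ n) :=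
    Module.Finite.iff_fg.2 (MvPolynomial.homogeneousSubmodule_fg ι ℂ n)
  have hle : W ≤ MvPolynomial.homogeneousSubmodule ι ℂ n := hWn
  obtain ⟨w, hw, hwo⟩ := ht.isPos.exists_orthogonal
    (Module.Finite.iff_fg.1 (Submodule.finiteDimensional_of_le hle)) p
  refine ⟨w, hw, ?_⟩
  -- The orthogonal complement of W in degree n is stable. If it were not in the radical, it would
  -- contain the highest power, which also lies in W; this power would be null and hence in the
  -- radical.
  let C : Submodule ℂ (MvPolynomial ι ℂ) := MvPolynomial.homogeneousSubmodule ι ℂ n ⊓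
    ⨅ v : W, LinearMap.ker (D.form (t / 2) v)
  have hC : ∀ q, q ∈ C ↔ q.IsHomogeneous n ∧ ∀ v ∈ W, D.form (t / 2) v q = 0 := fun q => by
    simp [C]
  have hpC : p - w ∈ C := (hC _).2 ⟨Submodule.sub_mem _ hp (hle hw), hwo⟩
  by_contra hpR
  have h1 := ht.X_pow_mem (W := C) (fun q hq => ((hC q).1 hq).1) (fun x hx q hq => ?_)
    (fun h => hpR (h hpC))
  · have h2 := ((hC _).1 h1).2 _ hX
    exact X_pow_notMem (half_pos ht.pos) n (ht.isPos.mem_radical (by rw [h2, Complex.zero_re]))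
  · obtain ⟨h3, h4⟩ := (hC q).1 hq
    refine (hC _).2 ⟨D.isHomogeneous_fock_K _ hx h3, fun v hv => ?_⟩
    have h5 := D.form_fock (t / 2) (D.τ x) v q
    rw [D.τ_τ, h4 _ (hW _ (D.z_τ_K hx) v hv)] at h5
    exact neg_eq_zero.1 h5.symm

/-- The elements of 𝔭₊ that map degree n into the radical form a subspace stable under the degree
zero part. If it were nonzero, it would contain `X o`, and a power of the variable `X o` would lie
in the radical. -/
theorem exists_ell_mul_notMem (hr : 0 < r) {x : G} (hx : ⁅D.z, x⁆ = x) (hx0 : x ≠ 0) (n : ℕ) :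
    ∃ p : MvPolynomial ι ℂ, p.IsHomogeneous n ∧ D.fock r x p ∉ D.radical r := by
  by_contra! h
  let U : Submodule ℂ G :=
    { carrier := {x | ⁅D.z, x⁆ = x ∧ ∀ p : MvPolynomial ι ℂ, p.IsHomogeneous n →
        D.fock r x p ∈ D.radical r}
      add_mem' := fun ha hb => ⟨by rw [lie_add, ha.1, hb.1], fun p hp => by
        rw [fock_add]; exact Submodule.add_mem _ (ha.2 p hp) (hb.2 p hp)⟩
      zero_mem' := ⟨lie_zero _, fun p _ => by rw [fock_zero]; exact Submodule.zero_mem _⟩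
      smul_mem' := fun c a ha => ⟨by rw [lie_smul, ha.1], fun p hp => by
        rw [fock_smul]; exact Submodule.smul_mem _ _ (ha.2 p hp)⟩ }
  have h1 : D.X D.o ∈ U := by
    refine D.mem_of_irred (U := U) (fun y hy => hy.1) (fun w y hw hy => ⟨D.z_KP hw hy.1, ?_⟩)
      (fun h0 => hx0 ((Submodule.mem_bot ℂ).1 (h0 ▸ (⟨hx, h⟩ : x ∈ U)))) (D.z_X _)
    intro p hp
    rw [fock_lie, LinearMap.sub_apply, Module.End.mul_apply, Module.End.mul_apply]
    exact Submodule.sub_mem _ (D.fock_mem_radical r w (hy.2 p hp))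
      (hy.2 _ (D.isHomogeneous_fock_K r hw hp))
  have h2 := h1.2 _ (isHomogeneous_X_pow (D := D) n)
  rw [fock_X, ← pow_succ'] at h2
  exact X_pow_notMem hr _ h2

/-- The adjoint of `exists_ell_mul_notMem`: -τx is adjoint to x, and different degrees are
orthogonal. -/
theorem exists_lowering_notMem (hr : 0 < r) {x : G} (hx : ⁅D.z, x⁆ = x) (hx0 : x ≠ 0) (n : ℕ) :
    ∃ p : MvPolynomial ι ℂ, p.IsHomogeneous (n + 1) ∧ D.fock r (D.τ x) p ∉ D.radical r := by
  by_contra! h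
  obtain ⟨p, hp, hpR⟩ := exists_ell_mul_notMem (D := D) hr hx hx0 n
  apply hpR
  intro q
  have h1 := D.form_fock r x p (MvPolynomial.homogeneousComponent (n + 1) q)
  rw [h _ (MvPolynomial.homogeneousComponent_isHomogeneous _ _), neg_zero] at h1
  have h2 : D.form r (D.fock r x p) q = 0 := by
    rw [← MvPolynomial.sum_homogeneousComponent q, map_sum]
    refine Finset.sum_eq_zero fun m _ => ?_
    by_cases hm : m = n + 1
    · rw [hm, h1]
    · exact D.form_pairing r (D.isHomogeneous_fock_P r hx hp)
        (MvPolynomial.homogeneousComponent_isHomogeneous _ _) (Ne.symm hm)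
  rw [form_symm, h2, map_zero]

end HermitianDatum
end HermitianLie

/-! ### Cyclic modules over enveloping algebras and multiplicity-free decompositions -/

namespace HermitianLie

section Env

variable {𝔞 : Type*} [LieRing 𝔞] [LieAlgebra ℂ 𝔞]

/-- A subspace of the enveloping algebra that contains `1` and is stable under left multiplication
by the Lie algebra is everything. -/
theorem env_induction (T : Submodule ℂ (UniversalEnvelopingAlgebra ℂ 𝔞)) (h1 : 1 ∈ T)
    (h : ∀ (x : 𝔞), ∀ u ∈ T, UniversalEnvelopingAlgebra.ι ℂ x * u ∈ T)
    (u : UniversalEnvelopingAlgebra ℂ 𝔞) : u ∈ T := by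
  have hs : Function.Surjective (UniversalEnvelopingAlgebra.mkAlgHom ℂ 𝔞) :=
    RingCon.mkₐ_surjective _
  obtain ⟨a, rfl⟩ := hs u
  have key : ∀ t ∈ T, UniversalEnvelopingAlgebra.mkAlgHom ℂ 𝔞 a * t ∈ T := by
    induction a using TensorAlgebra.induction with
    | algebraMap c =>
      intro t ht
      rw [AlgHom.commutes, ← Algebra.smul_def]
      exact T.smul_mem _ ht
    | ι x => exact fun t ht => h x t ht
    | mul a b ha hb =>
      intro t ht
      rw [map_mul, mul_assoc]
      exact ha _ (hb _ ht)
    | add a b ha hb =>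
      intro t ht
      rw [map_add, add_mul]
      exact T.add_mem (ha _ ht) (hb _ ht)
  simpa using key 1 h1

theorem exists_envLift {S : Type*} [AddCommGroup S] [Module ℂ S]
    (Φ : 𝔞 →ₗ[ℂ] Module.End ℂ S) (h : ∀ x y, Φ ⁅x, y⁆ = Φ x * Φ y - Φ y * Φ x) :
    ∃ F : UniversalEnvelopingAlgebra ℂ 𝔞 →ₐ[ℂ] Module.End ℂ S,
      ∀ x, F (UniversalEnvelopingAlgebra.ι ℂ x) = Φ x := by
  letI : LieRing (Module.End ℂ S) := LieRing.ofAssociativeRing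
  let f : 𝔞 →ₗ⁅ℂ⁆ Module.End ℂ S := { Φ with map_lie' := fun {x y} => h x y }
  exact ⟨UniversalEnvelopingAlgebra.lift ℂ f, fun x => UniversalEnvelopingAlgebra.lift_ι_apply ℂ f x⟩

/-- The class of an element of the enveloping algebra in a cyclic module. -/
def EnvQuot.mk (M : Ideal (UniversalEnvelopingAlgebra ℂ 𝔞)) :
    UniversalEnvelopingAlgebra ℂ 𝔞 →ₗ[UniversalEnvelopingAlgebra ℂ 𝔞] EnvQuot M := M.mkQ

variable {M : Ideal (UniversalEnvelopingAlgebra ℂ 𝔞)}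

theorem EnvQuot.mk_surjective : Function.Surjective (EnvQuot.mk M) := M.mkQ_surjective

theorem EnvQuot.mk_eq_zero {u : UniversalEnvelopingAlgebra ℂ 𝔞} :
    EnvQuot.mk M u = 0 ↔ u ∈ M := Submodule.Quotient.mk_eq_zero M

theorem EnvQuot.lie_mk (x : 𝔞) (u : UniversalEnvelopingAlgebra ℂ 𝔞) :
    ⁅x, EnvQuot.mk M u⁆ = EnvQuot.mk M (UniversalEnvelopingAlgebra.ι ℂ x * u) := by
  rw [EnvQuot.lie_def, ← smul_eq_mul, map_smul]

theorem EnvQuot.mk_smul (a : ℂ) (u : UniversalEnvelopingAlgebra ℂ 𝔞) :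
    EnvQuot.mk M (a • u) = a • EnvQuot.mk M u := rfl

/-- `EnvQuot.mk` as a complex linear map. -/
def EnvQuot.mkLin (M : Ideal (UniversalEnvelopingAlgebra ℂ 𝔞)) :
    UniversalEnvelopingAlgebra ℂ 𝔞 →ₗ[ℂ] EnvQuot M where
  toFun := EnvQuot.mk M
  map_add' := map_add _
  map_smul' := EnvQuot.mk_smul

/-- The sum of the generalized eigenspaces for the eigenvalues different from `a`. -/
def awayFrom {V : Type*} [AddCommGroup V] [Module ℂ V] (T : Module.End ℂ V) (a : ℂ) :
    Submodule ℂ V where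
  carrier := {v | ∃ p : Polynomial ℂ, p.eval a ≠ 0 ∧ Polynomial.aeval T p v = 0}
  add_mem' := by
    rintro v w ⟨p, hp, hv⟩ ⟨q, hq, hw⟩
    refine ⟨p * q, by rw [Polynomial.eval_mul]; exact mul_ne_zero hp hq, ?_⟩
    rw [map_add, map_mul, Module.End.mul_apply, Module.End.mul_apply, hw, map_zero, add_zero,
      ← Module.End.mul_apply, ← map_mul, mul_comm, map_mul, Module.End.mul_apply, hv, map_zero]
  zero_mem' := ⟨1, by simp, map_zero _⟩
  smul_mem' := by
    rintro c v ⟨p, hp, hv⟩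
    exact ⟨p, hp, by rw [map_smul, hv, smul_zero]⟩

theorem mem_awayFrom_of_eigen {V : Type*} [AddCommGroup V] [Module ℂ V] {T : Module.End ℂ V}
    {a b : ℂ} {v : V} (hab : a ≠ b) (hv : T v = b • v) : v ∈ awayFrom T a :=
  ⟨Polynomial.X - Polynomial.C b, by simpa [sub_eq_zero] using hab, by
    simp [hv, Module.algebraMap_end_apply]⟩

theorem aeval_eigen {V : Type*} [AddCommGroup V] [Module ℂ V] {T : Module.End ℂ V} {a : ℂ} {v : V}
    (hv : T v = a • v) (p : Polynomial ℂ) : Polynomial.aeval T p v = p.eval a • v := by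
  induction p using Polynomial.induction_on' with
  | add p q hp hq => rw [map_add, LinearMap.add_apply, hp, hq, Polynomial.eval_add, add_smul]
  | monomial n c =>
    rw [Polynomial.aeval_monomial, Module.End.mul_apply, Polynomial.eval_monomial]
    have : ∀ n : ℕ, (T ^ n) v = a ^ n • v := fun n => by
      induction n with
      | zero => simp
      | succ n ih => rw [pow_succ', Module.End.mul_apply, ih, map_smul, hv, smul_smul, pow_succ]
    rw [this, Module.algebraMap_end_apply, smul_smul]

theorem aeval_mem {V : Type*} [AddCommGroup V] [Module ℂ V] {T : Module.End ℂ V}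
    {W : Submodule ℂ V} (hW : ∀ w ∈ W, T w ∈ W) (p : Polynomial ℂ) {w : V} (hw : w ∈ W) :
    Polynomial.aeval T p w ∈ W := by
  induction p using Polynomial.induction_on' with
  | add p q hp hq => rw [map_add, LinearMap.add_apply]; exact W.add_mem hp hq
  | monomial n c =>
    rw [Polynomial.aeval_monomial, Module.End.mul_apply, Module.algebraMap_end_apply]
    refine W.smul_mem _ ?_
    induction n with
    | zero => simpa using hw
    | succ n ih => rw [pow_succ', Module.End.mul_apply]; exact hW _ ih

theorem notMem_awayFrom {V : Type*} [AddCommGroup V] [Module ℂ V] {T : Module.End ℂ V} {a : ℂ}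
    {v : V} (hv : T v = a • v) (hv0 : v ≠ 0) : v ∉ awayFrom T a := by
  rintro ⟨p, hp, h⟩
  rw [aeval_eigen hv] at h
  exact (smul_ne_zero hp hv0) h

/-- Write an element of W as cv + e. A polynomial in T that annihilates e but does not vanish at a
maps it to a nonzero multiple of v if c ≠ 0, and v is not in W. -/
theorem le_awayFrom {V : Type*} [AddCommGroup V] [Module ℂ V] {T : Module.End ℂ V} {a : ℂ}
    {v : V} (hv : T v = a • v) (htop : ∀ w, ∃ c : ℂ, ∃ e ∈ awayFrom T a, w = c • v + e)
    {W : Submodule ℂ V} (hW : ∀ w ∈ W, T w ∈ W) (hvW : v ∉ W) : W ≤ awayFrom T a := by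
  intro w hw
  obtain ⟨c, e, ⟨p, hp, he⟩, rfl⟩ := htop w
  have h1 := aeval_mem hW p hw
  rw [map_add, map_smul, aeval_eigen hv, he, add_zero, smul_smul] at h1
  by_cases hc : c = 0
  · rw [hc, zero_smul, zero_add]; exact ⟨p, hp, he⟩
  · exact absurd ((Submodule.smul_mem_iff _ (mul_ne_zero hc hp)).1 h1) hvW

/-- Triangular structure of the cyclic module defined by a left ideal `J`: the Lie algebra is
spanned by eigenvectors of `ad H` with real eigenvalues; those with negative eigenvalue belong to
`J`, and those with eigenvalue zero are scalar modulo `J`. -/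
structure IsTriangular (J : Ideal (UniversalEnvelopingAlgebra ℂ 𝔞)) (H : 𝔞) (a : ℂ) : Prop where
  span : ∀ x : 𝔞, x ∈ Submodule.span ℂ {x | ∃ c : ℝ, ⁅H, x⁆ = (c : ℂ) • x}
  neg : ∀ (x : 𝔞) (c : ℝ), c < 0 → ⁅H, x⁆ = (c : ℂ) • x → UniversalEnvelopingAlgebra.ι ℂ x ∈ J
  zero : ∀ x : 𝔞, ⁅H, x⁆ = 0 → ∃ b : ℂ,
    UniversalEnvelopingAlgebra.ι ℂ x - algebraMap ℂ _ b ∈ J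
  self : UniversalEnvelopingAlgebra.ι ℂ H - algebraMap ℂ _ a ∈ J

variable {J : Ideal (UniversalEnvelopingAlgebra ℂ 𝔞)} {H : 𝔞} {a : ℂ}

/-- The action of `H` on the cyclic module. -/
def actH (J : Ideal (UniversalEnvelopingAlgebra ℂ 𝔞)) (H : 𝔞) : Module.End ℂ (EnvQuot J) :=
  LieModule.toEnd ℂ 𝔞 (EnvQuot J) H

namespace IsTriangular

theorem lie_one (hJ : IsTriangular J H a) : ⁅H, EnvQuot.mk J 1⁆ = a • EnvQuot.mk J 1 := by
  have := EnvQuot.mk_eq_zero.2 hJ.self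
  rw [map_sub, sub_eq_zero, Algebra.algebraMap_eq_smul_one, EnvQuot.mk_smul] at this
  rw [EnvQuot.lie_mk, mul_one, this]

/-- A substitute for the Poincaré–Birkhoff–Witt theorem: positive eigenvectors of `ad H` applied to
the generator span the module, and all vectors they produce beyond the generator have eigenvalue a +
c with c > 0. -/
theorem exists_add (hJ : IsTriangular J H a) (w : EnvQuot J) :
    ∃ c : ℂ, ∃ e ∈ awayFrom (actH J H) a, w = c • EnvQuot.mk J 1 + e := by
  let N : Submodule ℂ (EnvQuot J) := sInf {N | EnvQuot.mk J 1 ∈ N ∧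
    ∀ (x : 𝔞) (c : ℝ), 0 < c → ⁅H, x⁆ = (c : ℂ) • x → ∀ v ∈ N, ⁅x, v⁆ ∈ N}
  have hN1 : EnvQuot.mk J 1 ∈ N := by
    rw [Submodule.mem_sInf]; exact fun N hN => hN.1
  have hNx : ∀ (x : 𝔞) (c : ℝ), 0 < c → ⁅H, x⁆ = (c : ℂ) • x → ∀ v ∈ N, ⁅x, v⁆ ∈ N := by
    intro x c hc hx v hv
    rw [Submodule.mem_sInf] at hv ⊢
    exact fun N hN => hN.2 x c hc hx v (hv N hN)
  have hNind : ∀ N' : Submodule ℂ (EnvQuot J), EnvQuot.mk J 1 ∈ N' →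
      (∀ (x : 𝔞) (c : ℝ), 0 < c → ⁅H, x⁆ = (c : ℂ) • x → ∀ v ∈ N', ⁅x, v⁆ ∈ N') → N ≤ N' :=
    fun N' h1 h2 => sInf_le ⟨h1, h2⟩
  -- Elements of nonpositive eigenvalue preserve N: move them to the right past the positive ones.
  -- The commutator is again an eigenvector, of either sign, and on the generator they act by
  -- scalars.
  have step : ∀ v ∈ N, v ∈ N ∧ ∀ (x : 𝔞) (c : ℝ), c ≤ 0 → ⁅H, x⁆ = (c : ℂ) • x → ⁅x, v⁆ ∈ N := by
    let N' : Submodule ℂ (EnvQuot J) :=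
      { carrier := {v | v ∈ N ∧ ∀ (x : 𝔞) (c : ℝ), c ≤ 0 → ⁅H, x⁆ = (c : ℂ) • x → ⁅x, v⁆ ∈ N}
        add_mem' := fun hv hw => ⟨N.add_mem hv.1 hw.1, fun x c hc hx => by
          rw [lie_add]; exact N.add_mem (hv.2 x c hc hx) (hw.2 x c hc hx)⟩
        zero_mem' := ⟨N.zero_mem, fun x c _ _ => by rw [lie_zero]; exact N.zero_mem⟩
        smul_mem' := fun b v hv => ⟨N.smul_mem _ hv.1, fun x c hc hx => by
          rw [lie_smul]; exact N.smul_mem _ (hv.2 x c hc hx)⟩ }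
    refine hNind N' ⟨hN1, fun x c hc hx => ?_⟩ fun y e he hy v hv => ⟨hNx y e he hy v hv.1,
      fun x c hc hx => ?_⟩
    · rw [EnvQuot.lie_mk, mul_one]
      rcases hc.lt_or_eq with hc | hc
      · rw [EnvQuot.mk_eq_zero.2 (hJ.neg x c hc hx)]; exact N.zero_mem
      · obtain ⟨b, hb⟩ := hJ.zero x (by rw [hx, hc, Complex.ofReal_zero, zero_smul])
        have := EnvQuot.mk_eq_zero.2 hb
        rw [map_sub, sub_eq_zero, Algebra.algebraMap_eq_smul_one, EnvQuot.mk_smul] at this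
        rw [this]; exact N.smul_mem _ hN1
    · rw [leibniz_lie]
      refine N.add_mem ?_ (hNx y e he hy _ (hv.2 x c hc hx))
      have hxy : ⁅H, ⁅x, y⁆⁆ = ((c + e : ℝ) : ℂ) • ⁅x, y⁆ := by
        rw [leibniz_lie, hx, hy, smul_lie, lie_smul, Complex.ofReal_add, add_smul]
      rcases le_or_gt (c + e) 0 with h | h
      · exact hv.2 _ _ h hxy
      · exact hNx _ _ h hxy _ hv.1
  have htop : ∀ v, v ∈ N := by
    have h1 : ∀ (x : 𝔞), ∀ v ∈ N, ⁅x, v⁆ ∈ N := by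
      intro x v hv
      induction hJ.span x using Submodule.span_induction with
      | mem x hx =>
        obtain ⟨c, hx⟩ := hx
        rcases le_or_gt c 0 with h | h
        · exact (step v hv).2 x c h hx
        · exact hNx x c h hx v hv
      | zero => rw [zero_lie]; exact N.zero_mem
      | add x y _ _ h1 h2 => rw [add_lie]; exact N.add_mem h1 h2
      | smul b x _ h1 => rw [smul_lie]; exact N.smul_mem _ h1
    intro v
    obtain ⟨u, rfl⟩ := EnvQuot.mk_surjective v
    have h2 := env_induction (N.comap (EnvQuot.mkLin J)) hN1 (fun x u hu => by
      have := h1 x _ hu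
      rwa [EnvQuot.mkLin, LinearMap.coe_mk, AddHom.coe_mk, EnvQuot.lie_mk] at this) u
    exact h2
  let E : Set (EnvQuot J) := {v | ∃ c : ℝ, 0 < c ∧ ⁅H, v⁆ = (a + c) • v}
  have hE : N ≤ Submodule.span ℂ ({EnvQuot.mk J 1} ∪ E) := by
    refine hNind _ (Submodule.subset_span (Or.inl rfl)) fun x c hc hx v hv => ?_
    induction hv using Submodule.span_induction with
    | mem v hv =>
      refine Submodule.subset_span (Or.inr ?_)
      rcases hv with rfl | ⟨e, he, hv⟩
      · refine ⟨c, hc, ?_⟩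
        rw [leibniz_lie, hx, hJ.lie_one, smul_lie, lie_smul, add_smul, add_comm]
      · refine ⟨e + c, by linarith, ?_⟩
        rw [leibniz_lie, hx, hv, smul_lie, lie_smul]
        push_cast
        module
    | zero => rw [lie_zero]; exact Submodule.zero_mem _
    | add v w _ _ h1 h2 => rw [lie_add]; exact Submodule.add_mem _ h1 h2
    | smul b v _ h1 => rw [lie_smul]; exact Submodule.smul_mem _ _ h1
  have h3 := hE (htop w)
  rw [Submodule.span_union, Submodule.mem_sup] at h3
  obtain ⟨v, hv, e, he, rfl⟩ := h3
  obtain ⟨c, rfl⟩ := Submodule.mem_span_singleton.1 hv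
  refine ⟨c, e, ?_, rfl⟩
  refine Submodule.span_le.2 ?_ he
  rintro v ⟨c, hc, hv⟩
  refine mem_awayFrom_of_eigen (b := a + c) ?_ hv
  intro h
  have : (c : ℂ) = 0 := by linear_combination -h
  exact hc.ne' (by exact_mod_cast this)

/-- A proper left ideal containing `J` lies in the sum of the eigenspaces away from the lowest. -/
theorem mk_mem_awayFrom (hJ : IsTriangular J H a) (hJM : J ≤ M) (hM : M ≠ ⊤)
    {u : UniversalEnvelopingAlgebra ℂ 𝔞} (hu : u ∈ M) :
    EnvQuot.mk J u ∈ awayFrom (actH J H) a := by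
  let W : Submodule ℂ (EnvQuot J) := (M.restrictScalars ℂ).map (EnvQuot.mkLin J)
  have hW : ∀ w ∈ W, actH J H w ∈ W := by
    rintro _ ⟨v, hv, rfl⟩
    exact ⟨UniversalEnvelopingAlgebra.ι ℂ H * v, M.mul_mem_left _ hv, (EnvQuot.lie_mk H v).symm⟩
  refine le_awayFrom (v := EnvQuot.mk J 1) hJ.lie_one hJ.exists_add hW ?_ ⟨u, hu, rfl⟩
  rintro ⟨v, hv, h1⟩
  have h2 : EnvQuot.mk J (v - 1) = 0 := by rw [map_sub]; exact sub_eq_zero.2 h1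
  have h3 := hJM (EnvQuot.mk_eq_zero.1 h2)
  refine hM ((Ideal.eq_top_iff_one M).2 ?_)
  have := M.sub_mem hv h3
  rwa [sub_sub_cancel] at this

/-- Maximal left ideals containing `J` are unique. -/
theorem eq_of_isMaximal (hJ : IsTriangular J H a) {M' : Ideal (UniversalEnvelopingAlgebra ℂ 𝔞)}
    (hM : IsIrredQuotient J M) (hM' : IsIrredQuotient J M') : M = M' := by
  have hsup : M ⊔ M' ≠ ⊤ := by
    intro h
    have h1 : (1 : UniversalEnvelopingAlgebra ℂ 𝔞) ∈ M ⊔ M' := h ▸ Submodule.mem_top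
    obtain ⟨x, hx, y, hy, hxy⟩ := Submodule.mem_sup.1 h1
    have h2 := Submodule.add_mem _ (hJ.mk_mem_awayFrom hM.1 hM.2.ne_top hx)
      (hJ.mk_mem_awayFrom hM'.1 hM'.2.ne_top hy)
    rw [← map_add, hxy] at h2
    refine notMem_awayFrom (T := actH J H) hJ.lie_one (fun h0 => ?_) h2
    exact hM.2.ne_top ((Ideal.eq_top_iff_one M).2 (hM.1 (EnvQuot.mk_eq_zero.1 h0)))
  rw [hM.2.eq_of_le hsup le_sup_left]
  exact (hM'.2.eq_of_le hsup le_sup_right).symm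

end IsTriangular

/-- The annihilator of a vector modulo a stable subspace, and the resulting map to the cyclic
module. -/
theorem exists_toEnvQuot {S : Type*} [AddCommGroup S] [Module ℂ S]
    (F : UniversalEnvelopingAlgebra ℂ 𝔞 →ₐ[ℂ] Module.End ℂ S) {R : Submodule ℂ S} {s : S}
    (hM : ∀ u, u ∈ M ↔ F u s ∈ R) (g : S →ₗ[ℂ] S) (hg : ∀ p, ∃ u, F u s - g p ∈ R) :
    ∃ π : S →ₗ[ℂ] EnvQuot M, ∀ p u, F u s - g p ∈ R → π p = EnvQuot.mk M u := by
  let f : UniversalEnvelopingAlgebra ℂ 𝔞 →ₗ[ℂ] S ⧸ R :=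
    R.mkQ ∘ₗ (LinearMap.applyₗ s) ∘ₗ F.toLinearMap
  have hf : ∀ u, f u = R.mkQ (F u s) := fun u => rfl
  -- A linear choice of preimages in the enveloping algebra. The choice does not matter in the
  -- quotient, since M is the kernel of `f`.
  obtain ⟨h, hh⟩ := LinearMap.exists_rightInverse_of_surjective f.rangeRestrict
    (LinearMap.range_eq_top.2 f.surjective_rangeRestrict)
  have hgr : ∀ p, (R.mkQ ∘ₗ g) p ∈ LinearMap.range f := fun p => by
    obtain ⟨u, hu⟩ := hg p
    refine ⟨u, ?_⟩
    rw [hf, LinearMap.comp_apply, ← sub_eq_zero, ← map_sub]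
    exact (Submodule.Quotient.mk_eq_zero R).2 hu
  refine ⟨EnvQuot.mkLin M ∘ₗ h ∘ₗ LinearMap.codRestrict (LinearMap.range f) (R.mkQ ∘ₗ g) hgr,
    fun p u hu => ?_⟩
  rw [LinearMap.comp_apply, LinearMap.comp_apply]
  set v := h (LinearMap.codRestrict (LinearMap.range f) (R.mkQ ∘ₗ g) hgr p) with hv
  have h1 : f v = R.mkQ (g p) := by
    have := LinearMap.congr_fun hh (LinearMap.codRestrict (LinearMap.range f) (R.mkQ ∘ₗ g) hgr p)
    exact congrArg Subtype.val this
  change EnvQuot.mk M v = EnvQuot.mk M u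
  rw [← sub_eq_zero, ← map_sub, EnvQuot.mk_eq_zero, hM, map_sub, LinearMap.sub_apply]
  have h2 : F v s - g p ∈ R := by
    rw [← Submodule.Quotient.mk_eq_zero R, Submodule.Quotient.mk_sub]
    exact sub_eq_zero.2 h1
  have := R.sub_mem h2 hu
  rwa [sub_sub_sub_cancel_right] at this

end Env

/-- Multiplicity-free decomposition: a stable subspace that meets the component `n` contains it. -/
theorem exists_of_multiplicityFree {V 𝔥 : Type*} [AddCommGroup V] [Module ℂ V] [LieRing 𝔥]
    [LieAlgebra ℂ 𝔥] (ρ : 𝔥 → V →ₗ[ℂ] V) {L : ℕ → Type*} [∀ n, AddCommGroup (L n)]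
    [∀ n, Module ℂ (L n)] [∀ n, LieRingModule 𝔥 (L n)] [∀ n, LieModule ℂ 𝔥 (L n)]
    (hirr : ∀ n, LieModule.IsIrreducible ℂ 𝔥 (L n))
    (hne : ∀ m n, m ≠ n → IsEmpty (L m ≃ₗ⁅ℂ, 𝔥⁆ L n)) (π : ∀ n, V →ₗ[ℂ] L n)
    (hπ : ∀ n x v, π n (ρ x v) = ⁅x, π n v⁆) (hfin : ∀ v, {n | π n v ≠ 0}.Finite)
    {W : Submodule ℂ V} (hW : ∀ x, ∀ w ∈ W, ρ x w ∈ W) {n : ℕ} {w : V} (hw : w ∈ W)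
    (hwn : π n w ≠ 0) (y : L n) : ∃ w' ∈ W, π n w' = y ∧ ∀ m ≠ n, π m w' = 0 := by
  classical
  let supp : V → Finset ℕ := fun v => (hfin v).toFinset
  have hsupp : ∀ v m, m ∈ supp v ↔ π m v ≠ 0 := fun v m => by simp [supp]
  -- Take w0 in W with nonzero n-th component and the fewest nonzero components. If more than one
  -- component remained, minimality would give an isomorphism between two of the L's.
  let A : Set ℕ := {k | ∃ w ∈ W, π n w ≠ 0 ∧ (supp w).card = k}
  have hA : A.Nonempty := ⟨_, w, hw, hwn, rfl⟩
  obtain ⟨w0, hw0, hw0n, hcard⟩ := Nat.find_spec hA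
  have hmin : ∀ v ∈ W, π n v ≠ 0 → (supp w0).card ≤ (supp v).card := fun v hv hvn => by
    rw [hcard]; exact Nat.find_min' hA ⟨v, hv, hvn, rfl⟩
  let WF : Submodule ℂ V := W ⊓ ⨅ m : {m // m ∉ supp w0}, LinearMap.ker (π m)
  have hWF : ∀ v, v ∈ WF ↔ v ∈ W ∧ ∀ m ∉ supp w0, π m v = 0 := fun v => by simp [WF]
  have hw0F : w0 ∈ WF := (hWF _).2 ⟨hw0, fun m hm => by rwa [hsupp, not_not] at hm⟩
  have hWFρ : ∀ x, ∀ v ∈ WF, ρ x v ∈ WF := fun x v hv => by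
    obtain ⟨h1, h2⟩ := (hWF v).1 hv
    exact (hWF _).2 ⟨hW x v h1, fun m hm => by rw [hπ, h2 m hm, lie_zero]⟩
  have hsurj : ∀ m ∈ supp w0, ∀ y : L m, ∃ v ∈ WF, π m v = y := fun m hm y => by
    let N : LieSubmodule ℂ 𝔥 (L m) := { WF.map (π m) with
      lie_mem := by
        rintro x _ ⟨v, hv, rfl⟩
        exact ⟨ρ x v, hWFρ x v hv, hπ m x v⟩ }
    have hN : N ≠ ⊥ := fun h => by
      have h1 : π m w0 ∈ N := ⟨w0, hw0F, rfl⟩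
      rw [h, LieSubmodule.mem_bot] at h1
      exact (hsupp _ _).1 hm h1
    haveI := hirr m
    have h1 : y ∈ N := (IsSimpleOrder.eq_bot_or_eq_top N).resolve_left hN ▸ LieSubmodule.mem_top y
    exact h1
  by_cases hsing : ∀ m ∈ supp w0, m = n
  · obtain ⟨v, hv, hvy⟩ := hsurj n ((hsupp _ _).2 hw0n) y
    obtain ⟨h1, h2⟩ := (hWF v).1 hv
    exact ⟨v, h1, hvy, fun m hm => h2 m fun h => hm (hsing m h)⟩
  exfalso
  push Not at hsing
  obtain ⟨m, hm, hmn⟩ := hsing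
  -- A vector with m-th component zero and n-th component nonzero would have smaller support than
  -- w0. Hence the m-th component determines the n-th, and WF projects to the graph of an
  -- equivariant map from L m to L n.
  have hker : ∀ v ∈ WF, π m v = 0 → π n v = 0 := fun v hv hmv => by
    by_contra hvn
    obtain ⟨h1, h2⟩ := (hWF v).1 hv
    have h3 := hmin v h1 hvn
    have h4 : supp v ⊂ supp w0 := by
      refine ⟨fun k hk => ?_, fun h => ?_⟩
      · by_contra hk'
        exact (hsupp _ _).1 hk (h2 k hk')
      · exact (hsupp _ _).1 (h hm) hmv
    exact absurd (Finset.card_lt_card h4) (not_lt.2 h3)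
  choose s hsW hsπ using hsurj m hm
  have hwd : ∀ v ∈ WF, π n (s (π m v)) = π n v := fun v hv => by
    rw [← sub_eq_zero, ← map_sub]
    exact hker _ (WF.sub_mem (hsW _) hv) (by rw [map_sub, hsπ, sub_self])
  let f : L m →ₗ⁅ℂ, 𝔥⁆ L n :=
    { toFun := fun y => π n (s y)
      map_add' := fun y y' => by
        rw [← map_add, ← hwd _ (WF.add_mem (hsW y) (hsW y')), map_add, hsπ, hsπ]
      map_smul' := fun c y => by
        rw [RingHom.id_apply, ← map_smul, ← hwd _ (WF.smul_mem c (hsW y)), map_smul, hsπ]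
      map_lie' := fun {x y} => by
        change π n (s ⁅x, y⁆) = ⁅x, π n (s y)⁆
        rw [← hπ, ← hwd _ (hWFρ x _ (hsW y)), hπ, hsπ] }
  have hf : ∀ y, f y = π n (s y) := fun _ => rfl
  have hfs : Function.Surjective f := fun y => by
    obtain ⟨v, hv, rfl⟩ := hsurj n ((hsupp _ _).2 hw0n) y
    exact ⟨π m v, hwd v hv⟩
  have hfi : Function.Injective f := by
    haveI := hirr m
    rw [← LieModuleHom.ker_eq_bot]
    by_contra hk
    have h1 := (IsSimpleOrder.eq_bot_or_eq_top f.ker).resolve_left hk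
    have h2 : π m w0 ∈ f.ker := h1 ▸ LieSubmodule.mem_top _
    rw [LieModuleHom.mem_ker, hf, hwd w0 hw0F] at h2
    exact hw0n h2
  exact (hne m n hmn).false
    { f with
      invFun := Function.surjInv hfs
      left_inv := Function.leftInverse_surjInv ⟨hfi, hfs⟩
      right_inv := Function.rightInverse_surjInv hfs }

end HermitianLie

/-! ### The irreducible quotient as the Fock model modulo the radical -/

namespace HermitianLie

theorem map_aeval_eq {V W : Type*} [AddCommGroup V] [Module ℂ V] [AddCommGroup W] [Module ℂ W]
    {T : Module.End ℂ V} {T' : Module.End ℂ W} (f : V →ₗ[ℂ] W) (h : ∀ v, f (T v) = T' (f v))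
    (p : Polynomial ℂ) (v : V) : f (Polynomial.aeval T p v) = Polynomial.aeval T' p (f v) := by
  induction p using Polynomial.induction_on' with
  | add p q hp hq => simp only [map_add, LinearMap.add_apply, hp, hq]
  | monomial n c =>
    have : ∀ n : ℕ, f ((T ^ n) v) = (T' ^ n) (f v) := fun n => by
      induction n with
      | zero => simp
      | succ n ih => rw [pow_succ', pow_succ', Module.End.mul_apply, h, ih, Module.End.mul_apply]
    simp only [Polynomial.aeval_monomial, Module.End.mul_apply, Module.algebraMap_end_apply,
      map_smul, this]

theorem map_aeval_functional {V : Type*} [AddCommGroup V] [Module ℂ V] {T : Module.End ℂ V}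
    {a : ℂ} (f : V →ₗ[ℂ] ℂ) (h : ∀ v, f (T v) = a * f v) (p : Polynomial ℂ) (v : V) :
    f (Polynomial.aeval T p v) = p.eval a * f v := by
  have h1 := map_aeval_eq (T := T) (T' := (a • LinearMap.id : Module.End ℂ ℂ)) f
    (fun v => by rw [h]; rfl) p v
  rw [h1, aeval_eigen (a := a) rfl, smul_eq_mul]

section Env

variable {𝔞 : Type*} [LieRing 𝔞] [LieAlgebra ℂ 𝔞]
  {J : Ideal (UniversalEnvelopingAlgebra ℂ 𝔞)} {H : 𝔞} {a : ℂ}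

/-- A functional that vanishes on `J` and is equivariant for `H` vanishes away from the lowest
eigenvalue. -/
theorem functional_eq_zero_of_awayFrom (f : UniversalEnvelopingAlgebra ℂ 𝔞 →ₗ[ℂ] ℂ)
    (hJ : ∀ u ∈ J, f u = 0) (hf : ∀ u, f (UniversalEnvelopingAlgebra.ι ℂ H * u) = a * f u)
    {u : UniversalEnvelopingAlgebra ℂ 𝔞} (hu : EnvQuot.mk J u ∈ awayFrom (actH J H) a) :
    f u = 0 := by
  obtain ⟨p, hp, h⟩ := hu
  let T : Module.End ℂ (UniversalEnvelopingAlgebra ℂ 𝔞) :=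
    LinearMap.mulLeft ℂ (UniversalEnvelopingAlgebra.ι ℂ H)
  have h1 := map_aeval_eq (T := T) (T' := actH J H) (EnvQuot.mkLin J)
    (fun v => (EnvQuot.lie_mk H v).symm) p u
  have h2 := EnvQuot.mk_eq_zero.1 (h1.trans h)
  have h3 := hJ _ h2
  rw [map_aeval_functional (a := a) f hf] at h3
  exact (mul_eq_zero.1 h3).resolve_left hp

/-- The lowest eigenvalue occurs only on the generator modulo J, so an equivariant functional is
determined by its value there. -/
theorem IsTriangular.functional_eq_zero (hJ : IsTriangular J H a)
    (f : UniversalEnvelopingAlgebra ℂ 𝔞 →ₗ[ℂ] ℂ) (hfJ : ∀ u ∈ J, f u = 0)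
    (hf : ∀ u, f (UniversalEnvelopingAlgebra.ι ℂ H * u) = a * f u) (h1 : f 1 = 0)
    (u : UniversalEnvelopingAlgebra ℂ 𝔞) : f u = 0 := by
  obtain ⟨c, e, he, hu⟩ := hJ.exists_add (EnvQuot.mk J u)
  have h2 : EnvQuot.mk J (u - c • 1) = e := by
    rw [map_sub, EnvQuot.mk_smul, hu, add_sub_cancel_left]
  have h3 := functional_eq_zero_of_awayFrom f hfJ hf (u := u - c • 1) (h2 ▸ he)
  rwa [map_sub, map_smul, h1, smul_zero, sub_zero] at h3

end Env

namespace HermitianDatum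

variable {G ι : Type*} [LieRing G] [LieAlgebra ℂ G] [Fintype ι] [DecidableEq ι]
  (D : HermitianDatum G ι) (r : ℝ)

/-- The action of the enveloping algebra on the Fock model. -/
def env : UniversalEnvelopingAlgebra ℂ G →ₐ[ℂ] Module.End ℂ (MvPolynomial ι ℂ) :=
  (exists_envLift (D.fockLin r) (D.fock_lie r)).choose

theorem env_ι (x : G) : D.env r (UniversalEnvelopingAlgebra.ι ℂ x) = D.fock r x :=
  (exists_envLift (D.fockLin r) (D.fock_lie r)).choose_spec x

theorem env_ι_mul (x : G) (u : UniversalEnvelopingAlgebra ℂ G) (p : MvPolynomial ι ℂ) :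
    D.env r (UniversalEnvelopingAlgebra.ι ℂ x * u) p = D.fock r x (D.env r u p) := by
  rw [map_mul, Module.End.mul_apply, env_ι]

theorem env_one (p : MvPolynomial ι ℂ) : D.env r 1 p = p := by
  rw [map_one (D.env r)]; rfl

theorem exists_env_one (p : MvPolynomial ι ℂ) : ∃ u, D.env r u 1 = p := by
  induction p using MvPolynomial.induction_on with
  | C a => exact ⟨algebraMap ℂ _ a, by
      rw [AlgHom.commutes, Module.algebraMap_end_apply, MvPolynomial.smul_eq_C_mul, mul_one]⟩
  | add p q hp hq =>
    obtain ⟨u, rfl⟩ := hp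
    obtain ⟨v, rfl⟩ := hq
    exact ⟨u + v, by rw [map_add, LinearMap.add_apply]⟩
  | mul_X p i hp =>
    obtain ⟨u, rfl⟩ := hp
    exact ⟨UniversalEnvelopingAlgebra.ι ℂ (D.X i) * u, by rw [env_ι_mul, fock_X, mul_comm]⟩

theorem env_mem_radical (u : UniversalEnvelopingAlgebra ℂ G) {p : MvPolynomial ι ℂ}
    (hp : p ∈ D.radical r) : D.env r u p ∈ D.radical r := by
  let T : Submodule ℂ (UniversalEnvelopingAlgebra ℂ G) :=
    (D.radical r).comap (LinearMap.applyₗ p ∘ₗ (D.env r).toLinearMap)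
  refine env_induction T ?_ (fun x u hu => ?_) u
  · change D.env r 1 p ∈ D.radical r
    rwa [env_one]
  · change D.env r (UniversalEnvelopingAlgebra.ι ℂ x * u) p ∈ D.radical r
    rw [env_ι_mul]
    exact D.fock_mem_radical r x hu

/-- The annihilator of the generator modulo the radical. -/
def annIdeal : Ideal (UniversalEnvelopingAlgebra ℂ G) where
  carrier := {u | D.env r u 1 ∈ D.radical r}
  add_mem' := fun {u v} hu hv => by
    change D.env r (u + v) 1 ∈ D.radical r
    rw [map_add, LinearMap.add_apply]; exact Submodule.add_mem _ hu hv
  zero_mem' := by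
    change D.env r 0 1 ∈ D.radical r
    rw [map_zero]; exact Submodule.zero_mem _
  smul_mem' := fun u v hv => by
    change D.env r (u * v) 1 ∈ D.radical r
    rw [map_mul, Module.End.mul_apply]
    exact D.env_mem_radical r u hv

variable {D r}

theorem mem_annIdeal {u : UniversalEnvelopingAlgebra ℂ G} :
    u ∈ D.annIdeal r ↔ D.env r u 1 ∈ D.radical r := Iff.rfl

theorem constantCoeff_of_mem_radical {p : MvPolynomial ι ℂ} (hp : p ∈ D.radical r) :
    MvPolynomial.constantCoeff p = 0 := by
  rw [← D.form_one_left r]; exact hp 1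

variable (D r)

/-- The coefficient of the generator. -/
def vac : UniversalEnvelopingAlgebra ℂ G →ₗ[ℂ] ℂ :=
  D.form r 1 ∘ₗ LinearMap.applyₗ 1 ∘ₗ (D.env r).toLinearMap

theorem vac_apply (u : UniversalEnvelopingAlgebra ℂ G) :
    D.vac r u = MvPolynomial.constantCoeff (D.env r u 1) := by
  rw [← D.form_one_left r]; rfl

theorem vac_z (u : UniversalEnvelopingAlgebra ℂ G) :
    D.vac r (UniversalEnvelopingAlgebra.ι ℂ D.z * u) = (r * D.B D.z D.z) * D.vac r u := by
  rw [vac_apply, vac_apply, env_ι_mul, D.constantCoeff_fock_K r D.z_z]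

variable {D r} {J M : Ideal (UniversalEnvelopingAlgebra ℂ G)}

/-- A proper left ideal above J has no component along the generator. Its image in the polynomials
therefore has no constant terms and is stable under lowering, so it lies in the radical. -/
theorem le_annIdeal (hJ : IsTriangular J D.z (r * D.B D.z D.z)) (hJr : J ≤ D.annIdeal r)
    (hJM : J ≤ M) (hM : M ≠ ⊤) : M ≤ D.annIdeal r := by
  have h1 : ∀ u ∈ M, MvPolynomial.constantCoeff (D.env r u 1) = 0 := fun u hu => by
    rw [← vac_apply]
    exact functional_eq_zero_of_awayFrom _ (fun v hv => by
      rw [vac_apply]; exact constantCoeff_of_mem_radical (hJr hv)) (D.vac_z r)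
      (hJ.mk_mem_awayFrom hJM hM hu)
  have h2 := D.mem_radical_of_stable r ((M.restrictScalars ℂ).map
    (LinearMap.applyₗ 1 ∘ₗ (D.env r).toLinearMap)) ?_ ?_
  · exact fun u hu => h2 ⟨u, hu, rfl⟩
  · rintro i _ ⟨u, hu, rfl⟩
    exact ⟨UniversalEnvelopingAlgebra.ι ℂ (D.Y i) * u, M.mul_mem_left _ hu, D.env_ι_mul r _ _ _⟩
  · rintro _ ⟨u, hu, rfl⟩
    exact h1 u hu

theorem annIdeal_ne_top : D.annIdeal r ≠ ⊤ := fun h => by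
  have h1 := mem_annIdeal.1 ((Ideal.eq_top_iff_one _).1 h)
  rw [env_one] at h1
  exact D.one_notMem_radical r h1

theorem isIrredQuotient_annIdeal (hJ : IsTriangular J D.z (r * D.B D.z D.z))
    (hJr : J ≤ D.annIdeal r) : IsIrredQuotient J (D.annIdeal r) := by
  refine ⟨hJr, ⟨annIdeal_ne_top, fun M hM => ?_⟩⟩
  by_contra hne
  exact absurd (le_annIdeal hJ hJr (hJr.trans hM.le) hne) (not_le_of_gt hM)

theorem eq_annIdeal (hJ : IsTriangular J D.z (r * D.B D.z D.z)) (hJr : J ≤ D.annIdeal r)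
    (hM : IsIrredQuotient J M) : M = D.annIdeal r :=
  hM.2.eq_of_le annIdeal_ne_top (le_annIdeal hJ hJr hM.1 hM.2.ne_top)

/-- An invariant positive definite form on the irreducible quotient gives positivity. -/
theorem isPos_of_form (hJ : IsTriangular J D.z (r * D.B D.z D.z)) (hJr : J ≤ D.annIdeal r)
    (F : EnvQuot (D.annIdeal r) →ₗ⋆[ℂ] EnvQuot (D.annIdeal r) →ₗ[ℂ] ℂ)
    (hpos : ∀ v, v ≠ 0 → 0 < (F v v).re)
    (hsymm : ∀ v w, F w v = starRingEnd ℂ (F v w))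
    (hinv : ∀ (x : G) v w, F ⁅x, v⁆ w = -F v ⁅D.τ x, w⁆) : D.IsPos r := by
  set mk := EnvQuot.mk (D.annIdeal r) with hmk
  have h1 : mk 1 ≠ 0 := fun h => annIdeal_ne_top
    ((Ideal.eq_top_iff_one _).2 (EnvQuot.mk_eq_zero.1 h))
  set N := (F (mk 1) (mk 1)).re with hN
  have hN0 : 0 < N := hpos _ h1
  have hNF : F (mk 1) (mk 1) = N := (Complex.conj_eq_iff_re.1 (hsymm _ _).symm).symm
  have hb : starRingEnd ℂ (D.B D.z D.z) = D.B D.z D.z := by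
    rw [← D.B_τ, D.τ_z, map_neg, map_neg, LinearMap.neg_apply, neg_neg]
  have hz : ⁅D.z, mk 1⁆ = ((r : ℂ) * D.B D.z D.z) • mk 1 := by
    rw [hmk, EnvQuot.lie_mk, mul_one, ← EnvQuot.mk_smul, ← sub_eq_zero, ← map_sub,
      EnvQuot.mk_eq_zero, ← Algebra.algebraMap_eq_smul_one]
    exact hJr hJ.self
  -- Both sides vanish on J, transform by the lowest eigenvalue under z, and agree at the generator.
  have base : ∀ v, F (mk 1) (mk v) = N * D.vac r v := fun v => by
    let f : UniversalEnvelopingAlgebra ℂ G →ₗ[ℂ] ℂ :=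
      F (mk 1) ∘ₗ EnvQuot.mkLin (D.annIdeal r) - (N : ℂ) • D.vac r
    have hf : ∀ v, f v = F (mk 1) (mk v) - N * D.vac r v := fun v => rfl
    have := hJ.functional_eq_zero f (fun u hu => ?_) (fun u => ?_) ?_ v
    · rwa [hf, sub_eq_zero] at this
    · rw [hf, hmk, EnvQuot.mk_eq_zero.2 (hJr hu), map_zero, vac_apply,
        constantCoeff_of_mem_radical (hJr hu), mul_zero, sub_zero]
    · have h3 := hinv D.z (mk 1) (mk u)
      rw [hz, D.τ_z, neg_lie, map_neg, neg_neg, LinearMap.map_smulₛₗ, LinearMap.smul_apply, map_mul,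
        Complex.conj_ofReal, hb, hmk, EnvQuot.lie_mk, smul_eq_mul] at h3
      rw [hf, hf, vac_z, hmk, ← h3]
      ring
    · rw [hf, vac_apply, env_one, hNF, map_one MvPolynomial.constantCoeff, mul_one, sub_self]
  -- Moving the variables across by invariance identifies F with N times the contravariant form,
  -- where N > 0 is the norm of the generator.
  have key : ∀ p : MvPolynomial ι ℂ, ∃ u, D.env r u 1 = p ∧
      ∀ v, F (mk u) (mk v) = N * D.form r p (D.env r v 1) := by
    intro p
    induction p using MvPolynomial.induction_on with
    | C a =>
      refine ⟨a • 1, ?_, fun v => ?_⟩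
      · rw [map_smul, LinearMap.smul_apply, env_one,
          MvPolynomial.smul_eq_C_mul, mul_one]
      · rw [hmk, EnvQuot.mk_smul, LinearMap.map_smulₛₗ, LinearMap.smul_apply, ← hmk, base,
          form_C_left, vac_apply, smul_eq_mul]
        ring
    | add p q hp hq =>
      obtain ⟨u, hu, h2⟩ := hp
      obtain ⟨u', hu', h2'⟩ := hq
      refine ⟨u + u', by rw [map_add, LinearMap.add_apply, hu, hu'], fun v => ?_⟩
      rw [map_add, map_add, LinearMap.add_apply, h2, h2', map_add, LinearMap.add_apply]
      ring
    | mul_X p i hp =>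
      obtain ⟨u, hu, h2⟩ := hp
      refine ⟨UniversalEnvelopingAlgebra.ι ℂ (D.X i) * u, by
        rw [env_ι_mul, hu, fock_X, mul_comm], fun v => ?_⟩
      rw [hmk, ← EnvQuot.lie_mk, hinv, EnvQuot.lie_mk, ← hmk, h2, env_ι_mul, tau_X, mul_comm p,
        form_X_mul]
      ring
  intro p
  obtain ⟨u, hu, h2⟩ := key p
  have h3 : 0 ≤ (F (mk u) (mk u)).re := by
    by_cases h0 : mk u = 0
    · rw [h0, map_zero]; simp
    · exact (hpos _ h0).le
  rw [h2, hu, Complex.re_ofReal_mul] at h3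
  exact nonneg_of_mul_nonneg_right h3 hN0

/-- The irreducible quotient carries an invariant positive definite form if the contravariant form
is semidefinite. -/
theorem exists_form (hD : D.IsPos r) :
    ∃ F : EnvQuot (D.annIdeal r) →ₗ⋆[ℂ] EnvQuot (D.annIdeal r) →ₗ[ℂ] ℂ,
      (∀ v w, F w v = starRingEnd ℂ (F v w)) ∧ (∀ v, v ≠ 0 → 0 < (F v v).re) ∧
      ∀ (x : G) v w, F ⁅x, v⁆ w = -F v ⁅D.τ x, w⁆ := by
  -- The contravariant form is transported through a linear section. The section is equivariant only
  -- up to the radical, which the form does not see.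
  obtain ⟨s, hs⟩ := LinearMap.exists_rightInverse_of_surjective (EnvQuot.mkLin (D.annIdeal r))
    (LinearMap.range_eq_top.2 EnvQuot.mk_surjective)
  have hs' : ∀ v, EnvQuot.mk (D.annIdeal r) (s v) = v := fun v => LinearMap.congr_fun hs v
  let η : EnvQuot (D.annIdeal r) →ₗ[ℂ] MvPolynomial ι ℂ :=
    LinearMap.applyₗ 1 ∘ₗ (D.env r).toLinearMap ∘ₗ s
  have hη : ∀ v, η v = D.env r (s v) 1 := fun _ => rfl
  have hlie : ∀ (x : G) v, η ⁅x, v⁆ - D.fock r x (η v) ∈ D.radical r := fun x v => by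
    rw [hη, hη, ← env_ι_mul, ← LinearMap.sub_apply, ← map_sub, ← mem_annIdeal,
      ← EnvQuot.mk_eq_zero, map_sub, hs', ← EnvQuot.lie_mk, hs', sub_self]
  have hrad : ∀ v, η v ∈ D.radical r → v = 0 := fun v hv => by
    rw [← hs' v]; exact EnvQuot.mk_eq_zero.2 hv
  refine ⟨LinearMap.mk₂'ₛₗ (starRingEnd ℂ) (RingHom.id ℂ) (fun v w => D.form r (η v) (η w))
    (fun v v' w => by rw [map_add, map_add, LinearMap.add_apply])
    (fun a v w => by rw [map_smul, LinearMap.map_smulₛₗ, LinearMap.smul_apply])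
    (fun v w w' => by rw [map_add, map_add])
    (fun a v w => by rw [map_smul, map_smul, RingHom.id_apply]), fun v w => ?_, fun v hv => ?_,
    fun x v w => ?_⟩
  · exact D.form_symm r _ _
  · exact lt_of_le_of_ne (hD (η v)) fun h => hv (hrad v (hD.mem_radical h.symm))
  · change D.form r (η ⁅x, v⁆) (η w) = -D.form r (η v) (η ⁅D.τ x, w⁆)
    have h1 := D.form_radical_left r (hlie x v) (η w)
    have h2 := hlie (D.τ x) w (η v)
    rw [map_sub, LinearMap.sub_apply, sub_eq_zero] at h1
    rw [map_sub, sub_eq_zero] at h2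
    rw [h1, h2, form_fock]

end HermitianDatum
end HermitianLie

/-! ### The 𝔨-types of the model and the irreducibility criterion -/

namespace HermitianLie
namespace HermitianDatum

variable {G ι : Type*} [LieRing G] [LieAlgebra ℂ G] [Fintype ι] [DecidableEq ι]
  (D : HermitianDatum G ι) (r : ℝ) (K : LieSubalgebra ℂ G)

/-- The Fock representation restricted to a subalgebra. -/
def fockLinK : K →ₗ[ℂ] Module.End ℂ (MvPolynomial ι ℂ) where
  toFun x := D.fock r x
  map_add' x y := D.fock_add r x y
  map_smul' c x := D.fock_smul r c x

theorem fockLinK_lie (x y : K) : D.fockLinK r K ⁅x, y⁆ =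
    D.fockLinK r K x * D.fockLinK r K y - D.fockLinK r K y * D.fockLinK r K x :=
  D.fock_lie r x y

theorem exists_envK : ∃ F : UniversalEnvelopingAlgebra ℂ K →ₐ[ℂ] Module.End ℂ (MvPolynomial ι ℂ),
    ∀ x : K, F (UniversalEnvelopingAlgebra.ι ℂ x) = D.fockLinK r K x :=
  exists_envLift (D.fockLinK r K) (D.fockLinK_lie r K)

/-- The action of the enveloping algebra of a subalgebra on the Fock model. -/
def envK : UniversalEnvelopingAlgebra ℂ K →ₐ[ℂ] Module.End ℂ (MvPolynomial ι ℂ) :=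
  (D.exists_envK r K).choose

theorem envK_ι (x : K) : D.envK r K (UniversalEnvelopingAlgebra.ι ℂ x) = D.fock r x :=
  (D.exists_envK r K).choose_spec x

theorem envK_ι_mul (x : K) (u : UniversalEnvelopingAlgebra ℂ K) (p : MvPolynomial ι ℂ) :
    D.envK r K (UniversalEnvelopingAlgebra.ι ℂ x * u) p = D.fock r x (D.envK r K u p) := by
  rw [map_mul, Module.End.mul_apply, envK_ι]

theorem envK_one (p : MvPolynomial ι ℂ) : D.envK r K 1 p = p := by
  rw [map_one (D.envK r K)]; rfl

variable {K} in
theorem envK_mem {T : Submodule ℂ (MvPolynomial ι ℂ)}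
    (hT : ∀ x ∈ K, ∀ p ∈ T, D.fock r x p ∈ T) (u : UniversalEnvelopingAlgebra ℂ K)
    {p : MvPolynomial ι ℂ} (hp : p ∈ T) : D.envK r K u p ∈ T := by
  refine env_induction (T.comap (LinearMap.applyₗ p ∘ₗ (D.envK r K).toLinearMap)) ?_
    (fun x u hu => ?_) u
  · change D.envK r K 1 p ∈ T
    rwa [envK_one]
  · change D.envK r K (UniversalEnvelopingAlgebra.ι ℂ x * u) p ∈ T
    rw [envK_ι_mul]
    exact hT x x.2 _ hu

theorem envK_mem_radical (u : UniversalEnvelopingAlgebra ℂ K) {p : MvPolynomial ι ℂ}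
    (hp : p ∈ D.radical r) : D.envK r K u p ∈ D.radical r :=
  D.envK_mem r (fun x _ _ hq => D.fock_mem_radical r x hq) u hp

/-- The annihilator of the highest vector of degree `n` modulo the radical. -/
def annIdealK (n : ℕ) : Ideal (UniversalEnvelopingAlgebra ℂ K) where
  carrier := {u | D.envK r K u (MvPolynomial.X D.o ^ n) ∈ D.radical r}
  add_mem' := fun {u v} hu hv => by
    change D.envK r K (u + v) (MvPolynomial.X D.o ^ n) ∈ D.radical r
    rw [map_add, LinearMap.add_apply]; exact Submodule.add_mem _ hu hv
  zero_mem' := by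
    change D.envK r K 0 (MvPolynomial.X D.o ^ n) ∈ D.radical r
    rw [map_zero]; exact Submodule.zero_mem _
  smul_mem' := fun u v hv => by
    change D.envK r K (u * v) (MvPolynomial.X D.o ^ n) ∈ D.radical r
    rw [map_mul, Module.End.mul_apply]
    exact D.envK_mem_radical r K u hv

variable {D r K}

theorem mem_annIdealK {n : ℕ} {u : UniversalEnvelopingAlgebra ℂ K} :
    u ∈ D.annIdealK r K n ↔ D.envK r K u (MvPolynomial.X D.o ^ n) ∈ D.radical r := Iff.rfl

theorem annIdealK_ne_top (hr : 0 < r) (n : ℕ) : D.annIdealK r K n ≠ ⊤ := fun h => by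
  have h1 := mem_annIdealK.1 ((Ideal.eq_top_iff_one _).1 h)
  rw [envK_one] at h1
  exact X_pow_notMem hr n h1

theorem isHomogeneous_envK (hK : ∀ x, x ∈ K ↔ ⁅D.z, x⁆ = 0) (u : UniversalEnvelopingAlgebra ℂ K)
    {n : ℕ} {p : MvPolynomial ι ℂ} (hp : p.IsHomogeneous n) : (D.envK r K u p).IsHomogeneous n :=
  D.envK_mem r (T := MvPolynomial.homogeneousSubmodule ι ℂ n)
    (fun x hx _ hq => D.isHomogeneous_fock_K r ((hK x).1 hx) hq) u hp

/-- The cyclic space generated by a vector under the subalgebra. -/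
def cyclic (D : HermitianDatum G ι) (r : ℝ) (K : LieSubalgebra ℂ G) (p : MvPolynomial ι ℂ) :
    Submodule ℂ (MvPolynomial ι ℂ) :=
  LinearMap.range (LinearMap.applyₗ p ∘ₗ (D.envK r K).toLinearMap)

theorem mem_cyclic {p q : MvPolynomial ι ℂ} : q ∈ D.cyclic r K p ↔ ∃ u, D.envK r K u p = q :=
  Iff.rfl

theorem fock_mem_cyclic {p q : MvPolynomial ι ℂ} {x : G} (hx : x ∈ K)
    (hq : q ∈ D.cyclic r K p) : D.fock r x q ∈ D.cyclic r K p := by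
  obtain ⟨u, rfl⟩ := hq
  exact ⟨UniversalEnvelopingAlgebra.ι ℂ ⟨x, hx⟩ * u, D.envK_ι_mul r K ⟨x, hx⟩ u p⟩

theorem self_mem_cyclic (p : MvPolynomial ι ℂ) : p ∈ D.cyclic r K p := ⟨1, D.envK_one r K p⟩

variable {t : ℝ}

/-- For u outside the annihilator, the cyclic space of u applied to the highest power is not in the
radical, so it contains the highest power itself. A left multiple of u is therefore congruent to 1.
-/
theorem isMaximal_annIdealK (ht : D.IsEigenvalue t) (hK : ∀ x, x ∈ K ↔ ⁅D.z, x⁆ = 0) (n : ℕ) :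
    (D.annIdealK (t / 2) K n).IsMaximal := by
  refine ⟨annIdealK_ne_top (half_pos ht.pos) n, fun M hM => ?_⟩
  obtain ⟨u, huM, hu⟩ := SetLike.exists_of_lt hM
  have h1 := ht.X_pow_mem (n := n) (W := D.cyclic (t / 2) K
    (D.envK (t / 2) K u (MvPolynomial.X D.o ^ n))) ?_
    (fun w hw p hp => fock_mem_cyclic ((hK w).2 hw) hp) (fun h => hu (h (self_mem_cyclic _)))
  · obtain ⟨v, hv⟩ := mem_cyclic.1 h1
    refine (Ideal.eq_top_iff_one M).2 ?_
    have h2 : v * u - 1 ∈ D.annIdealK (t / 2) K n := by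
      rw [mem_annIdealK, map_sub, LinearMap.sub_apply, map_mul, Module.End.mul_apply, hv, envK_one,
        sub_self]
      exact Submodule.zero_mem _
    have h3 := M.sub_mem (M.mul_mem_left v huM) (hM.le h2)
    rwa [sub_sub_cancel] at h3
  · rintro _ ⟨v, rfl⟩
    exact isHomogeneous_envK hK v (isHomogeneous_envK hK u (isHomogeneous_X_pow n))

/-- The projection of the Fock model to the `n`-th component of its irreducible quotient. -/
theorem exists_component (ht : D.IsEigenvalue t) (hK : ∀ x, x ∈ K ↔ ⁅D.z, x⁆ = 0) (n : ℕ) :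
    ∃ π : MvPolynomial ι ℂ →ₗ[ℂ] EnvQuot (D.annIdealK (t / 2) K n),
      (∀ p, π p = 0 ↔ MvPolynomial.homogeneousComponent n p ∈ D.radical (t / 2)) ∧
      (∀ (x : K) p, π (D.fock (t / 2) x p) = ⁅x, π p⁆) := by
  -- The highest power generates its degree modulo the radical, so every homogeneous component is
  -- represented by an element of the enveloping algebra.
  have hg : ∀ p, ∃ u, D.envK (t / 2) K u (MvPolynomial.X D.o ^ n) -
      MvPolynomial.homogeneousComponent n p ∈ D.radical (t / 2) := fun p => by
    obtain ⟨w, ⟨u, rfl⟩, h⟩ := ht.exists_sub_mem (n := n)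
      (W := D.cyclic (t / 2) K (MvPolynomial.X D.o ^ n))
      (fun _ ⟨u, hu⟩ => hu ▸ isHomogeneous_envK hK u (isHomogeneous_X_pow n))
      (fun w hw p hp => fock_mem_cyclic ((hK w).2 hw) hp) (self_mem_cyclic _)
      (MvPolynomial.homogeneousComponent_isHomogeneous n p)
    · refine ⟨u, ?_⟩
      have := Submodule.neg_mem _ h
      rwa [neg_sub] at this
  obtain ⟨π, hπ⟩ := exists_toEnvQuot (D.envK (t / 2) K) (M := D.annIdealK (t / 2) K n)
    (fun u => mem_annIdealK) (MvPolynomial.homogeneousComponent n) hg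
  refine ⟨π, fun p => ?_, fun x p => ?_⟩
  · obtain ⟨u, hu⟩ := hg p
    rw [hπ p u hu, EnvQuot.mk_eq_zero, mem_annIdealK]
    constructor
    · intro h
      have := Submodule.sub_mem _ h hu
      rwa [sub_sub_cancel] at this
    · intro h
      have := Submodule.add_mem _ hu h
      rwa [sub_add_cancel] at this
  · obtain ⟨u, hu⟩ := hg p
    rw [hπ p u hu, EnvQuot.lie_mk]
    refine hπ _ _ ?_
    have h1 : MvPolynomial.homogeneousComponent n (D.fock (t / 2) x p) =
        D.fock (t / 2) x (MvPolynomial.homogeneousComponent n p) := by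
      have hx := (hK x).1 x.2
      conv_lhs => rw [← MvPolynomial.sum_homogeneousComponent p, map_sum, map_sum]
      have h2 : ∀ m, MvPolynomial.homogeneousComponent n
          (D.fock (t / 2) x (MvPolynomial.homogeneousComponent m p)) = if m = n then
            D.fock (t / 2) x (MvPolynomial.homogeneousComponent n p) else 0 := fun m => by
        rw [MvPolynomial.homogeneousComponent_of_mem (D.isHomogeneous_fock_K _ hx
          (MvPolynomial.homogeneousComponent_isHomogeneous m p))]
        split_ifs with h3 h4 h4
        · rw [h4]
        · exact absurd h3.symm h4
        · exact absurd h4.symm h3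
        · rfl
      simp only [h2, Finset.sum_ite_eq', Finset.mem_range]
      split_ifs with h3
      · rfl
      · rw [MvPolynomial.homogeneousComponent_eq_zero _ _ (by omega), map_zero]
    rw [envK_ι_mul, h1, ← map_sub]
    exact D.fock_mem_radical _ _ hu

/-- Elements with all homogeneous components in the radical belong to the radical. -/
theorem mem_radical_of_components {p : MvPolynomial ι ℂ}
    (h : ∀ n, MvPolynomial.homogeneousComponent n p ∈ D.radical r) : p ∈ D.radical r := by
  rw [← MvPolynomial.sum_homogeneousComponent p]
  exact Submodule.sum_mem _ fun n _ => h n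

/-- The two summands land in degrees n + 1 and n - 1, so the degree separates them; in degree zero
the second summand gives zero. -/
theorem homogeneousComponent_fock_add (x y : G) (hx : ⁅D.z, x⁆ = x) (hy : ⁅D.z, y⁆ = -y) {n : ℕ}
    {p : MvPolynomial ι ℂ} (hp : p.IsHomogeneous n) :
    MvPolynomial.homogeneousComponent (n + 1) (D.fock r (x + y) p) = D.fock r x p := by
  rw [fock_add, LinearMap.add_apply, map_add,
    MvPolynomial.homogeneousComponent_of_mem (D.isHomogeneous_fock_P r hx hp), if_pos rfl]
  cases n with
  | zero => rw [D.fock_N_zero r hy hp, map_zero, add_zero]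
  | succ n =>
    rw [MvPolynomial.homogeneousComponent_of_mem (D.isHomogeneous_fock_N r hy hp),
      if_neg (by omega), add_zero]

theorem homogeneousComponent_fock_add' (x y : G) (hx : ⁅D.z, x⁆ = x) (hy : ⁅D.z, y⁆ = -y) {n : ℕ}
    {p : MvPolynomial ι ℂ} (hp : p.IsHomogeneous (n + 1)) :
    MvPolynomial.homogeneousComponent n (D.fock r (x + y) p) = D.fock r y p := by
  rw [fock_add, LinearMap.add_apply, map_add,
    MvPolynomial.homogeneousComponent_of_mem (D.isHomogeneous_fock_P r hx hp), if_neg (by omega),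
    MvPolynomial.homogeneousComponent_of_mem (D.isHomogeneous_fock_N r hy hp), if_pos rfl, zero_add]

/-- Irreducibility of the restriction to a subalgebra that contains `x + τ x`. -/
theorem isIrreducible_of_components (ht : D.IsEigenvalue t) (hK : ∀ x, x ∈ K ↔ ⁅D.z, x⁆ = 0)
    (H : LieSubalgebra ℂ G) {x : G} (hx : ⁅D.z, x⁆ = x) (hx0 : x ≠ 0) (hxH : x + D.τ x ∈ H)
    (hirr : ∀ n, LieModule.IsIrreducible ℂ (H.comap K.incl) (EnvQuot (D.annIdealK (t / 2) K n)))
    (hne : ∀ m n, m ≠ n → IsEmpty (EnvQuot (D.annIdealK (t / 2) K m) ≃ₗ⁅ℂ, H.comap K.incl⁆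
      EnvQuot (D.annIdealK (t / 2) K n))) :
    LieModule.IsIrreducible ℂ H (EnvQuot (D.annIdeal (t / 2))) := by
  have hr : 0 < t / 2 := half_pos ht.pos
  obtain ⟨ψ, hψ⟩ := exists_toEnvQuot (D.env (t / 2)) (M := D.annIdeal (t / 2))
    (fun u => mem_annIdeal) LinearMap.id (fun p => by
      obtain ⟨u, rfl⟩ := D.exists_env_one (t / 2) p
      exact ⟨u, by rw [LinearMap.id_apply, sub_self]; exact Submodule.zero_mem _⟩)
  have hψu : ∀ u, ψ (D.env (t / 2) u 1) = EnvQuot.mk _ u := fun u =>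
    hψ _ u (by rw [LinearMap.id_apply, sub_self]; exact Submodule.zero_mem _)
  have hψs : Function.Surjective ψ := fun v => by
    obtain ⟨u, rfl⟩ := EnvQuot.mk_surjective v
    exact ⟨_, hψu u⟩
  have hψ0 : ∀ p, ψ p = 0 ↔ p ∈ D.radical (t / 2) := fun p => by
    obtain ⟨u, rfl⟩ := D.exists_env_one (t / 2) p
    rw [hψu, EnvQuot.mk_eq_zero, mem_annIdeal]
  have hψx : ∀ (y : G) p, ψ (D.fock (t / 2) y p) = ⁅y, ψ p⁆ := fun y p => by
    obtain ⟨u, rfl⟩ := D.exists_env_one (t / 2) p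
    rw [hψu, EnvQuot.lie_mk, ← hψu, env_ι_mul]
  choose π hπ0 hπx using exists_component ht hK
  haveI : Nontrivial (EnvQuot (D.annIdeal (t / 2))) :=
    ⟨⟨ψ 1, 0, fun h => D.one_notMem_radical _ ((hψ0 1).1 h)⟩⟩
  refine LieModule.IsIrreducible.mk fun N hN => ?_
  -- Pulling the submodule back to polynomials makes the grading available. The pullback contains
  -- the radical, and equality of W with everything gives the claim.
  let W : Submodule ℂ (MvPolynomial ι ℂ) := N.toSubmodule.comap ψ
  have hW : ∀ p, p ∈ W ↔ ψ p ∈ N := fun p => Iff.rfl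
  have hWx : ∀ y ∈ H, ∀ p ∈ W, D.fock (t / 2) y p ∈ W := fun y hy p hp => by
    rw [hW, hψx]
    exact N.lie_mem (x := (⟨y, hy⟩ : H)) hp
  have hRW : D.radical (t / 2) ≤ W := fun p hp => by
    rw [hW, (hψ0 p).2 hp]; exact N.zero_mem
  -- Multiplicity-freeness: W contains an element with prescribed n-th component and with all other
  -- components in the radical.
  have hfull : ∀ n, ∀ w ∈ W, MvPolynomial.homogeneousComponent n w ∉ D.radical (t / 2) →
      ∀ p : MvPolynomial ι ℂ, p.IsHomogeneous n → p ∈ W := fun n w hw hwn p hp => by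
    obtain ⟨w', hw', h1, h2⟩ := exists_of_multiplicityFree (𝔥 := H.comap K.incl)
      (L := fun n => EnvQuot (D.annIdealK (t / 2) K n)) (fun y => D.fock (t / 2) (y : K)) hirr hne π
      (fun n y v => hπx n y v) (fun v => by
        refine (Finset.range (v.totalDegree + 1)).finite_toSet.subset fun m hm => ?_
        by_contra hm'
        refine hm ((hπ0 m v).2 ?_)
        rw [MvPolynomial.homogeneousComponent_eq_zero _ _ (by simpa using hm')]
        exact Submodule.zero_mem _) (W := W)
      (fun y w hw => hWx _ y.2 w hw) hw (fun h => hwn ((hπ0 n w).1 h)) (π n p)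
    have h3 : p - w' ∈ D.radical (t / 2) := mem_radical_of_components fun m => by
      rw [← hπ0, map_sub]
      by_cases hm : m = n
      · rw [hm, h1, sub_self]
      · rw [h2 m hm, sub_zero, hπ0, MvPolynomial.homogeneousComponent_of_mem hp, if_neg hm]
        exact Submodule.zero_mem _
    have h4 := W.add_mem (hRW h3) hw'
    rwa [sub_add_cancel] at h4
  -- The part of degree n + 1 of (x + τx)p comes from x alone and is outside the radical for a
  -- suitable p, so W reaches the next degree. The element τx gives the opposite direction.
  have hup : ∀ n, (∀ p : MvPolynomial ι ℂ, p.IsHomogeneous n → p ∈ W) →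
      ∀ p : MvPolynomial ι ℂ, p.IsHomogeneous (n + 1) → p ∈ W := fun n hn => by
    obtain ⟨p, hp, hpR⟩ := exists_ell_mul_notMem (D := D) hr hx hx0 n
    refine hfull (n + 1) _ (hWx _ hxH p (hn p hp)) ?_
    rwa [homogeneousComponent_fock_add x _ hx (D.z_τ_P hx) hp]
  have hdown : ∀ n, (∀ p : MvPolynomial ι ℂ, p.IsHomogeneous (n + 1) → p ∈ W) →
      ∀ p : MvPolynomial ι ℂ, p.IsHomogeneous n → p ∈ W := fun n hn => by
    obtain ⟨p, hp, hpR⟩ := exists_lowering_notMem (D := D) hr hx hx0 n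
    refine hfull n _ (hWx _ hxH p (hn p hp)) ?_
    rwa [homogeneousComponent_fock_add' x _ hx (D.z_τ_P hx) hp]
  obtain ⟨w, hw, hwR⟩ : ∃ w ∈ W, w ∉ D.radical (t / 2) := by
    by_contra! h
    refine hN ((LieSubmodule.eq_bot_iff N).2 fun v hv => ?_)
    obtain ⟨p, rfl⟩ := hψs v
    exact (hψ0 p).2 (h p hv)
  obtain ⟨n, hn⟩ : ∃ n, MvPolynomial.homogeneousComponent n w ∉ D.radical (t / 2) := by
    by_contra! h
    exact hwR (mem_radical_of_components h)
  have h0 : ∀ p : MvPolynomial ι ℂ, p.IsHomogeneous 0 → p ∈ W := by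
    have := hfull n w hw hn
    clear hn
    induction n with
    | zero => exact this
    | succ n ih => exact ih (hdown n this)
  have hall : ∀ m, ∀ p : MvPolynomial ι ℂ, p.IsHomogeneous m → p ∈ W := fun m => by
    induction m with
    | zero => exact h0
    | succ m ih => exact hup m ih
  rw [eq_top_iff]
  intro v _
  obtain ⟨p, rfl⟩ := hψs v
  rw [← hW, ← MvPolynomial.sum_homogeneousComponent p]
  exact W.sum_mem fun m _ => hall m _ (MvPolynomial.homogeneousComponent_isHomogeneous m p)

end HermitianDatum
end HermitianLie

/-! ### Complexifications, in terms of real and imaginary parts -/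

namespace HermitianLie

/-- A complex Lie algebra `G` presented as a complexification of the real Lie algebra `𝔤`, with the
complex bilinear extension `B` of the Killing form of `𝔤`. -/
structure Complexification (𝔤 G : Type*) [LieRing 𝔤] [LieAlgebra ℝ 𝔤] [LieRing G]
    [LieAlgebra ℂ G] where
  e : 𝔤 → G
  e_add : ∀ X Y, e (X + Y) = e X + e Y
  e_smul : ∀ (a : ℝ) X, e (a • X) = (a : ℂ) • e X
  e_lie : ∀ X Y, e ⁅X, Y⁆ = ⁅e X, e Y⁆
  re : G → 𝔤
  im : G → 𝔤
  re_add_im : ∀ x, e (re x) + Complex.I • e (im x) = x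
  re_e : ∀ X Y, re (e X + Complex.I • e Y) = X
  im_e : ∀ X Y, im (e X + Complex.I • e Y) = Y
  B : G →ₗ[ℂ] G →ₗ[ℂ] ℂ
  B_symm : ∀ x y, B x y = B y x
  B_inv : ∀ x y w : G, B ⁅x, y⁆ w = B x ⁅y, w⁆
  B_e : ∀ X Y, B (e X) (e Y) = (killingForm ℝ 𝔤 X Y : ℂ)

namespace Complexification

variable {𝔤 G : Type*} [LieRing 𝔤] [LieAlgebra ℝ 𝔤] [LieRing G] [LieAlgebra ℂ G]
  (C : Complexification 𝔤 G)

theorem e_zero : C.e 0 = 0 := by simpa using C.e_smul 0 0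

theorem e_neg (X : 𝔤) : C.e (-X) = -C.e X := by simpa using C.e_smul (-1) X

theorem e_sub (X Y : 𝔤) : C.e (X - Y) = C.e X - C.e Y := by
  rw [sub_eq_add_neg, C.e_add, C.e_neg, ← sub_eq_add_neg]

theorem re_eq {x : G} {X Y : 𝔤} (h : x = C.e X + Complex.I • C.e Y) : C.re x = X := by
  rw [h, C.re_e]

theorem im_eq {x : G} {X Y : 𝔤} (h : x = C.e X + Complex.I • C.e Y) : C.im x = Y := by
  rw [h, C.im_e]

theorem ext_parts {x y : G} (h : C.re x = C.re y) (h' : C.im x = C.im y) : x = y := by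
  rw [← C.re_add_im x, ← C.re_add_im y, h, h']

theorem parts_e (X : 𝔤) : C.re (C.e X) = X ∧ C.im (C.e X) = 0 := by
  have : C.e X = C.e X + Complex.I • C.e 0 := by rw [C.e_zero, smul_zero, add_zero]
  exact ⟨C.re_eq this, C.im_eq this⟩

theorem parts_zero : C.re 0 = 0 ∧ C.im 0 = 0 := by
  have := C.parts_e 0
  rwa [C.e_zero] at this

theorem e_injective : Function.Injective C.e := fun X Y h => by
  rw [← (C.parts_e X).1, h, (C.parts_e Y).1]

theorem add_aux (x y : G) : x + y = C.e (C.re x + C.re y) + Complex.I • C.e (C.im x + C.im y) := by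
  rw [C.e_add, C.e_add]
  conv_lhs => rw [← C.re_add_im x, ← C.re_add_im y]
  module

theorem re_add (x y : G) : C.re (x + y) = C.re x + C.re y := C.re_eq (C.add_aux x y)

theorem im_add (x y : G) : C.im (x + y) = C.im x + C.im y := C.im_eq (C.add_aux x y)

theorem smul_aux (c : ℂ) (x : G) : c • x = C.e (c.re • C.re x - c.im • C.im x) +
    Complex.I • C.e (c.re • C.im x + c.im • C.re x) := by
  rw [C.e_add, C.e_sub]
  simp only [C.e_smul]
  conv_lhs => rw [← C.re_add_im x, ← Complex.re_add_im c]
  match_scalars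
  · ring
  · linear_combination (c.im : ℂ) * Complex.I_mul_I

theorem re_smul (c : ℂ) (x : G) : C.re (c • x) = c.re • C.re x - c.im • C.im x :=
  C.re_eq (C.smul_aux c x)

theorem im_smul (c : ℂ) (x : G) : C.im (c • x) = c.re • C.im x + c.im • C.re x :=
  C.im_eq (C.smul_aux c x)

theorem e_lie_aux (X : 𝔤) (x : G) :
    ⁅C.e X, x⁆ = C.e ⁅X, C.re x⁆ + Complex.I • C.e ⁅X, C.im x⁆ := by
  rw [C.e_lie, C.e_lie]
  conv_lhs => rw [← C.re_add_im x, lie_add, lie_smul]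

theorem re_e_lie (X : 𝔤) (x : G) : C.re ⁅C.e X, x⁆ = ⁅X, C.re x⁆ := C.re_eq (C.e_lie_aux X x)

theorem im_e_lie (X : 𝔤) (x : G) : C.im ⁅C.e X, x⁆ = ⁅X, C.im x⁆ := C.im_eq (C.e_lie_aux X x)

/-- Complex conjugation. -/
def conj : G →ₛₗ[starRingEnd ℂ] G where
  toFun x := C.e (C.re x) + Complex.I • C.e (-C.im x)
  map_add' x y := by
    rw [C.re_add, C.im_add, neg_add, C.e_add, C.e_add]; module
  map_smul' c x := by
    rw [C.re_smul, C.im_smul, neg_add, C.e_add, C.e_sub]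
    simp only [C.e_smul, C.e_neg]
    rw [show starRingEnd ℂ c = c.re - c.im * Complex.I from Complex.ext (by simp) (by simp)]
    match_scalars
    · ring
    · linear_combination -(c.im : ℂ) * Complex.I_mul_I

theorem conj_apply (x : G) : C.conj x = C.e (C.re x) + Complex.I • C.e (-C.im x) := rfl

theorem re_conj (x : G) : C.re (C.conj x) = C.re x := C.re_eq (C.conj_apply x)

theorem im_conj (x : G) : C.im (C.conj x) = -C.im x := C.im_eq (C.conj_apply x)

theorem conj_e (X : 𝔤) : C.conj (C.e X) = C.e X := by
  rw [conj_apply, (C.parts_e X).1, (C.parts_e X).2, neg_zero, C.e_zero, smul_zero, add_zero]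

theorem conj_conj (x : G) : C.conj (C.conj x) = x :=
  C.ext_parts (by rw [re_conj, re_conj]) (by rw [im_conj, im_conj, neg_neg])

theorem add_conj (x : G) : x + C.conj x = C.e (C.re x + C.re x) := by
  rw [C.conj_apply]
  conv_lhs => rw [← C.re_add_im x]
  rw [C.re_e, C.im_e, C.e_neg, C.e_add]; module

theorem conj_e_lie (X : 𝔤) (x : G) : C.conj ⁅C.e X, x⁆ = ⁅C.e X, C.conj x⁆ :=
  C.ext_parts (by rw [re_conj, re_e_lie, re_e_lie, re_conj])
    (by rw [im_conj, im_e_lie, im_e_lie, im_conj, lie_neg])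

theorem conj_lie (x y : G) : C.conj ⁅x, y⁆ = ⁅C.conj x, C.conj y⁆ := by
  conv_lhs => rw [← C.re_add_im x, add_lie, smul_lie, map_add, LinearMap.map_smulₛₗ, conj_e_lie,
    conj_e_lie]
  rw [conj_apply C x, C.e_neg, add_lie, smul_lie, Complex.conj_I, neg_lie]; module

theorem killing_symm (X Y : 𝔤) : killingForm ℝ 𝔤 X Y = killingForm ℝ 𝔤 Y X :=
  LieModule.traceForm_comm ℝ _ _ X Y

theorem killing_lie (X Y W : 𝔤) : killingForm ℝ 𝔤 ⁅X, Y⁆ W = killingForm ℝ 𝔤 X ⁅Y, W⁆ :=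
  LieModule.traceForm_apply_lie_apply ℝ _ _ X Y W

theorem B_parts (x y : G) : C.B x y =
    ((killingForm ℝ 𝔤 (C.re x) (C.re y) - killingForm ℝ 𝔤 (C.im x) (C.im y) : ℝ) : ℂ) +
    ((killingForm ℝ 𝔤 (C.re x) (C.im y) + killingForm ℝ 𝔤 (C.im x) (C.re y) : ℝ) : ℂ) *
      Complex.I := by
  conv_lhs => rw [← C.re_add_im x, ← C.re_add_im y]
  simp only [map_add, map_smul, LinearMap.add_apply, LinearMap.smul_apply, C.B_e, smul_eq_mul]
  push_cast
  linear_combination (killingForm ℝ 𝔤 (C.im x) (C.im y) : ℂ) * Complex.I_mul_I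

theorem B_conj (x y : G) : C.B (C.conj x) (C.conj y) = starRingEnd ℂ (C.B x y) := by
  rw [B_parts, B_parts, re_conj, im_conj, re_conj, im_conj]
  apply Complex.ext <;> simp
  ring

/-- The cross terms cancel, so definiteness of the Hermitian form x ↦ B(x, x̄) reduces to that of
the real Killing form on 𝔨 and on 𝔭. -/
theorem B_self_conj (x : G) : C.B x (C.conj x) =
    ((killingForm ℝ 𝔤 (C.re x) (C.re x) + killingForm ℝ 𝔤 (C.im x) (C.im x) : ℝ) : ℂ) := by
  rw [B_parts, re_conj, im_conj, killing_symm (C.re x) (-C.im x)]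
  apply Complex.ext <;> simp

end Complexification

/-! ### The grading element z' and the Cartan decomposition -/

/-- The datum of a simple Lie algebra of Hermitian type. -/
structure HermitianType (𝔤 : Type*) [LieRing 𝔤] [LieAlgebra ℝ 𝔤] where
  θ : 𝔤 ≃ₗ⁅ℝ⁆ 𝔤
  cartan : IsCartanInvolution θ
  z : 𝔤
  herm : IsHermitianElement θ z

namespace HermitianType

variable {𝔤 G : Type*} [LieRing 𝔤] [LieAlgebra ℝ 𝔤] [LieRing G] [LieAlgebra ℂ G]
  (T : HermitianType 𝔤) (C : Complexification 𝔤 G)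

theorem θ_lie (X Y : 𝔤) : T.θ ⁅X, Y⁆ = ⁅T.θ X, T.θ Y⁆ := T.θ.toLieHom.map_lie X Y

theorem θ_z : T.θ T.z = T.z := T.herm.1

theorem z_k {X : 𝔤} (hX : T.θ X = X) : ⁅T.z, X⁆ = 0 := T.herm.2.1 X hX

theorem z_p {X : 𝔤} (hX : T.θ X = -X) : ⁅T.z, ⁅T.z, X⁆⁆ = -X := T.herm.2.2 X hX

theorem exists_decomp (X : 𝔤) : ∃ K P, X = K + P ∧ T.θ K = K ∧ T.θ P = -P := by
  refine ⟨(1 / 2 : ℝ) • (X + T.θ X), (1 / 2 : ℝ) • (X - T.θ X), by module, ?_, ?_⟩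
  · rw [map_smul, map_add, T.cartan.1]; module
  · rw [map_smul, map_sub, T.cartan.1]; module

theorem θ_z_lie (X : 𝔤) : T.θ ⁅T.z, X⁆ = -⁅T.z, X⁆ := by
  obtain ⟨K, P, rfl, hK, hP⟩ := T.exists_decomp X
  rw [lie_add, T.z_k hK, zero_add, T.θ_lie, T.θ_z, hP, lie_neg]

theorem z_cube (X : 𝔤) : ⁅T.z, ⁅T.z, ⁅T.z, X⁆⁆⁆ = -⁅T.z, X⁆ := T.z_p (T.θ_z_lie X)

/-- As `ad z` is invertible on 𝔭, the centralizer of z is 𝔨 exactly. -/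
theorem z_eq_zero {X : 𝔤} : ⁅T.z, X⁆ = 0 ↔ T.θ X = X := by
  refine ⟨fun h => ?_, T.z_k⟩
  obtain ⟨K, P, rfl, hK, hP⟩ := T.exists_decomp X
  rw [lie_add, T.z_k hK, zero_add] at h
  have h1 := T.z_p hP
  rw [h, lie_zero, eq_comm, neg_eq_zero] at h1
  rw [h1, add_zero, hK]

theorem killing_neg {X : 𝔤} (hX : T.θ X = X) (h0 : X ≠ 0) : killingForm ℝ 𝔤 X X < 0 := by
  have := T.cartan.2 X h0
  rw [hX] at this
  linarith

theorem killing_pos {X : 𝔤} (hX : T.θ X = -X) (h0 : X ≠ 0) : 0 < killingForm ℝ 𝔤 X X := by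
  have := T.cartan.2 X h0
  rwa [hX, map_neg, neg_neg] at this

/-- The element `z' = -√-1 z`. -/
def z' : G := -(Complex.I • C.e T.z)

theorem conj_z' : C.conj (T.z' C) = -T.z' C := by
  rw [z', map_neg, LinearMap.map_smulₛₗ, C.conj_e, Complex.conj_I, neg_smul]

theorem I_z' : Complex.I • T.z' C = C.e T.z := by
  rw [z', smul_neg, ← mul_smul, Complex.I_mul_I, neg_smul, one_smul, neg_neg]

theorem z'_lie (x : G) : ⁅T.z' C, x⁆ = C.e ⁅T.z, C.im x⁆ + Complex.I • C.e (-⁅T.z, C.re x⁆) := by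
  rw [z', neg_lie, smul_lie, C.e_lie_aux, C.e_neg, smul_add, ← mul_smul, Complex.I_mul_I]
  module

theorem re_z'_lie (x : G) : C.re ⁅T.z' C, x⁆ = ⁅T.z, C.im x⁆ := C.re_eq (T.z'_lie C x)

theorem im_z'_lie (x : G) : C.im ⁅T.z' C, x⁆ = -⁅T.z, C.re x⁆ := C.im_eq (T.z'_lie C x)

theorem z'_eq_zero {x : G} : ⁅T.z' C, x⁆ = 0 ↔ T.θ (C.re x) = C.re x ∧ T.θ (C.im x) = C.im x := by
  rw [← T.z_eq_zero, ← T.z_eq_zero]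
  constructor
  · intro h
    have h1 := T.re_z'_lie C x
    have h2 := T.im_z'_lie C x
    rw [h, C.parts_zero.1] at h1
    rw [h, C.parts_zero.2, eq_comm, neg_eq_zero] at h2
    exact ⟨h2, h1.symm⟩
  · rintro ⟨h1, h2⟩
    rw [T.z'_lie, h1, h2, neg_zero, C.e_zero, smul_zero, add_zero]

theorem z'_cube (x : G) : ⁅T.z' C, ⁅T.z' C, ⁅T.z' C, x⁆⁆⁆ = ⁅T.z' C, x⁆ := by
  apply C.ext_parts
  · rw [re_z'_lie, im_z'_lie, re_z'_lie, lie_neg, T.z_cube, neg_neg]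
  · rw [im_z'_lie, re_z'_lie, im_z'_lie, lie_neg, lie_neg, T.z_cube, neg_neg]

/-- Elements in the image of `ad z'` belong to the complexification of `𝔭`. -/
theorem θ_of_eigen {x : G} {s : ℂ} (hs : s ≠ 0) (hx : ⁅T.z' C, x⁆ = s • x) :
    T.θ (C.re x) = -C.re x ∧ T.θ (C.im x) = -C.im x := by
  have h : x = ⁅T.z' C, s⁻¹ • x⁆ := by rw [lie_smul, hx, smul_smul, inv_mul_cancel₀ hs, one_smul]
  rw [h, re_z'_lie, im_z'_lie, map_neg, T.θ_z_lie, T.θ_z_lie]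
  exact ⟨rfl, rfl⟩

theorem conj_P {x : G} (hx : ⁅T.z' C, x⁆ = x) : ⁅T.z' C, C.conj x⁆ = -C.conj x := by
  have := congrArg C.conj hx
  rwa [C.conj_lie, T.conj_z', neg_lie, neg_eq_iff_eq_neg] at this

theorem conj_N {x : G} (hx : ⁅T.z' C, x⁆ = -x) : ⁅T.z' C, C.conj x⁆ = C.conj x := by
  have := congrArg C.conj hx
  rwa [C.conj_lie, T.conj_z', neg_lie, map_neg, neg_inj] at this

theorem conj_K {x : G} (hx : ⁅T.z' C, x⁆ = 0) : ⁅T.z' C, C.conj x⁆ = 0 := by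
  have := congrArg C.conj hx
  rwa [C.conj_lie, T.conj_z', neg_lie, map_zero, neg_eq_zero] at this

/-- Real and imaginary parts of an element of 𝔭₊ lie in 𝔭, where the Killing form is positive. -/
theorem B_P_pos {x : G} (hx : ⁅T.z' C, x⁆ = x) (h0 : x ≠ 0) : 0 < (C.B x (C.conj x)).re := by
  obtain ⟨h1, h2⟩ := T.θ_of_eigen C one_ne_zero (hx.trans (one_smul ℂ x).symm)
  rw [C.B_self_conj, Complex.ofReal_re]
  have h3 : ∀ X : 𝔤, T.θ X = -X → 0 ≤ killingForm ℝ 𝔤 X X := fun X hX => by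
    by_cases h : X = 0
    · rw [h, map_zero]
    · exact (T.killing_pos hX h).le
  by_cases h : C.re x = 0
  · have h' : C.im x ≠ 0 := fun h' =>
      h0 (C.ext_parts (h.trans C.parts_zero.1.symm) (h'.trans C.parts_zero.2.symm))
    exact add_pos_of_nonneg_of_pos (h3 _ h1) (T.killing_pos h2 h')
  · exact add_pos_of_pos_of_nonneg (T.killing_pos h1 h) (h3 _ h2)

theorem B_K_neg {x : G} (hx : ⁅T.z' C, x⁆ = 0) (h0 : x ≠ 0) : (C.B x (C.conj x)).re < 0 := by
  obtain ⟨h1, h2⟩ := (T.z'_eq_zero C).1 hx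
  rw [C.B_self_conj, Complex.ofReal_re]
  have h3 : ∀ X : 𝔤, T.θ X = X → killingForm ℝ 𝔤 X X ≤ 0 := fun X hX => by
    by_cases h : X = 0
    · rw [h, map_zero]
    · exact (T.killing_neg hX h).le
  by_cases h : C.re x = 0
  · have h' : C.im x ≠ 0 := fun h' =>
      h0 (C.ext_parts (h.trans C.parts_zero.1.symm) (h'.trans C.parts_zero.2.symm))
    exact add_neg_of_nonpos_of_neg (h3 _ h1) (T.killing_neg h2 h')
  · exact add_neg_of_neg_of_nonpos (T.killing_neg h1 h) (h3 _ h2)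

/-- The triangular decomposition of `G` by the eigenvalues of `ad z'`. -/
theorem exists_graded (x : G) : ∃ k p n : G, x = k + p + n ∧ ⁅T.z' C, k⁆ = 0 ∧
    ⁅T.z' C, p⁆ = p ∧ ⁅T.z' C, n⁆ = -n := by
  have h := T.z'_cube C x
  -- With T = `ad z'` and T³ = T, the projections to the three eigenspaces are 1 - T², (T² + T)/2
  -- and (T² - T)/2.
  refine ⟨x - ⁅T.z' C, ⁅T.z' C, x⁆⁆, (1 / 2 : ℂ) • (⁅T.z' C, ⁅T.z' C, x⁆⁆ + ⁅T.z' C, x⁆),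
    (1 / 2 : ℂ) • (⁅T.z' C, ⁅T.z' C, x⁆⁆ - ⁅T.z' C, x⁆), by module, ?_, ?_, ?_⟩
  · rw [lie_sub, h, sub_self]
  · rw [lie_smul, lie_add, h, add_comm]
  · rw [lie_smul, lie_sub, h]; module

/-- Real elements of `𝔭` have the form `x + conj x` with `x` in the `1`-eigenspace. -/
theorem exists_P {X : 𝔤} (hX : T.θ X = -X) : ∃ x : G, ⁅T.z' C, x⁆ = x ∧ C.e X = x + C.conj x := by
  have h : ⁅T.z' C, ⁅T.z' C, C.e X⁆⁆ = C.e X := by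
    apply C.ext_parts
    · rw [re_z'_lie, im_z'_lie, (C.parts_e X).1, lie_neg, T.z_p hX, neg_neg]
    · rw [im_z'_lie, re_z'_lie, (C.parts_e X).2, lie_zero, lie_zero, neg_zero]
  have h1 : C.conj ⁅T.z' C, C.e X⁆ = -⁅T.z' C, C.e X⁆ := by
    rw [C.conj_lie, C.conj_e, T.conj_z', neg_lie]
  have h2 : (starRingEnd ℂ) (1 / 2 : ℂ) = 1 / 2 := by
    rw [map_div₀, map_one, Complex.conj_ofNat]
  refine ⟨(1 / 2 : ℂ) • (C.e X + ⁅T.z' C, C.e X⁆), ?_, ?_⟩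
  · rw [lie_smul, lie_add, h, add_comm]
  · rw [LinearMap.map_smulₛₗ, map_add, h1, C.conj_e, h2]; module

theorem θ_re_P {x : G} (hx : ⁅T.z' C, x⁆ = x) : T.θ (C.re x) = -C.re x :=
  (T.θ_of_eigen C one_ne_zero (hx.trans (one_smul ℂ x).symm)).1

end HermitianType
end HermitianLie

/-! ### Irreducibility of 𝔭₊ and the center of 𝔨 -/

namespace HermitianLie

/-- The spectral theorem for an operator that is symmetric for a positive definite form. -/
theorem exists_orthonormal_eigenbasis {V : Type*} [AddCommGroup V] [Module ℂ V]
    [FiniteDimensional ℂ V] (S : V → V → ℂ) (hadd : ∀ u v w, S (u + v) w = S u w + S v w)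
    (hsmul : ∀ (a : ℂ) v w, S (a • v) w = starRingEnd ℂ a * S v w)
    (hsymm : ∀ v w, S w v = starRingEnd ℂ (S v w)) (hpos : ∀ v, v ≠ 0 → 0 < (S v v).re)
    (T : V →ₗ[ℂ] V) (hT : ∀ v w, S (T v) w = S v (T w)) :
    ∃ (b : Module.Basis (Fin (Module.finrank ℂ V)) ℂ V) (a : Fin (Module.finrank ℂ V) → ℝ),
      (∀ i j, S (b i) (b j) = if i = j then 1 else 0) ∧ ∀ i, T (b i) = (a i : ℂ) • b i := by
  have hS0 : S 0 0 = 0 := by simpa using hsmul 0 0 0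
  let core : InnerProductSpace.Core ℂ V :=
    { inner := S
      conj_inner_symm := fun x y => (hsymm y x).symm
      re_inner_nonneg := fun x => by
        by_cases h : x = 0
        · subst h
          change 0 ≤ (S 0 0).re
          rw [hS0]; exact le_rfl
        · exact (hpos x h).le
      add_left := hadd
      smul_left := fun x y a => hsmul a x y
      definite := fun x hx => by
        by_contra h
        have := hpos x h
        change S x x = 0 at hx
        rw [hx] at this
        exact lt_irrefl _ this }
  letI : NormedAddCommGroup V := core.toNormedAddCommGroup
  letI : InnerProductSpace ℂ V := InnerProductSpace.ofCore core.toCore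
  have hT' : T.IsSymmetric := hT
  refine ⟨(hT'.eigenvectorBasis rfl).toBasis, hT'.eigenvalues rfl, fun i j => ?_, fun i => ?_⟩
  · rw [OrthonormalBasis.coe_toBasis]
    exact orthonormal_iff_ite.1 (hT'.eigenvectorBasis rfl).orthonormal i j
  · rw [OrthonormalBasis.coe_toBasis]
    exact hT'.apply_eigenvectorBasis rfl i

namespace HermitianType

variable {𝔤 G : Type*} [LieRing 𝔤] [LieAlgebra ℝ 𝔤] [LieRing G] [LieAlgebra ℂ G]
  (T : HermitianType 𝔤) (C : Complexification 𝔤 G)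

/-- A subspace without null vectors is complemented by its orthogonal. -/
theorem exists_orthogonal_decomp [FiniteDimensional ℝ 𝔤] (W : Submodule ℝ 𝔤)
    (hW : ∀ X ∈ W, killingForm ℝ 𝔤 X X = 0 → X = 0) (X : 𝔤) :
    ∃ Y ∈ W, ∃ Y', X = Y + Y' ∧ ∀ U ∈ W, killingForm ℝ 𝔤 U Y' = 0 := by
  have hr : LinearMap.BilinForm.IsRefl (killingForm ℝ 𝔤) :=
    (LieModule.traceForm_isSymm ℝ 𝔤 𝔤).isRefl
  have h := (LinearMap.BilinForm.isCompl_orthogonal_iff_disjoint hr (W := W)).2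
    (Submodule.disjoint_def.2 fun X hX hX' => hW X hX (hX' X hX))
  obtain ⟨Y, hY, Y', hY', e⟩ := Submodule.mem_sup.1 (h.sup_eq_top ▸ Submodule.mem_top (x := X))
  exact ⟨Y, hY, Y', e.symm, fun U hU => hY' U hU⟩

/-- The `1`-eigenspace of `ad z'`. -/
def P : Submodule ℂ G where
  carrier := {x | ⁅T.z' C, x⁆ = x}
  add_mem' := fun {x y} hx hy => by
    change ⁅_, _⁆ = _ at hx hy ⊢
    rw [lie_add, hx, hy]
  zero_mem' := lie_zero _
  smul_mem' := fun c x hx => by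
    change ⁅_, _⁆ = _ at hx ⊢
    rw [lie_smul, hx]

theorem mem_P {x : G} : x ∈ T.P C ↔ ⁅T.z' C, x⁆ = x := Iff.rfl

variable [FiniteDimensional ℝ 𝔤] [LieAlgebra.IsSimple ℝ 𝔤]

/-- Simplicity makes 𝔭 irreducible under 𝔨: q + [q, q] is an ideal, and θ separates its two
summands. For the ideal property, let b ∈ 𝔭 be orthogonal to q. For A ∈ q, the bracket ⁅b, A⁆ lies
in 𝔨 and has Killing norm zero by invariance, so b commutes with q and with [q, q]. -/
theorem mem_of_stable (q : Submodule ℝ 𝔤) (hq : ∀ X ∈ q, T.θ X = -X)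
    (hk : ∀ K, T.θ K = K → ∀ X ∈ q, ⁅K, X⁆ ∈ q) (h0 : q ≠ ⊥) {X : 𝔤} (hX : T.θ X = -X) :
    X ∈ q := by
  let d : Submodule ℝ 𝔤 := Submodule.span ℝ {W | ∃ A ∈ q, ∃ A' ∈ q, ⁅A, A'⁆ = W}
  have hd : ∀ A ∈ q, ∀ A' ∈ q, ⁅A, A'⁆ ∈ d := fun A hA A' hA' =>
    Submodule.subset_span ⟨A, hA, A', hA', rfl⟩
  have hdk : ∀ D ∈ d, T.θ D = D := fun D hD => by
    induction hD using Submodule.span_induction with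
    | mem D h =>
      obtain ⟨A, hA, A', hA', rfl⟩ := h
      rw [T.θ_lie, hq A hA, hq A' hA', neg_lie, lie_neg, neg_neg]
    | zero => exact map_zero _
    | add D D' _ _ h h' => rw [map_add, h, h']
    | smul a D _ h => rw [map_smul, h]
  have horth : ∀ b, T.θ b = -b → (∀ U ∈ q, killingForm ℝ 𝔤 U b = 0) → ∀ A ∈ q, ⁅b, A⁆ = 0 :=
    fun b hb hbq A hA => by
      by_contra h
      have hK : T.θ ⁅b, A⁆ = ⁅b, A⁆ := by rw [T.θ_lie, hb, hq A hA, neg_lie, lie_neg, neg_neg]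
      have h1 := T.killing_neg hK h
      rw [Complexification.killing_lie, ← lie_skew, map_neg, Complexification.killing_symm,
        hbq _ (hk _ hK A hA), neg_zero] at h1
      exact lt_irrefl _ h1
  have hbd : ∀ b : 𝔤, (∀ A ∈ q, ⁅b, A⁆ = 0) → ∀ D ∈ d, ⁅b, D⁆ = 0 := fun b hb D hD => by
    induction hD using Submodule.span_induction with
    | mem D h =>
      obtain ⟨A, hA, A', hA', rfl⟩ := h
      rw [leibniz_lie, hb A hA, hb A' hA', zero_lie, lie_zero, add_zero]
    | zero => exact lie_zero _
    | add D D' _ _ h h' => rw [lie_add, h, h', add_zero]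
    | smul a D _ h => rw [lie_smul, h, smul_zero]
  have hkd : ∀ K, T.θ K = K → ∀ D ∈ d, ⁅K, D⁆ ∈ d := fun K hK D hD => by
    induction hD using Submodule.span_induction with
    | mem D h =>
      obtain ⟨A, hA, A', hA', rfl⟩ := h
      rw [leibniz_lie]
      exact d.add_mem (hd _ (hk K hK A hA) _ hA') (hd _ hA _ (hk K hK A' hA'))
    | zero => rw [lie_zero]; exact d.zero_mem
    | add D D' _ _ h h' => rw [lie_add]; exact d.add_mem h h'
    | smul a D _ h => rw [lie_smul]; exact d.smul_mem _ h
  have hstab : ∀ Y, ∀ W ∈ q ⊔ d, ⁅Y, W⁆ ∈ q ⊔ d := fun Y W hW => by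
    obtain ⟨A, hA, D, hD, rfl⟩ := Submodule.mem_sup.1 hW
    obtain ⟨K, P, rfl, hK, hP⟩ := T.exists_decomp Y
    obtain ⟨a, ha, b, rfl, hb⟩ := exists_orthogonal_decomp q (fun X hX h => by
      by_contra h'
      exact (T.killing_pos (hq X hX) h').ne' h) P
    have hb' : T.θ b = -b := by
      rw [map_add, hq a ha, neg_add] at hP
      exact add_left_cancel hP
    have h1 := horth b hb' hb
    rw [add_lie, lie_add, add_lie, lie_add, lie_add, h1 A hA, hbd b h1 D hD, add_zero, add_zero]
    refine Submodule.add_mem _ (Submodule.add_mem _ (Submodule.mem_sup_left (hk K hK A hA))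
      (Submodule.mem_sup_right (hkd K hK D hD))) (Submodule.add_mem _
      (Submodule.mem_sup_right (hd a ha A hA)) (Submodule.mem_sup_left ?_))
    rw [← lie_skew]
    exact q.neg_mem (hk D (hdk D hD) a ha)
  let I : LieIdeal ℝ 𝔤 := { q ⊔ d with lie_mem := fun {Y W} hW => hstab Y W hW }
  have hI : I = ⊤ := by
    refine (LieAlgebra.IsSimple.eq_bot_or_eq_top I).resolve_left fun h => h0 ?_
    refine (Submodule.eq_bot_iff q).2 fun A hA => ?_
    have : A ∈ I := show A ∈ q ⊔ d from Submodule.mem_sup_left hA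
    rwa [h, LieSubmodule.mem_bot] at this
  have hXI : X ∈ I := hI ▸ LieSubmodule.mem_top X
  obtain ⟨A, hA, D, hD, rfl⟩ := Submodule.mem_sup.1 (show X ∈ q ⊔ d from hXI)
  rw [map_add, hq A hA, hdk D hD, neg_add] at hX
  have h2 : D = -D := add_left_cancel hX
  have h3 : D = 0 := by
    have : (2 : ℝ) • D = 0 := by
      rw [two_smul]
      nth_rewrite 2 [h2]
      exact add_neg_cancel D
    exact (smul_eq_zero.1 this).resolve_left two_ne_zero
  rwa [h3, add_zero]

theorem eq_of_add_conj {x u : G} (hx : ⁅T.z' C, x⁆ = x) (hu : ⁅T.z' C, u⁆ = u)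
    (h : x + C.conj x = u + C.conj u) : x = u := by
  have h1 := congrArg (fun y => ⁅T.z' C, y⁆) h
  simp only [lie_add, hx, hu, T.conj_P C hx, T.conj_P C hu] at h1
  have h2 : (2 : ℂ) • x = (2 : ℂ) • u := by
    have h3 := congrArg₂ (· + ·) h h1
    calc (2 : ℂ) • x = x + C.conj x + (x + -C.conj x) := by module
      _ = u + C.conj u + (u + -C.conj u) := h3
      _ = (2 : ℂ) • u := by module
  exact smul_right_injective G (two_ne_zero' ℂ) h2

/-- The `1`-eigenspace of `ad z'` is irreducible under the centralizer of `z'`. -/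
theorem P_irred (U : Submodule ℂ G) (hU : ∀ u ∈ U, ⁅T.z' C, u⁆ = u)
    (hK : ∀ w : G, ⁅T.z' C, w⁆ = 0 → ∀ u ∈ U, ⁅w, u⁆ ∈ U) (h0 : U ≠ ⊥) {x : G}
    (hx : ⁅T.z' C, x⁆ = x) : x ∈ U := by
  -- The real points u + ū with u ∈ U. This transfers U to a subspace of 𝔭 stable under 𝔨.
  let q : Submodule ℝ 𝔤 :=
    { carrier := {X | ∃ u ∈ U, C.e X = u + C.conj u}
      add_mem' := by
        rintro X Y ⟨u, hu, h⟩ ⟨v, hv, h'⟩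
        refine ⟨u + v, U.add_mem hu hv, ?_⟩
        rw [C.e_add, h, h', map_add]; abel
      zero_mem' := ⟨0, U.zero_mem, by rw [C.e_zero, map_zero, add_zero]⟩
      smul_mem' := by
        rintro a X ⟨u, hu, h⟩
        refine ⟨(a : ℂ) • u, U.smul_mem _ hu, ?_⟩
        rw [C.e_smul, h, LinearMap.map_smulₛₗ, Complex.conj_ofReal, smul_add] }
  have hq : ∀ X, X ∈ q ↔ ∃ u ∈ U, C.e X = u + C.conj u := fun X => Iff.rfl
  have hre : ∀ y, ⁅T.z' C, y⁆ = y → T.θ (C.re y + C.re y) = -(C.re y + C.re y) := fun y hy => by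
    rw [map_add, T.θ_re_P C hy, neg_add]
  have h1 := T.mem_of_stable q (fun X hX => ?_) (fun K hK' X hX => ?_) (fun hbot => ?_) (hre x hx)
  · obtain ⟨u, hu, h⟩ := (hq _).1 h1
    rw [← C.add_conj] at h
    rwa [T.eq_of_add_conj C hx (hU u hu) h]
  · obtain ⟨u, hu, h⟩ := (hq _).1 hX
    rw [C.add_conj] at h
    rw [C.e_injective h, hre u (hU u hu)]
  · obtain ⟨u, hu, h⟩ := (hq _).1 hX
    refine ⟨⁅C.e K, u⁆, hK _ ((T.z'_eq_zero C).2 ?_) u hu, ?_⟩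
    · rw [(C.parts_e K).1, (C.parts_e K).2, map_zero]; exact ⟨hK', rfl⟩
    · rw [C.e_lie, h, lie_add, C.conj_e_lie]
  · refine h0 ((Submodule.eq_bot_iff U).2 fun u hu => ?_)
    have h2 : C.re u + C.re u ∈ q := ⟨u, hu, (C.add_conj u).symm⟩
    rw [hbot, Submodule.mem_bot] at h2
    refine T.eq_of_add_conj C (hU u hu) (lie_zero _) ?_
    rw [C.add_conj, h2, C.e_zero, map_zero, add_zero]

theorem eq_zero_of_central {Y : 𝔤} (h : ∀ X : 𝔤, ⁅Y, X⁆ = 0) : Y = 0 := by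
  have : Y ∈ LieAlgebra.center ℝ 𝔤 := (LieModule.mem_maxTrivSubmodule ℝ 𝔤 𝔤 Y).2 fun X => by
    rw [← lie_skew, h, neg_zero]
  rwa [LieAlgebra.center_eq_bot, LieSubmodule.mem_bot] at this

/-- The center of `𝔨` is spanned by `z`. -/
theorem exists_smul_of_center [FiniteDimensional ℂ G] {x₀ : G} (hx₀ : ⁅T.z' C, x₀⁆ = x₀)
    (hx₀' : x₀ ≠ 0) {Y : 𝔤} (hY : T.θ Y = Y) (hYk : ∀ K, T.θ K = K → ⁅Y, K⁆ = 0) :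
    ∃ a : ℝ, Y = a • T.z := by
  have hzY : ⁅T.z' C, C.e Y⁆ = 0 := (T.z'_eq_zero C).2 (by
    rw [(C.parts_e Y).1, (C.parts_e Y).2, map_zero]; exact ⟨hY, rfl⟩)
  have hYK : ∀ w : G, ⁅T.z' C, w⁆ = 0 → ⁅C.e Y, w⁆ = 0 := fun w hw => by
    obtain ⟨h1, h2⟩ := (T.z'_eq_zero C).1 hw
    rw [C.e_lie_aux, hYk _ h1, hYk _ h2, C.e_zero, smul_zero, add_zero]
  have hYP : ∀ x ∈ T.P C, ⁅C.e Y, x⁆ ∈ T.P C := fun x hx => by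
    rw [mem_P] at hx ⊢
    rw [leibniz_lie, hzY, zero_lie, zero_add, hx]
  -- Schur's lemma: Y acts on 𝔭₊ by a scalar c. It is imaginary because Y is skew for the Hermitian
  -- form, so Y - (Im c) z centralizes 𝔨, 𝔭₊ and 𝔭₋, and is zero.
  let f : Module.End ℂ (T.P C) := LinearMap.restrict (LieAlgebra.ad ℂ G (C.e Y)) hYP
  haveI : Nontrivial (T.P C) := ⟨⟨⟨x₀, hx₀⟩, 0, fun h => hx₀' (congrArg Subtype.val h)⟩⟩
  obtain ⟨c, hc⟩ := Module.End.exists_eigenvalue f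
  obtain ⟨v, hv⟩ := hc.exists_hasEigenvector
  have hv1 : ⁅C.e Y, (v : G)⁆ = c • (v : G) := congrArg Subtype.val hv.apply_eq_smul
  have hv0 : (v : G) ≠ 0 := fun h => hv.2 (Subtype.ext h)
  let U : Submodule ℂ G :=
    { carrier := {x | ⁅T.z' C, x⁆ = x ∧ ⁅C.e Y, x⁆ = c • x}
      add_mem' := fun {x y} hx hy =>
        ⟨by rw [lie_add, hx.1, hy.1], by rw [lie_add, hx.2, hy.2, smul_add]⟩
      zero_mem' := ⟨lie_zero _, by rw [lie_zero, smul_zero]⟩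
      smul_mem' := fun a x hx => ⟨by rw [lie_smul, hx.1], by rw [lie_smul, hx.2, smul_comm]⟩ }
  have hall : ∀ x, ⁅T.z' C, x⁆ = x → ⁅C.e Y, x⁆ = c • x := fun x hx => by
    refine (T.P_irred C U (fun u hu => hu.1) (fun w hw u hu => ⟨?_, ?_⟩) (fun h => ?_) hx).2
    · rw [leibniz_lie, hw, zero_lie, zero_add, hu.1]
    · rw [leibniz_lie, hYK w hw, zero_lie, zero_add, hu.2, lie_smul]
    · have : (v : G) ∈ U := ⟨v.2, hv1⟩
      rw [h, Submodule.mem_bot] at this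
      exact hv0 this
  have hcv : ⁅C.e Y, C.conj (v : G)⁆ = starRingEnd ℂ c • C.conj (v : G) := by
    rw [← C.conj_e_lie, hv1, LinearMap.map_smulₛₗ]
  have hc1 : (c + starRingEnd ℂ c) * C.B v (C.conj v) = 0 := by
    have h1 : C.B ⁅C.e Y, (v : G)⁆ (C.conj v) = -C.B v ⁅C.e Y, C.conj (v : G)⁆ := by
      rw [← lie_skew, map_neg, LinearMap.neg_apply, C.B_inv]
    rw [hv1, hcv, map_smul, map_smul, LinearMap.smul_apply, smul_eq_mul, smul_eq_mul] at h1
    linear_combination h1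
  have hc2 : c.re = 0 := by
    have h1 := (mul_eq_zero.1 hc1).resolve_right fun h => by
      have := T.B_P_pos C v.2 hv0
      rw [h] at this
      exact lt_irrefl _ this
    have h2 := congrArg Complex.re h1
    rw [Complex.add_re, Complex.conj_re, Complex.zero_re] at h2
    linarith
  refine ⟨c.im, sub_eq_zero.1 (eq_zero_of_central fun X => C.e_injective ?_)⟩
  have hcI : c = c.im * Complex.I := Complex.ext (by simp [hc2]) (by simp)
  have hW : C.e (Y - c.im • T.z) = C.e Y - c • T.z' C := by
    rw [C.e_sub, C.e_smul, ← T.I_z', smul_smul, ← hcI]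
  rw [C.e_lie, hW, C.e_zero]
  obtain ⟨k, p, n, e, hk, hp, hn⟩ := T.exists_graded C (C.e X)
  have hn' : ⁅C.e Y, n⁆ = -c • n := by
    have h1 := congrArg C.conj (hall _ (T.conj_N C hn))
    rw [C.conj_e_lie, LinearMap.map_smulₛₗ, C.conj_conj] at h1
    rw [h1]
    congr 1
    exact Complex.ext (by simp [hc2]) (by simp)
  rw [e, sub_lie, smul_lie, lie_add, lie_add, lie_add, lie_add, hYK k hk, hall p hp, hn', hk, hp,
    hn]
  module

/-- The Killing complement of [𝔨, 𝔨] in 𝔨 is central in 𝔨 by invariance and definiteness, hence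
consists of multiples of z. -/
theorem exists_derivedK [FiniteDimensional ℂ G] {x₀ : G} (hx₀ : ⁅T.z' C, x₀⁆ = x₀)
    (hx₀' : x₀ ≠ 0) {X : 𝔤} (hX : T.θ X = X) :
    ∃ D ∈ derivedK T.θ, ∃ a : ℝ, X = D + a • T.z := by
  have hd : ∀ D ∈ derivedK T.θ, T.θ D = D := fun D hD => by
    induction hD using Submodule.span_induction with
    | mem D h =>
      obtain ⟨A, hA, A', hA', rfl⟩ := h
      exact (fixedPoints T.θ).lie_mem hA hA'
    | zero => exact map_zero _
    | add D D' _ _ h h' => rw [map_add, h, h']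
    | smul a D _ h => rw [map_smul, h]
  obtain ⟨D, hD, Y, rfl, hY⟩ := exists_orthogonal_decomp (derivedK T.θ) (fun X hX h => by
    by_contra h'
    exact (T.killing_neg (hd X hX) h').ne h) X
  have hYk : T.θ Y = Y := by
    rw [map_add, hd D hD] at hX
    exact add_left_cancel hX
  obtain ⟨a, rfl⟩ := T.exists_smul_of_center C hx₀ hx₀' hYk fun K hK => by
    by_contra h
    have hYK : T.θ ⁅Y, K⁆ = ⁅Y, K⁆ := by rw [T.θ_lie, hYk, hK]
    have h1 := T.killing_neg hYK h
    rw [Complexification.killing_lie, Complexification.killing_symm,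
      hY _ (Submodule.subset_span ⟨K, hK, _, hYK, rfl⟩)] at h1
    exact lt_irrefl _ h1
  exact ⟨D, hD, a, rfl⟩

end HermitianType
end HermitianLie

/-! ### Weights of a torus and the extremal weight vector -/

namespace HermitianLie

variable {𝔤 G : Type*} [LieRing 𝔤] [LieAlgebra ℝ 𝔤] [LieRing G] [LieAlgebra ℂ G]

namespace Complexification

variable (C : Complexification 𝔤 G)

/-- `x` is a weight vector of weight `α` under `ad 𝔱`. -/
def IsWeight (𝔱 : LieSubalgebra ℝ 𝔤) (α : 𝔱 →ₗ[ℝ] ℂ) (x : G) : Prop :=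
  ∀ H : 𝔱, ⁅C.e H, x⁆ = α H • x

theorem B_conj_lie_of_conj_neg {h : G} (hh : C.conj h = -h) (x y : G) :
    C.B (C.conj ⁅h, x⁆) y = C.B (C.conj x) ⁅h, y⁆ := by
  rw [C.conj_lie, hh, neg_lie, lie_skew, C.B_inv]

theorem conj_I_e (H : 𝔤) : C.conj (Complex.I • C.e H) = -(Complex.I • C.e H) := by
  rw [LinearMap.map_smulₛₗ, C.conj_e, Complex.conj_I, neg_smul]

variable [FiniteDimensional ℂ G] {ε : ℝ} {V : Submodule ℂ G}

/-- An element with h̄ = -h acts by a symmetric operator. The sign ε covers both 𝔭₊, where the form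
B(x, x̄) is positive, and 𝔨_ℂ, where it is negative. -/
theorem exists_eigenbasis (hV : ∀ x ∈ V, x ≠ 0 → 0 < ε * (C.B x (C.conj x)).re) {h : G}
    (hh : C.conj h = -h) (hf : ∀ x ∈ V, ⁅h, x⁆ ∈ V) :
    ∃ (b : Module.Basis (Fin (Module.finrank ℂ V)) ℂ V) (a : Fin (Module.finrank ℂ V) → ℝ),
      (∀ i j, (ε : ℂ) * C.B (C.conj (b i : G)) (b j) = if i = j then 1 else 0) ∧
      ∀ i, ⁅h, (b i : G)⁆ = (a i : ℂ) • (b i : G) := by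
  obtain ⟨b, a, ho, hb⟩ := exists_orthonormal_eigenbasis (V := V)
    (fun v w => (ε : ℂ) * C.B (C.conj v) w)
    (fun u v w => by rw [Submodule.coe_add, map_add, map_add, LinearMap.add_apply, mul_add])
    (fun c v w => by
      rw [Submodule.coe_smul, LinearMap.map_smulₛₗ, map_smul, LinearMap.smul_apply, smul_eq_mul,
        mul_left_comm])
    (fun v w => by
      rw [map_mul, Complex.conj_ofReal, ← C.B_conj, C.conj_conj, C.B_symm])
    (fun v hv => by
      rw [C.B_symm, Complex.re_ofReal_mul]
      exact hV v v.2 fun h => hv (Subtype.ext h))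
    (LinearMap.restrict (LieAlgebra.ad ℂ G h) hf)
    (fun v w => by
      change (ε : ℂ) * C.B (C.conj ⁅h, (v : G)⁆) w = ε * C.B (C.conj (v : G)) ⁅h, (w : G)⁆
      rw [C.B_conj_lie_of_conj_neg hh])
  exact ⟨b, a, ho, fun i => congrArg Subtype.val (hb i)⟩

theorem mem_span_eigen (hV : ∀ x ∈ V, x ≠ 0 → 0 < ε * (C.B x (C.conj x)).re) {h : G}
    (hh : C.conj h = -h) (hf : ∀ x ∈ V, ⁅h, x⁆ ∈ V) {x : G} (hx : x ∈ V) :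
    x ∈ Submodule.span ℂ {y | y ∈ V ∧ ∃ a : ℝ, ⁅h, y⁆ = (a : ℂ) • y} := by
  obtain ⟨b, a, -, hb⟩ := C.exists_eigenbasis hV hh hf
  have h1 : x = ∑ i, b.repr ⟨x, hx⟩ i • (b i : G) := by
    have h2 := congrArg V.subtype (b.sum_repr ⟨x, hx⟩)
    rw [map_sum] at h2
    exact h2.symm
  rw [h1]
  refine Submodule.sum_mem _ fun i _ => Submodule.smul_mem _ _ (Submodule.subset_span
    ⟨(b i).2, a i, hb i⟩)

/-- A subspace stable under a torus is spanned by weight vectors. -/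
theorem mem_span_weight (𝔱 : LieSubalgebra ℝ 𝔤) (habel : ∀ H H' : 𝔱, ⁅(H : 𝔤), (H' : 𝔤)⁆ = 0)
    (hV : ∀ x ∈ V, x ≠ 0 → 0 < ε * (C.B x (C.conj x)).re)
    (hf : ∀ (H : 𝔱), ∀ x ∈ V, ⁅C.e H, x⁆ ∈ V) {x : G} (hx : x ∈ V) :
    x ∈ Submodule.span ℂ {y | y ∈ V ∧ ∃ α, C.IsWeight 𝔱 α y} := by
  induction hn : Module.finrank ℂ V using Nat.strong_induction_on generalizing V x with
  | _ n ih =>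
    subst hn
    -- Induction on the dimension: either the torus acts by scalars and every vector is a weight
    -- vector, or some √-1 H splits V into proper stable eigenspaces.
    by_cases hs : ∀ H : 𝔱, ∃ c : ℂ, ∀ x ∈ V, ⁅C.e H, x⁆ = c • x
    · by_cases hx0 : x = 0
      · rw [hx0]; exact Submodule.zero_mem _
      choose c hc using hs
      let α : 𝔱 →ₗ[ℝ] ℂ :=
        { toFun := c
          map_add' := fun H H' => smul_left_injective ℂ hx0 (by
            change c (H + H') • x = (c H + c H') • x
            rw [← hc _ x hx, add_smul, ← hc _ x hx, ← hc _ x hx, ← add_lie, ← C.e_add]; rfl)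
          map_smul' := fun a H => smul_left_injective ℂ hx0 (by
            change c (a • H) • x = (a • c H) • x
            rw [← hc _ x hx, Complex.real_smul, mul_smul, ← hc _ x hx, ← smul_lie, ← C.e_smul]
            rfl) }
      exact Submodule.subset_span ⟨hx, α, fun H => hc H x hx⟩
    · push Not at hs
      obtain ⟨H, hH⟩ := hs
      have h1 := C.mem_span_eigen hV (C.conj_I_e H) (fun x hx => by
        rw [smul_lie]; exact V.smul_mem _ (hf H x hx)) hx
      refine Submodule.span_le.2 ?_ h1
      rintro y ⟨hy, a, ha⟩
      let V' : Submodule ℂ G :=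
        V ⊓ Module.End.eigenspace (LieAlgebra.ad ℂ G (Complex.I • C.e H)) a
      have hV' : ∀ {w}, w ∈ V' ↔ w ∈ V ∧ ⁅Complex.I • C.e H, w⁆ = (a : ℂ) • w := fun {w} => by
        rw [Submodule.mem_inf, Module.End.mem_eigenspace_iff, LieAlgebra.ad_apply]
      have hlt : V' < V := by
        refine lt_of_le_of_ne inf_le_left fun h => ?_
        obtain ⟨w, hw, hne⟩ := hH (-Complex.I * a)
        refine hne ?_
        rw [← h] at hw
        rw [mul_smul, ← (hV'.1 hw).2, smul_lie, smul_smul, neg_mul, Complex.I_mul_I, neg_neg,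
          one_smul]
      have h2 := ih _ (Submodule.finrank_lt_finrank_of_lt hlt) (V := V')
        (x := y) (fun x hx => hV x (hV'.1 hx).1) (fun H' x hx => ?_)
        (hV'.2 ⟨hy, ha⟩) rfl
      · refine Submodule.span_mono ?_ h2
        rintro w ⟨h3, h4⟩
        exact ⟨(hV'.1 h3).1, h4⟩
      · refine hV'.2 ⟨hf H' x (hV'.1 hx).1, ?_⟩
        rw [leibniz_lie, smul_lie, ← C.e_lie, habel H H', C.e_zero, smul_zero, zero_lie, zero_add,
          (hV'.1 hx).2, lie_smul]

end Complexification

/-- A maximal torus of the maximal compact subalgebra, a regular element `H₀`, and a normalized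
weight vector `X` of extremal weight in the `1`-eigenspace of `ad z'`. -/
structure TorusData (T : HermitianType 𝔤) (C : Complexification 𝔤 G) where
  𝔱 : LieSubalgebra ℝ 𝔤
  abelian : ∀ H H' : 𝔱, ⁅(H : 𝔤), (H' : 𝔤)⁆ = 0
  θ_t : ∀ H : 𝔱, T.θ H = H
  maximal : ∀ Y, T.θ Y = Y → (∀ H : 𝔱, ⁅(H : 𝔤), Y⁆ = 0) → Y ∈ 𝔱
  H₀ : 𝔱
  regular : ∀ α x, ⁅T.z' C, x⁆ = 0 → x ≠ 0 → C.IsWeight 𝔱 α x → (α H₀).im = 0 → α = 0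
  X : G
  z'_X : ⁅T.z' C, X⁆ = X
  B_X : C.B X (C.conj X) = 1
  β : 𝔱 →ₗ[ℝ] ℂ
  weight : C.IsWeight 𝔱 β X
  highest : ∀ γ x, ⁅T.z' C, x⁆ = x → x ≠ 0 → C.IsWeight 𝔱 γ x → (γ H₀).im ≤ (β H₀).im

namespace TorusData

variable {T : HermitianType 𝔤} {C : Complexification 𝔤 G} (A : TorusData T C)

/-- The element of the complexified torus that defines positivity. -/
def H' : G := Complex.I • C.e A.H₀

theorem conj_H' : C.conj A.H' = -A.H' := C.conj_I_e _

theorem z'_e (H : A.𝔱) : ⁅T.z' C, C.e (H : 𝔤)⁆ = 0 := (T.z'_eq_zero C).2 (by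
  rw [(C.parts_e _).1, (C.parts_e _).2, map_zero]; exact ⟨A.θ_t H, rfl⟩)

theorem z'_H' : ⁅T.z' C, A.H'⁆ = 0 := by rw [H', lie_smul, z'_e, smul_zero]

theorem e_lie_H' (H : A.𝔱) : ⁅C.e (H : 𝔤), A.H'⁆ = 0 := by
  rw [H', lie_smul, ← C.e_lie, A.abelian, C.e_zero, smul_zero]

theorem H'_e (H : A.𝔱) : ⁅A.H', C.e (H : 𝔤)⁆ = 0 := by
  rw [← lie_skew, A.e_lie_H', neg_zero]

theorem X_ne_zero : A.X ≠ 0 := fun h => by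
  have := A.B_X
  rw [h, map_zero, LinearMap.zero_apply] at this
  exact zero_ne_one this

theorem weight_re {α : A.𝔱 →ₗ[ℝ] ℂ} {x : G} (hx : C.IsWeight A.𝔱 α x)
    (hx0 : C.B x (C.conj x) ≠ 0) (H : A.𝔱) : (α H).re = 0 := by
  have h1 : C.B ⁅C.e (H : 𝔤), x⁆ (C.conj x) = -C.B x (C.conj ⁅C.e (H : 𝔤), x⁆) := by
    rw [C.conj_e_lie, ← lie_skew, map_neg, LinearMap.neg_apply, C.B_inv]
  rw [hx H, LinearMap.map_smulₛₗ C.conj, map_smul, map_smul, LinearMap.smul_apply, smul_eq_mul,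
    smul_eq_mul] at h1
  have h2 : α H + starRingEnd ℂ (α H) = 0 :=
    (mul_eq_zero.1 (by linear_combination h1 :
      (α H + starRingEnd ℂ (α H)) * C.B x (C.conj x) = 0)).resolve_right hx0
  have h3 := congrArg Complex.re h2
  rw [Complex.add_re, Complex.conj_re, Complex.zero_re] at h3
  linarith

theorem B_P_ne_zero {x : G} (hx : ⁅T.z' C, x⁆ = x) (h0 : x ≠ 0) : C.B x (C.conj x) ≠ 0 :=
  fun h => by
    have := T.B_P_pos C hx h0
    rw [h] at this
    exact lt_irrefl _ this

theorem B_K_ne_zero {x : G} (hx : ⁅T.z' C, x⁆ = 0) (h0 : x ≠ 0) : C.B x (C.conj x) ≠ 0 :=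
  fun h => by
    have := T.B_K_neg C hx h0
    rw [h] at this
    exact lt_irrefl _ this

/-- Weights are imaginary on the torus, so √-1 H₀ has the eigenvalue -Im α(H₀). Positive roots thus
correspond to negative eigenvalues of `H'`. -/
theorem H'_lie {α : A.𝔱 →ₗ[ℝ] ℂ} {x : G} (hx : C.IsWeight A.𝔱 α x)
    (hx0 : C.B x (C.conj x) ≠ 0) : ⁅A.H', x⁆ = ((-(α A.H₀).im : ℝ) : ℂ) • x := by
  rw [H', smul_lie, hx A.H₀, smul_smul]
  congr 1
  exact Complex.ext (by simp) (by simp [A.weight_re hx hx0 A.H₀])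

theorem H'_X : ⁅A.H', A.X⁆ = ((-(A.β A.H₀).im : ℝ) : ℂ) • A.X :=
  A.H'_lie A.weight (B_P_ne_zero A.z'_X A.X_ne_zero)

variable [FiniteDimensional ℂ G]

theorem exists_weight {V : Submodule ℂ G} {ε : ℝ}
    (hV : ∀ x ∈ V, x ≠ 0 → 0 < ε * (C.B x (C.conj x)).re)
    (hf : ∀ (H : A.𝔱), ∀ x ∈ V, ⁅C.e (H : 𝔤), x⁆ ∈ V) {x : G} (hx : x ∈ V) :
    x ∈ Submodule.span ℂ {y | y ∈ V ∧ y ≠ 0 ∧ ∃ α, C.IsWeight A.𝔱 α y} := by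
  refine Submodule.span_le.2 (fun y hy => ?_) (C.mem_span_weight A.𝔱 A.abelian hV hf hx)
  by_cases h : y = 0
  · rw [h]; exact Submodule.zero_mem _
  · exact Submodule.subset_span ⟨hy.1, h, hy.2⟩

/-- Eigenspaces of `ad H'` on the eigenspaces of `ad z'` are spanned by weight vectors. -/
theorem mem_span_K {x : G} (hx : ⁅T.z' C, x⁆ = 0) {c : ℝ} (hc : ⁅A.H', x⁆ = (c : ℂ) • x) :
    x ∈ Submodule.span ℂ {y | ⁅T.z' C, y⁆ = 0 ∧ y ≠ 0 ∧
      ∃ α, C.IsWeight A.𝔱 α y ∧ c = -(α A.H₀).im} := by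
  let V : Submodule ℂ G := Module.End.eigenspace (LieAlgebra.ad ℂ G (T.z' C)) 0 ⊓
    Module.End.eigenspace (LieAlgebra.ad ℂ G A.H') c
  have hV : ∀ {w}, w ∈ V ↔ ⁅T.z' C, w⁆ = 0 ∧ ⁅A.H', w⁆ = (c : ℂ) • w := fun {w} => by
    rw [Submodule.mem_inf, Module.End.mem_eigenspace_iff, Module.End.mem_eigenspace_iff,
      LieAlgebra.ad_apply, LieAlgebra.ad_apply, zero_smul]
  refine Submodule.span_mono ?_ (A.exists_weight (V := V) (ε := -1) (fun w hw h0 => ?_)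
    (fun H w hw => ?_) (hV.2 ⟨hx, hc⟩))
  · rintro y ⟨hy, hy0, α, hα⟩
    refine ⟨(hV.1 hy).1, hy0, α, hα, ?_⟩
    have h1 := A.H'_lie hα (B_K_ne_zero (hV.1 hy).1 hy0)
    rw [(hV.1 hy).2] at h1
    exact Complex.ofReal_injective (smul_left_injective ℂ hy0 h1)
  · have := T.B_K_neg C (hV.1 hw).1 h0
    linarith
  · obtain ⟨h1, h2⟩ := hV.1 hw
    refine hV.2 ⟨?_, ?_⟩
    · rw [leibniz_lie, A.z'_e, zero_lie, zero_add, h1, lie_zero]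
    · rw [leibniz_lie, A.H'_e, zero_lie, zero_add, h2, lie_smul]

theorem mem_span_P {x : G} (hx : ⁅T.z' C, x⁆ = x) {c : ℝ} (hc : ⁅A.H', x⁆ = (c : ℂ) • x) :
    x ∈ Submodule.span ℂ {y | ⁅T.z' C, y⁆ = y ∧ y ≠ 0 ∧
      ∃ α, C.IsWeight A.𝔱 α y ∧ c = -(α A.H₀).im} := by
  let V : Submodule ℂ G := T.P C ⊓ Module.End.eigenspace (LieAlgebra.ad ℂ G A.H') c
  have hV : ∀ {w}, w ∈ V ↔ ⁅T.z' C, w⁆ = w ∧ ⁅A.H', w⁆ = (c : ℂ) • w := fun {w} => by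
    rw [Submodule.mem_inf, Module.End.mem_eigenspace_iff, LieAlgebra.ad_apply, T.mem_P]
  refine Submodule.span_mono ?_ (A.exists_weight (V := V) (ε := 1) (fun w hw h0 => ?_)
    (fun H w hw => ?_) (hV.2 ⟨hx, hc⟩))
  · rintro y ⟨hy, hy0, α, hα⟩
    refine ⟨(hV.1 hy).1, hy0, α, hα, ?_⟩
    have h1 := A.H'_lie hα (B_P_ne_zero (hV.1 hy).1 hy0)
    rw [(hV.1 hy).2] at h1
    exact Complex.ofReal_injective (smul_left_injective ℂ hy0 h1)
  · rw [one_mul]; exact T.B_P_pos C (hV.1 hw).1 h0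
  · obtain ⟨h1, h2⟩ := hV.1 hw
    refine hV.2 ⟨?_, ?_⟩
    · rw [leibniz_lie, A.z'_e, zero_lie, zero_add, h1]
    · rw [leibniz_lie, A.H'_e, zero_lie, zero_add, h2, lie_smul]

/-- Positive root vectors annihilate the extremal weight vector. -/
theorem lie_X_of_neg {w : G} (hw : ⁅T.z' C, w⁆ = 0) {c : ℝ} (hc : ⁅A.H', w⁆ = (c : ℂ) • w)
    (hc0 : c < 0) : ⁅w, A.X⁆ = 0 := by
  have h1 := A.mem_span_P (x := ⁅w, A.X⁆) (c := c - (A.β A.H₀).im)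
    (by rw [leibniz_lie, hw, zero_lie, zero_add, A.z'_X])
    (by rw [leibniz_lie, hc, A.H'_X, smul_lie, lie_smul, ← add_smul]; push_cast; congr 1)
  have h2 : {y | ⁅T.z' C, y⁆ = y ∧ y ≠ 0 ∧ ∃ α, C.IsWeight A.𝔱 α y ∧
      c - (A.β A.H₀).im = -(α A.H₀).im} = (∅ : Set G) := by
    refine Set.eq_empty_of_forall_notMem ?_
    rintro y ⟨hy, hy0, α, hα, e⟩
    have := A.highest α y hy hy0 hα
    linarith
  rwa [h2, Submodule.span_empty, Submodule.mem_bot] at h1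

/-- The centralizer of `H₀` in the complexification of `𝔨`. -/
theorem parts_mem_of_H' {x : G} (hx : ⁅T.z' C, x⁆ = 0) (h : ⁅A.H', x⁆ = 0) :
    C.re x ∈ A.𝔱 ∧ C.im x ∈ A.𝔱 := by
  have h1 := A.mem_span_K hx (c := 0) (by rw [h, Complex.ofReal_zero, zero_smul])
  have h2 : ∀ H : A.𝔱, ⁅C.e (H : 𝔤), x⁆ = 0 := fun H => by
    clear hx h
    induction h1 using Submodule.span_induction with
    | mem y hy =>
      obtain ⟨hy1, hy0, α, hα, e⟩ := hy
      rw [hα, A.regular α y hy1 hy0 hα (by linarith), LinearMap.zero_apply, zero_smul]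
    | zero => exact lie_zero _
    | add y w _ _ hy hw => rw [lie_add, hy, hw, add_zero]
    | smul a y _ hy => rw [lie_smul, hy, smul_zero]
  obtain ⟨h3, h4⟩ := (T.z'_eq_zero C).1 hx
  refine ⟨A.maximal _ h3 fun H => ?_, A.maximal _ h4 fun H => ?_⟩
  · rw [← C.re_e_lie, h2, C.parts_zero.1]
  · rw [← C.im_e_lie, h2, C.parts_zero.2]

theorem exists_lie_of_H' {x : G} (hx : ⁅T.z' C, x⁆ = 0) (h : ⁅A.H', x⁆ = 0) :
    ∃ c : ℂ, ⁅x, A.X⁆ = c • A.X := by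
  obtain ⟨h1, h2⟩ := A.parts_mem_of_H' hx h
  refine ⟨A.β ⟨_, h1⟩ + Complex.I * A.β ⟨_, h2⟩, ?_⟩
  conv_lhs => rw [← C.re_add_im x, add_lie, smul_lie]
  rw [add_smul, mul_smul, ← A.weight, ← A.weight]

theorem lie_eq_zero_of_H' {x y : G} (hx : ⁅T.z' C, x⁆ = 0) (h : ⁅A.H', x⁆ = 0)
    (hy : ⁅T.z' C, y⁆ = 0) (h' : ⁅A.H', y⁆ = 0) : ⁅x, y⁆ = 0 := by
  obtain ⟨h1, h2⟩ := A.parts_mem_of_H' hx h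
  obtain ⟨h3, h4⟩ := A.parts_mem_of_H' hy h'
  rw [← C.re_add_im x, ← C.re_add_im y]
  simp only [add_lie, lie_add, smul_lie, lie_smul, ← C.e_lie]
  rw [A.abelian ⟨_, h1⟩ ⟨_, h3⟩, A.abelian ⟨_, h1⟩ ⟨_, h4⟩, A.abelian ⟨_, h2⟩ ⟨_, h3⟩,
    A.abelian ⟨_, h2⟩ ⟨_, h4⟩, C.e_zero]
  simp

/-- The coroot element of the extremal weight. -/
def h : G := ⁅A.X, C.conj A.X⁆

theorem z'_h : ⁅T.z' C, A.h⁆ = 0 := by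
  rw [h, leibniz_lie, A.z'_X, T.conj_P C A.z'_X, lie_neg, add_neg_cancel]

theorem H'_conj {x : G} {c : ℝ} (hc : ⁅A.H', x⁆ = (c : ℂ) • x) :
    ⁅A.H', C.conj x⁆ = ((-c : ℝ) : ℂ) • C.conj x := by
  have := congrArg C.conj hc
  rw [C.conj_lie, A.conj_H', LinearMap.map_smulₛₗ, Complex.conj_ofReal, neg_lie,
    neg_eq_iff_eq_neg] at this
  rw [this, Complex.ofReal_neg, neg_smul]

theorem H'_h : ⁅A.H', A.h⁆ = 0 := by
  rw [h, leibniz_lie, A.H'_X, A.H'_conj A.H'_X, smul_lie, lie_smul, ← add_smul, neg_neg,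
    Complex.ofReal_neg, neg_add_cancel, zero_smul]

/-- The span of the positive root vectors. -/
def nPlus : Submodule ℂ G :=
  Submodule.span ℂ {w | ⁅T.z' C, w⁆ = 0 ∧ ∃ c : ℝ, c < 0 ∧ ⁅A.H', w⁆ = (c : ℂ) • w}

theorem z'_nPlus {w : G} (hw : w ∈ A.nPlus) : ⁅T.z' C, w⁆ = 0 := by
  induction hw using Submodule.span_induction with
  | mem y hy => exact hy.1
  | zero => exact lie_zero _
  | add y w _ _ hy hw => rw [lie_add, hy, hw, add_zero]
  | smul a y _ hy => rw [lie_smul, hy, smul_zero]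

theorem nPlus_lie_X {w : G} (hw : w ∈ A.nPlus) : ⁅w, A.X⁆ = 0 := by
  induction hw using Submodule.span_induction with
  | mem y hy =>
    obtain ⟨h1, c, hc, h2⟩ := hy
    exact A.lie_X_of_neg h1 h2 hc
  | zero => exact zero_lie _
  | add y w _ _ hy hw => rw [add_lie, hy, hw, add_zero]
  | smul a y _ hy => rw [smul_lie, hy, smul_zero]

theorem nPlus_lie {w y : G} (hw : w ∈ A.nPlus) (hy : ⁅T.z' C, y⁆ = 0) (hy' : ⁅A.H', y⁆ = 0) :
    ⁅w, y⁆ ∈ A.nPlus := by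
  induction hw using Submodule.span_induction with
  | mem w hw =>
    obtain ⟨h1, c, hc, h2⟩ := hw
    refine Submodule.subset_span ⟨?_, c, hc, ?_⟩
    · rw [leibniz_lie, h1, hy, zero_lie, lie_zero, add_zero]
    · rw [leibniz_lie, h2, hy', lie_zero, add_zero, smul_lie]
  | zero => rw [zero_lie]; exact Submodule.zero_mem _
  | add y w _ _ hy hw => rw [add_lie]; exact Submodule.add_mem _ hy hw
  | smul a y _ hy => rw [smul_lie]; exact Submodule.smul_mem _ _ hy

theorem B_eq_zero_of_eigen {x y : G} {c d : ℝ} (hx : ⁅A.H', x⁆ = (c : ℂ) • x)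
    (hy : ⁅A.H', y⁆ = (d : ℂ) • y) (hcd : c + d ≠ 0) : C.B x y = 0 := by
  have h1 : C.B ⁅A.H', x⁆ y = -C.B x ⁅A.H', y⁆ := by
    rw [← lie_skew, map_neg, LinearMap.neg_apply, C.B_inv]
  rw [hx, hy, map_smul, map_smul, LinearMap.smul_apply, smul_eq_mul, smul_eq_mul] at h1
  refine (mul_eq_zero.1 (by push_cast; linear_combination h1 :
    ((c + d : ℝ) : ℂ) * C.B x y = 0)).resolve_left ?_
  exact_mod_cast hcd

theorem B_nPlus {x y : G} (hx : x ∈ A.nPlus) (hy : y ∈ A.nPlus) : C.B x y = 0 := by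
  induction hx using Submodule.span_induction with
  | mem x hx =>
    obtain ⟨-, c, hc, h2⟩ := hx
    induction hy using Submodule.span_induction with
    | mem y hy =>
      obtain ⟨-, d, hd, h4⟩ := hy
      exact A.B_eq_zero_of_eigen h2 h4 (by linarith)
    | zero => exact map_zero _
    | add y w _ _ hy hw => rw [map_add, hy, hw, add_zero]
    | smul a y _ hy => rw [map_smul, hy, smul_zero]
  | zero => rw [map_zero, LinearMap.zero_apply]
  | add x w _ _ hx hw => rw [map_add, LinearMap.add_apply, hx, hw, add_zero]
  | smul a x _ hx => rw [map_smul, LinearMap.smul_apply, hx, smul_zero]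

/-- Diagonalize `ad H'` on the centralizer of z' and sort by the sign of the eigenvalue; conjugation
exchanges the signs. -/
theorem exists_triangular {W : G} (hW : ⁅T.z' C, W⁆ = 0) : ∃ a b d : G, W = a + b + d ∧
    a ∈ A.nPlus ∧ (⁅T.z' C, b⁆ = 0 ∧ ⁅A.H', b⁆ = 0) ∧ C.conj d ∈ A.nPlus := by
  have h1 := C.mem_span_eigen (V := Module.End.eigenspace (LieAlgebra.ad ℂ G (T.z' C)) 0)
    (ε := -1) (fun w hw h0 => by
      rw [Module.End.mem_eigenspace_iff, LieAlgebra.ad_apply, zero_smul] at hw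
      have := T.B_K_neg C hw h0
      linarith) A.conj_H' (fun w hw => by
      rw [Module.End.mem_eigenspace_iff, LieAlgebra.ad_apply, zero_smul] at hw ⊢
      rw [leibniz_lie, A.z'_H', hw, zero_lie, lie_zero, add_zero]) (x := W) (by
      rwa [Module.End.mem_eigenspace_iff, LieAlgebra.ad_apply, zero_smul])
  clear hW
  induction h1 using Submodule.span_induction with
  | mem y hy =>
    obtain ⟨hy, c, hc⟩ := hy
    rw [Module.End.mem_eigenspace_iff, LieAlgebra.ad_apply, zero_smul] at hy
    rcases lt_trichotomy c 0 with h | h | h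
    · exact ⟨y, 0, 0, by rw [add_zero, add_zero], Submodule.subset_span ⟨hy, c, h, hc⟩,
        ⟨lie_zero _, lie_zero _⟩, by rw [map_zero]; exact Submodule.zero_mem _⟩
    · exact ⟨0, y, 0, by rw [zero_add, add_zero], Submodule.zero_mem _,
        ⟨hy, by rw [hc, h, Complex.ofReal_zero, zero_smul]⟩,
        by rw [map_zero]; exact Submodule.zero_mem _⟩
    · exact ⟨0, 0, y, by rw [zero_add, zero_add], Submodule.zero_mem _,
        ⟨lie_zero _, lie_zero _⟩, Submodule.subset_span ⟨T.conj_K C hy, -c, by linarith,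
          A.H'_conj hc⟩⟩
  | zero =>
    exact ⟨0, 0, 0, by rw [add_zero, add_zero], Submodule.zero_mem _, ⟨lie_zero _, lie_zero _⟩,
      by rw [map_zero]; exact Submodule.zero_mem _⟩
  | add x y _ _ hx hy =>
    obtain ⟨a, b, d, rfl, ha, hb, hd⟩ := hx
    obtain ⟨a', b', d', rfl, ha', hb', hd'⟩ := hy
    exact ⟨a + a', b + b', d + d', by abel, Submodule.add_mem _ ha ha',
      ⟨by rw [lie_add, hb.1, hb'.1, add_zero], by rw [lie_add, hb.2, hb'.2, add_zero]⟩,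
      by rw [map_add]; exact Submodule.add_mem _ hd hd'⟩
  | smul k x _ hx =>
    obtain ⟨a, b, d, rfl, ha, hb, hd⟩ := hx
    exact ⟨k • a, k • b, k • d, by rw [smul_add, smul_add], Submodule.smul_mem _ _ ha,
      ⟨by rw [lie_smul, hb.1, smul_zero], by rw [lie_smul, hb.2, smul_zero]⟩,
      by rw [LinearMap.map_smulₛₗ]; exact Submodule.smul_mem _ _ hd⟩

/-- Elements commuting with `h` preserve the line of the extremal weight vector. -/
theorem exists_lie_of_commute {W : G} (hW : ⁅T.z' C, W⁆ = 0) (hWh : ⁅W, A.h⁆ = 0) :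
    ∃ c : ℂ, ⁅W, A.X⁆ = c • A.X := by
  obtain ⟨a, b, d, rfl, ha, ⟨hb, hb'⟩, hd⟩ := A.exists_triangular hW
  have hconj_h : C.conj A.h = -A.h := by
    rw [h, C.conj_lie, C.conj_conj, lie_skew]
  have h1 : ⁅b, A.h⁆ = 0 := A.lie_eq_zero_of_H' hb hb' A.z'_h A.H'_h
  have h2 : ⁅d, A.h⁆ = -⁅a, A.h⁆ := by
    rw [add_lie, add_lie, h1, add_zero] at hWh
    exact eq_neg_of_add_eq_zero_right hWh
  -- Both ⁅d, h⁆ and its conjugate lie in `nPlus`, on which `B` vanishes; so ⁅d, h⁆ has norm zero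
  -- and is zero.
  have h3 : ⁅d, A.h⁆ ∈ A.nPlus := by
    rw [h2]; exact Submodule.neg_mem _ (A.nPlus_lie ha A.z'_h A.H'_h)
  have h4 : C.conj ⁅d, A.h⁆ ∈ A.nPlus := by
    rw [C.conj_lie, hconj_h, lie_neg]
    exact Submodule.neg_mem _ (A.nPlus_lie hd A.z'_h A.H'_h)
  have h5 : ⁅d, A.h⁆ = 0 := by
    by_contra h0
    exact B_K_ne_zero (A.z'_nPlus h3) h0 (A.B_nPlus h3 h4)
  have hdK : ⁅T.z' C, d⁆ = 0 := by
    have := T.conj_K C (A.z'_nPlus hd)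
    rwa [C.conj_conj] at this
  -- Since d̄ annihilates X, the norm of ⁅d, X⁆ is up to sign B(⁅d̄, d⁆, h) = B(d̄, ⁅d, h⁆) = 0.
  have h6 : ⁅d, A.X⁆ = 0 := by
    by_contra h0
    refine B_P_ne_zero (by rw [leibniz_lie, hdK, zero_lie, zero_add, A.z'_X]) h0 ?_
    have h7 : ⁅C.conj d, ⁅d, A.X⁆⁆ = ⁅⁅C.conj d, d⁆, A.X⁆ := by
      rw [leibniz_lie, A.nPlus_lie_X hd, lie_zero, add_zero]
    have h8 : C.B ⁅d, A.X⁆ ⁅C.conj d, C.conj A.X⁆ = -C.B ⁅C.conj d, ⁅d, A.X⁆⁆ (C.conj A.X) := by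
      rw [← lie_skew (C.conj d) ⁅d, A.X⁆, map_neg, LinearMap.neg_apply, neg_neg, ← C.B_inv ⁅d, A.X⁆]
    rw [C.conj_lie, h8, h7, C.B_inv]
    change -C.B ⁅C.conj d, d⁆ A.h = 0
    rw [C.B_inv, h5, map_zero, neg_zero]
  obtain ⟨c, hc⟩ := A.exists_lie_of_H' hb hb'
  exact ⟨c, by rw [add_lie, add_lie, A.nPlus_lie_X ha, h6, zero_add, add_zero, hc]⟩

end TorusData
end HermitianLie

/-! ### Construction of the Hermitian datum from the torus -/

namespace HermitianLie

variable {𝔤 G : Type*} [LieRing 𝔤] [LieAlgebra ℝ 𝔤] [LieRing G] [LieAlgebra ℂ G]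

namespace TorusData

variable {T : HermitianType 𝔤} {C : Complexification 𝔤 G} (A : TorusData T C)
  [FiniteDimensional ℂ G]

theorem conj_h : C.conj A.h = -A.h := by rw [h, C.conj_lie, C.conj_conj, lie_skew]

theorem B_h_z' : C.B A.h (T.z' C) = 1 := by
  rw [h, C.B_inv, ← lie_skew, T.conj_P C A.z'_X, neg_neg, A.B_X]

theorem h_ne_zero : A.h ≠ 0 := fun h0 => by
  have := A.B_h_z'
  rw [h0, map_zero, LinearMap.zero_apply] at this
  exact zero_ne_one this

/-- The eigenvalue of `ad h` on the extremal weight vector. -/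
def s : ℝ := -(C.B A.h (C.conj A.h)).re

theorem s_pos : 0 < A.s := by
  have := T.B_K_neg C A.z'_h A.h_ne_zero
  rw [s]; linarith

theorem h_lie_X : ⁅A.h, A.X⁆ = (A.s : ℂ) • A.X := by
  obtain ⟨c, hc⟩ := A.exists_lie_of_commute A.z'_h (lie_self _)
  have h1 : C.B ⁅A.h, A.X⁆ (C.conj A.X) = -C.B A.h (C.conj A.h) := by
    rw [C.B_inv, A.conj_h, map_neg, neg_neg]; rfl
  rw [hc, map_smul, LinearMap.smul_apply, A.B_X, smul_eq_mul, mul_one] at h1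
  rw [hc, h1, s, C.B_self_conj, Complex.ofReal_re, Complex.ofReal_neg]

/-- The top eigenspace of `ad h` is a line. -/
theorem exists_smul_of_h_lie {v : G} (hv : ⁅T.z' C, v⁆ = v) (hhv : ⁅A.h, v⁆ = (A.s : ℂ) • v) :
    ∃ c : ℂ, v = c • A.X := by
  have hX := T.conj_P C A.z'_X
  have hhX : ⁅A.h, C.conj A.X⁆ = -((A.s : ℂ) • C.conj A.X) := by
    have := congrArg C.conj A.h_lie_X
    rwa [C.conj_lie, A.conj_h, neg_lie, LinearMap.map_smulₛₗ, Complex.conj_ofReal,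
      neg_eq_iff_eq_neg] at this
  -- The element ⁅v, X̄⁆ commutes with h, so it maps X to a multiple of X. As ⁅v, X⁆ = 0, the same
  -- bracket equals ⁅h, v⁆ = s v.
  obtain ⟨c, hc⟩ := A.exists_lie_of_commute (W := ⁅v, C.conj A.X⁆)
    (by rw [leibniz_lie, hv, hX, lie_neg, add_neg_cancel])
    (by rw [← lie_skew, leibniz_lie, hhv, hhX, smul_lie, lie_neg, lie_smul, add_neg_cancel,
      neg_zero])
  have hvX : ⁅v, A.X⁆ = 0 := by
    have h2 : ⁅T.z' C, ⁅v, A.X⁆⁆ = (2 : ℂ) • ⁅v, A.X⁆ := by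
      rw [leibniz_lie, hv, A.z'_X, two_smul]
    have h3 := T.z'_cube C ⁅v, A.X⁆
    rw [h2, lie_smul, h2, lie_smul, lie_smul, h2, smul_smul, smul_smul] at h3
    have h4 : (6 : ℂ) • ⁅v, A.X⁆ = 0 := by
      rw [← sub_eq_zero, ← sub_smul] at h3
      norm_num at h3
      rw [h3, smul_zero]
    exact (smul_eq_zero.1 h4).resolve_left (by norm_num)
  have h1 : ⁅⁅v, C.conj A.X⁆, A.X⁆ = ⁅A.h, v⁆ := by
    rw [lie_lie, hvX, lie_zero, sub_zero, ← lie_skew (C.conj A.X) A.X, lie_neg, lie_skew]; rfl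
  rw [hc, hhv] at h1
  refine ⟨(A.s : ℂ)⁻¹ * c, ?_⟩
  rw [mul_smul, h1, smul_smul, inv_mul_cancel₀ (by exact_mod_cast A.s_pos.ne'), one_smul]

variable [FiniteDimensional ℝ 𝔤] [LieAlgebra.IsSimple ℝ 𝔤]

/-- Diagonalize `ad h` on 𝔭₊ in an orthonormal basis. A basis vector not orthogonal to X has the
eigenvalue s, so it is a multiple of X by simplicity of this eigenvalue; the factor has modulus one
and does not change h. -/
theorem exists_datum : ∃ (n : ℕ) (D : HermitianDatum G (Fin n)), D.τ = C.conj ∧ D.B = C.B ∧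
    D.z = T.z' C ∧ ∃ c : ℂ, D.X D.o = c • A.X := by
  have hP1 : ∀ {x}, x ∈ T.P C ↔ ⁅T.z' C, x⁆ = x := Iff.rfl
  obtain ⟨b, a, ho, hb⟩ := C.exists_eigenbasis (V := T.P C) (ε := 1) (fun x hx h0 => by
    rw [one_mul]; exact T.B_P_pos C hx h0) A.conj_h (fun x hx => by
      rw [hP1] at hx ⊢
      rw [leibniz_lie, A.z'_h, zero_lie, zero_add, hx])
  have hbX : ∀ i j, C.B (b i : G) (C.conj (b j : G)) = if i = j then 1 else 0 := fun i j => by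
    have := ho j i
    rw [Complex.ofReal_one, one_mul, C.B_symm] at this
    rw [this]
    exact if_congr eq_comm rfl rfl
  have hspan : ∀ x, x ∈ Submodule.span ℂ (Set.range fun i => (b i : G)) ↔ ⁅T.z' C, x⁆ = x :=
    fun x => by
    have h1 : Submodule.span ℂ (Set.range fun i => (b i : G)) = T.P C := by
      have h2 : (Set.range fun i => (b i : G)) = (T.P C).subtype '' Set.range b := by
        rw [← Set.range_comp]; rfl
      rw [h2, Submodule.span_image, b.span_eq, Submodule.map_top, Submodule.range_subtype]
    rw [h1]; rfl
  have hspan' : ∀ x, ⁅T.z' C, x⁆ = -x →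
      x ∈ Submodule.span ℂ (Set.range (C.conj ∘ fun i => (b i : G))) := fun x hx => by
    have h1 := (hspan _).2 (T.conj_N C hx)
    rw [← C.conj_conj x]
    generalize C.conj x = y at h1
    induction h1 using Submodule.span_induction with
    | mem y hy =>
      obtain ⟨i, rfl⟩ := hy
      exact Submodule.subset_span ⟨i, rfl⟩
    | zero => rw [map_zero]; exact Submodule.zero_mem _
    | add y w _ _ hy hw => rw [map_add]; exact Submodule.add_mem _ hy hw
    | smul k y _ hy => rw [LinearMap.map_smulₛₗ]; exact Submodule.smul_mem _ _ hy
  have hXP : A.X ∈ T.P C := A.z'_X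
  obtain ⟨o, ho'⟩ : ∃ o, b.repr ⟨A.X, hXP⟩ o ≠ 0 := by
    by_contra! h0
    have h1 : b.repr ⟨A.X, hXP⟩ = 0 := Finsupp.ext h0
    rw [LinearEquiv.map_eq_zero_iff] at h1
    exact A.X_ne_zero (congrArg Subtype.val h1)
  have hao : a o = A.s := by
    have h1 : C.B (⁅A.h, A.X⁆) (C.conj (b o : G)) = C.B A.X (C.conj ⁅A.h, (b o : G)⁆) := by
      rw [C.B_symm, C.B_symm A.X, C.B_conj_lie_of_conj_neg A.conj_h]
    have h2 : C.B A.X (C.conj (b o : G)) = b.repr ⟨A.X, hXP⟩ o := by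
      have h3 := congrArg (T.P C).subtype (b.sum_repr ⟨A.X, hXP⟩)
      rw [map_sum] at h3
      have h4 : A.X = ∑ i, b.repr ⟨A.X, hXP⟩ i • (b i : G) := h3.symm
      conv_lhs => rw [h4]
      simp only [map_sum, map_smul, LinearMap.sum_apply, LinearMap.smul_apply, hbX, smul_eq_mul,
        mul_ite, mul_one, mul_zero, Finset.sum_ite_eq', Finset.mem_univ, if_true]
    rw [A.h_lie_X, hb, LinearMap.map_smulₛₗ C.conj, Complex.conj_ofReal, map_smul, map_smul,
      LinearMap.smul_apply, smul_eq_mul, smul_eq_mul, h2] at h1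
    exact Complex.ofReal_injective (mul_right_cancel₀ ho' h1).symm
  have htop : ∀ i, a i = A.s → ∃ c : ℂ, (b i : G) = c • A.X := fun i hi =>
    A.exists_smul_of_h_lie (b i).2 (by rw [hb, hi])
  obtain ⟨c, hc⟩ := htop o hao
  have hcc : c * starRingEnd ℂ c = 1 := by
    have h1 := hbX o o
    rwa [if_pos rfl, hc, LinearMap.map_smulₛₗ C.conj, map_smul, map_smul, LinearMap.smul_apply,
      A.B_X, smul_eq_mul, smul_eq_mul, mul_one, mul_comm] at h1
  have hh : ⁅(b o : G), C.conj (b o : G)⁆ = A.h := by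
    rw [hc, LinearMap.map_smulₛₗ C.conj, smul_lie, lie_smul, smul_smul, hcc, one_smul]; rfl
  let D : HermitianDatum G (Fin (Module.finrank ℂ (T.P C))) :=
    { τ := C.conj
      τ_lie := C.conj_lie
      τ_τ := C.conj_conj
      B := C.B
      B_symm := C.B_symm
      B_inv := C.B_inv
      B_τ := C.B_conj
      z := T.z' C
      τ_z := T.conj_z' C
      X := fun i => b i
      z_X := fun i => (b i).2
      B_X := hbX
      decomp := fun x => by
        obtain ⟨k, p, n, e, hk, hp, hn⟩ := T.exists_graded C x
        exact ⟨k, p, n, e, hk, (hspan p).2 hp, hspan' n hn⟩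
      neg := fun x hx h0 => T.B_K_neg C hx h0
      irred := fun U hU hK h0 i => T.P_irred C U (fun u hu => (hspan u).1 (hU hu))
        (fun w hw u hu => hK w u hw hu) h0 (b i).2
      o := o
      a := a
      lie_h := fun i => by rw [hh, hb]
      a_inj := fun i hi => by
        obtain ⟨c', hc'⟩ := htop i (hi.trans hao)
        by_contra hne
        have h1 := hbX i o
        rw [if_neg hne, hc, hc', LinearMap.map_smulₛₗ C.conj, map_smul, map_smul,
          LinearMap.smul_apply, A.B_X, smul_eq_mul, smul_eq_mul, mul_one] at h1
        rcases mul_eq_zero.1 h1 with h2 | h2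
        · rw [h2, mul_zero] at hcc
          exact zero_ne_one hcc
        · rw [h2, zero_smul] at hc'
          exact b.ne_zero i (Subtype.ext hc') }
  exact ⟨_, D, rfl, rfl, rfl, c, hc⟩

end TorusData

namespace HermitianDatum

variable {n : ℕ} {D : HermitianDatum G (Fin n)} {T : HermitianType 𝔤} {C : Complexification 𝔤 G}

/-- In real rank greater than one, `opT 0` has a positive eigenvalue in degree two. -/
theorem exists_isEigenvalue_of_rank (hτ : D.τ = C.conj) (hz : D.z = T.z' C) {X Y : 𝔤}
    (hX : T.θ X = -X) (hY : T.θ Y = -Y) (hX0 : X ≠ 0) (hXY : ⁅X, Y⁆ = 0)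
    (hne : ∀ ρ : ℝ, Y ≠ ρ • X) : ∃ t, D.IsEigenvalue t := by
  refine D.exists_isEigenvalue.resolve_right fun h => ?_
  obtain ⟨x, hx, ex⟩ := T.exists_P C hX
  obtain ⟨y, hy, ey⟩ := T.exists_P C hY
  rw [← hz] at hx hy
  have h1 : ⁅x, D.τ y⁆ + ⁅D.τ x, y⁆ = 0 := by
    have h2 := C.e_lie X Y
    rw [hXY, C.e_zero, ex, ey, ← hτ, add_lie, lie_add, lie_add, D.lie_PP hx hy,
      D.lie_NN (D.z_τ_P hx) (D.z_τ_P hy), zero_add, add_zero] at h2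
    exact h2.symm
  have hx0 : x ≠ 0 := fun h0 => hX0 (C.e_injective (by
    rw [ex, h0, map_zero, add_zero, C.e_zero]))
  obtain ⟨ρ, hρ⟩ := D.exists_real_of_scalar h hx hy hx0 h1
  refine hne ρ (C.e_injective ?_)
  rw [ey, hρ, C.e_smul, ex, LinearMap.map_smulₛₗ, Complex.conj_ofReal, smul_add]

end HermitianDatum
end HermitianLie

/-! ### Matching the inducing ideals with the Fock model -/

namespace HermitianLie

variable {𝔤 G : Type*} [LieRing 𝔤] [LieAlgebra ℝ 𝔤] [LieRing G] [LieAlgebra ℂ G]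

namespace HermitianType

variable (T : HermitianType 𝔤) (C : Complexification 𝔤 G)

theorem θ_derivedK {X : 𝔤} (hX : X ∈ derivedK T.θ) : T.θ X = X := by
  induction hX using Submodule.span_induction with
  | mem D h =>
    obtain ⟨A, hA, A', hA', rfl⟩ := h
    exact (fixedPoints T.θ).lie_mem hA hA'
  | zero => exact map_zero _
  | add D D' _ _ h h' => rw [map_add, h, h']
  | smul a D _ h => rw [map_smul, h]

theorem B_z'_derivedK {X : 𝔤} (hX : X ∈ derivedK T.θ) : C.B (T.z' C) (C.e X) = 0 := by
  have h1 : killingForm ℝ 𝔤 T.z X = 0 := by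
    induction hX using Submodule.span_induction with
    | mem D h =>
      obtain ⟨A, hA, A', hA', rfl⟩ := h
      rw [← Complexification.killing_lie, T.z_k hA, map_zero, LinearMap.zero_apply]
    | zero => exact map_zero _
    | add D D' _ _ h h' => rw [map_add, h, h', add_zero]
    | smul a D _ h => rw [map_smul, h, smul_zero]
  rw [z', map_neg, LinearMap.neg_apply, map_smul, LinearMap.smul_apply, C.B_e, h1,
    Complex.ofReal_zero, smul_zero, neg_zero]

theorem B_z'_z' : C.B (T.z' C) (T.z' C) = ((-killingForm ℝ 𝔤 T.z T.z : ℝ) : ℂ) := by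
  rw [z']
  simp only [map_neg, map_smul, LinearMap.neg_apply, LinearMap.smul_apply, C.B_e, smul_eq_mul]
  push_cast
  linear_combination (killingForm ℝ 𝔤 T.z T.z : ℂ) * Complex.I_mul_I

theorem B_z'_z : C.B (T.z' C) (C.e T.z) = Complex.I * C.B (T.z' C) (T.z' C) := by
  rw [← T.I_z', map_smul, smul_eq_mul]

end HermitianType

namespace TorusData

variable {T : HermitianType 𝔤} {C : Complexification 𝔤 G} (A : TorusData T C)
  [FiniteDimensional ℂ G] [FiniteDimensional ℝ 𝔤] [LieAlgebra.IsSimple ℝ 𝔤]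

theorem z_mem : T.z ∈ A.𝔱 := A.maximal _ T.θ_z fun H => by
  rw [← lie_skew, T.z_k (A.θ_t H), neg_zero]

/-- The torus is spanned by z and its intersection with [𝔨, 𝔨]. Both sides vanish on the latter and
agree at z. This converts a scalar weight into the parameter r of the model. -/
theorem weight_eq {lam : A.𝔱 →ₗ[ℝ] ℂ} (hlam : ∀ H : A.𝔱, (H : 𝔤) ∈ derivedK T.θ → lam H = 0)
    {r : ℂ} (hr : lam ⟨T.z, A.z_mem⟩ = r * C.B (T.z' C) (C.e T.z)) (H : A.𝔱) :
    lam H = r * C.B (T.z' C) (C.e (H : 𝔤)) := by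
  obtain ⟨X, hX, a, e⟩ := T.exists_derivedK C A.z'_X A.X_ne_zero (A.θ_t H)
  have hX' : X = ((H - a • ⟨T.z, A.z_mem⟩ : A.𝔱) : 𝔤) := by
    change X = (H : 𝔤) - a • T.z
    rw [e, add_sub_cancel_right]
  have h1 := hlam (H - a • ⟨T.z, A.z_mem⟩) (hX' ▸ hX)
  rw [map_sub, map_smul, hr, sub_eq_zero] at h1
  rw [h1, e, C.e_add, map_add, T.B_z'_derivedK C hX, zero_add, C.e_smul, map_smul,
    Complex.real_smul, smul_eq_mul]
  ring

/-- The left ideal of a scalar lowest weight module is triangular. -/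
theorem isTriangular_scalar {J : Ideal (UniversalEnvelopingAlgebra ℂ G)} {lam : A.𝔱 →ₗ[ℝ] ℂ}
    {r : ℂ} (hr : ∀ H : A.𝔱, lam H = r * C.B (T.z' C) (C.e (H : 𝔤)))
    (hN : ∀ Y, ⁅T.z' C, Y⁆ = -Y → UniversalEnvelopingAlgebra.ι ℂ Y ∈ J)
    (hD : ∀ X ∈ derivedK T.θ, UniversalEnvelopingAlgebra.ι ℂ (C.e X) ∈ J)
    (hH : ∀ H : A.𝔱, UniversalEnvelopingAlgebra.ι ℂ (C.e (H : 𝔤)) - algebraMap ℂ _ (lam H) ∈ J) :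
    IsTriangular J (T.z' C) (r * C.B (T.z' C) (T.z' C)) := by
  have hz := hH ⟨T.z, A.z_mem⟩
  rw [hr] at hz
  change UniversalEnvelopingAlgebra.ι ℂ (C.e T.z) -
    algebraMap ℂ _ (r * C.B (T.z' C) (C.e T.z)) ∈ J at hz
  have hsm : ∀ (a : ℂ) u, u ∈ J → a • u ∈ J := fun a u hu => by
    rw [Algebra.smul_def]; exact J.mul_mem_left _ hu
  have hk : ∀ X, T.θ X = X → ∃ b : ℂ, UniversalEnvelopingAlgebra.ι ℂ (C.e X) -
      algebraMap ℂ _ b ∈ J := fun X hX => by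
    obtain ⟨Y, hY, a, rfl⟩ := T.exists_derivedK C A.z'_X A.X_ne_zero hX
    refine ⟨a * (r * C.B (T.z' C) (C.e T.z)), ?_⟩
    have h2 := J.add_mem (hD Y hY) (hsm a _ hz)
    rw [C.e_add, C.e_smul, map_add, map_smul, map_mul (algebraMap ℂ _) (a : ℂ), ← Algebra.smul_def,
      add_sub_assoc, ← smul_sub]
    exact h2
  refine ⟨fun x => ?_, fun x c hc hx => ?_, fun x hx => ?_, ?_⟩
  · obtain ⟨k, p, n, rfl, hk, hp, hn⟩ := T.exists_graded C x
    refine Submodule.add_mem _ (Submodule.add_mem _ (Submodule.subset_span ⟨0, ?_⟩)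
      (Submodule.subset_span ⟨1, ?_⟩)) (Submodule.subset_span ⟨-1, ?_⟩)
    · rw [hk, Complex.ofReal_zero, zero_smul]
    · rw [hp, Complex.ofReal_one, one_smul]
    · rw [hn, Complex.ofReal_neg, Complex.ofReal_one, neg_smul, one_smul]
  · have h3 := T.z'_cube C x
    simp only [hx, lie_smul, smul_smul] at h3
    rw [← sub_eq_zero, ← sub_smul, smul_eq_zero] at h3
    rcases h3 with h3 | h3
    · have h4 : c * (c - 1) * (c + 1) = 0 := by
        have h5 : ((c * (c - 1) * (c + 1) : ℝ) : ℂ) = 0 := by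
          push_cast
          linear_combination h3
        exact_mod_cast h5
      -- The only negative eigenvalue of `ad z'` is -1, so these elements lie in 𝔭₋.
      have h6 : c = -1 := by
        rcases mul_eq_zero.1 h4 with h | h
        · rcases mul_eq_zero.1 h with h | h <;> linarith
        · linarith
      refine hN x ?_
      rw [hx, h6, Complex.ofReal_neg, Complex.ofReal_one, neg_smul, one_smul]
    · rw [h3, map_zero]; exact J.zero_mem
  · obtain ⟨h1, h2⟩ := (T.z'_eq_zero C).1 hx
    obtain ⟨b, hb⟩ := hk _ h1
    obtain ⟨b', hb'⟩ := hk _ h2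
    refine ⟨b + Complex.I * b', ?_⟩
    have h3 := J.add_mem hb (hsm Complex.I _ hb')
    rw [smul_sub, ← map_smul, Algebra.smul_def Complex.I (algebraMap ℂ _ b'), ← map_mul,
      sub_add_sub_comm, ← map_add, ← map_add, C.re_add_im] at h3
    exact h3
  · have h1 := hsm (-Complex.I) _ hz
    have h2 : (-Complex.I) • C.e T.z = T.z' C := by rw [HermitianType.z', neg_smul]
    have h3 : (-Complex.I) * (r * C.B (T.z' C) (C.e T.z)) = r * C.B (T.z' C) (T.z' C) := by
      rw [T.B_z'_z]
      linear_combination (-(r * C.B (T.z' C) (T.z' C))) * Complex.I_mul_I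
    rw [smul_sub, ← map_smul, h2, Algebra.smul_def, ← map_mul, h3] at h1
    exact h1

variable {n : ℕ} {D : HermitianDatum G (Fin n)} {r : ℝ}

theorem fock_K_one {x : G} (hx : ⁅D.z, x⁆ = 0) : D.fock r x 1 = ((r : ℂ) * D.B D.z x) • 1 := by
  rw [D.fock_one, D.ell_K hx, zero_add]

theorem ι_sub_mem_annIdeal {x : G} {a : ℂ} (hx : ⁅D.z, x⁆ = 0) (ha : a = r * D.B D.z x) :
    UniversalEnvelopingAlgebra.ι ℂ x - algebraMap ℂ _ a ∈ D.annIdeal r := by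
  rw [HermitianDatum.mem_annIdeal, map_sub, LinearMap.sub_apply, D.env_ι, fock_K_one hx, ha,
    AlgHom.commutes, Module.algebraMap_end_apply, sub_self]
  exact Submodule.zero_mem _

theorem ι_N_mem_annIdeal {x : G} (hx : ⁅D.z, x⁆ = -x) :
    UniversalEnvelopingAlgebra.ι ℂ x ∈ D.annIdeal r := by
  rw [HermitianDatum.mem_annIdeal, D.env_ι, D.fock_one, D.ell_N hx, D.B_KN D.z_z hx, mul_zero,
    zero_smul, add_zero]
  exact Submodule.zero_mem _

theorem ι_derivedK_mem_annIdeal (hB : D.B = C.B) (hz : D.z = T.z' C) {X : 𝔤}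
    (hX : X ∈ derivedK T.θ) : UniversalEnvelopingAlgebra.ι ℂ (C.e X) ∈ D.annIdeal r := by
  have h1 : ⁅D.z, C.e X⁆ = 0 := by
    rw [hz]
    refine (T.z'_eq_zero C).2 ?_
    rw [(C.parts_e X).1, (C.parts_e X).2, map_zero]; exact ⟨T.θ_derivedK hX, rfl⟩
  have h2 := ι_sub_mem_annIdeal (r := r) (a := 0) h1 (by
    rw [hB, hz, T.B_z'_derivedK C hX, mul_zero])
  rwa [map_zero, sub_zero] at h2

/-! ### Invariant forms -/

theorem isPos_of_unitarizable {J : Ideal (UniversalEnvelopingAlgebra ℂ G)}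
    (hτ : D.τ = C.conj)
    (hJ : IsTriangular J D.z (r * D.B D.z D.z)) (hJr : J ≤ D.annIdeal r)
    (F : EnvQuot (D.annIdeal r) →ₗ⋆[ℂ] EnvQuot (D.annIdeal r) →ₗ[ℂ] ℂ)
    (hsymm : ∀ v w, F w v = starRingEnd ℂ (F v w)) (hpos : ∀ v, v ≠ 0 → 0 < (F v v).re)
    (hinv : ∀ (X : 𝔤) v w, F ⁅C.e X, v⁆ w = -F v ⁅C.e X, w⁆) : D.IsPos r := by
  refine HermitianDatum.isPos_of_form hJ hJr F hpos hsymm fun x v w => ?_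
  rw [hτ, C.conj_apply]
  conv_lhs => rw [← C.re_add_im x]
  rw [add_lie, smul_lie, map_add, LinearMap.map_smulₛₗ F, LinearMap.add_apply,
    LinearMap.smul_apply, hinv, hinv, Complex.conj_I, add_lie, smul_lie, map_add, map_smul,
    C.e_neg, neg_lie, map_neg, smul_eq_mul, smul_eq_mul]
  ring

/-! ### The highest vectors of the components -/

section Compact

variable {K : LieSubalgebra ℂ G} {J : Ideal (UniversalEnvelopingAlgebra ℂ K)}

theorem H'_mem (hK : ∀ x, x ∈ K ↔ ⁅T.z' C, x⁆ = 0) : A.H' ∈ K := (hK _).2 A.z'_H'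

theorem e_mem (hK : ∀ x, x ∈ K ↔ ⁅T.z' C, x⁆ = 0) (H : A.𝔱) : C.e (H : 𝔤) ∈ K :=
  (hK _).2 (A.z'_e H)

/-- The left ideal of a highest weight module of `𝔨` is triangular. -/
theorem isTriangular_compact (hK : ∀ x, x ∈ K ↔ ⁅T.z' C, x⁆ = 0) {mu : A.𝔱 →ₗ[ℝ] ℂ}
    (hpos : ∀ (α : A.𝔱 →ₗ[ℝ] ℂ) (x : K), (x : G) ≠ 0 → C.IsWeight A.𝔱 α x → 0 < (α A.H₀).im →
      UniversalEnvelopingAlgebra.ι ℂ x ∈ J)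
    (hH : ∀ (H : A.𝔱) (x : K), (x : G) = C.e (H : 𝔤) →
      UniversalEnvelopingAlgebra.ι ℂ x - algebraMap ℂ _ (mu H) ∈ J) :
    IsTriangular J (⟨A.H', A.H'_mem hK⟩ : K) (Complex.I * mu A.H₀) := by
  have hsm : ∀ (a : ℂ) u, u ∈ J → a • u ∈ J := fun a u hu => by
    rw [Algebra.smul_def]; exact J.mul_mem_left _ hu
  have hcomb : ∀ (H H' : A.𝔱) (x : K), (x : G) = C.e (H : 𝔤) + Complex.I • C.e (H' : 𝔤) →
      UniversalEnvelopingAlgebra.ι ℂ x - algebraMap ℂ _ (mu H + Complex.I * mu H') ∈ J :=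
    fun H H' x hx => by
    have h3 := J.add_mem (hH H ⟨_, A.e_mem hK H⟩ rfl)
      (hsm Complex.I _ (hH H' ⟨_, A.e_mem hK H'⟩ rfl))
    rw [smul_sub, ← map_smul, Algebra.smul_def Complex.I (algebraMap ℂ _ (mu H')), ← map_mul,
      sub_add_sub_comm, ← map_add, ← map_add] at h3
    have h4 : x = (⟨_, A.e_mem hK H⟩ : K) + Complex.I • (⟨_, A.e_mem hK H'⟩ : K) := Subtype.ext hx
    rw [h4]
    exact h3
  refine ⟨fun x => ?_, fun x c hc hx => ?_, fun x hx => ?_, ?_⟩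
  · have h1 := C.mem_span_eigen (V := Module.End.eigenspace (LieAlgebra.ad ℂ G (T.z' C)) 0)
      (ε := -1) (fun w hw h0 => by
        rw [Module.End.mem_eigenspace_iff, LieAlgebra.ad_apply, zero_smul] at hw
        have := T.B_K_neg C hw h0
        linarith) A.conj_H' (fun w hw => by
        rw [Module.End.mem_eigenspace_iff, LieAlgebra.ad_apply, zero_smul] at hw ⊢
        rw [leibniz_lie, A.z'_H', hw, zero_lie, lie_zero, add_zero]) (x := x) (by
        rw [Module.End.mem_eigenspace_iff, LieAlgebra.ad_apply, zero_smul]; exact (hK _).1 x.2)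
    have h2 : ∃ h : (x : G) ∈ K, (⟨x, h⟩ : K) ∈ Submodule.span ℂ
        {y : K | ∃ c : ℝ, ⁅(⟨A.H', A.H'_mem hK⟩ : K), y⁆ = (c : ℂ) • y} := by
      generalize (x : G) = y at h1
      induction h1 using Submodule.span_induction with
      | mem y hy =>
        obtain ⟨hy, c, hc⟩ := hy
        rw [Module.End.mem_eigenspace_iff, LieAlgebra.ad_apply, zero_smul] at hy
        exact ⟨(hK _).2 hy, Submodule.subset_span ⟨c, Subtype.ext hc⟩⟩
      | zero => exact ⟨K.zero_mem, Submodule.zero_mem _⟩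
      | add y w _ _ hy hw =>
        obtain ⟨hy, hy'⟩ := hy
        obtain ⟨hw, hw'⟩ := hw
        exact ⟨K.add_mem hy hw, Submodule.add_mem _ hy' hw'⟩
      | smul a y _ hy =>
        obtain ⟨hy, hy'⟩ := hy
        exact ⟨K.smul_mem a hy, Submodule.smul_mem _ a hy'⟩
    exact h2.2
  -- Negative eigenvectors of `ad H'` are combinations of weight vectors with Im α(H₀) > 0, that is,
  -- of positive root vectors.
  · have h1 := A.mem_span_K (x := x) ((hK _).1 x.2) (c := c) (congrArg Subtype.val hx)
    have h2 : ∃ h : (x : G) ∈ K, UniversalEnvelopingAlgebra.ι ℂ (⟨x, h⟩ : K) ∈ J := by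
      clear hx
      generalize (x : G) = y at h1
      induction h1 using Submodule.span_induction with
      | mem y hy =>
        obtain ⟨hy, hy0, α, hα, e⟩ := hy
        exact ⟨(hK _).2 hy, hpos α ⟨y, (hK _).2 hy⟩ hy0 hα (by linarith)⟩
      | zero =>
        refine ⟨K.zero_mem, ?_⟩
        rw [show (⟨0, K.zero_mem⟩ : K) = 0 from rfl, map_zero]; exact J.zero_mem
      | add y w _ _ hy hw =>
        obtain ⟨hy, hy'⟩ := hy
        obtain ⟨hw, hw'⟩ := hw
        refine ⟨K.add_mem hy hw, ?_⟩
        rw [show (⟨y + w, K.add_mem hy hw⟩ : K) = ⟨y, hy⟩ + ⟨w, hw⟩ from rfl, map_add]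
        exact J.add_mem hy' hw'
      | smul a y _ hy =>
        obtain ⟨hy, hy'⟩ := hy
        refine ⟨K.smul_mem a hy, ?_⟩
        rw [show (⟨a • y, K.smul_mem a hy⟩ : K) = a • (⟨y, hy⟩ : K) from rfl, map_smul]
        exact hsm _ _ hy'
    exact h2.2
  · obtain ⟨h1, h2⟩ := A.parts_mem_of_H' ((hK _).1 x.2) (congrArg Subtype.val hx)
    exact ⟨_, hcomb ⟨_, h1⟩ ⟨_, h2⟩ x (C.re_add_im _).symm⟩
  · have := hcomb 0 A.H₀ ⟨A.H', A.H'_mem hK⟩ (by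
      change A.H' = C.e 0 + _
      rw [C.e_zero, zero_add]; rfl)
    rwa [map_zero, zero_add] at this

/-- An element of degree zero acts as a derivation, up to the scalar r B(z, x) by which it acts on
1. -/
theorem fock_X_pow {x : G} {c : ℂ} (hz : ⁅D.z, x⁆ = 0) (hx : ⁅x, D.X D.o⁆ = c • D.X D.o) (m : ℕ) :
    D.fock r x (MvPolynomial.X D.o ^ m) =
      (m * c + r * D.B D.z x) • MvPolynomial.X D.o ^ m := by
  induction m with
  | zero => rw [pow_zero, fock_K_one hz, Nat.cast_zero, zero_mul, zero_add]
  | succ m ih =>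
    rw [pow_succ', D.fock_X_mul, ih, hx, D.fock_smul, LinearMap.smul_apply, D.fock_X, mul_smul_comm,
      ← add_smul]
    congr 1
    push_cast
    ring

theorem ι_sub_mem_annIdealK {x : K} {a c : ℂ} {m : ℕ} (hz : ⁅D.z, (x : G)⁆ = 0)
    (hx : ⁅(x : G), D.X D.o⁆ = c • D.X D.o) (ha : a = m * c + r * D.B D.z x) :
    UniversalEnvelopingAlgebra.ι ℂ x - algebraMap ℂ _ a ∈ D.annIdealK r K m := by
  rw [HermitianDatum.mem_annIdealK, map_sub, LinearMap.sub_apply, D.envK_ι, fock_X_pow hz hx, ha,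
    AlgHom.commutes, Module.algebraMap_end_apply, sub_self]
  exact Submodule.zero_mem _

/-- A positive root vector annihilates the extremal vector, and is orthogonal to z' because their
eigenvalues under `ad H'` do not cancel. Both terms of its action on the powers are therefore zero.
-/
theorem ι_pos_mem_annIdealK (hB : D.B = C.B) (hz : D.z = T.z' C) {c : ℂ} (hX : D.X D.o = c • A.X)
    (hK : ∀ x, x ∈ K ↔ ⁅T.z' C, x⁆ = 0) {α : A.𝔱 →ₗ[ℝ] ℂ} {x : K} (hα : C.IsWeight A.𝔱 α x)
    (hpos : 0 < (α A.H₀).im) (m : ℕ) :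
    UniversalEnvelopingAlgebra.ι ℂ x ∈ D.annIdealK r K m := by
  by_cases h0 : (x : G) = 0
  · rw [show x = 0 from Subtype.ext h0, map_zero]; exact Ideal.zero_mem _
  have hxz := (hK _).1 x.2
  have h1 := A.H'_lie hα (B_K_ne_zero hxz h0)
  have h2 := A.lie_X_of_neg hxz h1 (by linarith)
  have h3 : C.B (T.z' C) x = 0 := A.B_eq_zero_of_eigen (c := 0) (by
    rw [← lie_skew, A.z'_H', neg_zero, Complex.ofReal_zero, zero_smul]) h1 (by linarith)
  have h4 := ι_sub_mem_annIdealK (r := r) (D := D) (x := x) (a := 0) (c := 0) (m := m)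
    (by rw [hz, hxz]) (by rw [hX, lie_smul, h2, smul_zero, zero_smul])
    (by rw [hB, hz, h3, mul_zero, mul_zero, add_zero])
  rwa [map_zero, sub_zero] at h4

theorem ι_t_mem_annIdealK (hB : D.B = C.B) (hz : D.z = T.z' C) {c : ℂ} (hX : D.X D.o = c • A.X)
    {lam : A.𝔱 →ₗ[ℝ] ℂ} (hr : ∀ H : A.𝔱, lam H = r * C.B (T.z' C) (C.e (H : 𝔤)))
    {H : A.𝔱} {x : K} (hx : (x : G) = C.e (H : 𝔤)) (m : ℕ) :
    UniversalEnvelopingAlgebra.ι ℂ x - algebraMap ℂ _ ((lam + m • A.β) H) ∈ D.annIdealK r K m := by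
  refine ι_sub_mem_annIdealK (c := A.β H) ?_ ?_ ?_
  · rw [hz, hx, A.z'_e]
  · rw [hX, lie_smul, hx, A.weight, smul_comm]
  · rw [hB, hz, hx, LinearMap.add_apply, LinearMap.smul_apply, hr, nsmul_eq_mul, add_comm]

end Compact

end TorusData
end HermitianLie

/-! ### From the concrete data of the statement to the abstract setting -/

namespace HermitianLie

variable {𝔤 : Type*} [LieRing 𝔤] [LieAlgebra ℝ 𝔤]

/-! ### The standard complexification -/

/-- The real part of an element of the complexification. -/
def rePart : ℂ ⊗[ℝ] 𝔤 →ₗ[ℝ] 𝔤 :=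
  (TensorProduct.lid ℝ 𝔤).toLinearMap ∘ₗ TensorProduct.map Complex.reLm LinearMap.id

/-- The imaginary part of an element of the complexification. -/
def imPart : ℂ ⊗[ℝ] 𝔤 →ₗ[ℝ] 𝔤 :=
  (TensorProduct.lid ℝ 𝔤).toLinearMap ∘ₗ TensorProduct.map Complex.imLm LinearMap.id

theorem rePart_tmul (c : ℂ) (X : 𝔤) : rePart (c ⊗ₜ[ℝ] X) = c.re • X := by
  simp [rePart]

theorem imPart_tmul (c : ℂ) (X : 𝔤) : imPart (c ⊗ₜ[ℝ] X) = c.im • X := by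
  simp [imPart]

theorem tmul_eq (c : ℂ) (X : 𝔤) : c ⊗ₜ[ℝ] X = c • ((1 : ℂ) ⊗ₜ[ℝ] X) := by
  rw [TensorProduct.smul_tmul', smul_eq_mul, mul_one]

theorem one_tmul_smul (a : ℝ) (X : 𝔤) : (1 : ℂ) ⊗ₜ[ℝ] (a • X) = (a : ℂ) • ((1 : ℂ) ⊗ₜ[ℝ] X) := by
  rw [← TensorProduct.smul_tmul, ← tmul_eq]
  congr 1
  simp

theorem re_add_im (x : ℂ ⊗[ℝ] 𝔤) :
    (1 : ℂ) ⊗ₜ[ℝ] rePart x + Complex.I • ((1 : ℂ) ⊗ₜ[ℝ] imPart x) = x := by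
  induction x with
  | zero => simp
  | tmul c X =>
    rw [rePart_tmul, imPart_tmul, one_tmul_smul, one_tmul_smul, ← mul_smul, ← add_smul, tmul_eq c X]
    congr 1
    rw [mul_comm]; exact Complex.re_add_im c
  | add x y hx hy =>
    rw [map_add, map_add, TensorProduct.tmul_add, TensorProduct.tmul_add]
    conv_rhs => rw [← hx, ← hy]
    module

variable (𝔤) in
/-- The complexification `ℂ ⊗ 𝔤`. -/
def stdComplexification [FiniteDimensional ℝ 𝔤] : Complexification 𝔤 (ℂ ⊗[ℝ] 𝔤) where
  e X := (1 : ℂ) ⊗ₜ[ℝ] X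
  e_add X Y := TensorProduct.tmul_add _ _ _
  e_smul a X := one_tmul_smul a X
  e_lie X Y := by
    refine Eq.trans ?_ (LieAlgebra.ExtendScalars.bracket_tmul ℝ ℂ 𝔤 𝔤 1 1 X Y).symm
    rw [one_mul]
  re := rePart
  im := imPart
  re_add_im := re_add_im
  re_e X Y := by rw [map_add, ← tmul_eq, rePart_tmul, rePart_tmul]; simp
  im_e X Y := by rw [map_add, ← tmul_eq, imPart_tmul, imPart_tmul]; simp
  B := killingForm ℂ (ℂ ⊗[ℝ] 𝔤)
  B_symm := LieModule.traceForm_comm ℂ (ℂ ⊗[ℝ] 𝔤) (ℂ ⊗[ℝ] 𝔤)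
  B_inv := LieModule.traceForm_apply_lie_apply ℂ (ℂ ⊗[ℝ] 𝔤) (ℂ ⊗[ℝ] 𝔤)
  B_e X Y := by
    have h := LinearMap.congr_fun (LinearMap.congr_fun
      (LieModule.traceForm_baseChange (R := ℝ) (L := 𝔤) (M := 𝔤) ℂ) ((1 : ℂ) ⊗ₜ[ℝ] X)) ((1 : ℂ) ⊗ₜ[ℝ] Y)
    refine Eq.trans ?_ (h.trans ?_)
    · rfl
    · simp

theorem stdComplexification_e [FiniteDimensional ℝ 𝔤] (X : 𝔤) :
    (stdComplexification 𝔤).e X = (1 : ℂ) ⊗ₜ[ℝ] X := rfl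

theorem mem_baseChange_iff (S : Submodule ℝ 𝔤) {x : ℂ ⊗[ℝ] 𝔤} :
    x ∈ S.baseChange ℂ ↔ rePart x ∈ S ∧ imPart x ∈ S := by
  constructor
  · intro hx
    rw [Submodule.baseChange_eq_span] at hx
    induction hx using Submodule.span_induction with
    | mem x hx =>
      obtain ⟨X, hX, rfl⟩ := hx
      change rePart ((1 : ℂ) ⊗ₜ[ℝ] X) ∈ S ∧ imPart ((1 : ℂ) ⊗ₜ[ℝ] X) ∈ S
      rw [rePart_tmul, imPart_tmul]
      exact ⟨S.smul_mem _ hX, S.smul_mem _ hX⟩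
    | zero => rw [map_zero, map_zero]; exact ⟨S.zero_mem, S.zero_mem⟩
    | add x y _ _ hx hy =>
      rw [map_add, map_add]; exact ⟨S.add_mem hx.1 hy.1, S.add_mem hx.2 hy.2⟩
    | smul c x _ hx =>
      rw [← re_add_im x, smul_add, smul_smul, ← tmul_eq, ← tmul_eq, map_add, map_add, rePart_tmul,
        rePart_tmul, imPart_tmul, imPart_tmul]
      exact ⟨S.add_mem (S.smul_mem _ hx.1) (S.smul_mem _ hx.2),
        S.add_mem (S.smul_mem _ hx.1) (S.smul_mem _ hx.2)⟩
  · rintro ⟨h1, h2⟩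
    rw [← re_add_im x]
    exact Submodule.add_mem _ (Submodule.tmul_mem_baseChange_of_mem _ h1)
      (Submodule.smul_mem _ _ (Submodule.tmul_mem_baseChange_of_mem _ h2))

theorem mem_weightSpace {𝔱 : LieSubalgebra ℝ 𝔤} [FiniteDimensional ℝ 𝔤] {α : 𝔱 →ₗ[ℝ] ℂ}
    {x : ℂ ⊗[ℝ] 𝔤} : x ∈ weightSpace 𝔱 α ↔ (stdComplexification 𝔤).IsWeight 𝔱 α x := by
  rw [weightSpace, Submodule.mem_iInf]
  exact forall_congr' fun H => Module.End.mem_eigenspace_iff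

namespace HermitianType

variable (T : HermitianType 𝔤) [FiniteDimensional ℝ 𝔤]

theorem std_z' : T.z' (stdComplexification 𝔤) = (-Complex.I) ⊗ₜ[ℝ] T.z := by
  rw [z', stdComplexification_e, ← tmul_eq, TensorProduct.neg_tmul]

theorem mem_fixedPointsC {x : ℂ ⊗[ℝ] 𝔤} :
    x ∈ fixedPointsC T.θ ↔ ⁅T.z' (stdComplexification 𝔤), x⁆ = 0 :=
  (mem_baseChange_iff (fixedPoints T.θ).toSubmodule).trans (T.z'_eq_zero (stdComplexification 𝔤) (x := x)).symm

theorem mem_pEigen {x : ℂ ⊗[ℝ] 𝔤} {s : ℂ} (hs : s ≠ 0) :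
    x ∈ pEigen T.θ T.z s ↔ ⁅T.z' (stdComplexification 𝔤), x⁆ = s • x := by
  rw [pEigen, Submodule.mem_inf, Module.End.mem_eigenspace_iff, ← T.std_z']
  refine ⟨fun h => h.2, fun h => ⟨?_, h⟩⟩
  exact (mem_baseChange_iff (noncompactPart T.θ)).2 (T.θ_of_eigen _ hs h)

theorem mem_pPlus {x : ℂ ⊗[ℝ] 𝔤} :
    x ∈ pPlus T.θ T.z ↔ ⁅T.z' (stdComplexification 𝔤), x⁆ = x := by
  rw [pPlus, T.mem_pEigen one_ne_zero, one_smul]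

theorem mem_pMinus {x : ℂ ⊗[ℝ] 𝔤} :
    x ∈ pMinus T.θ T.z ↔ ⁅T.z' (stdComplexification 𝔤), x⁆ = -x := by
  rw [pMinus, T.mem_pEigen (neg_ne_zero.2 one_ne_zero), neg_smul, one_smul]

/-! ### Cartan subalgebras of the maximal compact subalgebra -/

variable {𝔱 : LieSubalgebra ℝ 𝔤}

/-- Operators ad x with x ∈ 𝔨 are skew for the Killing form, which is definite on 𝔨. Hence (ad x)²y
= 0 implies ⁅x, y⁆ = 0, and nilpotency descends to commutativity. -/
theorem lie_eq_zero_of_cartan (h𝔱 : 𝔱 ≤ fixedPoints T.θ)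
    (hCartan : (𝔱.comap (fixedPoints T.θ).incl).IsCartanSubalgebra) (H H' : 𝔱) :
    ⁅(H : 𝔤), (H' : 𝔤)⁆ = 0 := by
  have := hCartan.nilpotent
  obtain ⟨k, hk⟩ := LieModule.exists_forall_pow_toEnd_eq_zero ℝ
    (𝔱.comap (fixedPoints T.θ).incl) (𝔱.comap (fixedPoints T.θ).incl)
  have h1 : ∀ (k : ℕ) (x y : 𝔱.comap (fixedPoints T.θ).incl),
      (LieModule.toEnd ℝ _ (𝔱.comap (fixedPoints T.θ).incl) x ^ k) y = 0 →
      ⁅((x : fixedPoints T.θ) : 𝔤), ((y : fixedPoints T.θ) : 𝔤)⁆ = 0 := fun k => by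
    induction k with
    | zero =>
      intro x y hy
      have hy' : ((y : fixedPoints T.θ) : 𝔤) = 0 :=
        congrArg (fun w : 𝔱.comap (fixedPoints T.θ).incl => ((w : fixedPoints T.θ) : 𝔤)) hy
      rw [hy', lie_zero]
    | succ k ih =>
      intro x y hy
      rw [pow_succ, Module.End.mul_apply] at hy
      have h2 := ih x _ hy
      change ⁅((x : fixedPoints T.θ) : 𝔤),
        ⁅((x : fixedPoints T.θ) : 𝔤), ((y : fixedPoints T.θ) : 𝔤)⁆⁆ = 0 at h2
      by_contra h0
      have h3 := T.killing_neg ((fixedPoints T.θ).lie_mem x.1.2 y.1.2) h0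
      have h4 : ∀ a b w : 𝔤, killingForm ℝ 𝔤 ⁅a, b⁆ w = -killingForm ℝ 𝔤 b ⁅a, w⁆ := fun a b w => by
        rw [← lie_skew, map_neg, LinearMap.neg_apply, Complexification.killing_lie]
      rw [h4, h2, map_zero, neg_zero] at h3
      exact lt_irrefl _ h3
  exact h1 k ⟨⟨H, h𝔱 H.2⟩, H.2⟩ ⟨⟨H', h𝔱 H'.2⟩, H'.2⟩ (by rw [hk]; rfl)

/-- An element of 𝔨 that commutes with 𝔱 normalizes it, and 𝔱 is its own normalizer in 𝔨. -/
theorem mem_of_cartan (h𝔱 : 𝔱 ≤ fixedPoints T.θ)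
    (hCartan : (𝔱.comap (fixedPoints T.θ).incl).IsCartanSubalgebra) (Y : 𝔤) (hY : T.θ Y = Y)
    (h : ∀ H : 𝔱, ⁅(H : 𝔤), Y⁆ = 0) : Y ∈ 𝔱 := by
  have h1 : (⟨Y, hY⟩ : fixedPoints T.θ) ∈ (𝔱.comap (fixedPoints T.θ).incl).normalizer := by
    rw [LieSubalgebra.mem_normalizer_iff]
    intro y hy
    have h2 : ⁅(⟨Y, hY⟩ : fixedPoints T.θ), y⁆ = 0 := Subtype.ext (by
      change ⁅Y, (y : 𝔤)⁆ = 0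
      rw [← lie_skew, h ⟨y, hy⟩, neg_zero])
    rw [h2]
    exact LieSubalgebra.zero_mem _
  rw [hCartan.self_normalizing] at h1
  exact h1

/-- The torus data attached to a Cartan subalgebra and a highest root. -/
theorem exists_extremal {𝓟 : Set (𝔱 →ₗ[ℝ] ℂ)} {β : 𝔱 →ₗ[ℝ] ℂ} {H₀ : 𝔱}
    (hP : ∀ α ∈ 𝓟, 0 < (α H₀).im) (hβ : IsHighestRoot T.θ T.z 𝔱 𝓟 β) :
    (∃ X, ⁅T.z' (stdComplexification 𝔤), X⁆ = X ∧
      (stdComplexification 𝔤).B X ((stdComplexification 𝔤).conj X) = 1 ∧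
      (stdComplexification 𝔤).IsWeight 𝔱 β X) ∧
    ∀ γ x, ⁅T.z' (stdComplexification 𝔤), x⁆ = x → x ≠ 0 →
      (stdComplexification 𝔤).IsWeight 𝔱 γ x → (γ H₀).im ≤ (β H₀).im := by
  constructor
  · obtain ⟨X, hX, hX0, hXw⟩ := hβ.1
    rw [T.mem_pPlus] at hX
    rw [mem_weightSpace] at hXw
    have hN := T.B_P_pos _ hX hX0
    set N := ((stdComplexification 𝔤).B X ((stdComplexification 𝔤).conj X)).re with hNdef
    have hN' : (stdComplexification 𝔤).B X ((stdComplexification 𝔤).conj X) = (N : ℂ) := by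
      rw [hNdef, Complexification.B_self_conj, Complex.ofReal_re]
    -- Any highest root vector, divided by its length.
    refine ⟨((Real.sqrt N)⁻¹ : ℂ) • X, ?_, ?_, fun H => ?_⟩
    · have h1 := congrArg (fun y => ((Real.sqrt N)⁻¹ : ℂ) • y) hX
      exact (lie_smul ((Real.sqrt N)⁻¹ : ℂ) (T.z' (stdComplexification 𝔤)) X).trans h1
    · rw [LinearMap.map_smulₛₗ (stdComplexification 𝔤).conj, map_smul, map_smul,
        LinearMap.smul_apply, hN', smul_eq_mul, smul_eq_mul, ← Complex.ofReal_inv,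
        Complex.conj_ofReal, ← Complex.ofReal_mul, ← Complex.ofReal_mul, ← Complex.ofReal_one]
      congr 1
      have h1 := Real.mul_self_sqrt hN.le
      have h2 := (Real.sqrt_pos.2 hN).ne'
      field_simp
      rw [sq, h1]
    · have h1 := congrArg (fun y => ((Real.sqrt N)⁻¹ : ℂ) • y) (hXw H)
      exact (lie_smul ((Real.sqrt N)⁻¹ : ℂ) ((stdComplexification 𝔤).e H) X).trans
        (h1.trans (smul_comm _ _ _))
  · intro γ x hx hx0 hγ
    have h1 := hβ.2 γ ⟨x, T.mem_pPlus.2 hx, hx0, mem_weightSpace.2 hγ⟩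
    have h2 : ∀ δ ∈ AddSubmonoid.closure 𝓟, 0 ≤ (δ H₀).im := fun δ hδ => by
      induction hδ using AddSubmonoid.closure_induction with
      | mem δ h => exact (hP δ h).le
      | zero => rw [LinearMap.zero_apply, Complex.zero_im]
      | add δ δ' _ _ h h' => rw [LinearMap.add_apply, Complex.add_im]; exact add_nonneg h h'
    have h3 := h2 _ h1
    rw [LinearMap.sub_apply, Complex.sub_im] at h3
    linarith

/-- An abelian subspace of 𝔭 of dimension at least two contains two elements that are not
proportional. -/
theorem exists_commuting (hrank : 1 < realRank T.θ) : ∃ X Y : 𝔤, T.θ X = -X ∧ T.θ Y = -Y ∧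
    X ≠ 0 ∧ ⁅X, Y⁆ = 0 ∧ ∀ ρ : ℝ, Y ≠ ρ • X := by
  obtain ⟨A, hA, hab, hd⟩ : ∃ A : Submodule ℝ 𝔤, A ≤ noncompactPart T.θ ∧
      (∀ X ∈ A, ∀ Y ∈ A, ⁅X, Y⁆ = 0) ∧ 1 < Module.finrank ℝ A := by
    by_contra! h
    refine not_lt_of_ge (csSup_le' ?_) hrank
    rintro d ⟨A, hA, hab, rfl⟩
    exact h A hA hab
  haveI : Nontrivial A := Module.nontrivial_of_finrank_pos (R := ℝ) (by omega)
  obtain ⟨X, hX⟩ := exists_ne (0 : A)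
  have hX0 : (X : 𝔤) ≠ 0 := fun h => hX (Subtype.ext h)
  by_contra! h
  have h1 : ∀ Y : A, ∃ ρ : ℝ, ρ • X = Y := fun Y => by
    obtain ⟨ρ, hρ⟩ := h X Y (hA X.2) (hA Y.2) hX0 (hab X X.2 Y Y.2)
    exact ⟨ρ, Subtype.ext hρ.symm⟩
  rw [(finrank_eq_one_iff_of_nonzero' X hX).2 h1] at hd
  exact lt_irrefl _ hd

end HermitianType
end HermitianLie

/-! ### Assembly -/

namespace HermitianLie
namespace TorusData

variable {𝔤 : Type*} [LieRing 𝔤] [LieAlgebra ℝ 𝔤] [FiniteDimensional ℝ 𝔤]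
  [LieAlgebra.IsSimple ℝ 𝔤] {T : HermitianType 𝔤} (A : TorusData T (stdComplexification 𝔤))
  {n : ℕ} {D : HermitianDatum (ℂ ⊗[ℝ] 𝔤) (Fin n)}

theorem isTriangular_scalarVermaIdeal {lam : A.𝔱 →ₗ[ℝ] ℂ} {r : ℂ}
    (hr : ∀ H : A.𝔱, lam H = r * (stdComplexification 𝔤).B (T.z' (stdComplexification 𝔤))
      ((stdComplexification 𝔤).e (H : 𝔤))) :
    IsTriangular (scalarVermaIdeal T.θ T.z A.𝔱 lam) (T.z' (stdComplexification 𝔤))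
      (r * (stdComplexification 𝔤).B (T.z' (stdComplexification 𝔤))
        (T.z' (stdComplexification 𝔤))) :=
  A.isTriangular_scalar hr
    (fun Y hY => Ideal.subset_span (Or.inl (Or.inl ⟨Y, T.mem_pMinus.2 hY, rfl⟩)))
    (fun X hX => Ideal.subset_span (Or.inl (Or.inr ⟨X, hX, rfl⟩)))
    (fun H => Ideal.subset_span (Or.inr ⟨H, rfl⟩))

theorem scalarVermaIdeal_le {lam : A.𝔱 →ₗ[ℝ] ℂ} {r : ℝ}
    (hB : D.B = (stdComplexification 𝔤).B) (hz : D.z = T.z' (stdComplexification 𝔤))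
    (hr : ∀ H : A.𝔱, lam H = r * (stdComplexification 𝔤).B (T.z' (stdComplexification 𝔤))
      ((stdComplexification 𝔤).e (H : 𝔤))) :
    scalarVermaIdeal T.θ T.z A.𝔱 lam ≤ D.annIdeal r := by
  refine Ideal.span_le.2 ?_
  rintro u ((⟨Y, hY, rfl⟩ | ⟨X, hX, rfl⟩) | ⟨H, rfl⟩)
  · refine ι_N_mem_annIdeal ?_
    rw [hz]; exact T.mem_pMinus.1 hY
  · exact ι_derivedK_mem_annIdeal hB hz hX
  · refine ι_sub_mem_annIdeal ?_ ?_
    · rw [hz]; exact A.z'_e H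
    · rw [hB, hz]; exact hr H

theorem isTriangular_compactVermaIdeal {P : Set (A.𝔱 →ₗ[ℝ] ℂ)} {mu : A.𝔱 →ₗ[ℝ] ℂ}
    (hP : P = {α | α ∈ compactRoots T.θ A.𝔱 ∧ 0 < (α A.H₀).im}) :
    IsTriangular (compactVermaIdeal T.θ A.𝔱 P mu)
      (⟨A.H', A.H'_mem fun _ => T.mem_fixedPointsC⟩ : fixedPointsC T.θ)
      (Complex.I * mu A.H₀) :=
  A.isTriangular_compact (fun _ => T.mem_fixedPointsC)
    (fun α x hx0 hx hpos => Ideal.subset_span (Or.inl ⟨α, by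
      rw [hP]
      exact ⟨⟨fun h => by
          rw [h, LinearMap.zero_apply, Complex.zero_im] at hpos
          exact lt_irrefl _ hpos, x, x.2, hx0, mem_weightSpace.2 hx⟩, hpos⟩,
      x, mem_weightSpace.2 hx, rfl⟩))
    (fun H x hx => Ideal.subset_span (Or.inr ⟨H, x, hx, rfl⟩))

theorem compactVermaIdeal_le {P : Set (A.𝔱 →ₗ[ℝ] ℂ)} {lam : A.𝔱 →ₗ[ℝ] ℂ} {r : ℝ}
    (hP : P = {α | α ∈ compactRoots T.θ A.𝔱 ∧ 0 < (α A.H₀).im})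
    (hB : D.B = (stdComplexification 𝔤).B) (hz : D.z = T.z' (stdComplexification 𝔤)) {c : ℂ}
    (hX : D.X D.o = c • A.X)
    (hr : ∀ H : A.𝔱, lam H = r * (stdComplexification 𝔤).B (T.z' (stdComplexification 𝔤))
      ((stdComplexification 𝔤).e (H : 𝔤))) (m : ℕ) :
    compactVermaIdeal T.θ A.𝔱 P (lam + m • A.β) ≤ D.annIdealK r (fixedPointsC T.θ) m := by
  refine Ideal.span_le.2 ?_
  rintro u (⟨α, hα, x, hx, rfl⟩ | ⟨H, x, hx, rfl⟩)
  · rw [hP] at hα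
    exact A.ι_pos_mem_annIdealK hB hz hX (fun _ => T.mem_fixedPointsC) (mem_weightSpace.1 hx)
      hα.2 m
  · exact A.ι_t_mem_annIdealK hB hz hX hr hx m

/-- The restriction of the minimal holomorphic representation to a symmetric subalgebra is
irreducible as soon as its `K`-types stay irreducible and pairwise inequivalent. -/
theorem isIrreducible_restrict {P : Set (A.𝔱 →ₗ[ℝ] ℂ)}
    (hP : P = {α | α ∈ compactRoots T.θ A.𝔱 ∧ 0 < (α A.H₀).im}) (hrank : 1 < realRank T.θ)
    {ζ : A.𝔱 →ₗ[ℝ] ℂ} (hζ : IsScalarWeight T.θ T.z A.𝔱 ζ) {c : ℝ}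
    (hc : IsFirstWallachPoint T.θ T.z A.𝔱 ζ c)
    {M : Ideal (UniversalEnvelopingAlgebra ℂ (ℂ ⊗[ℝ] 𝔤))} (hM : IsL T.θ T.z A.𝔱 (c • ζ) M)
    {σ : 𝔤 ≃ₗ⁅ℝ⁆ 𝔤} (hnoncompact : ∃ X ∈ noncompactPart T.θ, X ∈ fixedPoints σ ∧ X ≠ 0)
    {Q : ℕ → Ideal (UniversalEnvelopingAlgebra ℂ (fixedPointsC T.θ))}
    (hQ : ∀ k, IsF T.θ A.𝔱 P (c • ζ + k • A.β) (Q k))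
    (hirr : ∀ k, LieModule.IsIrreducible ℂ (compactFixedPointsC T.θ σ) (EnvQuot (Q k)))
    (hne : ∀ k l, k ≠ l →
      IsEmpty (EnvQuot (Q k) ≃ₗ⁅ℂ, compactFixedPointsC T.θ σ⁆ EnvQuot (Q l))) :
    LieModule.IsIrreducible ℂ (fixedPointsC σ) (EnvQuot M) := by
  obtain ⟨n, D, hτ, hB, hz, c₀, hX⟩ := A.exists_datum
  obtain ⟨X, Y, hX1, hY1, hX0, hXY, hXYne⟩ := T.exists_commuting hrank
  obtain ⟨t, ht⟩ := HermitianDatum.exists_isEigenvalue_of_rank hτ hz hX1 hY1 hX0 hXY hXYne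
  have hb : 0 < -killingForm ℝ 𝔤 T.z T.z := by
    have h0 : T.z ≠ 0 := fun h => hX0 (by
      have := T.z_p hX1
      rwa [h, zero_lie, eq_comm, neg_eq_zero] at this)
    linarith [T.killing_neg T.θ_z h0]
  set b := -killingForm ℝ 𝔤 T.z T.z with hbdef
  obtain ⟨Hz, hHz, hq⟩ := hζ.2.2
  set q := (-Complex.I * ζ Hz).re with hqdef
  have hζz : ζ ⟨T.z, A.z_mem⟩ = Complex.I * q := by
    rw [show (⟨T.z, A.z_mem⟩ : A.𝔱) = Hz from Subtype.ext hHz.symm, hqdef]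
    exact Complex.ext (by simp [hζ.1 Hz]) (by simp)
  -- The weight xζ corresponds to r = xq/b with q = ζ(z') and b = B(z', z'), both positive, so x and
  -- r increase together.
  have hr : ∀ (x : ℝ) (H : A.𝔱), (x • ζ) H =
      ((x * q / b : ℝ) : ℂ) * (stdComplexification 𝔤).B (T.z' (stdComplexification 𝔤))
        ((stdComplexification 𝔤).e (H : 𝔤)) := fun x H => by
    refine A.weight_eq (fun H hH => ?_) ?_ H
    · rw [LinearMap.smul_apply, hζ.2.1 H hH, smul_zero]
    · rw [LinearMap.smul_apply, hζz, T.B_z'_z, T.B_z'_z', Complex.real_smul]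
      have hb' : (b : ℂ) ≠ 0 := by exact_mod_cast hb.ne'
      rw [← hbdef]
      push_cast
      field_simp
  have htri : ∀ x : ℝ, IsTriangular (scalarVermaIdeal T.θ T.z A.𝔱 (x • ζ)) D.z
      (((x * q / b : ℝ) : ℂ) * D.B D.z D.z) := fun x => by
    rw [hz, hB]
    exact A.isTriangular_scalarVermaIdeal (hr x)
  have hle : ∀ x : ℝ, scalarVermaIdeal T.θ T.z A.𝔱 (x • ζ) ≤ D.annIdeal (x * q / b) := fun x =>
    A.scalarVermaIdeal_le hB hz (hr x)
  -- The first unitarizable point is r = t/2: the form is semidefinite there, so c is not larger,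
  -- and unitarizability at c bounds its parameter below by t/2.
  have hcr : c * q / b = t / 2 := by
    refine le_antisymm ?_ ?_
    · set x := t / 2 * b / q with hx
      have hxr : x * q / b = t / 2 := by
        rw [hx]; field_simp
      have hx0 : 0 < x := div_pos (mul_pos (half_pos ht.pos) hb) hq
      have h1 : x ∈ {x : ℝ | 0 < x ∧ ∃ M, IsL T.θ T.z A.𝔱 (x • ζ) M ∧
          IsUnitarizable 𝔤 (EnvQuot M)} := by
        refine ⟨hx0, D.annIdeal (x * q / b),
          HermitianDatum.isIrredQuotient_annIdeal (htri x) (hle x), ?_⟩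
        obtain ⟨F, hF1, hF2, hF3⟩ := HermitianDatum.exists_form (D := D) (r := x * q / b)
          (by rw [hxr]; exact ht.isPos)
        refine ⟨F, hF1, hF2, fun X v w => ?_⟩
        have h2 := hF3 ((stdComplexification 𝔤).e X) v w
        rw [hτ, Complexification.conj_e] at h2
        exact h2
      have h2 := hc.2 h1
      rw [← hxr]
      gcongr
    · obtain ⟨hc0, M', hM', F, hF1, hF2, hF3⟩ := hc.1
      have h1 := HermitianDatum.eq_annIdeal (htri c) (hle c) hM'
      subst h1
      have h2 := isPos_of_unitarizable hτ (htri c) (hle c) F hF1 hF2 hF3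
      exact ht.le_of_isPos (div_pos (mul_pos hc0 hq) hb) h2
  have hM' := HermitianDatum.eq_annIdeal (htri c) (hle c) hM
  have hKz : ∀ x, x ∈ fixedPointsC T.θ ↔ ⁅D.z, x⁆ = 0 := fun x => by
    rw [hz]; exact T.mem_fixedPointsC
  -- Both ideals are maximal above the same triangular ideal, so they agree. This identifies F(cζ +
  -- kβ) with the degree k component of the model.
  have hQ' : ∀ k, Q k = D.annIdealK (t / 2) (fixedPointsC T.θ) k := fun k =>
    (A.isTriangular_compactVermaIdeal hP).eq_of_isMaximal (hQ k)
      ⟨A.compactVermaIdeal_le hP hB hz hX (by rw [← hcr]; exact hr c) k,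
        HermitianDatum.isMaximal_annIdealK ht hKz k⟩
  obtain rfl : Q = fun k => D.annIdealK (t / 2) (fixedPointsC T.θ) k := funext hQ'
  rw [hcr] at hM'
  subst hM'
  obtain ⟨W, hW1, hW2, hW0⟩ := hnoncompact
  -- A nonzero element of 𝔭^σ is x + x̄ with x ∈ 𝔭₊, which is the element required by the criterion.
  obtain ⟨x, hx, ex⟩ := T.exists_P (stdComplexification 𝔤) hW1
  refine HermitianDatum.isIrreducible_of_components ht hKz (fixedPointsC σ) (x := x)
    (by rw [hz]; exact hx) (fun h0 => hW0 ((stdComplexification 𝔤).e_injective ?_)) ?_ hirr hne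
  · rw [ex, h0, map_zero, add_zero, Complexification.e_zero]
  · rw [hτ, ← ex]
    exact Submodule.tmul_mem_baseChange_of_mem (p := (fixedPoints σ).toSubmodule) _ hW2

end TorusData
end HermitianLie
end

theorem mainTheorem10 {𝔤 : Type*} [LieRing 𝔤] [LieAlgebra ℝ 𝔤] [FiniteDimensional ℝ 𝔤]
    [LieAlgebra.IsSimple ℝ 𝔤]
    -- a simple Lie algebra of Hermitian type and real rank greater than one
    (θ : 𝔤 ≃ₗ⁅ℝ⁆ 𝔤) (hθ : IsCartanInvolution θ)
    (z : 𝔤) (hz : IsHermitianElement θ z) (hrank : 1 < realRank θ)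
    -- a Cartan subalgebra of the maximal compact subalgebra, positive roots, highest root
    (𝔱 : LieSubalgebra ℝ 𝔤) (h𝔱 : 𝔱 ≤ fixedPoints θ)
    (hCartan : (𝔱.comap (fixedPoints θ).incl).IsCartanSubalgebra)
    (P : Set (𝔱 →ₗ[ℝ] ℂ)) (hP : IsPositiveSystem θ 𝔱 P)
    (β : 𝔱 →ₗ[ℝ] ℂ) (hβ : IsHighestRoot θ z 𝔱 P β)
    -- the minimal holomorphic representation
    (ζ : 𝔱 →ₗ[ℝ] ℂ) (hζ : IsScalarWeight θ z 𝔱 ζ)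
    (c : ℝ) (hc : IsFirstWallachPoint θ z 𝔱 ζ c)
    (M : Ideal (UniversalEnvelopingAlgebra ℂ (ℂ ⊗[ℝ] 𝔤))) (hM : IsL θ z 𝔱 (c • ζ) M)
    -- a non-compact symmetric subalgebra
    (σ : 𝔤 ≃ₗ⁅ℝ⁆ 𝔤) (hσ : ∀ X, σ (σ X) = X) (hσθ : ∀ X, σ (θ X) = θ (σ X))
    (hnoncompact : ∃ X ∈ noncompactPart θ, X ∈ fixedPoints σ ∧ X ≠ 0)
    (hdd : IsDiscretelyDecomposable (fixedPointsC σ) (EnvQuot M))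
    -- the K-types
    (Q : ℕ → Ideal (UniversalEnvelopingAlgebra ℂ (fixedPointsC θ)))
    (hQ : ∀ k, IsF θ 𝔱 P (c • ζ + k • β) (Q k))
    (hirr : ∀ k, LieModule.IsIrreducible ℂ (compactFixedPointsC θ σ) (EnvQuot (Q k)))
    (hne : ∀ k l, k ≠ l →
      IsEmpty (EnvQuot (Q k) ≃ₗ⁅ℂ, compactFixedPointsC θ σ⁆ EnvQuot (Q l))) :
    LieModule.IsIrreducible ℂ (fixedPointsC σ) (EnvQuot M) := by
  let T : HermitianType 𝔤 := ⟨θ, hθ, z, hz⟩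
  obtain ⟨H₀, hreg, hPeq⟩ := hP
  obtain ⟨⟨X, hX, hX1, hXβ⟩, hhigh⟩ := T.exists_extremal (H₀ := H₀)
    (fun α hα => by rw [hPeq] at hα; exact hα.2) hβ
  let A : TorusData T (stdComplexification 𝔤) :=
    { 𝔱 := 𝔱
      abelian := T.lie_eq_zero_of_cartan h𝔱 hCartan
      θ_t := fun H => h𝔱 H.2
      maximal := T.mem_of_cartan h𝔱 hCartan
      H₀ := H₀
      regular := fun α x hx hx0 hα h => by
        by_contra h0
        exact hreg α ⟨h0, x, T.mem_fixedPointsC.2 hx, hx0, mem_weightSpace.2 hα⟩ h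
      X := X
      z'_X := hX
      B_X := hX1
      β := β
      weight := hXβ
      highest := hhigh }
  exact A.isIrreducible_restrict hPeq hrank hζ hc hM hnoncompact hQ hirr hne
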